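/- **Setting.** Let $\Omega=\{x\in\mathbb R^3:x_3>0\}$, $T>0$. Write $\bar x=(x_1,x_2,-x_3)$, $x_\parallel=(x_1,x_2)$, $\langle v\rangle=\sqrt{1+|v|^2}$, $\hat v=v/\langle v\rangle$, $\iota_1=\iota_2=1$, $\iota_3=-1$, $B(x;t)=\{y\in\mathbb R^3:|x-y|<t\}$, $\omega=\frac{y-x}{|y-x|}$, $\bar\omega=(\omega_1,\omega_2,-\omega_3)$, $\underline 1=2$, $\underline 2=1$. Let $f=f(t,x,v)$ be measurable and such that: for a.e. $v$, $f(\cdot,\cdot,v)$ is continuous on $[0,T)\times\bar\Omega$; for some $\delta>0$, $\langle v\rangle^{4+\delta}f$ is bounded on $[0,T)\times\bar\Omega\times\mathbb R^3$; $f$ has weak derivatives $\partial_tf,\nabla_xf$ on $(0,T)\times\Omega\times\mathbb R^3$, and $\langle v\rangle\,\partial_tf$, $\langle v\rangle\nabla_xf$ are integrable on $(0,T)\times(\Omega\cap\{|x|<R\})\times\mathbb R^3$ for every $R$. Put $\rho=\int f\,dv$, $J=\int\hat v f\,dv$ and $Sf=\partial_tf+\hat v\cdot\nabla_xf$. Let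 $E_0,B_0\in C^1(\bar\Omega;\mathbb R^3)$ with $E_{0,1}=E_{0,2}=B_{0,3}=0$ on $\partial\Omega$, and put $\partial_tE_0:=\nabla\times B_0-4\pi J|_{t=0}$, $\partial_tB_0:=-\nabla\times E_0$. We say that $(E,B)$ is a *weak solution* if all components are integrable on $(0,T)\times(\Omega\cap\{|x|<R\})$ for every $R$ and weakly in $(0,T)\times\Omega$ $$\partial_t^2E-\Delta E=-4\pi\nabla\rho-4\pi\partial_tJ,\qquad \partial_t^2B-\Delta B=4\pi\nabla\times J,$$ with $(E,\partial_tE,B,\partial_tB)|_{t=0}=(E_0,\partial_tE_0,B_0,\partial_tB_0)$ and, on $\partial\Omega$, $E_1=E_2=B_3=0$, $\partial_3E_3=4\pi\rho$, $\partial_3B_1=4\pi J_2$, $\partial_3B_2=-4\pi J_1$. Here $u$ solves weakly $\partial_t^2u-\Delta u=G$, $u(0)=u_0$, $\partial_tu(0)=u_1$ with Dirichlet condition $u=0$ (resp. Neumann condition $\partial_3u=h$) on $\partial\Omega$ if $$\int_0^T\!\!\int_\Omega u(\partial_t^2\varphi-\Delta\varphi)\,dx\,dt=\int_0^T\!\!\int_\Omega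 G\varphi\,dx\,dt+\int_\Omega\big(u_1\varphi(0)-u_0\partial_t\varphi(0)\big)dx-\Big[\int_0^T\!\!\int_{\partial\Omega}h\varphi\,dx_\parallel dt\Big]$$ for all $\varphi\in C_c^\infty([0,T)\times\bar\Omega)$ with $\varphi=0$ on $\partial\Omega$ (resp. $\partial_3\varphi=0$ on $\partial\Omega$), the bracketed term being present only in the Neumann case. **Proposition.** For a.e. $(t,x)\in(0,T)\times\Omega$ all integrals below converge absolutely. Measurable fields $E,B$ form a weak solution if and only if for a.e. $(t,x)\in(0,T)\times\Omega$ and $i=1,2,3$ the following two formulas hold: $$\begin{aligned} E_i(t,x)={}&\frac1{4\pi t^2}\int_{\partial B(x;t)\cap\{y_3>0\}}\big(t\,\partial_tE_{0,i}(y)+E_{0,i}(y)+\nabla E_{0,i}(y)\cdot(y-x)\big)dS_y\\ &-\frac{\iota_i}{4\pi t^2}\int_{\partial B(x;t)\cap\{y_3<0\}}\big(t\,\partial_tE_{0,i}(\bar y)+E_{0,i}(\bar y)+\nabla E_{0,i}(\bar y)\cdot(\bar y-\bar x)\big)dS_y\\ &+\int_{B(x;t)\cap\{y_3>0\}}\int_{\mathbb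 R^3}\frac{(|\hat v|^2-1)(\hat v_i+\omega_i)}{|y-x|^2(1+\hat v\cdot\omega)^2}f(t-|y-x|,y,v)\,dv\,dy\\ &-\iota_i\int_{B(x;t)\cap\{y_3<0\}}\int_{\mathbb R^3}\frac{(|\hat v|^2-1)(\hat v_i+\bar\omega_i)}{|y-x|^2(1+\hat v\cdot\bar\omega)^2}f(t-|y-x|,\bar y,v)\,dv\,dy\\ &-\int_{B(x;t)\cap\{y_3>0\}}\int_{\mathbb R^3}\frac{\omega_i+\hat v_i}{1+\hat v\cdot\omega}(Sf)(t-|y-x|,y,v)\,dv\frac{dy}{|y-x|}\\ &+\iota_i\int_{B(x;t)\cap\{y_3<0\}}\int_{\mathbb R^3}\frac{\bar\omega_i+\hat v_i}{1+\hat v\cdot\bar\omega}(Sf)(t-|y-x|,\bar y,v)\,dv\frac{dy}{|y-x|}\\ &+\int_{B(x;t)\cap\{y_3=0\}}\int_{\mathbb R^3}\Big(\delta_{i3}-\frac{(\omega_i+\hat v_i)\hat v_3}{1+\hat v\cdot\omega}\Big)f(t-|y-x|,y_\parallel,0,v)\,dv\frac{dy_\parallel}{|y-x|}\\ &-\iota_i\int_{B(x;t)\cap\{y_3=0\}}\int_{\mathbb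 R^3}\Big(\delta_{i3}-\frac{(\bar\omega_i+\hat v_i)\hat v_3}{1+\hat v\cdot\bar\omega}\Big)f(t-|y-x|,y_\parallel,0,v)\,dv\frac{dy_\parallel}{|y-x|}\\ &-\int_{\partial B(x;t)\cap\{y_3>0\}}\int_{\mathbb R^3}\sum_j\omega_j\Big(\delta_{ij}-\frac{(\omega_i+\hat v_i)\hat v_j}{1+\hat v\cdot\omega}\Big)f(0,y,v)\,dv\frac{dS_y}{|y-x|}\\ &+\iota_i\int_{\partial B(x;t)\cap\{y_3<0\}}\int_{\mathbb R^3}\sum_j\bar\omega_j\Big(\delta_{ij}-\frac{(\bar\omega_i+\hat v_i)\hat v_j}{1+\hat v\cdot\bar\omega}\Big)f(0,\bar y,v)\,dv\frac{dS_y}{|y-x|}\\ &-\delta_{i3}\int_{B(x;t)\cap\{y_3=0\}}\int_{\mathbb R^3}\frac{2f(t-|y-x|,y_\parallel,0,v)}{|y-x|}\,dv\,dy_\parallel , \end{aligned}$$ $$\begin{aligned} B_i(t,x)={}&\frac1{4\pi t^2}\int_{\partial B(x;t)\cap\{y_3>0\}}\big(t\,\partial_tB_{0,i}(y)+B_{0,i}(y)+\nabla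 B_{0,i}(y)\cdot(y-x)\big)dS_y\\ &+\frac{\iota_i}{4\pi t^2}\int_{\partial B(x;t)\cap\{y_3<0\}}\big(t\,\partial_tB_{0,i}(\bar y)+B_{0,i}(\bar y)+\nabla B_{0,i}(\bar y)\cdot(\bar y-\bar x)\big)dS_y\\ &+\int_{B(x;t)\cap\{y_3>0\}}\int_{\mathbb R^3}\frac{(\omega\times\hat v)_i(1-|\hat v|^2)}{(1+\hat v\cdot\omega)^2|y-x|^2}f(t-|y-x|,y,v)\,dv\,dy\\ &+\iota_i\int_{B(x;t)\cap\{y_3<0\}}\int_{\mathbb R^3}\frac{(\bar\omega\times\hat v)_i(1-|\hat v|^2)}{(1+\hat v\cdot\bar\omega)^2|y-x|^2}f(t-|y-x|,\bar y,v)\,dv\,dy\\ &+\int_{B(x;t)\cap\{y_3>0\}}\int_{\mathbb R^3}\frac{(\omega\times\hat v)_i}{1+\hat v\cdot\omega}(Sf)(t-|y-x|,y,v)\,dv\frac{dy}{|y-x|}\\ &+\iota_i\int_{B(x;t)\cap\{y_3<0\}}\int_{\mathbb R^3}\frac{(\bar\omega\times\hat v)_i}{1+\hat v\cdot\bar\omega}(Sf)(t-|y-x|,\bar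 y,v)\,dv\frac{dy}{|y-x|}\\ &+\int_{B(x;t)\cap\{y_3=0\}}\int_{\mathbb R^3}\Big(-(e_3\times\hat v)_i+\frac{(\omega\times\hat v)_i\hat v_3}{1+\hat v\cdot\omega}\Big)f(t-|y-x|,y_\parallel,0,v)\,dv\frac{dy_\parallel}{|y-x|}\\ &+\iota_i\int_{B(x;t)\cap\{y_3=0\}}\int_{\mathbb R^3}\Big(-(e_3\times\hat v)_i+\frac{(\bar\omega\times\hat v)_i\hat v_3}{1+\hat v\cdot\bar\omega}\Big)f(t-|y-x|,y_\parallel,0,v)\,dv\frac{dy_\parallel}{|y-x|}\\ &+\int_{\partial B(x;t)\cap\{y_3>0\}}\int_{\mathbb R^3}\frac{(\omega\times\hat v)_i}{1+\hat v\cdot\omega}f(0,y,v)\,dv\frac{dS_y}{t}\\ &+\iota_i\int_{\partial B(x;t)\cap\{y_3<0\}}\int_{\mathbb R^3}\frac{(\bar\omega\times\hat v)_i}{1+\hat v\cdot\bar\omega}f(0,\bar y,v)\,dv\frac{dS_y}{t}\\ &+(-1)^i\,2(1-\delta_{i3})\int_{B(x;t)\cap\{y_3=0\}}\int_{\mathbb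 R^3}\frac{\hat v_{\underline i}\,f(t-|y-x|,y_\parallel,0,v)}{|y-x|}\,dv\,dy_\parallel . \end{aligned}$$ In the disc integrals $y=(y_\parallel,0)$, and the last term of $B_i$ is $0$ for $i=3$. -/

import Mathlib

open MeasureTheory Set
open scoped ContDiff

noncomputable section

namespace RVM

/-! ### Geometry of the half space and kinematics -/

/-- Physical space (and also velocity space) `ℝ³` with its Euclidean norm. Coordinates are indexed
by `Fin 3 = {0, 1, 2}`; the normal direction to the boundary is the coordinate `2`. -/
abbrev E3 := EuclideanSpace ℝ (Fin 3)

/-- The parameter space `ℝ²` of the boundary plane. -/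
abbrev E2 := EuclideanSpace ℝ (Fin 2)

/-- The open half space `Ω = {x₃ > 0}`. -/
def Ω : Set E3 := {x | 0 < x 2}

/-- The closed half space. -/
def Ωbar : Set E3 := {x | 0 ≤ x 2}

/-- The standard basis vectors. -/
def e (j : Fin 3) : E3 := EuclideanSpace.single j 1

/-- Reflection `x ↦ x̄ = (x₁, x₂, -x₃)`. -/
def bar (x : E3) : E3 := !₂[x 0, x 1, - x 2]

/-- The boundary point `(z₁, z₂, 0)`. -/
def planePoint (z : E2) : E3 := !₂[z 0, z 1, 0]

/-- `ι₁ = ι₂ = 1`, `ι₃ = -1`. -/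
def iota (i : Fin 3) : ℝ := if i = 2 then -1 else 1

/-- Kronecker delta. -/
def delta (i j : Fin 3) : ℝ := if i = j then 1 else 0

/-- `⟨v⟩ = √(1 + |v|²)`. -/
def bracket (v : E3) : ℝ := Real.sqrt (1 + ‖v‖ ^ 2)

/-- The relativistic velocity `v̂ = v / √(1 + |v|²)`. -/
def hat (v : E3) : E3 := (bracket v)⁻¹ • v

/-- The direction `ω = (y - x) / |y - x|`. -/
def dir (x y : E3) : E3 := ‖y - x‖⁻¹ • (y - x)

/-- The cross product in `ℝ³`. -/
def cross (a b : E3) : E3 := WithLp.toLp 2 (crossProduct a.ofLp b.ofLp)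

/-- The curl of a vector field, from its pointwise derivative. -/
def curl (F : E3 → E3) (x : E3) : E3 :=
  !₂[fderiv ℝ F x (e 1) 2 - fderiv ℝ F x (e 2) 1,
     fderiv ℝ F x (e 2) 0 - fderiv ℝ F x (e 0) 2,
     fderiv ℝ F x (e 0) 1 - fderiv ℝ F x (e 1) 0]

/-! ### Weak derivatives and the particle density -/

/-- `w` is the weak (distributional) derivative of `u` in the direction `a` on the open set `U`. -/
def HasWeakLineDeriv {V : Type*} [NormedAddCommGroup V] [NormedSpace ℝ V] [MeasureSpace V]
    (U : Set V) (a : V) (u w : V → ℝ) : Prop :=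
  LocallyIntegrableOn u U ∧ LocallyIntegrableOn w U ∧
    ∀ φ : V → ℝ, ContDiff ℝ ∞ φ → HasCompactSupport φ → tsupport φ ⊆ U →
      ∫ p in U, u p * lineDeriv ℝ φ p a = - ∫ p in U, w p * φ p

/-- The space-time domain `(0,T) × Ω`. -/
def spaceTime (T : ℝ) : Set (ℝ × E3) := Ioo 0 T ×ˢ Ω

/-- The phase-space-time domain `(0,T) × Ω × ℝ³`. -/
def phaseTime (T : ℝ) : Set (ℝ × E3 × E3) := Ioo 0 T ×ˢ Ω ×ˢ univ

/-- The class of densities `f(t,x,v)`: for almost every velocity, `f` is continuous in `(t,x)` up to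
`t = 0` and up to the boundary, `⟨v⟩^{4+δ} f` is bounded for some `δ > 0`, and `f` has weak
derivatives `ft = ∂ₜ f`, `fx = ∇ₓ f` such that `⟨v⟩ ∂ₜ f` and `⟨v⟩ ∇ₓ f` are integrable over
`(0,T) × (Ω ∩ {|x| < R}) × ℝ³` for each `R`. -/
structure IsDensity (T : ℝ) (f ft : ℝ × E3 × E3 → ℝ) (fx : ℝ × E3 × E3 → E3) : Prop where
  measurable : Measurable f
  continuousOn : ∀ᵐ v : E3, ContinuousOn (fun q : ℝ × E3 => f (q.1, q.2, v)) (Ico 0 T ×ˢ Ωbar)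
  decay : ∃ δ > (0 : ℝ), ∃ C : ℝ, ∀ᵐ v : E3, ∀ t ∈ Ico 0 T, ∀ x ∈ Ωbar,
    bracket v ^ (4 + δ) * |f (t, x, v)| ≤ C
  weak_t : HasWeakLineDeriv (phaseTime T) (1, 0, 0) f ft
  weak_x : ∀ j, HasWeakLineDeriv (phaseTime T) (0, e j, 0) f (fun p => fx p j)
  integrable_t : ∀ R : ℝ, IntegrableOn (fun p => bracket p.2.2 * ft p)
    (Ioo 0 T ×ˢ (Ω ∩ Metric.ball 0 R) ×ˢ univ)
  integrable_x : ∀ R : ℝ, IntegrableOn (fun p => bracket p.2.2 • fx p)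
    (Ioo 0 T ×ˢ (Ω ∩ Metric.ball 0 R) ×ˢ univ)

/-- The charge density `ρ = ∫ f dv`. -/
def rho (f : ℝ × E3 × E3 → ℝ) (p : ℝ × E3) : ℝ := ∫ v : E3, f (p.1, p.2, v)

/-- The `i`-th component of the current density `J = ∫ v̂ f dv`. -/
def curr (f : ℝ × E3 × E3 → ℝ) (i : Fin 3) (p : ℝ × E3) : ℝ :=
  ∫ v : E3, hat v i * f (p.1, p.2, v)

/-- `S f = ∂ₜ f + v̂ · ∇ₓ f`. -/
def transport (ft : ℝ × E3 × E3 → ℝ) (fx : ℝ × E3 × E3 → E3) (p : ℝ × E3 × E3) : ℝ :=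
  ft p + inner ℝ (hat p.2.2) (fx p)

/-! ### Weak solutions of the wave equation in the half space -/

/-- Test functions in `C_c^∞([0,T) × Ω̄)`, given by smooth extensions to `(-∞,T) × ℝ³`. -/
def IsTest (T : ℝ) (φ : ℝ × E3 → ℝ) : Prop :=
  ContDiff ℝ ∞ φ ∧ HasCompactSupport φ ∧ tsupport φ ⊆ Iio T ×ˢ univ

/-- `∂ₜ² φ - Δₓ φ`. -/
def box (φ : ℝ × E3 → ℝ) (p : ℝ × E3) : ℝ :=
  iteratedDeriv 2 (fun s => φ (s, p.2)) p.1 - Laplacian.laplacian (fun y => φ (p.1, y)) p.2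

/-- The contribution of the initial data `u(0) = u₀`, `∂ₜ u(0) = u₁` to the weak formulation. -/
def initialPairing (u₀ u₁ : E3 → ℝ) (φ : ℝ × E3 → ℝ) : ℝ :=
  ∫ x in Ω, (u₁ x * φ (0, x) - u₀ x * deriv (fun s => φ (s, x)) 0)

/-- Integrability over `(0,T) × (Ω ∩ {|x| < R})` for each `R`. -/
def LocallyIntegrableUpTo (T : ℝ) (u : ℝ × E3 → ℝ) : Prop :=
  ∀ R : ℝ, IntegrableOn u (Ioo 0 T ×ˢ (Ω ∩ Metric.ball 0 R))

/-- `u` is a weak solution in `(0,T) × Ω` of `∂ₜ² u - Δ u = G`, `u = 0` on `∂Ω`,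
`u(0) = u₀`, `∂ₜ u(0) = u₁`. -/
def IsWeakDirichlet (T : ℝ) (u₀ u₁ : E3 → ℝ) (G u : ℝ × E3 → ℝ) : Prop :=
  LocallyIntegrableUpTo T u ∧
  ∀ φ : ℝ × E3 → ℝ, IsTest T φ → (∀ t ∈ Ico 0 T, ∀ x : E3, x 2 = 0 → φ (t, x) = 0) →
    ∫ p in spaceTime T, u p * box φ p =
      (∫ p in spaceTime T, G p * φ p) + initialPairing u₀ u₁ φ

/-- `u` is a weak solution in `(0,T) × Ω` of `∂ₜ² u - Δ u = G`, `∂₃ u = h` on `∂Ω`,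
`u(0) = u₀`, `∂ₜ u(0) = u₁`. The test functions satisfy `∂₃ φ = 0` on `∂Ω`, so that no
boundary values of `u` occur. -/
def IsWeakNeumann (T : ℝ) (u₀ u₁ : E3 → ℝ) (G h u : ℝ × E3 → ℝ) : Prop :=
  LocallyIntegrableUpTo T u ∧
  ∀ φ : ℝ × E3 → ℝ, IsTest T φ →
    (∀ t ∈ Ico 0 T, ∀ x : E3, x 2 = 0 → fderiv ℝ (fun y => φ (t, y)) x (e 2) = 0) →
    ∫ p in spaceTime T, u p * box φ p =
      (∫ p in spaceTime T, G p * φ p) + initialPairing u₀ u₁ φ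
        - ∫ q in Ioo 0 T ×ˢ (univ : Set E2), h (q.1, planePoint q.2) * φ (q.1, planePoint q.2)

/-- `∂ₜ E₀ := ∇ × B₀ - 4π J|_{t=0}`. -/
def dtE0 (f : ℝ × E3 × E3 → ℝ) (B0 : E3 → E3) (i : Fin 3) (x : E3) : ℝ :=
  curl B0 x i - 4 * Real.pi * curr f i (0, x)

/-- `∂ₜ B₀ := -∇ × E₀`. -/
def dtB0 (E0 : E3 → E3) (i : Fin 3) (x : E3) : ℝ := - curl E0 x i

/-- The source `-4π ∂ᵢ ρ - 4π ∂ₜ Jᵢ` of the wave equation for `Eᵢ`, where `ρx = ∇ρ`, `Jt = ∂ₜ J`. -/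
def sourceE (ρx Jt : ℝ × E3 → E3) (i : Fin 3) (p : ℝ × E3) : ℝ :=
  - 4 * Real.pi * ρx p i - 4 * Real.pi * Jt p i

/-- The source `4π (∇ × J)ᵢ` of the wave equation for `Bᵢ`, where `Jx j = ∂ⱼ J`. -/
def sourceB (Jx : Fin 3 → ℝ × E3 → E3) (i : Fin 3) (p : ℝ × E3) : ℝ :=
  4 * Real.pi * (![Jx 1 p 2 - Jx 2 p 1, Jx 2 p 0 - Jx 0 p 2, Jx 0 p 1 - Jx 1 p 0] i)

/-- `(E, B)` solves weakly the wave equations `∂ₜ² E - Δ E = -4π ∇ρ - 4π ∂ₜ J`,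
`∂ₜ² B - Δ B = 4π ∇ × J` in `(0,T) × Ω` with the initial data `E₀`, `∂ₜ E₀`, `B₀`, `∂ₜ B₀`, with
`E₁ = E₂ = 0`, `B₃ = 0` and `∂₃ E₃ = 4π ρ`, `∂₃ B₁ = 4π J₂`, `∂₃ B₂ = -4π J₁` on `∂Ω`. -/
structure IsWeakField (T : ℝ) (f : ℝ × E3 × E3 → ℝ) (ρx Jt : ℝ × E3 → E3)
    (Jx : Fin 3 → ℝ × E3 → E3) (E0 B0 : E3 → E3) (E B : ℝ × E3 → E3) : Prop where
  E_one : IsWeakDirichlet T (fun x => E0 x 0) (dtE0 f B0 0) (sourceE ρx Jt 0) (fun p => E p 0)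
  E_two : IsWeakDirichlet T (fun x => E0 x 1) (dtE0 f B0 1) (sourceE ρx Jt 1) (fun p => E p 1)
  E_three : IsWeakNeumann T (fun x => E0 x 2) (dtE0 f B0 2) (sourceE ρx Jt 2)
    (fun p => 4 * Real.pi * rho f p) (fun p => E p 2)
  B_one : IsWeakNeumann T (fun x => B0 x 0) (dtB0 E0 0) (sourceB Jx 0)
    (fun p => 4 * Real.pi * curr f 1 p) (fun p => B p 0)
  B_two : IsWeakNeumann T (fun x => B0 x 1) (dtB0 E0 1) (sourceB Jx 1)
    (fun p => - 4 * Real.pi * curr f 0 p) (fun p => B p 1)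
  B_three : IsWeakDirichlet T (fun x => B0 x 2) (dtB0 E0 2) (sourceB Jx 2) (fun p => B p 2)

/-! ### The integrals in the representation formulas

Each kind of integral occurs over the part of the ball, sphere or disc of radius `t` about `x` that
lies in the upper half space, and, with `y` and `ω` replaced by `ȳ` and `ω̄` in the integrand, over
the part in the lower half space. -/

/-- Selects the direct (`upper`) or the reflected (`lower`) version of a term. -/
inductive Side
  | upper
  | lower

/-- The identity for the upper side, the reflection `y ↦ ȳ` for the lower side. -/
def Side.map : Side → E3 → E3
  | .upper, y => y
  | .lower, y => bar y

/-- `{y₃ > 0}` for the upper side, `{y₃ < 0}` for the lower side. -/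
def Side.halfSpace : Side → Set E3
  | .upper => {y | 0 < y 2}
  | .lower => {y | y 2 < 0}

/-- The integrand `k(ω, v) h(t - |y-x|, y, v) / |y-x|^m` (upper side), or
`k(ω̄, v) h(t - |y-x|, ȳ, v) / |y-x|^m` (lower side). -/
def bulkIntegrand (s : Side) (k : E3 → E3 → ℝ) (m : ℕ) (h : ℝ × E3 × E3 → ℝ) (t : ℝ) (x : E3)
    (p : E3 × E3) : ℝ :=
  k (s.map (dir x p.1)) p.2 * h (t - ‖p.1 - x‖, s.map p.1, p.2) / ‖p.1 - x‖ ^ m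

/-- `∫_{B(x;t) ∩ {±y₃ > 0}} ∫_{ℝ³} (integrand) dv dy`. -/
def bulkTerm (s : Side) (k : E3 → E3 → ℝ) (m : ℕ) (h : ℝ × E3 × E3 → ℝ) (t : ℝ) (x : E3) : ℝ :=
  ∫ y in Metric.ball x t ∩ s.halfSpace, ∫ v : E3, bulkIntegrand s k m h t x (y, v)

/-- Absolute convergence of `bulkTerm`. -/
def BulkConverges (s : Side) (k : E3 → E3 → ℝ) (m : ℕ) (h : ℝ × E3 × E3 → ℝ) (t : ℝ) (x : E3) :
    Prop :=
  IntegrableOn (bulkIntegrand s k m h t x) ((Metric.ball x t ∩ s.halfSpace) ×ˢ univ)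

/-- The integrand `k(ω, v) h(t - |y-x|, y, v) / |y-x|` (with `ω̄` on the lower side) at the boundary
point `y = (z, 0)`. -/
def planeIntegrand (s : Side) (k : E3 → E3 → ℝ) (h : ℝ × E3 × E3 → ℝ) (t : ℝ) (x : E3)
    (p : E2 × E3) : ℝ :=
  k (s.map (dir x (planePoint p.1))) p.2 *
    h (t - ‖planePoint p.1 - x‖, planePoint p.1, p.2) / ‖planePoint p.1 - x‖

/-- The disc `B(x;t) ∩ {y₃ = 0}`. -/
def disc (t : ℝ) (x : E3) : Set E2 := {z | planePoint z ∈ Metric.ball x t}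

/-- `∫_{B(x;t) ∩ {y₃ = 0}} ∫_{ℝ³} (integrand) dv dy_∥`. -/
def planeTerm (s : Side) (k : E3 → E3 → ℝ) (h : ℝ × E3 × E3 → ℝ) (t : ℝ) (x : E3) : ℝ :=
  ∫ z in disc t x, ∫ v : E3, planeIntegrand s k h t x (z, v)

/-- Absolute convergence of `planeTerm`. -/
def PlaneConverges (s : Side) (k : E3 → E3 → ℝ) (h : ℝ × E3 × E3 → ℝ) (t : ℝ) (x : E3) : Prop :=
  IntegrableOn (planeIntegrand s k h t x) (disc t x ×ˢ univ)

/-- The surface measure of the unit sphere `S²` (of total mass `4π`). -/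
def sphereMeasure : Measure (Metric.sphere (0 : E3) 1) := (volume : Measure E3).toSphere

/-- The directions `ω ∈ S²` such that `x + t ω` lies on the given side. -/
def sphereDirections (s : Side) (t : ℝ) (x : E3) : Set (Metric.sphere (0 : E3) 1) :=
  {w | x + t • (w : E3) ∈ s.halfSpace}

/-- The surface integral `∫_{∂B(x;t) ∩ {±y₃ > 0}} F(y) dS_y`, with `y = x + t ω`. -/
def sphereIntegral (s : Side) (F : E3 → ℝ) (t : ℝ) (x : E3) : ℝ :=
  t ^ 2 * ∫ w in sphereDirections s t x, F (x + t • (w : E3)) ∂sphereMeasure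

/-- The integrand `k(ω, v) f(0, y, v) / |y-x|` (with `ω̄`, `ȳ` on the lower side). -/
def initialIntegrand (s : Side) (k : E3 → E3 → ℝ) (h : ℝ × E3 × E3 → ℝ) (x : E3)
    (p : E3 × E3) : ℝ :=
  k (s.map (dir x p.1)) p.2 * h (0, s.map p.1, p.2) / ‖p.1 - x‖

/-- `∫_{∂B(x;t) ∩ {±y₃ > 0}} ∫_{ℝ³} (integrand) dv dS_y`. -/
def initialTerm (s : Side) (k : E3 → E3 → ℝ) (h : ℝ × E3 × E3 → ℝ) (t : ℝ) (x : E3) : ℝ :=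
  sphereIntegral s (fun y => ∫ v : E3, initialIntegrand s k h x (y, v)) t x

/-- Absolute convergence of `initialTerm`. -/
def InitialConverges (s : Side) (k : E3 → E3 → ℝ) (h : ℝ × E3 × E3 → ℝ) (t : ℝ) (x : E3) : Prop :=
  Integrable (fun p : Metric.sphere (0 : E3) 1 × E3 =>
      initialIntegrand s k h x (x + t • (p.1 : E3), p.2))
    ((sphereMeasure.restrict (sphereDirections s t x)).prod volume)

/-- The integrand `t u₁(y) + u₀(y) + ∇u₀(y) · (y - x)` (with `ȳ`, `x̄` on the lower side, so that
there the last term is `∇_∥ u₀(ȳ) · (y_∥ - x_∥) - ∂₃ u₀(ȳ) (y₃ - x₃)`). -/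
def kirchhoffIntegrand (s : Side) (u₀ u₁ : E3 → ℝ) (t : ℝ) (x : E3) (y : E3) : ℝ :=
  t * u₁ (s.map y) + u₀ (s.map y) + fderiv ℝ u₀ (s.map y) (s.map y - s.map x)

/-- `1/(4π t²) ∫_{∂B(x;t) ∩ {±y₃ > 0}} (integrand) dS_y`. -/
def kirchhoffTerm (s : Side) (u₀ u₁ : E3 → ℝ) (t : ℝ) (x : E3) : ℝ :=
  1 / (4 * Real.pi * t ^ 2) * sphereIntegral s (kirchhoffIntegrand s u₀ u₁ t x) t x

/-- Absolute convergence of `kirchhoffTerm`. -/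
def KirchhoffConverges (s : Side) (u₀ u₁ : E3 → ℝ) (t : ℝ) (x : E3) : Prop :=
  IntegrableOn (fun w : Metric.sphere (0 : E3) 1 =>
    kirchhoffIntegrand s u₀ u₁ t x (x + t • (w : E3))) (sphereDirections s t x) sphereMeasure

/-! ### Kernels -/

/-- `(|v̂|² - 1)(v̂ᵢ + ωᵢ) / (1 + v̂·ω)²`. -/
def kerET (i : Fin 3) (om v : E3) : ℝ :=
  (‖hat v‖ ^ 2 - 1) * (hat v i + om i) / (1 + inner ℝ (hat v) om) ^ 2

/-- `(ωᵢ + v̂ᵢ) / (1 + v̂·ω)`. -/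
def kerES (i : Fin 3) (om v : E3) : ℝ := (om i + hat v i) / (1 + inner ℝ (hat v) om)

/-- `δᵢⱼ - (ωᵢ + v̂ᵢ) v̂ⱼ / (1 + v̂·ω)`. -/
def kerEA (i j : Fin 3) (om v : E3) : ℝ :=
  delta i j - (om i + hat v i) * hat v j / (1 + inner ℝ (hat v) om)

/-- `∑ⱼ ωⱼ (δᵢⱼ - (ωᵢ + v̂ᵢ) v̂ⱼ / (1 + v̂·ω))`. -/
def kerEI (i : Fin 3) (om v : E3) : ℝ := ∑ j, om j * kerEA i j om v

/-- `2 δᵢ₃`. -/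
def kerEN (i : Fin 3) (_om _v : E3) : ℝ := 2 * delta i 2

/-- `(ω × v̂)ᵢ (1 - |v̂|²) / (1 + v̂·ω)²`. -/
def kerBT (i : Fin 3) (om v : E3) : ℝ :=
  cross om (hat v) i * (1 - ‖hat v‖ ^ 2) / (1 + inner ℝ (hat v) om) ^ 2

/-- `(ω × v̂)ᵢ / (1 + v̂·ω)`. -/
def kerBS (i : Fin 3) (om v : E3) : ℝ := cross om (hat v) i / (1 + inner ℝ (hat v) om)

/-- `-(e₃ × v̂)ᵢ + (ω × v̂)ᵢ v̂₃ / (1 + v̂·ω)`. -/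
def kerBA (i : Fin 3) (om v : E3) : ℝ :=
  - cross (e 2) (hat v) i + cross om (hat v) i * hat v 2 / (1 + inner ℝ (hat v) om)

/-- `(-1)ⁱ 2 (1 - δᵢ₃) v̂_{i̲}` with `1̲ = 2`, `2̲ = 1`; that is `-2 v̂₂`, `2 v̂₁`, `0` for
`i = 1, 2, 3`. -/
def kerBN (i : Fin 3) (_om v : E3) : ℝ := ![-2 * hat v 1, 2 * hat v 0, 0] i

/-! ### The representation formulas -/

/-- The right-hand side of the representation of `Eᵢ(t,x)`. -/
def formulaE (f ft : ℝ × E3 × E3 → ℝ) (fx : ℝ × E3 × E3 → E3) (E0 B0 : E3 → E3) (i : Fin 3)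
    (t : ℝ) (x : E3) : ℝ :=
  kirchhoffTerm .upper (fun y => E0 y i) (dtE0 f B0 i) t x
    - iota i * kirchhoffTerm .lower (fun y => E0 y i) (dtE0 f B0 i) t x
    + bulkTerm .upper (kerET i) 2 f t x
    - iota i * bulkTerm .lower (kerET i) 2 f t x
    - bulkTerm .upper (kerES i) 1 (transport ft fx) t x
    + iota i * bulkTerm .lower (kerES i) 1 (transport ft fx) t x
    + planeTerm .upper (kerEA i 2) f t x
    - iota i * planeTerm .lower (kerEA i 2) f t x
    - initialTerm .upper (kerEI i) f t x
    + iota i * initialTerm .lower (kerEI i) f t x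
    - planeTerm .upper (kerEN i) f t x

/-- The right-hand side of the representation of `Bᵢ(t,x)`. -/
def formulaB (f ft : ℝ × E3 × E3 → ℝ) (fx : ℝ × E3 × E3 → E3) (E0 B0 : E3 → E3) (i : Fin 3)
    (t : ℝ) (x : E3) : ℝ :=
  kirchhoffTerm .upper (fun y => B0 y i) (dtB0 E0 i) t x
    + iota i * kirchhoffTerm .lower (fun y => B0 y i) (dtB0 E0 i) t x
    + bulkTerm .upper (kerBT i) 2 f t x
    + iota i * bulkTerm .lower (kerBT i) 2 f t x
    + bulkTerm .upper (kerBS i) 1 (transport ft fx) t x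
    + iota i * bulkTerm .lower (kerBS i) 1 (transport ft fx) t x
    + planeTerm .upper (kerBA i) f t x
    + iota i * planeTerm .lower (kerBA i) f t x
    + initialTerm .upper (kerBS i) f t x
    + iota i * initialTerm .lower (kerBS i) f t x
    + planeTerm .upper (kerBN i) f t x

/-- All integrals in `formulaE` and `formulaB` converge absolutely at `(t,x)`. -/
def FormulasConverge (f ft : ℝ × E3 × E3 → ℝ) (fx : ℝ × E3 × E3 → E3) (E0 B0 : E3 → E3)
    (t : ℝ) (x : E3) : Prop :=
  ∀ i : Fin 3,
    (∀ s : Side,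
      KirchhoffConverges s (fun y => E0 y i) (dtE0 f B0 i) t x ∧
      BulkConverges s (kerET i) 2 f t x ∧
      BulkConverges s (kerES i) 1 (transport ft fx) t x ∧
      PlaneConverges s (kerEA i 2) f t x ∧
      InitialConverges s (kerEI i) f t x ∧
      KirchhoffConverges s (fun y => B0 y i) (dtB0 E0 i) t x ∧
      BulkConverges s (kerBT i) 2 f t x ∧
      BulkConverges s (kerBS i) 1 (transport ft fx) t x ∧
      PlaneConverges s (kerBA i) f t x ∧
      InitialConverges s (kerBS i) f t x) ∧
    PlaneConverges .upper (kerEN i) f t x ∧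
    PlaneConverges .upper (kerBN i) f t x

end RVM

end

/-!
The representation formulas are proved by duality. Under the reflection `x ↦ x̄` the integrals over
the lower half of a ball, sphere or disc about `x` become those over the upper half about `x̄`
(`bulkTerm_lower`, `planeTerm_lower`, `initialTerm_lower`, `kirchhoffTerm_lower`). Every component
of `E` and `B` is therefore represented by a field `F(t,x) = U(t,x) + σ U(t,x̄)`, where `U` consists
of upper integrals only, `σ = 1` belongs to the Neumann and `σ = -1` to the Dirichlet condition
(`field`). All six components are instances of one computation, in which the kernels are built
from a first order operator `α₀(v) ∂ₜ + α(v) · ∇ₓ` with velocity-dependent coefficients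
(`IsSourceOperator`), namely `v̂ᵢ ∂ₜ + ∂ᵢ` for `Eᵢ` and `(eᵢ × v̂) · ∇ₓ` for `Bᵢ`; the source of the
wave equation is `-4π ∫ (α₀ ∂ₜ + α · ∇ₓ) f dv`, and the Neumann datum is `4π ∫ α₃ f dv`.

Integrated against a test function `ψ`, a retarded integral over the backward cone of `(t,x)` turns,
by `z = x - y` and `s = t - |z|`, into an integral of `ψ` over the forward cone of `(s,y)`
(`retarded_duality`, `sphereRetarded_duality`). These changes of variables also give the absolute
convergence at almost every `(t,x)`, as `⟨v⟩ f`, `⟨v⟩ ∂ₜ f` and `⟨v⟩ ∇ₓ f` are locally integrable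
and the kernels grow at most like `⟨v⟩`. With `z` fixed, the derivatives in `S f` are moved to the
test function by an integration by parts in `(s,y)`, which produces the terms on the boundary plane
and at `s = 0` (`integral_by_parts_direction`). What remains is an identity for the kernels on the
cone in the variable `z` (`IsSourceOperator.integral_decomposition`), by which all terms together
reduce to the source and the Neumann datum integrated against the potential
`φ(s,y) = ∫ ψ(s + |z|, y + z) / (4π |z|) dz` (`conePairing_source_eq`). The Kirchhoff terms become
in the same way the pairing of `φ` with the initial data
(`IsInitialDatum.conePairing_kirchhoffKernel`).

The potential `φ` solves the backward wave equation `∂ₜ² φ - Δ φ = ψ`, and the potential of the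
even or odd reflection of `ψ` satisfies the Neumann or Dirichlet condition. If `u` is a weak
solution, it may be tested with this `φ`; by the duality, `∫ u ψ = ∫ F ψ` for all `ψ`, hence
`u = F` almost everywhere (`ae_eq_field_of_weak`). Conversely let `φ` be an admissible test function
and `ψ = ∂ₜ² φ - Δ φ`. The cutoffs of `ψ` near the boundary plane are covered by the duality, and
their potentials converge boundedly, together with the time derivatives, to `φ` by Kirchhoff's
formula in the half space, so that the weak formulation holds for `F` in the limit
(`integral_field_mul_box`). Finally the weak derivatives of `ρ` and `J` are identified with the
velocity moments of the weak derivatives of `f` (`ae_eq_source`).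
-/

noncomputable section

namespace RVM

open Filter Topology
open scoped Pointwise

/-! ### Relativistic velocities and the kernels -/

lemma one_le_bracket (v : E3) : 1 ≤ bracket v := by
  unfold bracket
  rw [Real.one_le_sqrt]
  nlinarith [sq_nonneg ‖v‖]

lemma bracket_pos (v : E3) : 0 < bracket v := lt_of_lt_of_le one_pos (one_le_bracket v)

lemma bracket_sq (v : E3) : bracket v ^ 2 = 1 + ‖v‖ ^ 2 := by
  unfold bracket
  rw [Real.sq_sqrt]
  positivity

lemma norm_hat_sq (v : E3) : ‖hat v‖ ^ 2 = 1 - (bracket v ^ 2)⁻¹ := by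
  have h := bracket_pos v
  have h2 := bracket_sq v
  unfold hat
  rw [norm_smul, Real.norm_of_nonneg (inv_nonneg.2 h.le), mul_pow, inv_pow]
  have : ‖v‖ ^ 2 = bracket v ^ 2 - 1 := by linarith
  rw [this]
  field_simp

lemma norm_hat_le_one (v : E3) : ‖hat v‖ ≤ 1 := by
  have h := norm_hat_sq v
  have h2 : 0 < (bracket v ^ 2)⁻¹ := by have := bracket_pos v; positivity
  nlinarith [norm_nonneg (hat v)]

lemma continuous_bracket : Continuous bracket := by
  unfold bracket
  fun_prop

lemma contDiff_bracket : ContDiff ℝ ∞ bracket := by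
  unfold bracket
  refine ContDiff.sqrt ?_ ?_
  · exact contDiff_const.add (contDiff_norm_sq ℝ)
  · intro v
    positivity

lemma contDiff_hat : ContDiff ℝ ∞ hat := by
  unfold hat
  exact (contDiff_bracket.inv fun v => (bracket_pos v).ne').smul contDiff_id

lemma contDiff_hat_apply (i : Fin 3) : ContDiff ℝ ∞ (fun v => hat v i) :=
  (contDiff_euclidean.1 contDiff_hat) i

lemma continuous_hat : Continuous hat := contDiff_hat.continuous

lemma abs_apply_le_norm (x : E3) (i : Fin 3) : |x i| ≤ ‖x‖ := by
  simpa using PiLp.norm_apply_le x i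

lemma abs_hat_apply_le (v : E3) (i : Fin 3) : |hat v i| ≤ 1 :=
  (abs_apply_le_norm _ i).trans (norm_hat_le_one v)

/-- The denominators of the kernels are bounded below by `1 / (2⟨v⟩²)`. -/
lemma inv_le_one_add_inner_hat (v om : E3) (h : ‖om‖ ≤ 1) :
    (2 * bracket v ^ 2)⁻¹ ≤ 1 + inner ℝ (hat v) om := by
  have h1 : |inner ℝ (hat v) om| ≤ ‖hat v‖ * ‖om‖ := abs_real_inner_le_norm _ _
  have h2 : ‖hat v‖ * ‖om‖ ≤ ‖hat v‖ := mul_le_of_le_one_right (norm_nonneg _) h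
  have h3 := norm_hat_sq v
  have h4 := norm_hat_le_one v
  have h5 : (2 * bracket v ^ 2)⁻¹ = (1 - ‖hat v‖ ^ 2) / 2 := by
    rw [h3, mul_inv]; ring
  have h6 := neg_le_of_abs_le h1
  rw [h5]
  nlinarith [norm_nonneg (hat v)]

lemma one_add_inner_hat_pos (v om : E3) (h : ‖om‖ ≤ 1) : 0 < 1 + inner ℝ (hat v) om := by
  refine lt_of_lt_of_le ?_ (inv_le_one_add_inner_hat v om h)
  have := bracket_pos v
  positivity

lemma norm_add_hat_sq_le (v om : E3) (h : ‖om‖ ≤ 1) :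
    ‖om + hat v‖ ^ 2 ≤ 2 * (1 + inner ℝ (hat v) om) := by
  have h1 := norm_hat_le_one v
  have h2 : ‖om + hat v‖ ^ 2 = ‖om‖ ^ 2 + 2 * inner ℝ om (hat v) + ‖hat v‖ ^ 2 :=
    norm_add_sq_real om (hat v)
  rw [h2, real_inner_comm]
  nlinarith [norm_nonneg om, norm_nonneg (hat v)]

lemma cross_apply_zero (a b : E3) : cross a b 0 = a 1 * b 2 - a 2 * b 1 := by
  simp [cross, crossProduct]

lemma cross_apply_one (a b : E3) : cross a b 1 = a 2 * b 0 - a 0 * b 2 := by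
  simp [cross, crossProduct]

lemma cross_apply_two (a b : E3) : cross a b 2 = a 0 * b 1 - a 1 * b 0 := by
  simp [cross, crossProduct]

lemma norm_sq_eq_sum (x : E3) : ‖x‖ ^ 2 = x 0 ^ 2 + x 1 ^ 2 + x 2 ^ 2 := by
  rw [EuclideanSpace.real_norm_sq_eq, Fin.sum_univ_three]

lemma inner_eq_sum (x y : E3) : inner ℝ x y = x 0 * y 0 + x 1 * y 1 + x 2 * y 2 := by
  simp [PiLp.inner_apply, Fin.sum_univ_three, mul_comm]

lemma abs_cross_apply_le (a b : E3) (i : Fin 3) : |cross a b i| ≤ ‖a‖ * ‖b‖ := by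
  apply abs_le_of_sq_le_sq _ (by positivity)
  rw [mul_pow, norm_sq_eq_sum, norm_sq_eq_sum]
  fin_cases i
  · simp only [Fin.zero_eta, cross_apply_zero]
    nlinarith [sq_nonneg (a 1 * b 1 + a 2 * b 2), sq_nonneg (a 0 * b 0), sq_nonneg (a 0 * b 1),
      sq_nonneg (a 0 * b 2), sq_nonneg (a 1 * b 0), sq_nonneg (a 2 * b 0)]
  · simp only [Fin.mk_one, cross_apply_one]
    nlinarith [sq_nonneg (a 2 * b 2 + a 0 * b 0), sq_nonneg (a 1 * b 1), sq_nonneg (a 0 * b 1),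
      sq_nonneg (a 2 * b 1), sq_nonneg (a 1 * b 0), sq_nonneg (a 1 * b 2)]
  · simp only [Fin.reduceFinMk, cross_apply_two]
    nlinarith [sq_nonneg (a 1 * b 1 + a 0 * b 0), sq_nonneg (a 2 * b 2), sq_nonneg (a 0 * b 2),
      sq_nonneg (a 1 * b 2), sq_nonneg (a 2 * b 0), sq_nonneg (a 2 * b 1)]

/-- The cross product `ω × v̂` is small where the denominator `1 + v̂ · ω` is. -/
lemma abs_cross_hat_le (v om : E3) (h : ‖om‖ ≤ 1) (i : Fin 3) :
    |cross om (hat v) i| ≤ ‖om + hat v‖ := by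
  have h0 : cross om (hat v) i = cross om (om + hat v) i := by
    fin_cases i <;> simp [cross_apply_zero, cross_apply_one, cross_apply_two] <;> ring
  rw [h0]
  exact (abs_cross_apply_le _ _ i).trans (mul_le_of_le_one_left (norm_nonneg _) h)

/-- The bound behind the growth `⟨v⟩` of all kernels: a numerator of size at most `|ω + v̂|` over
the first power of `1 + v̂ · ω`. -/
lemma abs_div_one_add_inner_le (v om : E3) (h : ‖om‖ ≤ 1) {N : ℝ} (hN : |N| ≤ ‖om + hat v‖) :
    |N / (1 + inner ℝ (hat v) om)| ≤ 4 * bracket v := by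
  have hp := one_add_inner_hat_pos v om h
  have hi := inv_le_one_add_inner_hat v om h
  have hb := bracket_pos v
  have hs := norm_add_hat_sq_le v om h
  set D := 1 + inner ℝ (hat v) om
  rw [abs_div, abs_of_pos hp, div_le_iff₀ hp]
  refine hN.trans ?_
  apply abs_le_of_sq_le_sq' _ (by positivity) |>.2
  refine hs.trans ?_
  have h1 : 1 ≤ 2 * bracket v ^ 2 * D := by
    have := mul_le_mul_of_nonneg_left hi (show 0 ≤ 2 * bracket v ^ 2 by positivity)
    rwa [mul_inv_cancel₀ (by positivity)] at this
  have h2 : (4 * bracket v * D) ^ 2 = 8 * D * (2 * bracket v ^ 2 * D) := by ring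
  rw [h2]
  nlinarith

/-- The same bound for the kernels with the second power of `1 + v̂ · ω` in the denominator, which
carry the additional factor `1 - |v̂|² = ⟨v⟩⁻²`. -/
lemma abs_mul_div_one_add_inner_sq_le (v om : E3) (h : ‖om‖ ≤ 1) {N : ℝ}
    (hN : |N| ≤ ‖om + hat v‖) :
    |N * (1 - ‖hat v‖ ^ 2) / (1 + inner ℝ (hat v) om) ^ 2| ≤ 8 * bracket v := by
  have hp := one_add_inner_hat_pos v om h
  have hi := inv_le_one_add_inner_hat v om h
  have hb := bracket_pos v
  have h1 := abs_div_one_add_inner_le v om h hN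
  have h2 : N * (1 - ‖hat v‖ ^ 2) / (1 + inner ℝ (hat v) om) ^ 2 =
      N / (1 + inner ℝ (hat v) om) * ((bracket v ^ 2)⁻¹ / (1 + inner ℝ (hat v) om)) := by
    rw [norm_hat_sq]
    field_simp
    ring
  rw [h2, abs_mul]
  have h3 : |(bracket v ^ 2)⁻¹ / (1 + inner ℝ (hat v) om)| ≤ 2 := by
    rw [abs_of_pos (by positivity), div_le_iff₀ hp]
    rw [mul_inv] at hi
    linarith
  calc _ ≤ 4 * bracket v * 2 := mul_le_mul h1 h3 (abs_nonneg _) (by positivity)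
    _ = _ := by ring

lemma continuous_hat_snd_apply (i : Fin 3) : Continuous fun p : E3 × E3 => hat p.2 i :=
  (contDiff_hat_apply i).continuous.comp continuous_snd

lemma continuous_fst_apply (i : Fin 3) : Continuous fun p : E3 × E3 => p.1 i := by fun_prop

lemma continuous_one_add_inner_hat :
    Continuous fun p : E3 × E3 => 1 + inner ℝ (hat p.2) p.1 :=
  continuous_const.add ((continuous_hat.comp continuous_snd).inner continuous_fst)

lemma measurable_kerES (i : Fin 3) : Measurable fun p : E3 × E3 => kerES i p.1 p.2 :=
  ((continuous_fst_apply i).add (continuous_hat_snd_apply i)).measurable.div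
    continuous_one_add_inner_hat.measurable

lemma contDiff_one_add_inner_hat (om : E3) :
    ContDiff ℝ ∞ fun v => 1 + inner ℝ (hat v) om :=
  contDiff_const.add (contDiff_hat.inner ℝ contDiff_const)

lemma contDiff_cross_hat (i : Fin 3) (om : E3) : ContDiff ℝ ∞ fun v => cross om (hat v) i := by
  have h := contDiff_hat_apply
  fin_cases i
  · simp only [Fin.zero_eta, cross_apply_zero]
    exact (contDiff_const.mul (h 2)).sub (contDiff_const.mul (h 1))
  · simp only [Fin.mk_one, cross_apply_one]
    exact (contDiff_const.mul (h 0)).sub (contDiff_const.mul (h 2))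
  · simp only [Fin.reduceFinMk, cross_apply_two]
    exact (contDiff_const.mul (h 1)).sub (contDiff_const.mul (h 0))

/-- The weight left over from `⟨v⟩^{4+δ}` after one power of `⟨v⟩` is spent on the kernels is
integrable in velocity. -/
lemma integrable_bracket_rpow {δ : ℝ} (hδ : 0 < δ) :
    Integrable fun v : E3 => bracket v ^ (-(3 + δ)) := by
  have h := integrable_rpow_neg_one_add_norm_sq (E := E3) (μ := volume) (r := 3 + δ)
    (by simp; linarith)
  refine h.congr (Filter.Eventually.of_forall fun v => ?_)
  simp only [bracket]
  rw [Real.sqrt_eq_rpow, ← Real.rpow_mul (by positivity)]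
  congr 1
  ring

/-! ### Reflection -/

@[simp] lemma bar_apply_zero (x : E3) : bar x 0 = x 0 := by simp [bar]
@[simp] lemma bar_apply_one (x : E3) : bar x 1 = x 1 := by simp [bar]
@[simp] lemma bar_apply_two (x : E3) : bar x 2 = - x 2 := by simp [bar]

/-- The reflection as a linear isometry. -/
def barIso : E3 ≃ₗᵢ[ℝ] E3 where
  toFun := bar
  invFun := bar
  map_add' x y := by ext i; fin_cases i <;> simp; ring
  map_smul' c x := by ext i; fin_cases i <;> simp
  left_inv x := by ext i; fin_cases i <;> simp
  right_inv x := by ext i; fin_cases i <;> simp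
  norm_map' x := by
    have h : ‖bar x‖ ^ 2 = ‖x‖ ^ 2 := by simp [norm_sq_eq_sum]
    exact (sq_eq_sq₀ (norm_nonneg _) (norm_nonneg _)).1 h

@[simp] lemma bar_bar (x : E3) : bar (bar x) = x := barIso.left_inv x

lemma norm_bar (x : E3) : ‖bar x‖ = ‖x‖ := barIso.norm_map x

lemma bar_sub (x y : E3) : bar (x - y) = bar x - bar y := map_sub barIso x y

lemma bar_add (x y : E3) : bar (x + y) = bar x + bar y := map_add barIso x y

lemma bar_smul (c : ℝ) (x : E3) : bar (c • x) = c • bar x := map_smul barIso c x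

lemma norm_bar_sub (x y : E3) : ‖bar x - y‖ = ‖x - bar y‖ := by
  rw [← norm_bar (x - bar y), bar_sub, bar_bar]

lemma continuous_bar : Continuous bar := barIso.continuous

lemma measurePreserving_bar : MeasurePreserving bar (volume : Measure E3) volume :=
  barIso.measurePreserving

lemma bar_eq_self {x : E3} (h : x 2 = 0) : bar x = x := by
  ext i; fin_cases i <;> simp [h]

lemma planePoint_two (z : E2) : planePoint z 2 = 0 := by simp [planePoint]
lemma bar_planePoint (z : E2) : bar (planePoint z) = planePoint z := bar_eq_self (planePoint_two z)

lemma continuous_planePoint : Continuous planePoint := by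
  refine (PiLp.continuous_toLp 2 _).comp (continuous_pi fun i => ?_)
  fin_cases i <;> simp <;> fun_prop

lemma measurableEmbedding_bar : MeasurableEmbedding bar :=
  barIso.toHomeomorph.measurableEmbedding

lemma isOpen_Ω : IsOpen Ω := by
  unfold Ω
  exact isOpen_lt continuous_const (by fun_prop)

lemma measurableSet_Ω : MeasurableSet Ω := isOpen_Ω.measurableSet

/-! ### Integration over the half space, along lines and in polar coordinates -/

/-- The parametrization of `ℝ³` by the point of the boundary plane below and the height. -/
def aboveMap (p : E2 × ℝ) : E3 := planePoint p.1 + p.2 • e 2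

@[simp] lemma aboveMap_zero (p : E2 × ℝ) : aboveMap p 0 = p.1 0 := by
  simp [aboveMap, planePoint, e]
@[simp] lemma aboveMap_one (p : E2 × ℝ) : aboveMap p 1 = p.1 1 := by
  simp [aboveMap, planePoint, e]
@[simp] lemma aboveMap_two (p : E2 × ℝ) : aboveMap p 2 = p.2 := by
  simp [aboveMap, planePoint, e]

lemma continuous_aboveMap : Continuous aboveMap := by
  have := continuous_planePoint
  unfold aboveMap
  fun_prop

lemma injective_aboveMap : Function.Injective aboveMap := by
  intro p q h
  have h0 := congrArg (fun x : E3 => x 0) h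
  have h1 := congrArg (fun x : E3 => x 1) h
  have h2 := congrArg (fun x : E3 => x 2) h
  simp only [aboveMap_zero, aboveMap_one, aboveMap_two] at h0 h1 h2
  refine Prod.ext ?_ h2
  ext i
  fin_cases i
  · exact h0
  · exact h1

lemma measurableEmbedding_aboveMap : MeasurableEmbedding aboveMap :=
  continuous_aboveMap.measurableEmbedding injective_aboveMap

lemma measurePreserving_aboveMap : MeasurePreserving aboveMap volume volume := by
  have h1 := (volume_preserving_piFinSuccAbove (fun _ : Fin 3 => ℝ) 2).symm
  have h2 : MeasurePreserving (fun p : E2 × ℝ => (p.2, (WithLp.ofLp p.1 : Fin 2 → ℝ)))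
      volume volume :=
    ((MeasurePreserving.id volume).prod (PiLp.volume_preserving_ofLp (Fin 2))).comp
      Measure.measurePreserving_swap
  have h3 := (PiLp.volume_preserving_toLp (Fin 3)).comp (h1.comp h2)
  have h4 : aboveMap = WithLp.toLp 2 ∘ ⇑(MeasurableEquiv.piFinSuccAbove (fun _ => ℝ) 2).symm ∘
      fun p : E2 × ℝ => (p.2, (WithLp.ofLp p.1 : Fin 2 → ℝ)) := by
    funext p
    refine PiLp.ext fun i => ?_
    fin_cases i
    · simp
      rfl
    · simp
      rfl
    · simp
  rw [h4]
  exact h3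

lemma preimage_aboveMap_Ω : aboveMap ⁻¹' Ω = univ ×ˢ Ioi 0 := by
  ext p
  simp [Ω]

lemma measurePreserving_aboveMap_Ω :
    MeasurePreserving aboveMap (volume.prod (volume.restrict (Ioi 0))) (volume.restrict Ω) := by
  have h := measurePreserving_aboveMap.restrict_preimage measurableSet_Ω
  rw [preimage_aboveMap_Ω, Measure.volume_eq_prod, ← Measure.prod_restrict,
    Measure.restrict_univ] at h
  exact h

/-- The integral over the half space of a normal derivative, by the fundamental theorem of calculus
on vertical half lines. An isolated singularity `c` is allowed, since almost no line meets it. -/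
lemma integral_Ω_normal {P P' : E3 → ℝ} (c : E3) (hcont : ContinuousOn P (Ωbar \ {c}))
    (hd : ∀ y ∈ Ω, y ≠ c → HasLineDerivAt ℝ P (P' y) y (e 2)) (R : ℝ)
    (hR : ∀ y ∈ Ωbar, R ≤ ‖y‖ → P y = 0) (hint : IntegrableOn P' Ω) :
    ∫ y in Ω, P' y = - ∫ w : E2, P (planePoint w) := by
  have hi : Integrable (fun p : E2 × ℝ => P' (aboveMap p))
      (volume.prod (volume.restrict (Ioi 0))) :=
    (measurePreserving_aboveMap_Ω.integrable_comp_emb measurableEmbedding_aboveMap).2 hint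
  rw [← measurePreserving_aboveMap_Ω.integral_comp measurableEmbedding_aboveMap, integral_prod _ hi,
    ← integral_neg]
  have hne : ∀ᵐ w : E2, w ≠ !₂[c 0, c 1] :=
    compl_mem_ae_iff.2 (measure_singleton _)
  refine integral_congr_ae ?_
  filter_upwards [hi.prod_right_ae, hne] with w hw hwc
  have hnc : ∀ r, aboveMap (w, r) ≠ c := by
    intro r h
    apply hwc
    ext i
    fin_cases i
    · simp [← h]
    · simp [← h]
  have key := integral_Ioi_of_hasDerivAt_of_tendsto (a := 0) (f := fun r => P (aboveMap (w, r)))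
    (f' := fun r => P' (aboveMap (w, r))) (m := 0) ?_ ?_ hw ?_
  · rw [key]
    simp [aboveMap]
  · have h1 : ContinuousOn (fun r => P (aboveMap (w, r))) (Ici 0) :=
      hcont.comp (f := fun r => aboveMap (w, r)) (by
        have := continuous_aboveMap
        fun_prop) (fun r hr => ⟨by simpa [Ωbar] using hr, hnc r⟩)
    exact h1 0 self_mem_Ici
  · intro r hr
    have h1 := hd (aboveMap (w, r)) (by simpa [Ω] using hr) (hnc r)
    unfold HasLineDerivAt at h1
    have h2 : HasDerivAt (fun s => P (aboveMap (w, r) + (s - r) • e 2)) (P' (aboveMap (w, r))) r := by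
      have h3 : HasDerivAt (fun s : ℝ => s - r) 1 r := (hasDerivAt_id r).sub_const r
      have h4 := HasDerivAt.scomp (h := fun s : ℝ => s - r) r (by simpa using h1) h3
      simpa [Function.comp_def] using h4
    have h5 : (fun s => P (aboveMap (w, s))) =
        fun s => P (aboveMap (w, r) + (s - r) • e 2) := by
      funext s
      congr 1
      simp only [aboveMap]
      module
    rw [h5]
    exact h2
  · refine tendsto_const_nhds.congr' ?_
    filter_upwards [Filter.eventually_ge_atTop (max R 0)] with r hr
    refine (hR _ (by simpa [Ωbar] using (le_max_right _ _).trans hr) ?_).symm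
    have h1 := abs_apply_le_norm (aboveMap (w, r)) 2
    rw [aboveMap_two] at h1
    exact ((le_max_left _ _).trans hr).trans ((le_abs_self _).trans h1)

/-- The integral of a directional derivative vanishes over a domain which is invariant under
translations in that direction. An isolated singularity `c` is allowed: the function is replaced by
`0` on the null line through `c`. -/
lemma setIntegral_lineDeriv_eq_zero {P P' : E3 → ℝ} {D : Set E3} (hD : MeasurableSet D) (u c : E3)
    (hinv : ∀ y, ∀ r : ℝ, y ∈ D → y + r • u ∈ D)
    (hd : ∀ y ∈ D, y ≠ c → HasLineDerivAt ℝ P (P' y) y u)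
    (hP : IntegrableOn P D) (hP' : IntegrableOn P' D) : ∫ y in D, P' y = 0 := by
  classical
  set L : Set E3 := (fun r : ℝ => c + r • u) '' univ with hL
  have hLc : IsClosed L := by
    have : L = (AffineSubspace.mk' c (Submodule.span ℝ {u}) : Set E3) := by
      ext y
      simp only [hL, image_univ, mem_range, SetLike.mem_coe, AffineSubspace.mem_mk',
        Submodule.mem_span_singleton, vsub_eq_sub]
      constructor
      · rintro ⟨r, rfl⟩
        exact ⟨r, by simp⟩
      · rintro ⟨r, hr⟩
        exact ⟨r, by rw [hr]; abel⟩
    rw [this]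
    exact AffineSubspace.closed_of_finiteDimensional _
  have hL0 : volume L = 0 := by
    have : L = (AffineSubspace.mk' c (Submodule.span ℝ {u}) : Set E3) := by
      ext y
      simp only [hL, image_univ, mem_range, SetLike.mem_coe, AffineSubspace.mem_mk',
        Submodule.mem_span_singleton, vsub_eq_sub]
      constructor
      · rintro ⟨r, rfl⟩
        exact ⟨r, by simp⟩
      · rintro ⟨r, hr⟩
        exact ⟨r, by rw [hr]; abel⟩
    rw [this]
    apply Measure.addHaar_affineSubspace
    intro h
    have h1 := congrArg AffineSubspace.direction h
    rw [AffineSubspace.direction_mk', AffineSubspace.direction_top] at h1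
    have h2 := (finrank_span_le_card (R := ℝ) ({u} : Set E3))
    rw [h1, finrank_top] at h2
    simp at h2
  set S := D \ L with hS
  have hSm : MeasurableSet S := hD.diff hLc.measurableSet
  have hSD : S =ᵐ[volume] D := by
    refine sdiff_null_ae_eq_self ?_
    exact hL0
  have hSinv : ∀ y, ∀ r : ℝ, (y + r • u ∈ S ↔ y ∈ S) := by
    have h1 : ∀ y, ∀ r : ℝ, y ∈ S → y + r • u ∈ S := by
      rintro y r ⟨hy1, hy2⟩
      refine ⟨hinv y r hy1, ?_⟩
      rintro ⟨r', -, h'⟩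
      refine hy2 ⟨r' - r, mem_univ _, ?_⟩
      have : y = c + r' • u - r • u := by simp only at h'; rw [h']; abel
      rw [this]
      module
    intro y r
    refine ⟨fun h => ?_, h1 y r⟩
    have := h1 _ (-r) h
    simpa using this
  have hint : ∀ Q : E3 → ℝ, IntegrableOn Q D → Integrable (S.indicator Q) := fun Q hQ =>
    (integrable_indicator_iff hSm).2 (hQ.mono_set sdiff_subset)
  have key := integral_bilinear_hasLineDerivAt_right_eq_neg_left_of_integrable (μ := volume)
    (f := S.indicator P) (f' := S.indicator P') (g := fun _ => (1 : ℝ)) (g' := fun _ => (0 : ℝ))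
    (v := u) (B := ContinuousLinearMap.mul ℝ ℝ) (by simpa using hint P' hP') (by simp)
    (by simpa using hint P hP) ?_ ?_
  · have h2 : ∫ y, S.indicator P' y = 0 := by simpa using key
    rw [← h2, integral_indicator hSm]
    exact setIntegral_congr_set hSD.symm
  · intro x _
    unfold HasLineDerivAt
    by_cases hx : x ∈ S
    · have h1 : (fun t : ℝ => S.indicator P (x + t • u)) = fun t => P (x + t • u) := by
        ext t
        rw [indicator_of_mem ((hSinv x t).2 hx)]
      rw [h1, indicator_of_mem hx]
      refine hd x hx.1 ?_
      rintro rfl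
      exact hx.2 ⟨0, mem_univ _, by simp⟩
    · have h1 : (fun t : ℝ => S.indicator P (x + t • u)) = fun t => 0 := by
        ext t
        rw [indicator_of_notMem (fun h => hx ((hSinv x t).1 h))]
      rw [h1, indicator_of_notMem hx]
      exact hasDerivAt_const _ _
  · intro x _
    unfold HasLineDerivAt
    exact hasDerivAt_const _ _

/-- The radial measure `t² dt` on `(0, ∞)`. -/
def radialMeasure : Measure ℝ :=
  (volume.restrict (Ioi 0)).withDensity fun t => ENNReal.ofReal (t ^ 2)

instance : SigmaFinite radialMeasure := by
  unfold radialMeasure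
  exact SigmaFinite.withDensity_ofReal _

instance : IsFiniteMeasure sphereMeasure := by unfold sphereMeasure; infer_instance

lemma measurePreserving_polar :
    MeasurePreserving (fun p : ℝ × Metric.sphere (0 : E3) 1 => p.1 • (p.2 : E3))
      (radialMeasure.prod sphereMeasure) volume := by
  have hr : MeasurePreserving (Subtype.val : Ioi (0 : ℝ) → ℝ) (Measure.volumeIoiPow 2)
      radialMeasure := by
    refine ⟨measurable_subtype_coe, ?_⟩
    ext s hs
    rw [Measure.map_apply measurable_subtype_coe hs, Measure.volumeIoiPow,
      withDensity_apply _ (measurable_subtype_coe hs), radialMeasure, withDensity_apply _ hs,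
      setLIntegral_subtype measurableSet_Ioi _ fun a : ℝ => ENNReal.ofReal (a ^ 2),
      Measure.restrict_restrict hs]
    congr 2
    ext x
    simp [and_comm]
  have ha : MeasurePreserving (fun p : Metric.sphere (0 : E3) 1 × Ioi (0 : ℝ) => ((p.2 : ℝ), p.1))
      (sphereMeasure.prod (Measure.volumeIoiPow 2)) (radialMeasure.prod sphereMeasure) :=
    (hr.prod (MeasurePreserving.id sphereMeasure)).comp Measure.measurePreserving_swap
  have hb0 := (volume : Measure E3).measurePreserving_homeomorphUnitSphereProd
  have hdim : Module.finrank ℝ E3 - 1 = 2 := by simp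
  rw [hdim] at hb0
  have hb1 := MeasurePreserving.symm (homeomorphUnitSphereProd E3).toMeasurableEquiv hb0
  have hval : MeasurePreserving (Subtype.val : ({0}ᶜ : Set E3) → E3)
      ((volume : Measure E3).comap (↑)) volume := by
    refine ⟨measurable_subtype_coe, ?_⟩
    rw [map_comap_subtype_coe (measurableSet_singleton _).compl]
    exact Measure.restrict_eq_self_of_ae_mem (by simp [ae_iff])
  have hb := hval.comp hb1
  refine ⟨by fun_prop, ?_⟩
  rw [← ha.map_eq, Measure.map_map (by fun_prop) ha.measurable, ← hb.map_eq]
  congr 1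

lemma integral_radialMeasure (F : ℝ → ℝ) :
    ∫ t, F t ∂radialMeasure = ∫ t in Ioi (0 : ℝ), t ^ 2 * F t := by
  unfold radialMeasure
  rw [integral_withDensity_eq_integral_toReal_smul (by fun_prop) (by simp)]
  refine integral_congr_ae (Filter.Eventually.of_forall fun t => ?_)
  simp [ENNReal.toReal_ofReal (sq_nonneg t)]

lemma sphereMeasure_real_univ : sphereMeasure.real univ = 4 * Real.pi := by
  unfold sphereMeasure
  rw [Measure.toSphere_real_apply_univ]
  simp [measureReal_def, EuclideanSpace.volume_ball_fin_three]
  rw [ENNReal.toReal_ofReal (by positivity)]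
  ring

/-! ### Partial derivatives in space-time -/

/-- The derivative of a function on space-time in the direction `a`. -/
def pd (a : ℝ × E3) (ψ : ℝ × E3 → ℝ) (p : ℝ × E3) : ℝ := fderiv ℝ ψ p a

lemma contDiff_pd {ψ : ℝ × E3 → ℝ} (h : ContDiff ℝ ∞ ψ) (a : ℝ × E3) : ContDiff ℝ ∞ (pd a ψ) :=
  (h.fderiv_right (m := ∞) (by simp)).clm_apply contDiff_const

lemma tsupport_pd_subset (a : ℝ × E3) (ψ : ℝ × E3 → ℝ) : tsupport (pd a ψ) ⊆ tsupport ψ := by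
  refine (closure_mono fun p hp => ?_).trans (closure_minimal (support_fderiv_subset ℝ (f := ψ))
    (isClosed_tsupport ψ))
  intro h
  exact hp (by simp [pd, h])

lemma hasCompactSupport_pd {ψ : ℝ × E3 → ℝ} (h : HasCompactSupport ψ) (a : ℝ × E3) :
    HasCompactSupport (pd a ψ) :=
  h.mono' ((subset_tsupport _).trans (tsupport_pd_subset a ψ))

lemma IsTest.pd {T : ℝ} {ψ : ℝ × E3 → ℝ} (h : IsTest T ψ) (a : ℝ × E3) : IsTest T (pd a ψ) :=
  ⟨contDiff_pd h.1 a, hasCompactSupport_pd h.2.1 a, (tsupport_pd_subset a ψ).trans h.2.2⟩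

lemma pd_comm {ψ : ℝ × E3 → ℝ} (h : ContDiff ℝ ∞ ψ) (a b : ℝ × E3) :
    pd a (pd b ψ) = pd b (pd a ψ) := by
  have h1 : ∀ a b p, pd a (pd b ψ) p = fderiv ℝ (fderiv ℝ ψ) p a b := by
    intro a b p
    have hd : DifferentiableAt ℝ (fderiv ℝ ψ) p :=
      (h.fderiv_right (m := ∞) (by simp)).differentiable (by simp) p
    unfold pd
    rw [fderiv_clm_apply hd (by fun_prop)]
    simp
  funext p
  rw [h1, h1]
  exact (h.contDiffAt.isSymmSndFDerivAt
    (by simpa using WithTop.coe_le_coe.2 (le_top : (2 : ℕ∞) ≤ ⊤))) a b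

lemma pd_add {ψ : ℝ × E3 → ℝ} (a b : ℝ × E3) (p : ℝ × E3) :
    pd (a + b) ψ p = pd a ψ p + pd b ψ p := map_add _ _ _

lemma pd_smul {ψ : ℝ × E3 → ℝ} (c : ℝ) (a : ℝ × E3) (p : ℝ × E3) :
    pd (c • a) ψ p = c * pd a ψ p := by simp [pd]

lemma eq_sum_smul_e (u : E3) : u = u 0 • e 0 + u 1 • e 1 + u 2 • e 2 := by
  ext i; fin_cases i <;> simp [e]

lemma pd_space_eq_sum {ψ : ℝ × E3 → ℝ} (u : E3) (p : ℝ × E3) :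
    pd (0, u) ψ p = ∑ j, u j * pd (0, e j) ψ p := by
  have h : ((0 : ℝ), u) = u 0 • ((0 : ℝ), e 0) + u 1 • ((0 : ℝ), e 1) + u 2 • ((0 : ℝ), e 2) := by
    ext i
    · simp
    · simp only [Prod.snd_add, Prod.smul_snd]
      conv_lhs => rw [eq_sum_smul_e u]
  rw [h, pd_add, pd_add, pd_smul, pd_smul, pd_smul, Fin.sum_univ_three]

/-- The wave operator in terms of directional derivatives. -/
def wave (ψ : ℝ × E3 → ℝ) (p : ℝ × E3) : ℝ :=
  pd (1, 0) (pd (1, 0) ψ) p - ∑ j, pd (0, e j) (pd (0, e j) ψ) p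

lemma deriv_time_eq_pd {ψ : ℝ × E3 → ℝ} (h : ContDiff ℝ ∞ ψ) (t : ℝ) (x : E3) :
    deriv (fun s => ψ (s, x)) t = pd (1, 0) ψ (t, x) := by
  have h1 : HasFDerivAt ψ (fderiv ℝ ψ (t, x)) (t, x) :=
    (h.differentiable (by simp) _).hasFDerivAt
  have h2 : HasDerivAt (fun s : ℝ => (s, x)) ((1 : ℝ), (0 : E3)) t :=
    (hasDerivAt_id t).prodMk (hasDerivAt_const t x)
  exact (h1.comp_hasDerivAt t h2).deriv

lemma fderiv_space_eq_pd {ψ : ℝ × E3 → ℝ} (h : ContDiff ℝ ∞ ψ) (t : ℝ) (x u : E3) :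
    fderiv ℝ (fun y => ψ (t, y)) x u = pd (0, u) ψ (t, x) := by
  have h1 : HasFDerivAt ψ (fderiv ℝ ψ (t, x)) (t, x) :=
    (h.differentiable (by simp) _).hasFDerivAt
  have h2 : HasFDerivAt (fun y : E3 => (t, y))
      ((0 : E3 →L[ℝ] ℝ).prod (ContinuousLinearMap.id ℝ E3)) x :=
    (hasFDerivAt_const t x).prodMk (hasFDerivAt_id x)
  have h3 : HasFDerivAt (fun y => ψ (t, y)) _ x := h1.comp x h2
  rw [h3.fderiv]
  simp [pd]

lemma box_eq_wave {ψ : ℝ × E3 → ℝ} (h : ContDiff ℝ ∞ ψ) : box ψ = wave ψ := by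
  funext p
  unfold box wave
  congr 1
  · rw [iteratedDeriv_succ, iteratedDeriv_one]
    have h1 : deriv (fun s => ψ (s, p.2)) = fun s => pd (1, 0) ψ (s, p.2) :=
      funext fun s => deriv_time_eq_pd h s p.2
    rw [h1, deriv_time_eq_pd (contDiff_pd h _)]
  · rw [InnerProductSpace.laplacian_eq_iteratedFDeriv_orthonormalBasis _
      (EuclideanSpace.basisFun (Fin 3) ℝ)]
    refine Finset.sum_congr rfl fun j _ => ?_
    have h0 : ContDiff ℝ ∞ fun y => ψ (p.1, y) := h.comp (contDiff_const.prodMk contDiff_id)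
    have hd : DifferentiableAt ℝ (fderiv ℝ fun y => ψ (p.1, y)) p.2 :=
      (h0.fderiv_right (m := ∞) (by simp)).differentiable (by simp) _
    rw [iteratedFDeriv_two_apply]
    have h1 : fderiv ℝ (fderiv ℝ fun y => ψ (p.1, y)) p.2 (e j) (e j) =
        fderiv ℝ (fun y => fderiv ℝ (fun y => ψ (p.1, y)) y (e j)) p.2 (e j) := by
      rw [fderiv_clm_apply hd (by fun_prop)]
      simp
    have h2 : (fun y => fderiv ℝ (fun y => ψ (p.1, y)) y (e j)) =
        fun y => pd (0, e j) ψ (p.1, y) := funext fun y => fderiv_space_eq_pd h _ _ _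
    simp only [EuclideanSpace.basisFun_apply]
    change fderiv ℝ (fderiv ℝ fun y => ψ (p.1, y)) p.2 (e j) (e j) = _
    rw [h1, h2, fderiv_space_eq_pd (contDiff_pd h _)]

lemma IsTest.wave {T : ℝ} {ψ : ℝ × E3 → ℝ} (h : IsTest T ψ) : IsTest T (wave ψ) := by
  have hj : ∀ j, IsTest T (RVM.pd (0, e j) (RVM.pd (0, e j) ψ)) := fun j => (h.pd _).pd _
  have ht : IsTest T (RVM.pd (1, 0) (RVM.pd (1, 0) ψ)) := (h.pd _).pd _
  have heq : RVM.wave ψ = RVM.pd (1, 0) (RVM.pd (1, 0) ψ) -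
      ((RVM.pd (0, e 0) (RVM.pd (0, e 0) ψ) + RVM.pd (0, e 1) (RVM.pd (0, e 1) ψ)) +
        RVM.pd (0, e 2) (RVM.pd (0, e 2) ψ)) := by
    funext p
    simp [RVM.wave, Fin.sum_univ_three]
  rw [heq]
  refine ⟨ht.1.sub (((hj 0).1.add (hj 1).1).add (hj 2).1), ?_, ?_⟩
  · exact ht.2.1.sub (((hj 0).2.1.add (hj 1).2.1).add (hj 2).2.1)
  · refine (tsupport_sub _ _).trans (union_subset ht.2.2 ?_)
    refine (tsupport_add _ _).trans (union_subset ?_ (hj 2).2.2)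
    exact (tsupport_add _ _).trans (union_subset (hj 0).2.2 (hj 1).2.2)

/-! ### Functions on the light cone -/

lemma hasDerivAt_norm_line {z : E3} (hz : z ≠ 0) (u : E3) :
    HasDerivAt (fun r : ℝ => ‖z + r • u‖) (inner ℝ z u / ‖z‖) 0 := by
  have h1 : HasDerivAt (fun r : ℝ => z + r • u) u 0 := by
    simpa using ((hasDerivAt_id (0 : ℝ)).smul_const u).const_add z
  have h2 := h1.norm_sq
  have h3 := h2.sqrt (by simpa using hz)
  have h4 : (fun r : ℝ => Real.sqrt (‖z + r • u‖ ^ 2)) = fun r => ‖z + r • u‖ := by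
    funext r
    rw [Real.sqrt_sq (norm_nonneg _)]
  rw [h4] at h3
  convert h3 using 1
  simp
  ring

lemma hasLineDerivAt_cone {ψ : ℝ × E3 → ℝ} (h : ContDiff ℝ ∞ ψ) (s : ℝ) (y : E3) {z : E3}
    (hz : z ≠ 0) (u : E3) :
    HasLineDerivAt ℝ (fun z => ψ (s + ‖z‖, y + z))
      (pd (0, u) ψ (s + ‖z‖, y + z) + inner ℝ z u / ‖z‖ * pd (1, 0) ψ (s + ‖z‖, y + z)) z u := by
  unfold HasLineDerivAt
  have h1 : HasFDerivAt ψ (fderiv ℝ ψ (s + ‖z + (0 : ℝ) • u‖, y + (z + (0 : ℝ) • u)))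
      (s + ‖z + (0 : ℝ) • u‖, y + (z + (0 : ℝ) • u)) :=
    (h.differentiable (by simp) _).hasFDerivAt
  have h2 : HasDerivAt (fun r : ℝ => (s + ‖z + r • u‖, y + (z + r • u)))
      (inner ℝ z u / ‖z‖, u) 0 := by
    refine ((hasDerivAt_norm_line hz u).const_add s).prodMk (HasDerivAt.const_add y ?_)
    simpa using ((hasDerivAt_id (0 : ℝ)).smul_const u).const_add z
  have h3 := h1.comp_hasDerivAt (0 : ℝ) h2
  refine h3.congr_deriv ?_
  have h4 : ((inner ℝ z u / ‖z‖ : ℝ), u) =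
      ((0 : ℝ), u) + (inner ℝ z u / ‖z‖ : ℝ) • ((1 : ℝ), (0 : E3)) := by simp
  rw [h4, map_add, map_smul]
  simp [pd]

lemma integrableOn_norm_pow_inv (m : ℕ) (hm : m ≤ 2) (R : ℝ) :
    IntegrableOn (fun z : E3 => (‖z‖ ^ m)⁻¹) (Metric.ball 0 R) := by
  rw [integrableOn_fun_norm_addHaar (μ := (volume : Measure E3)) (f := fun r => (r ^ m)⁻¹)]
  have h : ContinuousOn (fun r : ℝ => r ^ (2 - m)) (Icc 0 R) := by fun_prop
  refine ((h.integrableOn_Icc).mono_set Ioo_subset_Icc_self).congr_fun (fun r hr => ?_)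
    measurableSet_Ioo
  have hr0 : (r : ℝ) ≠ 0 := hr.1.ne'
  simp only [finrank_euclideanSpace, Fintype.card_fin, smul_eq_mul]
  rw [pow_sub₀ _ hr0 hm]

/-- A bound for the support of a function with compact support in space-time. -/
lemma exists_bound_of_hasCompactSupport {g : ℝ × E3 → ℝ} (h : HasCompactSupport g) :
    ∃ R, 0 < R ∧ ∀ p, g p ≠ 0 → |p.1| < R ∧ ‖p.2‖ < R := by
  obtain ⟨R, hR, h1⟩ := h.isBounded.exists_pos_norm_lt
  refine ⟨R, hR, fun p hp => ?_⟩
  have h2 := h1 p (subset_tsupport _ hp)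
  rw [Prod.norm_def, max_lt_iff] at h2
  exact h2

lemma integrable_kernel_cone {κ : E3 → ℝ} {C : ℝ} {m : ℕ} (hm : m ≤ 2) (hκ : Measurable κ)
    (hb : ∀ z, |κ z| ≤ C * (‖z‖ ^ m)⁻¹) {g : ℝ × E3 → ℝ} (hg : Continuous g)
    (hgc : HasCompactSupport g) (s : ℝ) (y : E3) :
    Integrable fun z => κ z * g (s + ‖z‖, y + z) := by
  obtain ⟨R, hR, hRg⟩ := exists_bound_of_hasCompactSupport hgc
  obtain ⟨M, hM⟩ := hg.bounded_above_of_compact_support hgc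
  have hM0 : 0 ≤ M := (norm_nonneg _).trans (hM 0)
  have hdom : Integrable ((Metric.ball (0 : E3) (R + ‖y‖)).indicator
      fun z => C * (‖z‖ ^ m)⁻¹ * M) :=
    (integrable_indicator_iff Metric.isOpen_ball.measurableSet).2
      (((integrableOn_norm_pow_inv m hm _).const_mul C).mul_const M)
  refine hdom.mono' ?_ (Filter.Eventually.of_forall fun z => ?_)
  · exact (hκ.mul (hg.measurable.comp (by fun_prop))).aestronglyMeasurable
  · by_cases hz : z ∈ Metric.ball (0 : E3) (R + ‖y‖)
    · rw [indicator_of_mem hz, norm_mul]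
      exact mul_le_mul (hb z) (hM _) (norm_nonneg _) ((abs_nonneg _).trans (hb z))
    · rw [indicator_of_notMem hz]
      have : g (s + ‖z‖, y + z) = 0 := by
        by_contra hne
        have h1 := (hRg _ hne).2
        apply hz
        rw [mem_ball_zero_iff]
        have h2 : ‖z‖ ≤ ‖y + z‖ + ‖y‖ := by
          have := norm_sub_le (y + z) y
          simpa using this
        simp only at h1
        linarith
      simp [this]

lemma abs_inner_div_norm_le (z u : E3) : |inner ℝ z u / ‖z‖| ≤ ‖u‖ := by
  rw [abs_div, abs_norm]
  rcases eq_or_ne z 0 with rfl | hz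
  · simp
  · rw [div_le_iff₀ (by positivity), mul_comm]
    exact abs_real_inner_le_norm z u

/-- Integration by parts along the light cone, against a kernel which is singular like `1/|z|`
at the vertex. No contribution from the vertex occurs. -/
lemma integral_kernel_cone {κ κ' : E3 → ℝ} {C : ℝ} (hκ : Measurable κ) (hκ' : Measurable κ')
    (hb : ∀ z, |κ z| ≤ C * (‖z‖ ^ 1)⁻¹) (hb' : ∀ z, |κ' z| ≤ C * (‖z‖ ^ 2)⁻¹) (u : E3)
    (hd : ∀ z, z ≠ 0 → HasLineDerivAt ℝ κ (κ' z) z u) {ψ : ℝ × E3 → ℝ} (h : ContDiff ℝ ∞ ψ)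
    (hc : HasCompactSupport ψ) (s : ℝ) (y : E3) :
    ∫ z, (κ z * pd (0, u) ψ (s + ‖z‖, y + z) +
      κ z * (inner ℝ z u / ‖z‖) * pd (1, 0) ψ (s + ‖z‖, y + z) +
        κ' z * ψ (s + ‖z‖, y + z)) = 0 := by
  have i1 := integrable_kernel_cone (m := 1) (by norm_num) hκ hb (contDiff_pd h (0, u)).continuous
    (hasCompactSupport_pd hc _) s y
  have i2 := integrable_kernel_cone (C := C * ‖u‖) (m := 1) (by norm_num)
    (κ := fun z => κ z * (inner ℝ z u / ‖z‖)) (by fun_prop)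
    (fun z => by
      rw [abs_mul, mul_right_comm]
      exact mul_le_mul (hb z) (abs_inner_div_norm_le z u) (abs_nonneg _)
        ((abs_nonneg _).trans (hb z)))
    (contDiff_pd h (1, 0)).continuous (hasCompactSupport_pd hc _) s y
  have i3 := integrable_kernel_cone (m := 2) le_rfl hκ' hb' h.continuous hc s y
  have i0 := integrable_kernel_cone (m := 1) (by norm_num) hκ hb h.continuous hc s y
  rw [← setIntegral_univ]
  refine setIntegral_lineDeriv_eq_zero (P := fun z => κ z * ψ (s + ‖z‖, y + z))
    MeasurableSet.univ u 0 (fun _ _ _ => mem_univ _) (fun z _ hz => ?_) i0.integrableOn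
    ((i1.add i2).add i3).integrableOn
  have h1 := hd z hz
  have h2 := hasLineDerivAt_cone h s y hz u
  unfold HasLineDerivAt at h1 h2 ⊢
  refine (h1.mul h2).congr_deriv ?_
  simp only [zero_smul, add_zero]
  ring

/-! ### The kernels and the first order operators they invert -/

/-- The coefficients of a first order operator `α₀ ∂ₜ + α · ∇ₓ`, depending on the velocity, from
which all kernels of the representation formulas are built. For `Eᵢ` it is `∂ᵢ + v̂ᵢ ∂ₜ`, for `Bᵢ` it
is `(v̂ × ∇)ᵢ`. Up to the factor `4π`, its integral against `f` in `v` is the source of the wave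
equation. -/
structure IsSourceOperator (α0 : E3 → ℝ) (α : E3 → E3) : Prop where
  smooth_time : ContDiff ℝ ∞ α0
  smooth_space : ContDiff ℝ ∞ α
  compat : ∀ v, inner ℝ (α v) (hat v) = α0 v
  bound : ∀ om v, ‖om‖ ≤ 1 → |α0 v + inner ℝ om (α v)| ≤ ‖om + hat v‖
  norm_le : ∀ v, ‖α v‖ ≤ 1

/-- The kernel in front of `S f`, for a general source operator. -/
def kerS (α0 : E3 → ℝ) (α : E3 → E3) (om v : E3) : ℝ :=
  (α0 v + inner ℝ om (α v)) / (1 + inner ℝ (hat v) om)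

/-- The kernel in front of `f`, for a general source operator. -/
def kerT (α0 : E3 → ℝ) (α : E3 → E3) (om v : E3) : ℝ :=
  -(α0 v + inner ℝ om (α v)) * (1 - ‖hat v‖ ^ 2) / (1 + inner ℝ (hat v) om) ^ 2

/-- The direction `-z / |z|`, so that `ω = back (x - y)`. -/
def back (z : E3) : E3 := -(‖z‖⁻¹ • z)

lemma norm_back_le_one (z : E3) : ‖back z‖ ≤ 1 := by
  unfold back
  rw [norm_neg, norm_smul, norm_inv, norm_norm]
  exact inv_mul_le_one

lemma measurable_back : Measurable back := by
  unfold back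
  fun_prop

lemma dir_eq_back (x y : E3) : dir x y = back (x - y) := by
  unfold dir back
  rw [norm_sub_rev, ← smul_neg, neg_sub]

namespace IsSourceOperator

variable {α0 : E3 → ℝ} {α : E3 → E3}

lemma abs_time_le (hα : IsSourceOperator α0 α) (v : E3) : |α0 v| ≤ 1 := by
  rw [← hα.compat v]
  exact (abs_real_inner_le_norm _ _).trans
    (mul_le_one₀ (hα.norm_le v) (norm_nonneg _) (norm_hat_le_one v))

lemma abs_kerS_le (hα : IsSourceOperator α0 α) (om v : E3) (h : ‖om‖ ≤ 1) :
    |kerS α0 α om v| ≤ 8 * bracket v := by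
  have h1 := abs_div_one_add_inner_le v om h (hα.bound om v h)
  have h2 := bracket_pos v
  unfold kerS
  linarith

lemma abs_kerT_le (hα : IsSourceOperator α0 α) (om v : E3) (h : ‖om‖ ≤ 1) :
    |kerT α0 α om v| ≤ 8 * bracket v :=
  abs_mul_div_one_add_inner_sq_le v om h (by rw [abs_neg]; exact hα.bound om v h)

lemma continuous_numerator (hα : IsSourceOperator α0 α) :
    Continuous fun p : E3 × E3 => α0 p.2 + inner ℝ p.1 (α p.2) :=
  (hα.smooth_time.continuous.comp continuous_snd).add
    (continuous_fst.inner (hα.smooth_space.continuous.comp continuous_snd))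

lemma measurable_kerS (hα : IsSourceOperator α0 α) :
    Measurable fun p : E3 × E3 => kerS α0 α p.1 p.2 :=
  hα.continuous_numerator.measurable.div continuous_one_add_inner_hat.measurable

lemma measurable_kerT (hα : IsSourceOperator α0 α) :
    Measurable fun p : E3 × E3 => kerT α0 α p.1 p.2 :=
  (hα.continuous_numerator.neg.mul (continuous_const.sub
    ((continuous_hat.comp continuous_snd).norm.pow 2))).measurable.div
    (continuous_one_add_inner_hat.pow 2).measurable

lemma contDiff_kerS (hα : IsSourceOperator α0 α) (om : E3) (h : ‖om‖ ≤ 1) :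
    ContDiff ℝ ∞ (kerS α0 α om) :=
  (hα.smooth_time.add (contDiff_const.inner ℝ hα.smooth_space)).div
    (contDiff_one_add_inner_hat om) fun v => (one_add_inner_hat_pos v om h).ne'

lemma inner_back (z u : E3) : inner ℝ (back z) u = -(inner ℝ z u / ‖z‖) := by
  unfold back
  rw [inner_neg_left, real_inner_smul_left]
  ring

/-- The derivative in the direction `v̂` of the kernel `kerS / |z|`. -/
lemma hasLineDerivAt_kerS (hα : IsSourceOperator α0 α) (v : E3) {z : E3} (hz : z ≠ 0) :
    HasLineDerivAt ℝ (fun z => ‖z‖⁻¹ * kerS α0 α (back z) v)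
      ((‖z‖ ^ 2)⁻¹ * (kerT α0 α (back z) v + inner ℝ (back z) (α v))) z (hat v) := by
  unfold HasLineDerivAt
  have hpos := one_add_inner_hat_pos v (back z) (norm_back_le_one z)
  have hz0 : 0 < ‖z‖ := norm_pos_iff.2 hz
  have hev : ∀ r : ℝ, z + r • hat v ≠ 0 →
      ‖z + r • hat v‖⁻¹ * kerS α0 α (back (z + r • hat v)) v =
      (α0 v * ‖z + r • hat v‖ - (inner ℝ z (α v) + r * α0 v)) /
        (‖z + r • hat v‖ * (‖z + r • hat v‖ - (inner ℝ z (hat v) + r * ‖hat v‖ ^ 2))) := by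
    intro r hr
    have hr0 : 0 < ‖z + r • hat v‖ := norm_pos_iff.2 hr
    have h1 : inner ℝ (z + r • hat v) (α v) = inner ℝ z (α v) + r * α0 v := by
      rw [inner_add_left, real_inner_smul_left, real_inner_comm (α v) (hat v), hα.compat]
    have h2 : inner ℝ (z + r • hat v) (hat v) = inner ℝ z (hat v) + r * ‖hat v‖ ^ 2 := by
      rw [inner_add_left, real_inner_smul_left, real_inner_self_eq_norm_sq]
    have h3 := one_add_inner_hat_pos v (back (z + r • hat v)) (norm_back_le_one _)
    rw [real_inner_comm, inner_back, h2] at h3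
    unfold kerS
    rw [real_inner_comm (back _) (hat v), inner_back, inner_back, h1, h2]
    set N := ‖z + r • hat v‖
    set q := inner ℝ z (hat v) + r * ‖hat v‖ ^ 2
    have h4 : N - q ≠ 0 := by
      have : N - q = N * (1 + -(q / N)) := by field_simp; ring
      rw [this]
      positivity
    have h5 : 1 + -(q / N) = (N - q) / N := by field_simp; ring
    rw [h5]
    field_simp
    ring
  have hd1 := hasDerivAt_norm_line hz (hat v)
  set n := ‖z‖
  set q := inner ℝ z (hat v)
  have hD0 : n - q ≠ 0 := by
    have h3 := hpos
    rw [real_inner_comm, inner_back] at h3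
    have : n - q = n * (1 + -(q / n)) := by field_simp; ring
    rw [this]
    positivity
  have hnum : HasDerivAt (fun r : ℝ => α0 v * ‖z + r • hat v‖ - (inner ℝ z (α v) + r * α0 v))
      (α0 v * (q / n) - α0 v) 0 := by
    refine (hd1.const_mul (α0 v)).sub (HasDerivAt.const_add _ ?_)
    simpa using (hasDerivAt_id (0 : ℝ)).mul_const (α0 v)
  have hden : HasDerivAt (fun r : ℝ => ‖z + r • hat v‖ *
      (‖z + r • hat v‖ - (inner ℝ z (hat v) + r * ‖hat v‖ ^ 2)))
      (q / n * (n - q) + n * (q / n - ‖hat v‖ ^ 2)) 0 := by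
    have h1 : HasDerivAt (fun r : ℝ => ‖z + r • hat v‖ - (inner ℝ z (hat v) + r * ‖hat v‖ ^ 2))
        (q / n - ‖hat v‖ ^ 2) 0 := by
      refine hd1.sub (HasDerivAt.const_add _ ?_)
      simpa using (hasDerivAt_id (0 : ℝ)).mul_const (‖hat v‖ ^ 2)
    refine (hd1.mul h1).congr_deriv ?_
    simp [n, q]
  have hdiv := hnum.div hden (by simpa [n, q] using ⟨hz, hD0⟩)
  have hne : ∀ᶠ r : ℝ in nhds 0, z + r • hat v ≠ 0 := by
    have hc : Continuous fun r : ℝ => z + r • hat v := by fun_prop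
    exact hc.continuousAt.eventually_ne (by simpa using hz)
  refine (hdiv.congr_of_eventuallyEq (hne.mono fun r hr => hev r hr)).congr_deriv ?_
  simp only [zero_smul, add_zero, zero_mul]
  unfold kerT
  rw [real_inner_comm (back _) (hat v), inner_back, inner_back]
  change _ = (n ^ 2)⁻¹ * (-(α0 v + -(inner ℝ z (α v) / n)) * (1 - ‖hat v‖ ^ 2) /
    (1 + -(q / n)) ^ 2 + -(inner ℝ z (α v) / n))
  have h5 : 1 + -(q / n) = (n - q) / n := by field_simp; ring
  rw [h5]
  change (_ * (n * (n - q)) - (α0 v * n - _) * _) / (n * (n - q)) ^ 2 = _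
  field_simp
  ring

lemma hasLineDerivAt_inv_norm {z : E3} (hz : z ≠ 0) (u : E3) :
    HasLineDerivAt ℝ (fun z : E3 => ‖z‖⁻¹) ((‖z‖ ^ 2)⁻¹ * inner ℝ (back z) u) z u := by
  unfold HasLineDerivAt
  have h := (hasDerivAt_norm_line hz u).inv (by simpa using hz)
  refine h.congr_deriv ?_
  rw [inner_back]
  simp
  ring

lemma abs_inner_back_le (z u : E3) : |inner ℝ (back z) u| ≤ ‖u‖ := by
  rw [inner_back, abs_neg]
  exact abs_inner_div_norm_le z u

/-- The Glassey-Strauss decomposition: along the light cone, the operator `α₀ ∂ₜ + α · ∇` is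
expressed by the transport operator `∂ₜ + v̂ · ∇` and by derivatives tangential to the cone, and the
latter are integrated by parts. -/
lemma integral_decomposition (hα : IsSourceOperator α0 α) {ψ : ℝ × E3 → ℝ} (h : ContDiff ℝ ∞ ψ)
    (hc : HasCompactSupport ψ) (s : ℝ) (y v : E3) :
    ∫ z, (‖z‖⁻¹ * (α0 v * pd (1, 0) ψ (s + ‖z‖, y + z) + pd (0, α v) ψ (s + ‖z‖, y + z)) -
      ‖z‖⁻¹ * kerS α0 α (back z) v *
        (pd (1, 0) ψ (s + ‖z‖, y + z) + pd (0, hat v) ψ (s + ‖z‖, y + z)) -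
      (‖z‖ ^ 2)⁻¹ * kerT α0 α (back z) v * ψ (s + ‖z‖, y + z)) = 0 := by
  have hbk := measurable_back
  have hmS : Measurable fun z => kerS α0 α (back z) v :=
    hα.measurable_kerS.comp (measurable_back.prodMk measurable_const)
  have hmT : Measurable fun z => kerT α0 α (back z) v :=
    hα.measurable_kerT.comp (measurable_back.prodMk measurable_const)
  have hv := bracket_pos v
  have hib : ∀ z, |inner ℝ (back z) (α v)| ≤ 1 := fun z =>
    (abs_inner_back_le z _).trans (hα.norm_le v)
  have hinn : Measurable fun z => inner ℝ (back z) (α v) := by fun_prop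
  -- integration by parts along the cone in the direction `α(v)`
  have key1 := integral_kernel_cone (κ := fun z : E3 => ‖z‖⁻¹)
    (κ' := fun z => (‖z‖ ^ 2)⁻¹ * inner ℝ (back z) (α v)) (C := 1) (by fun_prop) (by fun_prop)
    (fun z => by simp) (fun z => by
      rw [abs_mul, abs_of_nonneg (by positivity : 0 ≤ (‖z‖ ^ 2)⁻¹), mul_comm]
      exact mul_le_mul_of_nonneg_right (hib z) (by positivity)) (α v)
    (fun z hz => hasLineDerivAt_inv_norm hz (α v)) h hc s y
  -- integration by parts along the cone in the direction `v̂`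
  have key2 := integral_kernel_cone (κ := fun z : E3 => ‖z‖⁻¹ * kerS α0 α (back z) v)
    (κ' := fun z => (‖z‖ ^ 2)⁻¹ * (kerT α0 α (back z) v + inner ℝ (back z) (α v)))
    (C := 8 * bracket v + 1) (by fun_prop) (by fun_prop)
    (fun z => by
      rw [abs_mul, abs_of_nonneg (by positivity : 0 ≤ ‖z‖⁻¹), mul_comm, pow_one]
      refine mul_le_mul_of_nonneg_right ?_ (by positivity)
      have := hα.abs_kerS_le (back z) v (norm_back_le_one z)
      linarith) (fun z => by
      rw [abs_mul, abs_of_nonneg (by positivity : 0 ≤ (‖z‖ ^ 2)⁻¹), mul_comm]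
      refine mul_le_mul_of_nonneg_right ?_ (by positivity)
      exact (abs_add_le _ _).trans
        (add_le_add (hα.abs_kerT_le (back z) v (norm_back_le_one z)) (hib z))) (hat v)
    (fun z hz => hα.hasLineDerivAt_kerS v hz) h hc s y
  have hI : ∀ (K : E3 → ℝ) (m : ℕ) (C : ℝ) (g : ℝ × E3 → ℝ), m ≤ 2 → Measurable K →
      (∀ z, |K z| ≤ C) → ContDiff ℝ ∞ g → HasCompactSupport g →
      Integrable fun z => (‖z‖ ^ m)⁻¹ * K z * g (s + ‖z‖, y + z) := by
    intro K m C g hm hK hC hg hgc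
    refine integrable_kernel_cone (C := C) (m := m) hm (by fun_prop) (fun z => ?_)
      hg.continuous hgc s y
    rw [abs_mul, abs_of_nonneg (by positivity : 0 ≤ (‖z‖ ^ m)⁻¹), mul_comm]
    exact mul_le_mul_of_nonneg_right (hC z) (by positivity)
  have hSb : ∀ z, |kerS α0 α (back z) v| ≤ 8 * bracket v := fun z =>
    hα.abs_kerS_le (back z) v (norm_back_le_one z)
  have hTb : ∀ z, |kerT α0 α (back z) v| ≤ 8 * bracket v := fun z =>
    hα.abs_kerT_le (back z) v (norm_back_le_one z)
  have hsm := fun a => contDiff_pd h a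
  have hcs := fun a => hasCompactSupport_pd hc a
  have hir : ∀ u z, |inner ℝ z u / ‖z‖| ≤ ‖u‖ := fun u z => abs_inner_div_norm_le z u
  have a1 := hI (fun _ => 1) 1 1 _ (by norm_num) (by fun_prop) (by simp) (hsm (0, α v)) (hcs _)
  have a2 := hI (fun z => inner ℝ z (α v) / ‖z‖) 1 _ _ (by norm_num) (by fun_prop) (hir (α v))
    (hsm (1, 0)) (hcs _)
  have a3 := hI (fun z => inner ℝ (back z) (α v)) 2 _ _ le_rfl (by fun_prop) hib h hc
  have b1 := hI _ 1 _ _ (by norm_num) hmS hSb (hsm (0, hat v)) (hcs _)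
  have b2 := hI (fun z => kerS α0 α (back z) v * (inner ℝ z (hat v) / ‖z‖)) 1
    (8 * bracket v * ‖hat v‖) _ (by norm_num) (by fun_prop)
    (fun z => by rw [abs_mul]; exact mul_le_mul (hSb z) (hir _ z) (abs_nonneg _) (by positivity))
    (hsm (1, 0)) (hcs _)
  have b3 := hI (fun z => kerT α0 α (back z) v + inner ℝ (back z) (α v)) 2 (8 * bracket v + 1) _
    le_rfl (by fun_prop) (fun z => (abs_add_le _ _).trans (add_le_add (hTb z) (hib z))) h hc
  have e1 := integral_sub ((a1.add a2).add a3) ((b1.add b2).add b3)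
  have hz0 : ∀ᵐ z : E3, z ≠ 0 := compl_mem_ae_iff.2 (measure_singleton _)
  have e2 : ∀ {X Y : ℝ}, X = 0 → Y = 0 → X - Y = 0 := by rintro _ _ rfl rfl; simp
  refine Eq.trans ?_ (e1.trans (e2 ?_ ?_))
  · refine integral_congr_ae (hz0.mono fun z hz => ?_)
    have hn : ‖z‖ ≠ 0 := norm_ne_zero_iff.2 hz
    have hpos := one_add_inner_hat_pos v (back z) (norm_back_le_one z)
    -- The derivatives in time produced by the two integrations by parts combine to the original one.
    have hrel : kerS α0 α (back z) v * (1 - inner ℝ z (hat v) / ‖z‖) =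
        α0 v - inner ℝ z (α v) / ‖z‖ := by
      have h1 : 1 - inner ℝ z (hat v) / ‖z‖ = 1 + inner ℝ (hat v) (back z) := by
        rw [real_inner_comm (back z) (hat v), inner_back]; ring
      rw [h1, kerS, div_mul_cancel₀ _ hpos.ne', inner_back]
      ring
    simp only [Pi.add_apply, pow_one]
    have h2 : α0 v = kerS α0 α (back z) v * (1 - inner ℝ z (hat v) / ‖z‖) +
      inner ℝ z (α v) / ‖z‖ := by linarith
    rw [h2]
    ring
  · refine Eq.trans (integral_congr_ae (Filter.Eventually.of_forall fun z => ?_)) key1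
    simp
  · refine Eq.trans (integral_congr_ae (Filter.Eventually.of_forall fun z => ?_)) key2
    simp only [Pi.add_apply, pow_one]
    ring

end IsSourceOperator

lemma inner_e (u : E3) (i : Fin 3) : inner ℝ u (e i) = u i := by
  rw [inner_eq_sum]
  fin_cases i <;> simp [e]

/-- The operator `v̂ᵢ ∂ₜ + ∂ᵢ` belonging to `Eᵢ`. -/
lemma isSourceOperator_electric (i : Fin 3) :
    IsSourceOperator (fun v => hat v i) (fun _ => e i) where
  smooth_time := contDiff_hat_apply i
  smooth_space := contDiff_const
  compat v := by rw [real_inner_comm, inner_e]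
  bound om v h := by
    have := abs_apply_le_norm (om + hat v) i
    simpa [inner_e, add_comm] using this
  norm_le v := by simp [e]

lemma inner_cross_e (i : Fin 3) (om w : E3) :
    inner ℝ om (cross (e i) w) = - cross om w i := by
  rw [inner_eq_sum]
  simp only [cross_apply_zero, cross_apply_one, cross_apply_two]
  fin_cases i <;> simp [e, cross_apply_zero, cross_apply_one, cross_apply_two] <;> ring

/-- The operator `(v̂ × ∇)ᵢ` belonging to `Bᵢ`. -/
lemma isSourceOperator_magnetic (i : Fin 3) :
    IsSourceOperator (fun _ => 0) (fun v => cross (e i) (hat v)) where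
  smooth_time := contDiff_const
  smooth_space := contDiff_euclidean.2 fun j => contDiff_cross_hat j (e i)
  compat v := by
    rw [real_inner_comm, inner_cross_e]
    fin_cases i <;> simp [cross_apply_zero, cross_apply_one, cross_apply_two] <;> ring
  bound om v h := by
    rw [zero_add, inner_cross_e, abs_neg]
    exact abs_cross_hat_le v om h i
  norm_le v := by
    have h1 := inner_cross_e i (cross (e i) (hat v)) (hat v)
    rw [real_inner_self_eq_norm_sq] at h1
    have h2 : ‖cross (e i) (hat v)‖ ^ 2 ≤ ‖cross (e i) (hat v)‖ * ‖hat v‖ := by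
      rw [h1]
      exact (neg_le_abs _).trans (abs_cross_apply_le _ _ i)
    have h3 := norm_hat_le_one v
    nlinarith [norm_nonneg (cross (e i) (hat v)), norm_nonneg (hat v)]

lemma kerES_eq (i : Fin 3) : kerES i = kerS (fun v => hat v i) (fun _ => e i) := by
  funext om v
  simp [kerES, kerS, inner_e, add_comm]

lemma kerET_eq (i : Fin 3) : kerET i = kerT (fun v => hat v i) (fun _ => e i) := by
  funext om v
  simp only [kerET, kerT, inner_e]
  ring

lemma kerBS_eq (i : Fin 3) (om v : E3) :
    kerBS i om v = - kerS (fun _ => 0) (fun v => cross (e i) (hat v)) om v := by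
  rw [kerBS, kerS, inner_cross_e]
  ring

lemma kerBT_eq (i : Fin 3) : kerBT i = kerT (fun _ => 0) (fun v => cross (e i) (hat v)) := by
  funext om v
  rw [kerBT, kerT, inner_cross_e]
  ring

/-! ### Kirchhoff's formula in the half space -/

lemma continuous_cone_center {g : ℝ × E3 → ℝ} (hg : Continuous g) (t : ℝ) (c : E3) :
    Continuous fun y => g (t + ‖y - c‖, y) :=
  hg.comp (by fun_prop)

lemma integrable_kernel_cone_center {κ : E3 → ℝ} {C : ℝ} {m : ℕ} (hm : m ≤ 2) (hκ : Measurable κ)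
    (hb : ∀ z, |κ z| ≤ C * (‖z‖ ^ m)⁻¹) {g : ℝ × E3 → ℝ} (hg : Continuous g)
    (hgc : HasCompactSupport g) (t : ℝ) (c : E3) :
    Integrable fun y => κ (y - c) * g (t + ‖y - c‖, y) := by
  have h := (integrable_kernel_cone hm hκ hb hg hgc t c).comp_sub_right c
  simpa using h

lemma measurableSet_Ωbar : MeasurableSet Ωbar := by
  have : IsClosed Ωbar := isClosed_le continuous_const (by fun_prop)
  exact this.measurableSet

lemma Ω_ae_eq_Ωbar : Ω =ᵐ[volume] Ωbar := by
  have h0 : volume {y : E3 | y 2 = 0} = 0 := by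
    have h1 : volume (aboveMap ⁻¹' {y : E3 | y 2 = 0}) = 0 := by
      have : aboveMap ⁻¹' {y : E3 | y 2 = 0} = univ ×ˢ {0} := by
        ext p; simp
      rw [this, Measure.volume_eq_prod, Measure.prod_prod]
      simp
    rwa [measurePreserving_aboveMap.measure_preimage_emb measurableEmbedding_aboveMap] at h1
  have h2 : ∀ᵐ y : E3, y 2 ≠ 0 := by
    rw [ae_iff]
    simpa using h0
  filter_upwards [h2] with y hy
  apply propext
  change 0 < y 2 ↔ 0 ≤ y 2
  exact ⟨le_of_lt, fun h => lt_of_le_of_ne h hy.symm⟩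

/-- The half space version of `integral_kernel_cone`: only the direction normal to the boundary
plane produces a boundary term. -/
lemma setIntegral_Ω_kernel_cone {κ κ' : E3 → ℝ} {C : ℝ} (hκ : Measurable κ) (hκ' : Measurable κ')
    (hκc : ContinuousOn κ {0}ᶜ)
    (hb : ∀ z, |κ z| ≤ C * (‖z‖ ^ 1)⁻¹) (hb' : ∀ z, |κ' z| ≤ C * (‖z‖ ^ 2)⁻¹) (j : Fin 3)
    (hd : ∀ z, z ≠ 0 → HasLineDerivAt ℝ κ (κ' z) z (e j)) {ψ : ℝ × E3 → ℝ} (h : ContDiff ℝ ∞ ψ)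
    (hc : HasCompactSupport ψ) (t : ℝ) (c : E3) :
    Integrable (fun y => κ (y - c) * pd (0, e j) ψ (t + ‖y - c‖, y) +
      κ (y - c) * ((y - c) j / ‖y - c‖) * pd (1, 0) ψ (t + ‖y - c‖, y) +
        κ' (y - c) * ψ (t + ‖y - c‖, y)) ∧
    ∫ y in Ω, (κ (y - c) * pd (0, e j) ψ (t + ‖y - c‖, y) +
      κ (y - c) * ((y - c) j / ‖y - c‖) * pd (1, 0) ψ (t + ‖y - c‖, y) +
        κ' (y - c) * ψ (t + ‖y - c‖, y)) =
    - (if j = 2 then ∫ w : E2, κ (planePoint w - c) * ψ (t + ‖planePoint w - c‖, planePoint w)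
        else 0) := by
  have i1 := integrable_kernel_cone_center (m := 1) (by norm_num) hκ hb
    (contDiff_pd h (0, e j)).continuous (hasCompactSupport_pd hc _) t c
  have i2 := integrable_kernel_cone_center (C := C * ‖e j‖) (m := 1) (by norm_num)
    (κ := fun z => κ z * (z j / ‖z‖)) (by fun_prop)
    (fun z => by
      rw [abs_mul, mul_right_comm, ← inner_e z j]
      exact mul_le_mul (hb z) (abs_inner_div_norm_le z _) (abs_nonneg _)
        ((abs_nonneg _).trans (hb z)))
    (contDiff_pd h (1, 0)).continuous (hasCompactSupport_pd hc _) t c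
  have i3 := integrable_kernel_cone_center (m := 2) le_rfl hκ' hb' h.continuous hc t c
  have i0 := integrable_kernel_cone_center (m := 1) (by norm_num) hκ hb h.continuous hc t c
  have hder : ∀ y, y ≠ c → HasLineDerivAt ℝ (fun y => κ (y - c) * ψ (t + ‖y - c‖, y))
      (κ (y - c) * pd (0, e j) ψ (t + ‖y - c‖, y) +
      κ (y - c) * ((y - c) j / ‖y - c‖) * pd (1, 0) ψ (t + ‖y - c‖, y) +
        κ' (y - c) * ψ (t + ‖y - c‖, y)) y (e j) := by
    intro y hy
    have hz : y - c ≠ 0 := sub_ne_zero.2 hy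
    have h1 := hd (y - c) hz
    have h2 := hasLineDerivAt_cone h t c hz (e j)
    unfold HasLineDerivAt at h1 h2 ⊢
    have h3 := h1.mul h2
    have h4 : (fun r : ℝ => (fun y => κ (y - c) * ψ (t + ‖y - c‖, y)) (y + r • e j)) =
        (fun r : ℝ => κ (y - c + r • e j)) *
          fun r : ℝ => (fun z => ψ (t + ‖z‖, c + z)) (y - c + r • e j) := by
      funext r
      have h5 : y + r • e j - c = y - c + r • e j := by abel
      have h6 : c + (y - c + r • e j) = y + r • e j := by abel
      simp only [Pi.mul_apply, h5, h6]
    rw [h4]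
    refine h3.congr_deriv ?_
    simp only [zero_smul, add_zero, add_sub_cancel, inner_e]
    ring
  refine ⟨(i1.add i2).add i3, ?_⟩
  split_ifs with hj
  · subst hj
    obtain ⟨R, hR, hRψ⟩ := exists_bound_of_hasCompactSupport hc
    refine integral_Ω_normal (P := fun y => κ (y - c) * ψ (t + ‖y - c‖, y)) c ?_
      (fun y _ hy => hder y hy) R ?_ ((i1.add i2).add i3).integrableOn
    · refine ContinuousOn.mul (hκc.comp (by fun_prop) ?_)
        (continuous_cone_center h.continuous t c).continuousOn
      intro y hy
      simpa [sub_eq_zero] using hy.2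
    · intro y _ hy
      have : ψ (t + ‖y - c‖, y) = 0 := by
        by_contra hne
        exact absurd (hRψ _ hne).2 (not_lt.2 hy)
      simp [this]
  · rw [neg_zero]
    refine setIntegral_lineDeriv_eq_zero (P := fun y => κ (y - c) * ψ (t + ‖y - c‖, y))
      measurableSet_Ω (e j) c ?_ (fun y _ hy => hder y hy) i0.integrableOn
      ((i1.add i2).add i3).integrableOn
    intro y r hy
    have : e j 2 = 0 := by
      simp [e, Ne.symm hj]
    simpa [Ω, this] using hy

lemma hasLineDerivAt_apply_mul_inv_norm_sq {z : E3} (hz : z ≠ 0) (j : Fin 3) :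
    HasLineDerivAt ℝ (fun z : E3 => z j * (‖z‖ ^ 2)⁻¹)
      ((‖z‖ ^ 2)⁻¹ * (1 - 2 * (z j / ‖z‖) ^ 2)) z (e j) := by
  unfold HasLineDerivAt
  have h0 := hasDerivAt_norm_line hz (e j)
  have h1 : HasDerivAt (fun r : ℝ => (z + r • e j) j) 1 0 := by
    have : (fun r : ℝ => (z + r • e j) j) = fun r => z j + r := by
      funext r; simp [e]
    rw [this]
    exact (hasDerivAt_id (0 : ℝ)).const_add (z j)
  have hn : ‖z‖ ≠ 0 := norm_ne_zero_iff.2 hz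
  have h2 := h1.mul ((h0.pow 2).inv (by simpa using hz))
  refine h2.congr_deriv ?_
  simp only [zero_smul, add_zero, inner_e]
  simp
  field_simp
  ring

lemma back_apply (z : E3) (j : Fin 3) : back z j = -(z j / ‖z‖) := by
  rw [← inner_e (back z), IsSourceOperator.inner_back, inner_e]

/-- The radial derivative `∂ₜ φ + θ · ∇φ` on the light cone with vertex `(t, c)`, over `r²`. -/
def radialPart (φ : ℝ × E3 → ℝ) (t : ℝ) (c : E3) (z : E3) : ℝ :=
  (‖z‖ ^ 2)⁻¹ * (∑ j, z j / ‖z‖ * pd (0, e j) φ (t + ‖z‖, c + z) + pd (1, 0) φ (t + ‖z‖, c + z))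

lemma integrable_radialPart {φ : ℝ × E3 → ℝ} (h : ContDiff ℝ ∞ φ) (hc : HasCompactSupport φ)
    (t : ℝ) (c : E3) : Integrable (radialPart φ t c) := by
  have h1 : ∀ j, Integrable fun z : E3 =>
      (‖z‖ ^ 2)⁻¹ * (z j / ‖z‖) * pd (0, e j) φ (t + ‖z‖, c + z) := fun j =>
    integrable_kernel_cone (C := ‖e j‖) (m := 2) le_rfl (by fun_prop)
      (fun z => by
        rw [abs_mul, abs_of_nonneg (by positivity : 0 ≤ (‖z‖ ^ 2)⁻¹), mul_comm, ← inner_e z j]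
        exact mul_le_mul_of_nonneg_right (abs_inner_div_norm_le z _) (by positivity))
      (contDiff_pd h _).continuous (hasCompactSupport_pd hc _) t c
  have h2 : Integrable fun z : E3 => (‖z‖ ^ 2)⁻¹ * pd (1, 0) φ (t + ‖z‖, c + z) :=
    integrable_kernel_cone (C := 1) (m := 2) le_rfl (by fun_prop) (fun z => by simp)
      (contDiff_pd h _).continuous (hasCompactSupport_pd hc _) t c
  refine (((h1 0).add ((h1 1).add (h1 2))).add h2).congr (Filter.Eventually.of_forall fun z => ?_)
  simp only [Pi.add_apply, radialPart, Fin.sum_univ_three]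
  ring

/-- Green's identity on the part of a light cone with vertex `(t, c)` over the half space. -/
lemma integral_Ω_wave_cone {φ : ℝ × E3 → ℝ} (h : ContDiff ℝ ∞ φ) (hc : HasCompactSupport φ)
    (t : ℝ) (c : E3) :
    ∫ y in Ω, ‖y - c‖⁻¹ * wave φ (t + ‖y - c‖, y) =
      (∫ w : E2, ‖planePoint w - c‖⁻¹ *
        pd (0, e 2) φ (t + ‖planePoint w - c‖, planePoint w)) -
      (∫ w : E2, (planePoint w - c) 2 * (‖planePoint w - c‖ ^ 2)⁻¹ *
          pd (1, 0) φ (t + ‖planePoint w - c‖, planePoint w)) -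
      ∫ y in Ω, radialPart φ t c (y - c) := by
  have hcont : ContinuousOn (fun z : E3 => ‖z‖⁻¹) {0}ᶜ :=
    ContinuousOn.inv₀ (by fun_prop) (fun z hz => by simpa using hz)
  have hcont2 : ContinuousOn (fun z : E3 => (‖z‖ ^ 2)⁻¹) {0}ᶜ :=
    ContinuousOn.inv₀ (by fun_prop) (fun z hz => by simpa using hz)
  have hbk := measurable_back
  have hun : ∀ (z : E3) j, |z j / ‖z‖| ≤ 1 := fun z j => by
    have := abs_inner_div_norm_le z (e j)
    rw [inner_e] at this
    simpa [e] using this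
  have A := fun j => setIntegral_Ω_kernel_cone (κ := fun z : E3 => ‖z‖⁻¹)
    (κ' := fun z => (‖z‖ ^ 2)⁻¹ * inner ℝ (back z) (e j)) (C := 1) (by fun_prop) (by fun_prop)
    hcont (fun z => by simp) (fun z => by
      rw [abs_mul, abs_of_nonneg (by positivity : 0 ≤ (‖z‖ ^ 2)⁻¹), mul_comm]
      refine mul_le_mul_of_nonneg_right ?_ (by positivity)
      simpa [e] using IsSourceOperator.abs_inner_back_le z (e j)) j
    (fun z hz => IsSourceOperator.hasLineDerivAt_inv_norm hz (e j)) (contDiff_pd h (0, e j))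
    (hasCompactSupport_pd hc _) t c
  have B := fun j => setIntegral_Ω_kernel_cone (κ := fun z : E3 => z j * (‖z‖ ^ 2)⁻¹)
    (κ' := fun z => (‖z‖ ^ 2)⁻¹ * (1 - 2 * (z j / ‖z‖) ^ 2)) (C := 1) (by fun_prop) (by fun_prop)
    (ContinuousOn.mul (by fun_prop) hcont2) (fun z => by
      have h1 : z j * (‖z‖ ^ 2)⁻¹ = z j / ‖z‖ * ‖z‖⁻¹ := by
        rw [pow_two, mul_inv]; ring
      rw [h1, abs_mul, abs_of_nonneg (by positivity : 0 ≤ ‖z‖⁻¹), pow_one]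
      exact mul_le_mul_of_nonneg_right (hun z j) (by positivity)) (fun z => by
      rw [abs_mul, abs_of_nonneg (by positivity : 0 ≤ (‖z‖ ^ 2)⁻¹), mul_comm]
      refine mul_le_mul_of_nonneg_right ?_ (by positivity)
      have h1 : (z j / ‖z‖) ^ 2 ≤ 1 := (sq_le_one_iff_abs_le_one _).2 (hun z j)
      rw [abs_le]
      constructor <;> nlinarith [sq_nonneg (z j / ‖z‖)]) j
    (fun z hz => hasLineDerivAt_apply_mul_inv_norm_sq hz j) (contDiff_pd h (1, 0))
    (hasCompactSupport_pd hc _) t c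
  have R0 : Integrable fun y => radialPart φ t c (y - c) :=
    (integrable_radialPart h hc t c).comp_sub_right c
  have A' : ∀ j, IntegrableOn _ Ω := fun j => (A j).1.integrableOn
  have B' : ∀ j, IntegrableOn _ Ω := fun j => (B j).1.integrableOn
  have e1 := integral_sub (integrable_finsetSum Finset.univ fun j _ => B' j)
    (integrable_finsetSum Finset.univ fun j _ => A' j)
  have e2 := integral_sub ((integrable_finsetSum Finset.univ fun j _ => B' j).sub
    (integrable_finsetSum Finset.univ fun j _ => A' j)) R0.integrableOn
  rw [integral_finsetSum _ fun j _ => B' j, integral_finsetSum _ fun j _ => A' j] at e1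
  simp only [fun j => (A j).2, fun j => (B j).2] at e1
  have e3 := e2.trans (congrArg (· - ∫ y in Ω, radialPart φ t c (y - c)) e1)
  refine Eq.trans (integral_congr_ae ?_) (e3.trans ?_)
  · refine (ae_restrict_of_ae (compl_mem_ae_iff.2 (measure_singleton c))).mono fun y hy => ?_
    have hn : ‖y - c‖ ≠ 0 := norm_ne_zero_iff.2 (sub_ne_zero.2 hy)
    have hsq := norm_sq_eq_sum (y - c)
    have hcm : ∀ j, pd (1, 0) (pd (0, e j) φ) = pd (0, e j) (pd (1, 0) φ) :=
      fun j => pd_comm h _ _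
    simp only [Pi.sub_apply, radialPart, wave, Fin.sum_univ_three, add_sub_cancel, hcm,
      back_apply, inner_e]
    set n := ‖y - c‖
    generalize hz0 : (y - c) 0 = z0 at *
    generalize hz1 : (y - c) 1 = z1 at *
    generalize hz2 : (y - c) 2 = z2 at *
    have hz0' : z0 ^ 2 = n ^ 2 - z1 ^ 2 - z2 ^ 2 := by linarith
    field_simp
    ring_nf
    rw [hz0']
    ring
  · simp
    ring

lemma integral_polar {W : E3 → ℝ} (hW : Integrable W) :
    ∫ z, W z = ∫ w, (∫ r in Ioi (0 : ℝ), r ^ 2 * W (r • (w : E3))) ∂sphereMeasure := by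
  have h1 : Integrable (fun p : ℝ × Metric.sphere (0 : E3) 1 => W (p.1 • (p.2 : E3)))
      (radialMeasure.prod sphereMeasure) :=
    (measurePreserving_polar.integrable_comp hW.aestronglyMeasurable).2 hW
  have h2 : ∫ z, W z = ∫ p : ℝ × Metric.sphere (0 : E3) 1, W (p.1 • (p.2 : E3))
      ∂(radialMeasure.prod sphereMeasure) := by
    rw [← measurePreserving_polar.map_eq, integral_map measurePreserving_polar.aemeasurable]
    rw [measurePreserving_polar.map_eq]
    exact hW.aestronglyMeasurable
  rw [h2, integral_prod_symm _ h1]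
  refine integral_congr_ae (Filter.Eventually.of_forall fun w => ?_)
  simp only
  rw [integral_radialMeasure]

lemma setIntegral_Ω_shift (F : E3 → ℝ) (x : E3) :
    ∫ y in Ω, F (y - x) = ∫ z, {z | x + z ∈ Ω}.indicator F z := by
  rw [← integral_indicator measurableSet_Ω,
    ← integral_add_left_eq_self _ x]
  refine integral_congr_ae (Filter.Eventually.of_forall fun z => ?_)
  simp [indicator]

lemma setIntegral_Ω_shift_bar (F : E3 → ℝ) (x : E3) :
    ∫ y in Ω, F (y - bar x) = ∫ z, {z | bar (x + z) ∈ Ω}.indicator (fun z => F (bar z)) z := by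
  rw [setIntegral_Ω_shift, ← measurePreserving_bar.integral_comp measurableEmbedding_bar]
  refine integral_congr_ae (Filter.Eventually.of_forall fun z => ?_)
  have h := bar_add x z
  by_cases hm : bar x + bar z ∈ Ω
  · have hm' : bar (x + z) ∈ Ω := by rwa [h]
    simp [indicator, hm, hm']
  · have hm' : bar (x + z) ∉ Ω := by rwa [h]
    simp [indicator, hm, hm']

/-- On a ray from the vertex of the light cone that is reflected at the boundary plane, the radial
derivative integrates to minus the value at the vertex, by the fundamental theorem of calculus. The
boundary condition is what makes the reflected function continuous along the ray. -/
lemma integral_ray {φ : ℝ × E3 → ℝ} (h : ContDiff ℝ ∞ φ) (hc : HasCompactSupport φ) {σ t : ℝ}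
    {x : E3} (hx : x ∈ Ωbar) (hbc : ∀ s ≥ t, ∀ y : E3, y 2 = 0 → φ (s, y) = σ * φ (s, y))
    {w : E3} (hw : ‖w‖ = 1) :
    ∫ r in Ioi (0 : ℝ), (if 0 ≤ x 2 + r * w 2
      then ∑ j, w j * pd (0, e j) φ (t + r, x + r • w) + pd (1, 0) φ (t + r, x + r • w)
      else σ * (∑ j, bar w j * pd (0, e j) φ (t + r, bar (x + r • w)) +
        pd (1, 0) φ (t + r, bar (x + r • w)))) = - φ (t, x) := by
  set f' : ℝ → ℝ := fun r => if 0 ≤ x 2 + r * w 2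
      then ∑ j, w j * pd (0, e j) φ (t + r, x + r • w) + pd (1, 0) φ (t + r, x + r • w)
      else σ * (∑ j, bar w j * pd (0, e j) φ (t + r, bar (x + r • w)) +
        pd (1, 0) φ (t + r, bar (x + r • w))) with hf'
  set f : ℝ → ℝ := fun r => if 0 ≤ x 2 + |r| * w 2 then φ (t + |r|, x + |r| • w)
    else σ * φ (t + |r|, bar (x + |r| • w)) with hf
  have hcb := continuous_bar
  have hfc : Continuous f := by
    refine Continuous.if_le (h.continuous.comp (by fun_prop)) (continuous_const.mul
      (h.continuous.comp (by fun_prop))) (by fun_prop) (by fun_prop) ?_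
    intro r hr
    have h2 : (x + |r| • w) 2 = 0 := by simpa using hr.symm
    rw [bar_eq_self h2]
    exact hbc _ (by simp) _ h2
  -- the point at distance `r` along the direct and the reflected ray
  have hder : ∀ (c u : E3) (r : ℝ), HasDerivAt (fun r : ℝ => φ (t + r, c + r • u))
      (∑ j, u j * pd (0, e j) φ (t + r, c + r • u) + pd (1, 0) φ (t + r, c + r • u)) r := by
    intro c u r
    have h1 : HasFDerivAt φ (fderiv ℝ φ (t + r, c + r • u)) (t + r, c + r • u) :=
      (h.differentiable (by simp) _).hasFDerivAt
    have h2 : HasDerivAt (fun r : ℝ => (t + r, c + r • u)) ((1 : ℝ), u) r := by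
      refine ((hasDerivAt_id r).const_add t).prodMk (HasDerivAt.const_add c ?_)
      simpa using (hasDerivAt_id r).smul_const u
    refine (h1.comp_hasDerivAt r h2).congr_deriv ?_
    have h3 : ((1 : ℝ), u) = ((0 : ℝ), u) + ((1 : ℝ), (0 : E3)) := by simp
    rw [h3, map_add, ← pd_space_eq_sum]
    rfl
  have hbar : ∀ r : ℝ, bar (x + r • w) = bar x + r • bar w := fun r => by
    rw [bar_add, bar_smul]
  obtain ⟨R, hR, hRφ⟩ := exists_bound_of_hasCompactSupport hc
  have hRpd : ∀ a p, pd a φ p ≠ 0 → ‖p.2‖ ≤ R := by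
    intro a p hp
    have h1 : p ∈ tsupport φ := tsupport_pd_subset a φ (subset_tsupport _ hp)
    have h2 : tsupport φ ⊆ {p | ‖p.2‖ ≤ R} :=
      closure_minimal (fun q hq => (hRφ q hq).2.le) (isClosed_le (by fun_prop) (by fun_prop))
    exact h2 h1
  set b := R + ‖x‖ + 1 with hb
  have hb0 : 0 ≤ b := by positivity
  have hfar : ∀ r, b ≤ r → R < ‖x + r • w‖ := by
    intro r hr
    have h1 : ‖r • w‖ ≤ ‖x + r • w‖ + ‖x‖ := by
      have := norm_sub_le (x + r • w) x
      simpa using this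
    rw [norm_smul, hw, mul_one, Real.norm_of_nonneg (hb0.trans hr)] at h1
    linarith
  have hzero : ∀ r, b ≤ r → f' r = 0 := by
    intro r hr
    have h1 : ∀ a y, ‖y‖ = ‖x + r • w‖ → pd a φ (t + r, y) = 0 := by
      intro a y hy
      by_contra hne
      have := hRpd a _ hne
      have := hfar r hr
      simp only at *
      linarith
    simp only [hf']
    simp [h1 _ _ rfl, h1 _ _ (norm_bar _)]
  have hfb : f b = 0 := by
    have h1 : ∀ y, ‖y‖ = ‖x + b • w‖ → φ (t + b, y) = 0 := by
      intro y hy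
      by_contra hne
      have := (hRφ _ hne).2
      have := hfar b le_rfl
      simp only at *
      linarith
    simp only [hf, abs_of_nonneg hb0]
    simp [h1 _ rfl, h1 _ (norm_bar _)]
  have hf0 : f 0 = φ (t, x) := by
    have : 0 ≤ x 2 := hx
    simp [hf, this]
  have hcount : {r : ℝ | x 2 + r * w 2 = 0 ∧ w 2 ≠ 0}.Countable := by
    refine Set.Subsingleton.countable ?_
    rintro r ⟨hr1, hr2⟩ r' ⟨hr1', -⟩
    have : (r - r') * w 2 = 0 := by linarith
    rcases mul_eq_zero.1 this with h3 | h3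
    · linarith
    · exact absurd h3 hr2
  have hcpd : ∀ a, Continuous (pd a φ) := fun a => (contDiff_pd h a).continuous
  have hmeas : Measurable f' := by
    have hm : ∀ a, Measurable (pd a φ) := fun a => (hcpd a).measurable
    have hmb := hcb.measurable
    refine Measurable.ite (measurableSet_le measurable_const (by fun_prop)) ?_ ?_
    · refine Measurable.add (Finset.measurable_sum _ fun j _ => ?_) ?_
      · exact measurable_const.mul ((hm _).comp (by fun_prop))
      · exact (hm _).comp (by fun_prop)
    · refine measurable_const.mul (Measurable.add (Finset.measurable_sum _ fun j _ => ?_) ?_)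
      · exact measurable_const.mul ((hm _).comp (by fun_prop))
      · exact (hm _).comp (by fun_prop)
  have hbd : ∃ M, ∀ r, ‖f' r‖ ≤ M := by
    choose M hM using fun a => (hcpd a).bounded_above_of_compact_support
      (hasCompactSupport_pd hc a)
    have hsum : ∀ (u : E3) p, ‖u‖ ≤ 1 → ‖∑ j, u j * pd (0, e j) φ p + pd (1, 0) φ p‖ ≤
        ∑ j, M (0, e j) + M (1, 0) := by
      intro u p hu
      refine (norm_add_le _ _).trans (add_le_add ((norm_sum_le _ _).trans
        (Finset.sum_le_sum fun j _ => ?_)) (hM _ _))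
      rw [norm_mul]
      refine (mul_le_of_le_one_left (norm_nonneg _) ?_).trans (hM _ _)
      exact (abs_apply_le_norm u j).trans hu
    refine ⟨max 1 |σ| * (∑ j, M (0, e j) + M (1, 0)), fun r => ?_⟩
    have hpos : 0 ≤ ∑ j, M (0, e j) + M (1, 0) :=
      (norm_nonneg _).trans (hsum 0 (0, 0) (by simp))
    simp only [hf']
    split_ifs
    · refine (hsum w _ hw.le).trans ?_
      exact le_mul_of_one_le_left hpos (le_max_left _ _)
    · rw [norm_mul]
      exact mul_le_mul (le_max_right _ _) (hsum (bar w) _ (by rw [norm_bar, hw]))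
        (norm_nonneg _) (by positivity)
  obtain ⟨M, hM⟩ := hbd
  have hint : IntervalIntegrable f' volume 0 b := by
    rw [intervalIntegrable_iff_integrableOn_Ioc_of_le hb0]
    exact Measure.integrableOn_of_bounded (by simp) hmeas.aestronglyMeasurable
      (Filter.Eventually.of_forall hM)
  have key := integral_eq_of_hasDerivAt_off_countable_of_le f f' hb0 hcount hfc.continuousOn ?_
    hint
  · rw [hfb, hf0, intervalIntegral.integral_of_le hb0, zero_sub] at key
    rw [← key]
    refine (setIntegral_eq_of_subset_of_forall_sdiff_eq_zero measurableSet_Ioi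
      Ioc_subset_Ioi_self fun r hr => ?_)
    refine hzero r ?_
    by_contra hlt
    exact hr.2 ⟨hr.1, (not_le.1 hlt).le⟩
  · rintro r ⟨hr, hrs⟩
    have habs : ∀ᶠ r' in nhds r, |r'| = r' := by
      filter_upwards [lt_mem_nhds hr.1] with r' hr' using abs_of_pos hr'
    have hcont : Continuous fun r : ℝ => x 2 + r * w 2 := by fun_prop
    rcases lt_trichotomy (x 2 + r * w 2) 0 with hneg | hz | hpos
    · have h1 : f' r = σ * (∑ j, bar w j * pd (0, e j) φ (t + r, bar x + r • bar w) +
          pd (1, 0) φ (t + r, bar x + r • bar w)) := by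
        simp only [hf', if_neg (not_le.2 hneg), hbar]
      rw [h1]
      refine ((hder (bar x) (bar w) r).const_mul σ).congr_of_eventuallyEq ?_
      filter_upwards [habs, hcont.continuousAt.eventually_lt_const hneg] with r' h2 h3
      simp only [hf, h2, if_neg (not_le.2 h3), hbar]
    · have hw2 : w 2 = 0 := by
        by_contra hne
        exact hrs ⟨hz, hne⟩
      have hx2 : 0 ≤ x 2 := hx
      have h1 : f' r = ∑ j, w j * pd (0, e j) φ (t + r, x + r • w) +
          pd (1, 0) φ (t + r, x + r • w) := by
        simp only [hf', hz, le_refl, if_true]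
      rw [h1]
      refine (hder x w r).congr_of_eventuallyEq ?_
      filter_upwards [habs] with r' h2
      simp [hf, h2, hw2, hx2]
    · have h1 : f' r = ∑ j, w j * pd (0, e j) φ (t + r, x + r • w) +
          pd (1, 0) φ (t + r, x + r • w) := by
        simp only [hf', if_pos hpos.le]
      rw [h1]
      refine (hder x w r).congr_of_eventuallyEq ?_
      filter_upwards [habs, hcont.continuousAt.eventually_const_lt hpos] with r' h2 h3
      simp only [hf, h2, if_pos h3.le]

lemma integral_radialPart_reflect {φ : ℝ × E3 → ℝ} (h : ContDiff ℝ ∞ φ) (hc : HasCompactSupport φ)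
    {σ t : ℝ} {x : E3} (hx : x ∈ Ωbar)
    (hbc : ∀ s ≥ t, ∀ y : E3, y 2 = 0 → φ (s, y) = σ * φ (s, y)) :
    (∫ y in Ω, radialPart φ t x (y - x)) + σ * ∫ y in Ω, radialPart φ t (bar x) (y - bar x) =
      - (4 * Real.pi * φ (t, x)) := by
  have hi1 : Integrable ({z | x + z ∈ Ωbar}.indicator (radialPart φ t x)) :=
    (integrable_radialPart h hc t x).indicator
      (measurableSet_Ωbar.preimage (by fun_prop))
  have hi2 : Integrable ({z | bar (x + z) ∈ Ω}.indicator fun z => radialPart φ t (bar x) (bar z)) :=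
    Integrable.indicator ((measurePreserving_bar.integrable_comp_emb measurableEmbedding_bar).2
      (integrable_radialPart h hc t (bar x)))
      (measurableSet_Ω.preimage (continuous_bar.measurable.comp (by fun_prop)))
  rw [setIntegral_congr_set Ω_ae_eq_Ωbar]
  have e1 : ∫ y in Ωbar, radialPart φ t x (y - x) =
      ∫ z, {z | x + z ∈ Ωbar}.indicator (radialPart φ t x) z := by
    rw [← integral_indicator measurableSet_Ωbar, ← integral_add_left_eq_self _ x]
    refine integral_congr_ae (Filter.Eventually.of_forall fun z => ?_)
    simp [indicator]
  rw [e1, setIntegral_Ω_shift_bar, ← integral_const_mul, ← integral_add hi1 (hi2.const_mul σ)]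
  refine (integral_polar (hi1.add (hi2.const_mul σ))).trans ?_
  have hray : ∀ w : Metric.sphere (0 : E3) 1, ∫ r in Ioi (0 : ℝ), r ^ 2 *
      ({z | x + z ∈ Ωbar}.indicator (radialPart φ t x) (r • (w : E3)) +
        σ * {z | bar (x + z) ∈ Ω}.indicator (fun z => radialPart φ t (bar x) (bar z))
          (r • (w : E3))) = - φ (t, x) := by
    intro w
    have hw : ‖(w : E3)‖ = 1 := by simp
    rw [← integral_ray h hc hx hbc hw]
    refine setIntegral_congr_fun measurableSet_Ioi fun r hr => ?_
    have hr0 : 0 < r := hr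
    have hn : ‖r • (w : E3)‖ = r := by
      rw [norm_smul, hw, mul_one, Real.norm_of_nonneg hr0.le]
    have hu : x + r • (w : E3) ∈ Ωbar ↔ 0 ≤ x 2 + r * (w : E3) 2 := by
      simp [Ωbar]
    have hl : bar (x + r • (w : E3)) ∈ Ω ↔ ¬ 0 ≤ x 2 + r * (w : E3) 2 := by
      simp only [Ω, mem_ofPred_eq, bar_apply_two, PiLp.add_apply, PiLp.smul_apply, smul_eq_mul,
        Left.neg_pos_iff, not_le]
    simp only [indicator, mem_ofPred_eq, hu, hl]
    split_ifs with h0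
    · simp only [radialPart, hn, mul_zero, add_zero]
      have h1 : ∀ j, (r • (w : E3)) j / r = (w : E3) j := fun j => by
        simp only [PiLp.smul_apply, smul_eq_mul]
        field_simp
      simp only [h1]
      field_simp
    · simp only [radialPart, norm_bar, hn, zero_add]
      have h1 : ∀ j, (bar (r • (w : E3))) j / r = bar (w : E3) j := fun j => by
        simp only [bar_smul, PiLp.smul_apply, smul_eq_mul]
        field_simp
      simp only [h1, bar_add]
      field_simp
  simp only [Pi.add_apply, hray]
  rw [integral_const, sphereMeasure_real_univ]
  simp

/-- Kirchhoff's formula in the half space: a test function `φ` with Neumann (`σ = 1`) or Dirichlet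
(`σ = -1`) boundary values is recovered from `□φ` by the retarded potential of the even or odd
reflection of `□φ`. -/
lemma kirchhoff_reflect {φ : ℝ × E3 → ℝ} (h : ContDiff ℝ ∞ φ) (hc : HasCompactSupport φ)
    {σ t : ℝ} {x : E3} (hx : x ∈ Ωbar)
    (hbc : (σ = 1 ∧ ∀ s ≥ t, ∀ y : E3, y 2 = 0 → pd (0, e 2) φ (s, y) = 0) ∨
      (σ = -1 ∧ ∀ s ≥ t, ∀ y : E3, y 2 = 0 → φ (s, y) = 0)) :
    (∫ y in Ω, ‖y - x‖⁻¹ * wave φ (t + ‖y - x‖, y)) +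
      σ * ∫ y in Ω, ‖y - bar x‖⁻¹ * wave φ (t + ‖y - bar x‖, y) = 4 * Real.pi * φ (t, x) := by
  have hrad := integral_radialPart_reflect h hc (σ := σ) (t := t) hx (by
    intro s hs y hy
    rcases hbc with ⟨h1, -⟩ | ⟨-, h2⟩
    · rw [h1, one_mul]
    · rw [h2 s hs y hy, mul_zero])
  rw [integral_Ω_wave_cone h hc, integral_Ω_wave_cone h hc]
  have hn : ∀ w, ‖planePoint w - bar x‖ = ‖planePoint w - x‖ := fun w => by
    rw [← bar_planePoint w, ← bar_sub, norm_bar, bar_planePoint]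
  have h2 : ∀ w, (planePoint w - bar x) 2 = - (planePoint w - x) 2 := fun w => by
    simp [planePoint_two]
  have hle : ∀ w, t ≤ t + ‖planePoint w - x‖ := fun w => by
    have := norm_nonneg (planePoint w - x)
    linarith
  rcases hbc with ⟨h1, hN⟩ | ⟨h1, hD⟩
  · have hA : ∀ w, pd (0, e 2) φ (t + ‖planePoint w - x‖, planePoint w) = 0 :=
      fun w => hN _ (hle w) _ (planePoint_two w)
    simp only [hn, h2, hA, mul_zero, integral_zero, neg_mul, integral_neg]
    subst h1
    linarith
  · have hB : ∀ w, (planePoint w - x) 2 * (‖planePoint w - x‖ ^ 2)⁻¹ *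
        pd (1, 0) φ (t + ‖planePoint w - x‖, planePoint w) = 0 := by
      intro w
      rcases eq_or_ne (planePoint w) x with hwx | hwx
      · simp [hwx]
      · have hpos : 0 < ‖planePoint w - x‖ := norm_pos_iff.2 (sub_ne_zero.2 hwx)
        rw [← deriv_time_eq_pd h]
        have : (fun s => φ (s, planePoint w)) =ᶠ[nhds (t + ‖planePoint w - x‖)] fun _ => 0 := by
          filter_upwards [lt_mem_nhds (show t < t + ‖planePoint w - x‖ by linarith)] with s hs
          exact hD s hs.le _ (planePoint_two w)
        rw [this.deriv_eq]
        simp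
    simp only [hn, h2, neg_mul, integral_neg]
    simp only [hB, integral_zero]
    subst h1
    linarith

/-! ### Potentials -/

/-- The potential `(4π)⁻¹ ∫ g(t + |z|, x + z) / |z| dz`, the solution operator of the backward wave
equation in the whole space. -/
def potential (g : ℝ × E3 → ℝ) (p : ℝ × E3) : ℝ :=
  (4 * Real.pi)⁻¹ * ∫ z, ‖z‖⁻¹ * g (p.1 + ‖z‖, p.2 + z)

/-- The even (`σ = 1`) or odd (`σ = -1`) reflection. -/
def reflect (σ : ℝ) (g : ℝ × E3 → ℝ) (p : ℝ × E3) : ℝ := g p + σ * g (p.1, bar p.2)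

lemma integrable_potential {g : ℝ × E3 → ℝ} (hg : Continuous g) (hgc : HasCompactSupport g)
    (p : ℝ × E3) : Integrable fun z => ‖z‖⁻¹ * g (p.1 + ‖z‖, p.2 + z) :=
  integrable_kernel_cone (C := 1) (m := 1) (by norm_num) (by fun_prop) (fun z => by simp) hg hgc _ _

lemma hasFDerivAt_potential {ψ : ℝ × E3 → ℝ} (h : ContDiff ℝ ∞ ψ) (hc : HasCompactSupport ψ)
    (p : ℝ × E3) : HasFDerivAt (potential ψ) ((4 * Real.pi)⁻¹ •
      ∫ z, ‖z‖⁻¹ • fderiv ℝ ψ (p.1 + ‖z‖, p.2 + z)) p := by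
  have hf : Continuous (fderiv ℝ ψ) := (h.fderiv_right (m := ∞) (by simp)).continuous
  have hfc : HasCompactSupport (fderiv ℝ ψ) := hc.fderiv ℝ
  obtain ⟨R, hR, hRψ⟩ := exists_bound_of_hasCompactSupport hc
  have hRf : ∀ q, fderiv ℝ ψ q ≠ 0 → ‖q.2‖ ≤ R := by
    intro q hq
    have h1 : q ∈ tsupport ψ := support_fderiv_subset ℝ hq
    have h2 : tsupport ψ ⊆ {p | ‖p.2‖ ≤ R} :=
      closure_minimal (fun q hq => (hRψ q hq).2.le) (isClosed_le (by fun_prop) (by fun_prop))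
    exact h2 h1
  obtain ⟨M, hM⟩ := hf.bounded_above_of_compact_support hfc
  have hM0 : 0 ≤ M := (norm_nonneg _).trans (hM 0)
  have hdom : Integrable ((Metric.ball (0 : E3) (R + ‖p.2‖ + 2)).indicator
      fun z => (‖z‖ ^ 1)⁻¹ * M) :=
    (integrable_indicator_iff Metric.isOpen_ball.measurableSet).2
      ((integrableOn_norm_pow_inv 1 (by norm_num) _).mul_const M)
  unfold potential
  refine HasFDerivAt.const_mul (hasFDerivAt_integral_of_dominated_of_fderiv_le
    (F' := fun p z => ‖z‖⁻¹ • fderiv ℝ ψ (p.1 + ‖z‖, p.2 + z))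
    (Metric.ball_mem_nhds p one_pos)
    (Filter.Eventually.of_forall fun q => (integrable_potential h.continuous hc q).1)
    (integrable_potential h.continuous hc p) ?_ ?_ hdom ?_) _
  · exact ((measurable_norm.inv).aestronglyMeasurable).smul
      (hf.comp (by fun_prop : Continuous fun z : E3 => (p.1 + ‖z‖, p.2 + z))).aestronglyMeasurable
  · refine Filter.Eventually.of_forall fun z q hq => ?_
    by_cases hz : z ∈ Metric.ball (0 : E3) (R + ‖p.2‖ + 2)
    · rw [indicator_of_mem hz, norm_smul, pow_one, norm_inv, norm_norm]
      exact mul_le_mul_of_nonneg_left (hM _) (by positivity)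
    · rw [indicator_of_notMem hz]
      have : fderiv ℝ ψ (q.1 + ‖z‖, q.2 + z) = 0 := by
        by_contra hne
        have h1 := hRf _ hne
        apply hz
        rw [mem_ball_zero_iff]
        have h2 : ‖z‖ ≤ ‖q.2 + z‖ + ‖q.2‖ := by
          have := norm_sub_le (q.2 + z) q.2
          simpa using this
        have h3 : ‖q.2‖ < ‖p.2‖ + 1 := by
          have h4 : ‖q.2 - p.2‖ < 1 := by
            have h5 : dist q p < 1 := hq
            rw [dist_eq_norm, Prod.norm_def, max_lt_iff] at h5
            exact h5.2
          have h6 : ‖q.2‖ ≤ ‖q.2 - p.2‖ + ‖p.2‖ := by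
            have := norm_add_le (q.2 - p.2) p.2
            simpa using this
          linarith
        simp only at h1
        linarith
      simp [this]
  · refine Filter.Eventually.of_forall fun z q _ => ?_
    have h1 : HasFDerivAt ψ (fderiv ℝ ψ (q.1 + ‖z‖, q.2 + z)) (q.1 + ‖z‖, q.2 + z) :=
      (h.differentiable (by simp) _).hasFDerivAt
    have h2 : HasFDerivAt (fun q : ℝ × E3 => (q.1 + ‖z‖, q.2 + z))
        (ContinuousLinearMap.id ℝ (ℝ × E3)) q := by
      have h3 : (fun q : ℝ × E3 => (q.1 + ‖z‖, q.2 + z)) = fun q => q + (‖z‖, z) := rfl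
      rw [h3]
      exact (hasFDerivAt_id q).add_const _
    have h4 := (h1.comp q h2).const_mul ‖z‖⁻¹
    simpa using h4

lemma pd_potential {ψ : ℝ × E3 → ℝ} (h : ContDiff ℝ ∞ ψ) (hc : HasCompactSupport ψ)
    (a : ℝ × E3) : pd a (potential ψ) = potential (pd a ψ) := by
  have hf : Continuous (fderiv ℝ ψ) := (h.fderiv_right (m := ∞) (by simp)).continuous
  funext p
  unfold pd
  rw [(hasFDerivAt_potential h hc p).fderiv]
  simp only [smul_apply, smul_eq_mul, potential]
  congr 1
  rw [ContinuousLinearMap.integral_apply]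
  · simp
  · have hb := hf.bounded_above_of_compact_support (hc.fderiv ℝ)
    have hn : Continuous fun q => ‖fderiv ℝ ψ q‖ := hf.norm
    have h1 := integrable_potential hn (hc.fderiv ℝ).norm p
    refine h1.mono' ?_ (Filter.Eventually.of_forall fun z => ?_)
    · exact ((measurable_norm.inv).aestronglyMeasurable).smul
        (hf.comp (by fun_prop : Continuous fun z : E3 => (p.1 + ‖z‖, p.2 + z))).aestronglyMeasurable
    · rw [norm_smul, norm_inv, norm_norm]

lemma contDiff_potential {ψ : ℝ × E3 → ℝ} (h : ContDiff ℝ ∞ ψ) (hc : HasCompactSupport ψ) :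
    ContDiff ℝ ∞ (potential ψ) := by
  rw [contDiff_infty]
  intro n
  induction n generalizing ψ with
  | zero =>
    exact contDiff_zero.2
      (Differentiable.continuous fun p => (hasFDerivAt_potential h hc p).differentiableAt)
  | succ n ih =>
    rw [Nat.cast_add, Nat.cast_one, contDiff_succ_iff_fderiv_apply]
    refine ⟨fun p => (hasFDerivAt_potential h hc p).differentiableAt, by simp, fun a => ?_⟩
    have h1 : (fun p => fderiv ℝ (potential ψ) p a) = potential (pd a ψ) := pd_potential h hc a
    rw [h1]
    exact ih (contDiff_pd h a) (hasCompactSupport_pd hc a)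

lemma wave_potential {ψ : ℝ × E3 → ℝ} (h : ContDiff ℝ ∞ ψ) (hc : HasCompactSupport ψ) :
    wave (potential ψ) = potential (wave ψ) := by
  funext p
  have h2 : ∀ a, pd a (pd a (potential ψ)) = potential (pd a (pd a ψ)) := fun a => by
    rw [pd_potential h hc, pd_potential (contDiff_pd h a) (hasCompactSupport_pd hc a)]
  have hi : ∀ a, Integrable fun z => ‖z‖⁻¹ * pd a (pd a ψ) (p.1 + ‖z‖, p.2 + z) := fun a =>
    integrable_potential (contDiff_pd (contDiff_pd h a) a).continuous
      (hasCompactSupport_pd (hasCompactSupport_pd hc a) a) p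
  simp only [wave, h2, potential, mul_sub, Finset.mul_sum]
  rw [integral_sub (hi _) (integrable_finsetSum _ fun j _ => hi _),
    integral_finsetSum _ fun j _ => hi _, mul_sub, Finset.mul_sum]

/-- Reflection of space-time at the boundary plane. -/
def barTime : (ℝ × E3) ≃L[ℝ] (ℝ × E3) :=
  (ContinuousLinearEquiv.refl ℝ ℝ).prodCongr barIso.toContinuousLinearEquiv

lemma contDiff_comp_bar {g : ℝ × E3 → ℝ} (h : ContDiff ℝ ∞ g) :
    ContDiff ℝ ∞ fun p : ℝ × E3 => g (p.1, bar p.2) :=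
  h.comp barTime.contDiff

lemma hasCompactSupport_comp_bar {g : ℝ × E3 → ℝ} (h : HasCompactSupport g) :
    HasCompactSupport fun p : ℝ × E3 => g (p.1, bar p.2) :=
  h.comp_homeomorph barTime.toHomeomorph

lemma contDiff_reflect {g : ℝ × E3 → ℝ} (h : ContDiff ℝ ∞ g) (σ : ℝ) :
    ContDiff ℝ ∞ (reflect σ g) :=
  h.add (contDiff_const.mul (contDiff_comp_bar h))

lemma hasCompactSupport_reflect {g : ℝ × E3 → ℝ} (h : HasCompactSupport g) (σ : ℝ) :
    HasCompactSupport (reflect σ g) :=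
  h.add ((hasCompactSupport_comp_bar h).mul_left (f := fun _ => σ))

lemma pd_comp_bar {g : ℝ × E3 → ℝ} (h : ContDiff ℝ ∞ g) (a p : ℝ × E3) :
    pd a (fun p => g (p.1, bar p.2)) p = pd (a.1, bar a.2) g (p.1, bar p.2) := by
  have h1 : HasFDerivAt g (fderiv ℝ g (barTime p)) (barTime p) :=
    (h.differentiable (by simp) _).hasFDerivAt
  have h2 : HasFDerivAt (fun p : ℝ × E3 => g (p.1, bar p.2)) _ p := h1.comp p barTime.hasFDerivAt
  unfold pd
  rw [h2.fderiv]
  rfl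

lemma bar_e (j : Fin 3) : bar (e j) = (if j = 2 then (-1 : ℝ) else 1) • e j := by
  ext i
  fin_cases j <;> fin_cases i <;> simp [e]

lemma pd_const_mul {g : ℝ × E3 → ℝ} (h : ContDiff ℝ ∞ g) (c : ℝ) (a p : ℝ × E3) :
    pd a (fun q => c * g q) p = c * pd a g p := by
  have d := h.differentiable (by simp) p
  unfold pd
  rw [fderiv_const_mul d]
  rfl

lemma pd_comp_bar_e {g : ℝ × E3 → ℝ} (h : ContDiff ℝ ∞ g) (j : Fin 3) (p : ℝ × E3) :
    pd (0, e j) (fun p => g (p.1, bar p.2)) p =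
      (if j = 2 then (-1 : ℝ) else 1) * pd (0, e j) g (p.1, bar p.2) := by
  rw [pd_comp_bar h]
  simp only
  rw [bar_e, ← pd_smul]
  split_ifs <;> simp

lemma pd_pd_comp_bar {g : ℝ × E3 → ℝ} (h : ContDiff ℝ ∞ g) (j : Fin 3) (p : ℝ × E3) :
    pd (0, e j) (pd (0, e j) fun p => g (p.1, bar p.2)) p =
      pd (0, e j) (pd (0, e j) g) (p.1, bar p.2) := by
  have h1 : (pd (0, e j) fun p => g (p.1, bar p.2)) =
      fun q => (if j = 2 then (-1 : ℝ) else 1) * (fun p => pd (0, e j) g (p.1, bar p.2)) q := by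
    funext q
    rw [pd_comp_bar_e h]
  rw [h1, pd_const_mul (contDiff_comp_bar (contDiff_pd h _)), pd_comp_bar_e (contDiff_pd h _),
    ← mul_assoc]
  split_ifs <;> simp

lemma wave_reflect {g : ℝ × E3 → ℝ} (h : ContDiff ℝ ∞ g) (σ : ℝ) :
    wave (reflect σ g) = reflect σ (wave g) := by
  have hb := contDiff_comp_bar h
  have h1 : ∀ (f₁ f₂ : ℝ × E3 → ℝ), ContDiff ℝ ∞ f₁ → ContDiff ℝ ∞ f₂ → ∀ a,
      pd a (fun p => f₁ p + σ * f₂ p) = fun p => pd a f₁ p + σ * pd a f₂ p := by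
    intro f₁ f₂ h₁ h₂ a
    funext p
    have d1 := h₁.differentiable (by simp) p
    have d2 := h₂.differentiable (by simp) p
    unfold pd
    rw [fderiv_fun_add d1 (d2.const_mul σ), fderiv_const_mul d2]
    rfl
  have h2 : ∀ a, pd a (pd a (reflect σ g)) = fun p =>
      pd a (pd a g) p + σ * pd a (pd a fun p => g (p.1, bar p.2)) p := by
    intro a
    have : reflect σ g = fun p => g p + σ * (fun p => g (p.1, bar p.2)) p := rfl
    rw [this, h1 _ _ h hb, h1 _ _ (contDiff_pd h a) (contDiff_pd hb a)]
  have ht : ∀ p, pd (1, 0) (pd (1, 0) fun p => g (p.1, bar p.2)) p =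
      pd (1, 0) (pd (1, 0) g) (p.1, bar p.2) := by
    intro p
    have h3 : (pd (1, 0) fun p => g (p.1, bar p.2)) = fun p => pd (1, 0) g (p.1, bar p.2) := by
      funext q
      rw [pd_comp_bar h]
      simp [show bar 0 = 0 from map_zero barIso]
    rw [h3, pd_comp_bar (contDiff_pd h _)]
    simp [show bar 0 = 0 from map_zero barIso]
  funext p
  simp only [wave, h2, reflect, ht, pd_pd_comp_bar h, Finset.sum_add_distrib, ← Finset.mul_sum]
  ring

/-- Restriction to the half space, by zero. -/
def cutΩ (g : ℝ × E3 → ℝ) (p : ℝ × E3) : ℝ := {p : ℝ × E3 | p.2 ∈ Ω}.indicator g p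

lemma potential_reflect_cutΩ {g : ℝ × E3 → ℝ} (hg : Continuous g) (hgc : HasCompactSupport g)
    (σ t : ℝ) (x : E3) :
    potential (reflect σ (cutΩ g)) (t, x) = (4 * Real.pi)⁻¹ *
      ((∫ y in Ω, ‖y - x‖⁻¹ * g (t + ‖y - x‖, y)) +
        σ * ∫ y in Ω, ‖y - bar x‖⁻¹ * g (t + ‖y - bar x‖, y)) := by
  have e1 := setIntegral_Ω_shift (fun z => ‖z‖⁻¹ * g (t + ‖z‖, x + z)) x
  have e2 := setIntegral_Ω_shift_bar (fun z => ‖z‖⁻¹ * g (t + ‖z‖, bar x + z)) x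
  simp only [add_sub_cancel] at e1 e2
  have hi1 : Integrable ({z | x + z ∈ Ω}.indicator fun z => ‖z‖⁻¹ * g (t + ‖z‖, x + z)) :=
    (integrable_potential hg hgc (t, x)).indicator (measurableSet_Ω.preimage (by fun_prop))
  have hi2 : Integrable ({z | bar (x + z) ∈ Ω}.indicator
      fun z => ‖bar z‖⁻¹ * g (t + ‖bar z‖, bar x + bar z)) :=
    Integrable.indicator ((measurePreserving_bar.integrable_comp_emb measurableEmbedding_bar).2
      (integrable_potential hg hgc (t, bar x)))
      (measurableSet_Ω.preimage (continuous_bar.measurable.comp (by fun_prop)))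
  rw [e1, e2, ← integral_const_mul σ, ← integral_add hi1 (hi2.const_mul σ), potential]
  congr 1
  refine integral_congr_ae (Filter.Eventually.of_forall fun z => ?_)
  simp only [reflect, cutΩ, indicator, mem_ofPred_eq, norm_bar, ← bar_add]
  split_ifs <;> ring

/-- A function vanishing near the boundary plane and outside the half space. -/
lemma cutΩ_eq_self {g : ℝ × E3 → ℝ} (h : ∀ p, g p ≠ 0 → p.2 ∈ Ω) : cutΩ g = g := by
  funext p
  unfold cutΩ
  by_cases hp : p.2 ∈ Ω
  · exact indicator_of_mem (by exact hp) _
  · rw [indicator_of_notMem (by exact hp)]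
    by_contra hne
    exact hp (h p (Ne.symm hne))

/-- The test function is recovered from its wave operator, with the boundary conditions. -/
lemma potential_reflect_wave {φ : ℝ × E3 → ℝ} (h : ContDiff ℝ ∞ φ) (hc : HasCompactSupport φ)
    {σ t : ℝ} {x : E3} (hx : x ∈ Ωbar)
    (hbc : (σ = 1 ∧ ∀ s ≥ t, ∀ y : E3, y 2 = 0 → pd (0, e 2) φ (s, y) = 0) ∨
      (σ = -1 ∧ ∀ s ≥ t, ∀ y : E3, y 2 = 0 → φ (s, y) = 0)) :
    potential (reflect σ (cutΩ (wave φ))) (t, x) = φ (t, x) := by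
  have hw : ContDiff ℝ ∞ (wave φ) := by
    unfold wave
    exact (contDiff_pd (contDiff_pd h _) _).sub
      (ContDiff.sum fun j _ => contDiff_pd (contDiff_pd h _) _)
  have hwc : HasCompactSupport (wave φ) := by
    refine hc.mono' fun p hp => ?_
    by_contra hne
    apply hp
    have h1 : ∀ a, pd a (pd a φ) p = 0 := fun a => by
      by_contra hn
      exact hne (tsupport_pd_subset _ _ (tsupport_pd_subset _ _ (subset_tsupport _ hn)))
    simp [wave, h1]
  rw [potential_reflect_cutΩ hw.continuous hwc, kirchhoff_reflect h hc hx hbc]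
  have := Real.pi_pos
  field_simp

/-! ### Potentials as test functions -/

lemma contDiff_wave {φ : ℝ × E3 → ℝ} (h : ContDiff ℝ ∞ φ) : ContDiff ℝ ∞ (wave φ) := by
  unfold wave
  exact (contDiff_pd (contDiff_pd h _) _).sub
    (ContDiff.sum fun j _ => contDiff_pd (contDiff_pd h _) _)

lemma tsupport_wave_subset (φ : ℝ × E3 → ℝ) : tsupport (wave φ) ⊆ tsupport φ := by
  refine closure_minimal (fun p hp => ?_) (isClosed_tsupport φ)
  by_contra hne
  apply hp
  have h1 : ∀ a, pd a (pd a φ) p = 0 := fun a => by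
    by_contra hn
    exact hne (tsupport_pd_subset _ _ (tsupport_pd_subset _ _ (subset_tsupport _ hn)))
  simp [wave, h1]

/-- The support of a test function stays away from the final time. -/
lemma exists_time_bound {T : ℝ} {g : ℝ × E3 → ℝ} (hc : HasCompactSupport g)
    (hT : tsupport g ⊆ Iio T ×ˢ univ) : ∃ T' < T, ∀ p, g p ≠ 0 → p.1 ≤ T' := by
  have hK : IsCompact (Prod.fst '' tsupport g) := hc.isCompact.image continuous_fst
  rcases (Prod.fst '' tsupport g).eq_empty_or_nonempty with h | h
  · refine ⟨T - 1, by linarith, fun p hp => ?_⟩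
    have := mem_image_of_mem Prod.fst (subset_tsupport _ hp)
    rw [h] at this
    exact this.elim
  · obtain ⟨q, hq, hq1⟩ := hK.sSup_mem h
    refine ⟨sSup (Prod.fst '' tsupport g), ?_, fun p hp =>
      le_csSup hK.bddAbove (mem_image_of_mem Prod.fst (subset_tsupport _ hp))⟩
    rw [← hq1]
    exact (hT hq).1

lemma exists_of_potential_ne_zero {g : ℝ × E3 → ℝ} {p : ℝ × E3} (h : potential g p ≠ 0) :
    ∃ z, g (p.1 + ‖z‖, p.2 + z) ≠ 0 := by
  by_contra! hne
  exact h (by simp [potential, hne])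

/-- A potential is a test function, up to a cutoff at negative times. -/
lemma exists_isTest_eq_potential {T : ℝ} {g : ℝ × E3 → ℝ} (h : ContDiff ℝ ∞ g)
    (hc : HasCompactSupport g) (hT : tsupport g ⊆ Iio T ×ˢ univ) :
    ∃ φ, IsTest T φ ∧ ∀ p : ℝ × E3, -1 ≤ p.1 → φ p = potential g p := by
  obtain ⟨T', hT', hg⟩ := exists_time_bound hc hT
  obtain ⟨R, hR, hRg⟩ := exists_bound_of_hasCompactSupport hc
  set φ : ℝ × E3 → ℝ := fun p => Real.smoothTransition (p.1 + 2) * potential g p with hφ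
  have hsupp : Function.support φ ⊆ Icc (-2) T' ×ˢ Metric.closedBall (0 : E3) (R + T' + 2) := by
    intro p hp
    have h1 : Real.smoothTransition (p.1 + 2) ≠ 0 := left_ne_zero_of_mul hp
    have h2 : -2 ≤ p.1 := by
      by_contra! hlt
      exact h1 (Real.smoothTransition.zero_of_nonpos (by linarith))
    obtain ⟨z, hz⟩ := exists_of_potential_ne_zero (right_ne_zero_of_mul hp)
    have h3 := hg _ hz
    have h4 := (hRg _ hz).2
    simp only at h3 h4
    have h5 : ‖p.2‖ ≤ ‖p.2 + z‖ + ‖z‖ := by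
      have := norm_sub_le (p.2 + z) z
      simpa using this
    have h6 := norm_nonneg z
    refine ⟨⟨h2, by linarith⟩, ?_⟩
    rw [mem_closedBall_zero_iff]
    linarith
  have hK : IsCompact (Icc (-2) T' ×ˢ Metric.closedBall (0 : E3) (R + T' + 2)) :=
    isCompact_Icc.prod (isCompact_closedBall _ _)
  refine ⟨φ, ⟨?_, HasCompactSupport.of_support_subset_isCompact hK hsupp, ?_⟩, fun p hp => ?_⟩
  · exact (Real.smoothTransition.contDiff.comp (contDiff_fst.add contDiff_const)).mul
      (contDiff_potential h hc)
  · refine (closure_minimal hsupp hK.isClosed).trans ?_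
    rintro p ⟨hp, -⟩
    exact ⟨hp.2.trans_lt hT', mem_univ _⟩
  · simp only [hφ]
    rw [Real.smoothTransition.one_of_one_le (by linarith), one_mul]

lemma reflect_bar {σ : ℝ} (hσ : σ = 1 ∨ σ = -1) (g : ℝ × E3 → ℝ) (t : ℝ) (x : E3) :
    reflect σ g (t, bar x) = σ * reflect σ g (t, x) := by
  simp only [reflect, bar_bar]
  rcases hσ with rfl | rfl <;> ring

lemma potential_reflect_bar {σ : ℝ} (hσ : σ = 1 ∨ σ = -1) (g : ℝ × E3 → ℝ) (t : ℝ) (x : E3) :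
    potential (reflect σ g) (t, bar x) = σ * potential (reflect σ g) (t, x) := by
  unfold potential
  rw [← measurePreserving_bar.integral_comp measurableEmbedding_bar, mul_left_comm,
    ← integral_const_mul σ]
  congr 1
  refine integral_congr_ae (Filter.Eventually.of_forall fun z => ?_)
  simp only [norm_bar]
  rw [← bar_add, reflect_bar hσ]
  ring

lemma eq_zero_of_odd {u : ℝ × E3 → ℝ} (h : ∀ t x, u (t, bar x) = -1 * u (t, x)) {t : ℝ} {x : E3}
    (hx : x 2 = 0) : u (t, x) = 0 := by
  have := h t x
  rw [bar_eq_self hx] at this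
  linarith

lemma pd_normal_eq_zero_of_even {u : ℝ × E3 → ℝ} (hu : ContDiff ℝ ∞ u)
    (h : ∀ t x, u (t, bar x) = 1 * u (t, x)) {t : ℝ} {x : E3} (hx : x 2 = 0) :
    pd (0, e 2) u (t, x) = 0 := by
  have h1 := pd_comp_bar_e hu 2 (t, x)
  have h2 : (fun p : ℝ × E3 => u (p.1, bar p.2)) = u := funext fun p => by rw [h]; simp
  rw [h2] at h1
  simp only [bar_eq_self hx, if_true] at h1
  linarith

/-- The potential of the reflection of a function with compact support in the half space solves the
wave equation there. -/
lemma wave_potential_reflect {σ : ℝ} (hσ : σ = 1 ∨ σ = -1) {ψ : ℝ × E3 → ℝ}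
    (h : ContDiff ℝ ∞ ψ) (hc : HasCompactSupport ψ) (hΩ : tsupport ψ ⊆ univ ×ˢ Ω) {p : ℝ × E3}
    (hp : p.2 ∈ Ωbar) : wave (potential (reflect σ ψ)) p = ψ p := by
  have hplane : ∀ s, ∀ y : E3, y 2 = 0 → (s, y) ∉ tsupport ψ := by
    intro s y hy hm
    have : 0 < y 2 := (hΩ hm).2
    exact this.ne' hy
  rw [wave_potential (contDiff_reflect h σ) (hasCompactSupport_reflect hc σ), wave_reflect h,
    ← cutΩ_eq_self (g := wave ψ)
      (fun q hq => (hΩ (tsupport_wave_subset ψ (subset_tsupport _ hq))).2)]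
  refine potential_reflect_wave (t := p.1) (x := p.2) h hc hp ?_
  rcases hσ with rfl | rfl
  · refine Or.inl ⟨rfl, fun s _ y hy => ?_⟩
    by_contra hne
    exact hplane s y hy (tsupport_pd_subset _ _ (subset_tsupport _ hne))
  · refine Or.inr ⟨rfl, fun s _ y hy => ?_⟩
    by_contra hne
    exact hplane s y hy (subset_tsupport _ hne)

/-! ### The reflected terms -/

/-- The reflection of the unit sphere. -/
def sphereBar (w : Metric.sphere (0 : E3) 1) : Metric.sphere (0 : E3) 1 :=
  ⟨bar w, by simp [norm_bar]⟩

lemma coe_sphereBar (w : Metric.sphere (0 : E3) 1) : (sphereBar w : E3) = bar w := rfl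

lemma sphereBar_sphereBar (w : Metric.sphere (0 : E3) 1) : sphereBar (sphereBar w) = w :=
  Subtype.ext (by simp [coe_sphereBar])

lemma continuous_sphereBar : Continuous sphereBar :=
  (continuous_bar.comp continuous_subtype_val).subtype_mk _

lemma measurableEmbedding_sphereBar : MeasurableEmbedding sphereBar :=
  continuous_sphereBar.measurableEmbedding
    (Function.LeftInverse.injective (g := sphereBar) sphereBar_sphereBar)

lemma measurePreserving_sphereBar : MeasurePreserving sphereBar sphereMeasure sphereMeasure := by
  refine ⟨continuous_sphereBar.measurable, ?_⟩
  ext s hs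
  have hs' := continuous_sphereBar.measurable hs
  rw [Measure.map_apply continuous_sphereBar.measurable hs]
  unfold sphereMeasure
  rw [Measure.toSphere_apply' _ hs, Measure.toSphere_apply' _ hs']
  congr 1
  refine Eq.trans ?_ (measurePreserving_bar.measure_preimage_emb measurableEmbedding_bar _)
  congr 1
  ext x
  simp only [Set.mem_smul, mem_image, mem_preimage]
  constructor
  · rintro ⟨r, hr, y, ⟨w, hw, rfl⟩, rfl⟩
    exact ⟨r, hr, _, ⟨_, hw, rfl⟩, by rw [coe_sphereBar, bar_smul]⟩
  · rintro ⟨r, hr, y, ⟨w, hw, rfl⟩, h⟩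
    refine ⟨r, hr, _, ⟨sphereBar w, by rwa [sphereBar_sphereBar], rfl⟩, ?_⟩
    rw [coe_sphereBar, ← bar_smul, h, bar_bar]

lemma bar_preimage_ball_inter (t : ℝ) (x : E3) :
    bar ⁻¹' (Metric.ball (bar x) t ∩ Side.upper.halfSpace) =
      Metric.ball x t ∩ Side.lower.halfSpace := by
  ext y
  simp only [mem_preimage, mem_inter_iff, Metric.mem_ball, dist_eq_norm, Side.halfSpace,
    mem_ofPred_eq, bar_apply_two, ← bar_sub, norm_bar, Left.neg_pos_iff]

lemma dir_bar (x y : E3) : dir (bar x) (bar y) = bar (dir x y) := by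
  unfold dir
  rw [bar_smul, ← bar_sub, norm_bar]

lemma bulkIntegrand_lower (k : E3 → E3 → ℝ) (m : ℕ) (h : ℝ × E3 × E3 → ℝ) (t : ℝ) (x y v : E3) :
    bulkIntegrand .lower k m h t x (y, v) = bulkIntegrand .upper k m h t (bar x) (bar y, v) := by
  simp only [bulkIntegrand, Side.map, dir_bar, ← bar_sub, norm_bar]

lemma bulkTerm_lower (k : E3 → E3 → ℝ) (m : ℕ) (h : ℝ × E3 × E3 → ℝ) (t : ℝ) (x : E3) :
    bulkTerm .lower k m h t x = bulkTerm .upper k m h t (bar x) := by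
  unfold bulkTerm
  refine Eq.trans ?_
    (measurePreserving_bar.setIntegral_preimage_emb measurableEmbedding_bar _ _)
  rw [bar_preimage_ball_inter]
  simp only [bulkIntegrand_lower]

/-- Reflection of the position, at fixed velocity. -/
def barFst : E3 × E3 ≃ᵐ E3 × E3 :=
  (barIso.toHomeomorph.toMeasurableEquiv).prodCongr (MeasurableEquiv.refl E3)

lemma measurePreserving_barFst : MeasurePreserving barFst volume volume :=
  measurePreserving_bar.prod (MeasurePreserving.id volume)

lemma bulkConverges_lower (k : E3 → E3 → ℝ) (m : ℕ) (h : ℝ × E3 × E3 → ℝ) (t : ℝ) (x : E3) :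
    BulkConverges .lower k m h t x ↔ BulkConverges .upper k m h t (bar x) := by
  unfold BulkConverges
  have h1 : barFst ⁻¹' ((Metric.ball (bar x) t ∩ Side.upper.halfSpace) ×ˢ univ) =
      (Metric.ball x t ∩ Side.lower.halfSpace) ×ˢ univ := by
    rw [← bar_preimage_ball_inter]
    rfl
  have h2 : bulkIntegrand .upper k m h t (bar x) ∘ barFst = bulkIntegrand .lower k m h t x :=
    funext fun p => (bulkIntegrand_lower k m h t x p.1 p.2).symm
  rw [← h1, ← h2]
  exact measurePreserving_barFst.integrableOn_comp_preimage barFst.measurableEmbedding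

lemma planeIntegrand_lower (k : E3 → E3 → ℝ) (h : ℝ × E3 × E3 → ℝ) (t : ℝ) (x : E3) :
    planeIntegrand .lower k h t x = planeIntegrand .upper k h t (bar x) := by
  funext p
  have h1 : ‖planePoint p.1 - bar x‖ = ‖planePoint p.1 - x‖ := by
    rw [norm_sub_rev, norm_bar_sub, bar_planePoint, norm_sub_rev]
  have h2 : dir (bar x) (planePoint p.1) = bar (dir x (planePoint p.1)) := by
    rw [← dir_bar, bar_planePoint]
  simp only [planeIntegrand, Side.map, h1, h2]

lemma disc_bar (t : ℝ) (x : E3) : disc t (bar x) = disc t x := by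
  ext z
  have h1 : ‖planePoint z - bar x‖ = ‖planePoint z - x‖ := by
    rw [norm_sub_rev, norm_bar_sub, bar_planePoint, norm_sub_rev]
  simp only [disc, mem_ofPred_eq, Metric.mem_ball, dist_eq_norm, h1]

lemma planeTerm_lower (k : E3 → E3 → ℝ) (h : ℝ × E3 × E3 → ℝ) (t : ℝ) (x : E3) :
    planeTerm .lower k h t x = planeTerm .upper k h t (bar x) := by
  simp only [planeTerm, planeIntegrand_lower, disc_bar]

lemma planeConverges_lower (k : E3 → E3 → ℝ) (h : ℝ × E3 × E3 → ℝ) (t : ℝ) (x : E3) :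
    PlaneConverges .lower k h t x ↔ PlaneConverges .upper k h t (bar x) := by
  simp only [PlaneConverges, planeIntegrand_lower, disc_bar]

lemma sphereBar_preimage_directions (t : ℝ) (x : E3) :
    sphereBar ⁻¹' sphereDirections .upper t (bar x) = sphereDirections .lower t x := by
  ext w
  simp only [sphereDirections, mem_preimage, mem_ofPred_eq, coe_sphereBar, ← bar_smul, ← bar_add,
    Side.halfSpace, bar_apply_two, Left.neg_pos_iff]

lemma sphereIntegral_lower (F : E3 → ℝ) (t : ℝ) (x : E3) :
    sphereIntegral .lower (fun y => F (bar y)) t x = sphereIntegral .upper F t (bar x) := by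
  unfold sphereIntegral
  congr 1
  refine Eq.trans ?_ (measurePreserving_sphereBar.setIntegral_preimage_emb
    measurableEmbedding_sphereBar _ _)
  rw [sphereBar_preimage_directions]
  simp only [coe_sphereBar, ← bar_smul, ← bar_add]

lemma initialIntegrand_lower (k : E3 → E3 → ℝ) (h : ℝ × E3 × E3 → ℝ) (x y v : E3) :
    initialIntegrand .lower k h x (y, v) = initialIntegrand .upper k h (bar x) (bar y, v) := by
  simp only [initialIntegrand, Side.map, dir_bar, ← bar_sub, norm_bar]

lemma initialTerm_lower (k : E3 → E3 → ℝ) (h : ℝ × E3 × E3 → ℝ) (t : ℝ) (x : E3) :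
    initialTerm .lower k h t x = initialTerm .upper k h t (bar x) := by
  unfold initialTerm
  rw [← sphereIntegral_lower]
  simp only [initialIntegrand_lower]

lemma initialConverges_lower (k : E3 → E3 → ℝ) (h : ℝ × E3 × E3 → ℝ) (t : ℝ) (x : E3) :
    InitialConverges .lower k h t x ↔ InitialConverges .upper k h t (bar x) := by
  unfold InitialConverges
  have h1 : MeasurePreserving (fun p : Metric.sphere (0 : E3) 1 × E3 => (sphereBar p.1, p.2))
      ((sphereMeasure.restrict (sphereDirections .lower t x)).prod volume)
      ((sphereMeasure.restrict (sphereDirections .upper t (bar x))).prod volume) := by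
    rw [← sphereBar_preimage_directions]
    exact (measurePreserving_sphereBar.restrict_preimage_emb measurableEmbedding_sphereBar _).prod
      (MeasurePreserving.id volume)
  have h2 : MeasurableEmbedding fun p : Metric.sphere (0 : E3) 1 × E3 => (sphereBar p.1, p.2) :=
    measurableEmbedding_sphereBar.prodMap MeasurableEmbedding.id
  rw [← h1.integrable_comp_emb h2]
  refine integrable_congr (Filter.Eventually.of_forall fun p => ?_)
  simp only [Function.comp, initialIntegrand_lower, coe_sphereBar, bar_add, bar_smul]

lemma kirchhoffIntegrand_lower (u₀ u₁ : E3 → ℝ) (t : ℝ) (x y : E3) :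
    kirchhoffIntegrand .lower u₀ u₁ t x y =
      kirchhoffIntegrand .upper u₀ u₁ t (bar x) (bar y) := rfl

lemma kirchhoffTerm_lower (u₀ u₁ : E3 → ℝ) (t : ℝ) (x : E3) :
    kirchhoffTerm .lower u₀ u₁ t x = kirchhoffTerm .upper u₀ u₁ t (bar x) := by
  unfold kirchhoffTerm
  rw [← sphereIntegral_lower]
  rfl

lemma kirchhoffConverges_lower (u₀ u₁ : E3 → ℝ) (t : ℝ) (x : E3) :
    KirchhoffConverges .lower u₀ u₁ t x ↔ KirchhoffConverges .upper u₀ u₁ t (bar x) := by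
  unfold KirchhoffConverges
  refine Iff.trans ?_
    (measurePreserving_sphereBar.integrableOn_comp_preimage measurableEmbedding_sphereBar)
  rw [sphereBar_preimage_directions]
  refine integrableOn_congr_fun_ae (Filter.Eventually.of_forall fun w => ?_)
  simp only [Function.comp, kirchhoffIntegrand_lower, coe_sphereBar, bar_add, bar_smul]

/-! ### Duality between the retarded integrals and potentials -/

/-- The functions against which fields on `(0,T) × ℝ³` are tested. -/
structure IsWeight (T : ℝ) (g : ℝ × E3 → ℝ) : Prop where
  measurable : Measurable g
  bounded : ∃ M, ∀ p, |g p| ≤ M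
  support : ∃ R, ∀ p, g p ≠ 0 → p.1 < T ∧ ‖p.2‖ < R

lemma IsTest.isWeight {T : ℝ} {g : ℝ × E3 → ℝ} (h : IsTest T g) : IsWeight T g where
  measurable := h.1.continuous.measurable
  bounded := h.1.continuous.bounded_above_of_compact_support h.2.1
  support := by
    obtain ⟨R, -, hR⟩ := exists_bound_of_hasCompactSupport h.2.1
    exact ⟨R, fun p hp => ⟨(h.2.2 (subset_tsupport _ hp)).1, (hR p hp).2⟩⟩

lemma isWeight_indicator (T R : ℝ) :
    IsWeight T ((Iio T ×ˢ Metric.ball (0 : E3) R).indicator fun _ => (1 : ℝ)) where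
  measurable := measurable_const.indicator (measurableSet_Iio.prod Metric.isOpen_ball.measurableSet)
  bounded := ⟨1, fun p => by
    unfold indicator
    split_ifs <;> simp⟩
  support := ⟨R, fun p hp => by
    have h1 : p ∈ Iio T ×ˢ Metric.ball (0 : E3) R := mem_of_indicator_ne_zero hp
    exact ⟨h1.1, by simpa using h1.2⟩⟩

/-- A field `X` on `(0,T) × ℝ³` which is locally integrable up to the boundary, and whose integral
against a weight `g` is `A g`. -/
def IsDual (T : ℝ) (X : ℝ × E3 → ℝ) (A : (ℝ × E3 → ℝ) → ℝ) : Prop :=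
  ∀ g, IsWeight T g → IntegrableOn (fun p => X p * g p) (Ioo 0 T ×ˢ univ) ∧
    ∫ p in Ioo 0 T ×ˢ univ, X p * g p = A g

section

variable {N : Type*} [MeasurableSpace N]

/-- The integral over `z ∈ ℝ³` and over points `n` with position `pos n` and time `τ n` of the
kernel `H(z, n)` against the weight `g` at `(τ n + |z|, pos n + z)`. -/
def conePairing (ν : Measure N) (τ : N → ℝ) (pos : N → E3) (H : E3 × N → ℝ) (g : ℝ × E3 → ℝ) : ℝ :=
  ∫ p, H p * g (τ p.2 + ‖p.1‖, pos p.2 + p.1) ∂((volume : Measure E3).prod ν)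

/-- Kernels which are locally integrable in `n` and have at most the singularity `1/|z|²`. -/
structure IsConeKernel (ν : Measure N) (τ : N → ℝ) (pos : N → E3) (H : E3 × N → ℝ) : Prop where
  measurable_time : Measurable τ
  measurable_pos : Measurable pos
  nonneg : ∀ᵐ n ∂ν, 0 ≤ τ n
  aestronglyMeasurable : AEStronglyMeasurable H ((volume : Measure E3).prod ν)
  bound : ∃ b : N → ℝ, (∀ R, IntegrableOn b {n | ‖pos n‖ < R} ν) ∧
    ∀ᵐ p ∂((volume : Measure E3).prod ν), |H p| ≤ b p.2 * ((‖p.1‖ ^ 2)⁻¹ + 1)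

lemma inv_pow_le_inv_sq_add_one (r : ℝ) {m : ℕ} (hm : m ≤ 2) :
    (r ^ m)⁻¹ ≤ (r ^ 2)⁻¹ + 1 := by
  have h0 : 0 ≤ (r ^ 2)⁻¹ := by positivity
  interval_cases m
  · simpa using h0
  · simp only [pow_one, ← inv_pow]
    nlinarith [sq_nonneg (r⁻¹ - 1)]
  · linarith

lemma IsConeKernel.integrable {ν : Measure N} [SFinite ν] {τ : N → ℝ} {pos : N → E3}
    {H : E3 × N → ℝ} (hH : IsConeKernel ν τ pos H) {T : ℝ} {g : ℝ × E3 → ℝ} (hg : IsWeight T g) :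
    Integrable (fun p => H p * g (τ p.2 + ‖p.1‖, pos p.2 + p.1))
      ((volume : Measure E3).prod ν) := by
  obtain ⟨b, hb, hHb⟩ := hH.bound
  obtain ⟨M, hM⟩ := hg.bounded
  obtain ⟨R, hR⟩ := hg.support
  have hτ := hH.measurable_time
  have hpos := hH.measurable_pos
  have hM0 : 0 ≤ M := (abs_nonneg _).trans (hM 0)
  have hS : MeasurableSet {n | ‖pos n‖ < R + T} := measurableSet_lt hpos.norm measurable_const
  have h1 : Integrable ((Metric.ball (0 : E3) T).indicator fun z => (‖z‖ ^ 2)⁻¹ + 1) :=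
    (integrable_indicator_iff Metric.isOpen_ball.measurableSet).2
      ((integrableOn_norm_pow_inv 2 le_rfl T).add
        (integrableOn_const measure_ball_lt_top.ne))
  have h2 : Integrable ({n | ‖pos n‖ < R + T}.indicator fun n => |b n| * M) ν :=
    (integrable_indicator_iff hS).2 ((hb _).abs.mul_const M)
  refine (h1.mul_prod h2).mono' ?_ ?_
  · exact hH.aestronglyMeasurable.mul (hg.measurable.comp (by fun_prop)).aestronglyMeasurable
  · have hn : ∀ᵐ p : E3 × N ∂((volume : Measure E3).prod ν), 0 ≤ τ p.2 :=
      Measure.quasiMeasurePreserving_snd.ae hH.nonneg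
    filter_upwards [hHb, hn] with p hp hp0
    by_cases hz : g (τ p.2 + ‖p.1‖, pos p.2 + p.1) = 0
    · rw [hz, mul_zero, norm_zero]
      refine mul_nonneg (indicator_nonneg (fun _ _ => by positivity) _)
        (indicator_nonneg (fun _ _ => by positivity) _)
    · obtain ⟨h3, h4⟩ := hR _ hz
      simp only at h3 h4
      have h5 : ‖p.1‖ < T := by linarith
      have h6 : ‖pos p.2‖ ≤ ‖pos p.2 + p.1‖ + ‖p.1‖ := by
        have := norm_sub_le (pos p.2 + p.1) p.1
        simpa using this
      rw [indicator_of_mem (by simpa using h5), indicator_of_mem (by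
        simp only [mem_ofPred_eq]
        linarith), norm_mul, Real.norm_eq_abs, Real.norm_eq_abs]
      calc |H p| * |g (τ p.2 + ‖p.1‖, pos p.2 + p.1)|
          ≤ (|b p.2| * ((‖p.1‖ ^ 2)⁻¹ + 1)) * M := by
            refine mul_le_mul (hp.trans ?_) (hM _) (abs_nonneg _) (by positivity)
            exact mul_le_mul_of_nonneg_right (le_abs_self _) (by positivity)
        _ = _ := by ring

end

/-- Fubini's theorem after a measure preserving change of variables that straightens the cones. -/
lemma integral_of_measurePreserving {P Q M : Type*} [MeasurableSpace P] [MeasurableSpace Q]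
    [MeasurableSpace M] {μP : Measure P} {μQ : Measure Q} {μM : Measure M} [SFinite μP] [SFinite μQ]
    {Ψ : P × Q → M} (hΨ : MeasurePreserving Ψ (μP.prod μQ) μM) {J : M → ℝ} (hJ : Integrable J μM)
    {K : P → Q → ℝ} {G : P → ℝ} (h : ∀ᵐ p ∂μP, ∀ q, J (Ψ (p, q)) = K p q * G p) :
    (∀ᵐ p ∂μP, G p ≠ 0 → Integrable (K p) μQ) ∧ Integrable (fun p => (∫ q, K p q ∂μQ) * G p) μP ∧
      ∫ p, (∫ q, K p q ∂μQ) * G p ∂μP = ∫ x, J x ∂μM := by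
  have h1 : Integrable (J ∘ Ψ) (μP.prod μQ) := (hΨ.integrable_comp hJ.aestronglyMeasurable).2 hJ
  have h2 : ∀ᵐ p ∂μP, ∫ q, (J ∘ Ψ) (p, q) ∂μQ = (∫ q, K p q ∂μQ) * G p := by
    filter_upwards [h] with p hp
    rw [← integral_mul_const]
    exact integral_congr_ae (Filter.Eventually.of_forall hp)
  refine ⟨?_, h1.integral_prod_left.congr h2, ?_⟩
  · filter_upwards [h1.prod_right_ae, h] with p hp1 hp hG
    have h3 : Integrable (fun q => K p q * G p) μQ :=
      hp1.congr (Filter.Eventually.of_forall fun q => hp q)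
    exact (h3.div_const (G p)).congr (Filter.Eventually.of_forall fun q => by
      simp only
      field_simp)
  · rw [← integral_congr_ae h2, ← integral_prod _ h1, ← hΨ.map_eq, integral_map hΨ.aemeasurable]
    · rfl
    · rw [hΨ.map_eq]
      exact hJ.aestronglyMeasurable

section

variable {Q : Type*} [MeasurableSpace Q]

lemma measurePreserving_cone_fiber (c : E3) :
    MeasurePreserving (fun p : ℝ × E3 => (p.2 - c, p.1 - ‖p.2 - c‖)) volume
      ((volume : Measure E3).prod (volume : Measure ℝ)) := by
  have h1 : MeasurePreserving (fun p : E3 × ℝ => (p.1 - c, p.2 - ‖p.1 - c‖))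
      ((volume : Measure E3).prod (volume : Measure ℝ)) (volume.prod volume) :=
    (measurePreserving_sub_right volume c).skew_product (g := fun x t => t - ‖x - c‖) (by fun_prop)
      (Filter.Eventually.of_forall fun x => (measurePreserving_sub_right volume ‖x - c‖).map_eq)
  exact h1.comp Measure.measurePreserving_swap

/-- The change of variables `z = x - y`, `s = t - |x - y|`. -/
lemma measurePreserving_cone (νQ : Measure Q) [SFinite νQ] {pos : Q → E3} (hpos : Measurable pos) :
    MeasurePreserving (fun p : (ℝ × E3) × Q =>
        (p.1.2 - pos p.2, (p.1.1 - ‖p.1.2 - pos p.2‖, p.2)))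
      ((volume : Measure (ℝ × E3)).prod νQ)
      ((volume : Measure E3).prod ((volume : Measure ℝ).prod νQ)) := by
  have h1 : MeasurePreserving (fun p : Q × (ℝ × E3) =>
      (p.1, (p.2.2 - pos p.1, p.2.1 - ‖p.2.2 - pos p.1‖)))
      (νQ.prod volume) (νQ.prod ((volume : Measure E3).prod (volume : Measure ℝ))) :=
    (MeasurePreserving.id νQ).skew_product
      (g := fun (q : Q) (p : ℝ × E3) => (p.2 - pos q, p.1 - ‖p.2 - pos q‖))
      (by unfold Function.uncurry; fun_prop)
      (Filter.Eventually.of_forall fun q => (measurePreserving_cone_fiber (pos q)).map_eq)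
  exact (measurePreserving_prodAssoc _ _ _).comp
    (Measure.measurePreserving_swap.comp (h1.comp Measure.measurePreserving_swap))

/-- The retarded integral of `H` at the point `p` of space-time. -/
def retarded (νQ : Measure Q) (pos : Q → E3) (H : E3 × (ℝ × Q) → ℝ) (p : ℝ × E3) : ℝ :=
  ∫ q in {q | ‖p.2 - pos q‖ < p.1}, H (p.2 - pos q, (p.1 - ‖p.2 - pos q‖, q)) ∂νQ

/-- A retarded integral converges absolutely almost everywhere, and its integral against a test
function is the cone pairing: the map `(z, t, q) ↦ (t + |z|, pos q + z, q)` preserves the measure. -/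
lemma retarded_duality {T : ℝ} {νQ : Measure Q} [SFinite νQ] {pos : Q → E3} (hpos : Measurable pos)
    {H : E3 × (ℝ × Q) → ℝ}
    (hH : IsConeKernel ((volume.restrict (Ioo 0 T)).prod νQ) Prod.fst (fun n => pos n.2) H) :
    (∀ᵐ p ∂((volume : Measure (ℝ × E3)).restrict (Ioo 0 T ×ˢ univ)),
      IntegrableOn (fun q => H (p.2 - pos q, (p.1 - ‖p.2 - pos q‖, q)))
        {q | ‖p.2 - pos q‖ < p.1} νQ) ∧
    IsDual T (retarded νQ pos H)
      (conePairing ((volume.restrict (Ioo 0 T)).prod νQ) Prod.fst (fun n => pos n.2) H) := by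
  have hm : ∀ p : ℝ × E3, MeasurableSet {q | ‖p.2 - pos q‖ < p.1} := fun p =>
    measurableSet_lt (measurable_const.sub hpos).norm measurable_const
  have hms : MeasurableSet ((univ : Set E3) ×ˢ (Ioo (0 : ℝ) T ×ˢ (univ : Set Q))) :=
    MeasurableSet.univ.prod (measurableSet_Ioo.prod MeasurableSet.univ)
  have hμ : (volume : Measure E3).prod ((volume.restrict (Ioo 0 T)).prod νQ) =
      ((volume : Measure E3).prod ((volume : Measure ℝ).prod νQ)).restrict
        (univ ×ˢ (Ioo (0 : ℝ) T ×ˢ (univ : Set Q))) := by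
    rw [← Measure.prod_restrict, ← Measure.prod_restrict, Measure.restrict_univ,
      Measure.restrict_univ]
  have key : ∀ g, IsWeight T g → _ := fun g hg =>
    integral_of_measurePreserving (measurePreserving_cone νQ hpos)
      (J := (univ ×ˢ (Ioo (0 : ℝ) T ×ˢ (univ : Set Q))).indicator
        fun p => H p * g (p.2.1 + ‖p.1‖, pos p.2.2 + p.1))
      (K := fun p => {q | ‖p.2 - pos q‖ < p.1}.indicator
        fun q => H (p.2 - pos q, (p.1 - ‖p.2 - pos q‖, q))) (G := g)
      ((integrable_indicator_iff hms).2 (by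
        have := hH.integrable hg
        rwa [hμ] at this))
      (Filter.Eventually.of_forall fun p q => by
        obtain ⟨R, hR⟩ := hg.support
        by_cases hg0 : g p = 0
        · simp only [indicator, sub_add_cancel, add_sub_cancel]
          simp [hg0]
        · have h1 := (hR p hg0).1
          have h2 := norm_nonneg (p.2 - pos q)
          simp only [indicator, sub_add_cancel, add_sub_cancel, mem_prod, mem_univ, true_and,
            and_true, mem_Ioo, mem_ofPred_eq, sub_pos]
          by_cases h3 : ‖p.2 - pos q‖ < p.1
          · rw [if_pos ⟨h3, by linarith⟩, if_pos h3]
          · rw [if_neg (fun h => h3 h.1), if_neg h3, zero_mul])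
  refine ⟨?_, fun g hg => ?_⟩
  · rw [ae_restrict_iff' (measurableSet_Ioo.prod MeasurableSet.univ)]
    have h1 := fun n : ℕ => (key _ (isWeight_indicator T n)).1
    rw [← ae_all_iff] at h1
    filter_upwards [h1] with p hp hpT
    -- `key`, with the weights `1_{|x| < n}`, covers every point
    obtain ⟨n, hn⟩ := exists_nat_gt ‖p.2‖
    have hmem : p ∈ Iio T ×ˢ Metric.ball (0 : E3) n := ⟨hpT.1.2, by simpa using hn⟩
    have h2 := hp n (by
      rw [indicator_of_mem hmem]
      exact one_ne_zero)
    exact (integrable_indicator_iff (hm p)).1 h2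
  · obtain ⟨-, h1, h2⟩ := key g hg
    obtain ⟨R, hR⟩ := hg.support
    have h3 : ∀ p, ∫ q, {q | ‖p.2 - pos q‖ < p.1}.indicator
        (fun q => H (p.2 - pos q, (p.1 - ‖p.2 - pos q‖, q))) q ∂νQ = retarded νQ pos H p :=
      fun p => integral_indicator (hm p)
    simp only [h3] at h1 h2
    refine ⟨h1.integrableOn, ?_⟩
    rw [setIntegral_eq_integral_of_forall_compl_eq_zero, h2, integral_indicator hms, ← hμ]
    · rfl
    · intro p hp
      by_cases hg0 : g p = 0
      · rw [hg0, mul_zero]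
      · have h4 := (hR p hg0).1
        have h5 : p.1 ≤ 0 := by
          by_contra! h6
          exact hp ⟨⟨h6, h4⟩, mem_univ _⟩
        have h7 : {q | ‖p.2 - pos q‖ < p.1} = ∅ := by
          ext q
          simp only [mem_ofPred_eq, mem_empty_iff_false, iff_false, not_lt]
          exact h5.trans (norm_nonneg _)
        simp [retarded, h7]

end

lemma radialMeasure_prod : radialMeasure.prod (volume : Measure E3) =
    ((volume : Measure (ℝ × E3)).restrict (Ioi 0 ×ˢ univ)).withDensity
      fun p => ENNReal.ofReal (p.1 ^ 2) := by
  unfold radialMeasure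
  rw [prod_withDensity_left (by fun_prop), Measure.volume_eq_prod, ← Measure.prod_restrict,
    Measure.restrict_univ]

lemma ae_radialMeasure_prod_iff {P : ℝ × E3 → Prop} :
    (∀ᵐ p ∂(radialMeasure.prod (volume : Measure E3)), P p) ↔
      ∀ᵐ p ∂((volume : Measure (ℝ × E3)).restrict (Ioi 0 ×ˢ univ)), P p := by
  rw [radialMeasure_prod, ae_withDensity_iff (by fun_prop)]
  constructor
  · intro h
    filter_upwards [h, ae_restrict_mem (measurableSet_Ioi.prod MeasurableSet.univ)] with p hp h0
    refine hp ?_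
    have : (0 : ℝ) < p.1 := h0.1
    simp only [ne_eq, ENNReal.ofReal_eq_zero, not_le]
    positivity
  · intro h
    filter_upwards [h] with p hp _ using hp

lemma integrable_radialMeasure_prod_iff {F : ℝ × E3 → ℝ} :
    Integrable F (radialMeasure.prod (volume : Measure E3)) ↔
      IntegrableOn (fun p => p.1 ^ 2 * F p) (Ioi 0 ×ˢ univ) := by
  rw [radialMeasure_prod, integrable_withDensity_iff_integrable_smul' (by fun_prop) (by simp)]
  refine integrable_congr (Filter.Eventually.of_forall fun t => ?_)
  simp [ENNReal.toReal_ofReal (sq_nonneg t.1)]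

lemma integral_radialMeasure_prod (F : ℝ × E3 → ℝ) :
    ∫ p, F p ∂(radialMeasure.prod (volume : Measure E3)) =
      ∫ p in Ioi 0 ×ˢ univ, p.1 ^ 2 * F p := by
  rw [radialMeasure_prod, integral_withDensity_eq_integral_toReal_smul (by fun_prop) (by simp)]
  refine integral_congr_ae (Filter.Eventually.of_forall fun t => ?_)
  simp [ENNReal.toReal_ofReal (sq_nonneg t.1)]

section

variable {V : Type*} [MeasurableSpace V]

/-- The change of variables `z = -t ω`, `y = x + t ω`. -/
lemma measurePreserving_sphere (νV : Measure V) [SFinite νV] :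
    MeasurePreserving (fun p : (ℝ × E3) × (Metric.sphere (0 : E3) 1 × V) =>
        (-(p.1.1 • (p.2.1 : E3)), (p.1.2 + p.1.1 • (p.2.1 : E3), p.2.2)))
      ((radialMeasure.prod volume).prod (sphereMeasure.prod νV))
      ((volume : Measure E3).prod ((volume : Measure E3).prod νV)) := by
  have hA : MeasurePreserving (fun p : (ℝ × E3) × (Metric.sphere (0 : E3) 1 × V) =>
      ((p.1.1, p.2.1), (p.1.2, p.2.2))) ((radialMeasure.prod volume).prod (sphereMeasure.prod νV))
      ((radialMeasure.prod sphereMeasure).prod ((volume : Measure E3).prod νV)) := by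
    have h1 : MeasurePreserving (fun p : E3 × (Metric.sphere (0 : E3) 1 × V) =>
        (p.2.1, (p.1, p.2.2))) ((volume : Measure E3).prod (sphereMeasure.prod νV))
        (sphereMeasure.prod ((volume : Measure E3).prod νV)) :=
      ((MeasurePreserving.id sphereMeasure).prod Measure.measurePreserving_swap).comp
        ((measurePreserving_prodAssoc _ _ _).comp Measure.measurePreserving_swap)
    have : SFinite (sphereMeasure.prod νV) := inferInstance
    have : SFinite ((volume : Measure E3).prod (sphereMeasure.prod νV)) := inferInstance
    exact (MeasurePreserving.symm _ (measurePreserving_prodAssoc _ _ _)).comp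
      (((MeasurePreserving.id radialMeasure).prod h1).comp
        (measurePreserving_prodAssoc radialMeasure (volume : Measure E3) (sphereMeasure.prod νV)))
  have hC : MeasurePreserving (fun p : E3 × (E3 × V) => (-p.1, (p.2.1 + p.1, p.2.2)))
      ((volume : Measure E3).prod ((volume : Measure E3).prod νV))
      ((volume : Measure E3).prod ((volume : Measure E3).prod νV)) :=
    (Measure.measurePreserving_neg (volume : Measure E3)).skew_product
      (g := fun (u : E3) (p : E3 × V) => (p.1 + u, p.2)) (by unfold Function.uncurry; fun_prop)
      (Filter.Eventually.of_forall fun u =>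
        ((measurePreserving_add_right volume u).prod (MeasurePreserving.id νV)).map_eq)
  exact hC.comp ((measurePreserving_polar.prod (MeasurePreserving.id _)).comp hA)

/-- The integral of `H` over the part of the sphere of radius `t` about `x` in the half space. -/
def sphereRetarded (νV : Measure V) (H : E3 × (E3 × V) → ℝ) (p : ℝ × E3) : ℝ :=
  p.1 ^ 2 * ∫ q in sphereDirections .upper p.1 p.2 ×ˢ univ,
    H (-(p.1 • (q.1 : E3)), (p.2 + p.1 • (q.1 : E3), q.2)) ∂(sphereMeasure.prod νV)

lemma measurableSet_sphereDirections (t : ℝ) (x : E3) :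
    MeasurableSet (sphereDirections .upper t x) :=
  measurableSet_Ω.preimage (by fun_prop : Measurable fun w : Metric.sphere (0 : E3) 1 =>
    x + t • (w : E3))

/-- The integrals over spheres, which carry the values at `t = 0`, converge absolutely almost
everywhere and are dual to a cone pairing. The measure `t² dS dt` is Lebesgue measure in polar
coordinates around `y`. -/
lemma sphereRetarded_duality {T : ℝ} {νV : Measure V} [SFinite νV] {H : E3 × (E3 × V) → ℝ}
    (hH : IsConeKernel ((volume.restrict Ω).prod νV) (fun _ => 0) Prod.fst H) :
    (∀ᵐ p ∂((volume : Measure (ℝ × E3)).restrict (Ioo 0 T ×ˢ univ)),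
      IntegrableOn (fun q : Metric.sphere (0 : E3) 1 × V =>
          H (-(p.1 • (q.1 : E3)), (p.2 + p.1 • (q.1 : E3), q.2)))
        (sphereDirections .upper p.1 p.2 ×ˢ univ) (sphereMeasure.prod νV)) ∧
    IsDual T (sphereRetarded νV H)
      (conePairing ((volume.restrict Ω).prod νV) (fun _ => 0) Prod.fst H) := by
  have hm : ∀ p : ℝ × E3, MeasurableSet (sphereDirections .upper p.1 p.2 ×ˢ (univ : Set V)) :=
    fun p => (measurableSet_sphereDirections _ _).prod MeasurableSet.univ
  have hms : MeasurableSet ((univ : Set E3) ×ˢ (Ω ×ˢ (univ : Set V))) :=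
    MeasurableSet.univ.prod (measurableSet_Ω.prod MeasurableSet.univ)
  have hμ : (volume : Measure E3).prod ((volume.restrict Ω).prod νV) =
      ((volume : Measure E3).prod ((volume : Measure E3).prod νV)).restrict
        (univ ×ˢ (Ω ×ˢ (univ : Set V))) := by
    rw [← Measure.prod_restrict, ← Measure.prod_restrict, Measure.restrict_univ,
      Measure.restrict_univ]
  have hpos : ∀ᵐ p ∂(radialMeasure.prod (volume : Measure E3)), 0 < p.1 := by
    rw [ae_radialMeasure_prod_iff]
    filter_upwards [ae_restrict_mem (measurableSet_Ioi.prod MeasurableSet.univ)] with p hp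
    exact hp.1
  have key : ∀ g, IsWeight T g → _ := fun g hg =>
    integral_of_measurePreserving (measurePreserving_sphere νV)
      (J := (univ ×ˢ (Ω ×ˢ (univ : Set V))).indicator
        fun p => H p * g (0 + ‖p.1‖, p.2.1 + p.1))
      (K := fun p => (sphereDirections .upper p.1 p.2 ×ˢ univ).indicator
        fun q => H (-(p.1 • (q.1 : E3)), (p.2 + p.1 • (q.1 : E3), q.2))) (G := g)
      ((integrable_indicator_iff hms).2 (by
        have := hH.integrable hg
        rwa [hμ] at this))
      (by
        filter_upwards [hpos] with p hp q
        have h1 : ‖-(p.1 • (q.1 : E3))‖ = p.1 := by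
          rw [norm_neg, norm_smul, Real.norm_of_nonneg hp.le]
          simp
        have h2 : (q ∈ sphereDirections .upper p.1 p.2 ×ˢ (univ : Set V)) ↔
            p.2 + p.1 • (q.1 : E3) ∈ Ω := by
          simp only [mem_prod, mem_univ, and_true]
          rfl
        by_cases h3 : p.2 + p.1 • (q.1 : E3) ∈ Ω
        · rw [indicator_of_mem (by exact ⟨mem_univ _, h3, mem_univ _⟩), indicator_of_mem (h2.2 h3)]
          simp only [h1, zero_add, add_neg_cancel_right]
        · rw [indicator_of_notMem (by exact fun h => h3 h.2.1), indicator_of_notMem (mt h2.1 h3),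
            zero_mul])
  refine ⟨?_, fun g hg => ?_⟩
  · rw [ae_restrict_iff' (measurableSet_Ioo.prod MeasurableSet.univ)]
    have h1 := fun n : ℕ => (key _ (isWeight_indicator T n)).1
    rw [← ae_all_iff, ae_radialMeasure_prod_iff,
      ae_restrict_iff' (measurableSet_Ioi.prod MeasurableSet.univ)] at h1
    filter_upwards [h1] with p hp hpT
    obtain ⟨n, hn⟩ := exists_nat_gt ‖p.2‖
    have hmem : p ∈ Iio T ×ˢ Metric.ball (0 : E3) n := ⟨hpT.1.2, by simpa using hn⟩
    have h2 := hp ⟨hpT.1.1, mem_univ _⟩ n (by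
      rw [indicator_of_mem hmem]
      exact one_ne_zero)
    exact (integrable_indicator_iff (hm p)).1 h2
  · obtain ⟨-, h1, h2⟩ := key g hg
    obtain ⟨R, hR⟩ := hg.support
    rw [integrable_radialMeasure_prod_iff] at h1
    rw [integral_radialMeasure_prod] at h2
    have h3 : ∀ p : ℝ × E3, p.1 ^ 2 * ((∫ q, (sphereDirections .upper p.1 p.2 ×ˢ univ).indicator
        (fun q => H (-(p.1 • (q.1 : E3)), (p.2 + p.1 • (q.1 : E3), q.2))) q
          ∂(sphereMeasure.prod νV)) * g p) = sphereRetarded νV H p * g p := by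
      intro p
      rw [integral_indicator (hm p), ← mul_assoc]
      rfl
    simp only [h3] at h1 h2
    have hsub : Ioo (0 : ℝ) T ×ˢ (univ : Set E3) ⊆ Ioi 0 ×ˢ univ :=
      prod_mono Ioo_subset_Ioi_self subset_rfl
    refine ⟨h1.mono_set hsub, ?_⟩
    have h5 : ∫ p in Ioo 0 T ×ˢ univ, sphereRetarded νV H p * g p =
        ∫ p in Ioi 0 ×ˢ univ, sphereRetarded νV H p * g p :=
      (setIntegral_eq_of_subset_of_forall_sdiff_eq_zero
        (measurableSet_Ioi.prod MeasurableSet.univ) hsub (fun p hp => by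
          by_cases hg0 : g p = 0
          · rw [hg0, mul_zero]
          · exact absurd ⟨⟨hp.1.1, (hR p hg0).1⟩, mem_univ _⟩ hp.2)).symm
    rw [h5, h2, integral_indicator hms, ← hμ]
    rfl

end

/-! ### The terms of the representation formulas as dual fields -/

/-- Kernels `k(ω, v)` of growth at most `⟨v⟩` in the velocity. -/
structure IsVelocityKernel (k : E3 → E3 → ℝ) : Prop where
  measurable : Measurable fun p : E3 × E3 => k p.1 p.2
  bound : ∃ C, ∀ om v, ‖om‖ ≤ 1 → |k om v| ≤ C * bracket v

/-- Densities `h` on a space of points with position `pos` and velocity `vel`, for which `⟨v⟩ h` is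
locally integrable in the position. -/
structure IsLocalDensity {N : Type*} [MeasurableSpace N] (ν : Measure N) (pos vel : N → E3)
    (h : N → ℝ) : Prop where
  measurable_pos : Measurable pos
  measurable_vel : Measurable vel
  aestronglyMeasurable : AEStronglyMeasurable h ν
  integrableOn : ∀ R, IntegrableOn (fun n => bracket (vel n) * h n) {n | ‖pos n‖ < R} ν

/-- The kernel `k(-z/|z|, v) h / |z|^m`. -/
def velKernel {N : Type*} (k : E3 → E3 → ℝ) (m : ℕ) (vel : N → E3) (h : N → ℝ) (p : E3 × N) : ℝ :=
  k (back p.1) (vel p.2) * h p.2 * (‖p.1‖ ^ m)⁻¹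

lemma isConeKernel_velKernel {N : Type*} [MeasurableSpace N] {ν : Measure N} [SFinite ν]
    {τ : N → ℝ} {pos vel : N → E3} {h : N → ℝ} {k : E3 → E3 → ℝ} {m : ℕ} (hm : m ≤ 2)
    (hk : IsVelocityKernel k) (hh : IsLocalDensity ν pos vel h) (hτ : Measurable τ)
    (hτ0 : ∀ᵐ n ∂ν, 0 ≤ τ n) : IsConeKernel ν τ pos (velKernel k m vel h) where
  measurable_time := hτ
  measurable_pos := hh.measurable_pos
  nonneg := hτ0
  aestronglyMeasurable := by
    have h1 : Measurable fun p : E3 × N => k (back p.1) (vel p.2) :=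
      hk.measurable.comp (f := fun p : E3 × N => (back p.1, vel p.2))
        ((measurable_back.comp measurable_fst).prodMk (hh.measurable_vel.comp measurable_snd))
    have h2 : Measurable fun p : E3 × N => (‖p.1‖ ^ m)⁻¹ := by fun_prop
    exact (h1.aestronglyMeasurable.mul hh.aestronglyMeasurable.comp_snd).mul h2.aestronglyMeasurable
  bound := by
    obtain ⟨C, hC⟩ := hk.bound
    refine ⟨fun n => |C| * |bracket (vel n) * h n|,
      fun R => ((hh.integrableOn R).abs).const_mul _, Filter.Eventually.of_forall fun p => ?_⟩
    unfold velKernel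
    rw [abs_mul, abs_mul, abs_of_nonneg (by positivity : 0 ≤ (‖p.1‖ ^ m)⁻¹)]
    refine mul_le_mul ?_ (inv_pow_le_inv_sq_add_one _ hm) (by positivity)
      (by positivity)
    simp only [abs_mul, abs_of_pos (bracket_pos (vel p.2)), ← mul_assoc]
    exact mul_le_mul_of_nonneg_right ((hC _ _ (norm_back_le_one _)).trans
      (mul_le_mul_of_nonneg_right (le_abs_self C) (bracket_pos _).le)) (abs_nonneg _)

lemma IsDual.congr {T : ℝ} {X Y : ℝ × E3 → ℝ} {A : (ℝ × E3 → ℝ) → ℝ} (h : IsDual T X A)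
    (hXY : ∀ᵐ p ∂((volume : Measure (ℝ × E3)).restrict (Ioo 0 T ×ˢ univ)), X p = Y p) :
    IsDual T Y A := by
  intro g hg
  obtain ⟨h1, h2⟩ := h g hg
  have h3 : (fun p => X p * g p) =ᵐ[(volume : Measure (ℝ × E3)).restrict (Ioo 0 T ×ˢ univ)]
      fun p => Y p * g p := hXY.mono fun p hp => by simp only [hp]
  exact ⟨h1.congr_fun_ae h3, by rw [← h2, integral_congr_ae h3]⟩

section

variable {T : ℝ} {k : E3 → E3 → ℝ} {h : ℝ × E3 × E3 → ℝ}

/-- The measure on phase space-time. -/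
lemma volume_restrict_phaseTime (T : ℝ) : (volume : Measure (ℝ × E3 × E3)).restrict (phaseTime T) =
    (volume.restrict (Ioo 0 T)).prod ((volume.restrict Ω).prod volume) := by
  rw [phaseTime, Measure.volume_eq_prod, Measure.volume_eq_prod, ← Measure.prod_restrict,
    ← Measure.prod_restrict, Measure.restrict_univ]

lemma bulk_duality {m : ℕ} (hm : m ≤ 2) (hk : IsVelocityKernel k)
    (hh : IsLocalDensity (volume.restrict (phaseTime T)) (fun n => n.2.1) (fun n => n.2.2) h) :
    (∀ᵐ p ∂((volume : Measure (ℝ × E3)).restrict (Ioo 0 T ×ˢ univ)),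
      BulkConverges .upper k m h p.1 p.2) ∧
    IsDual T (fun p => bulkTerm .upper k m h p.1 p.2)
      (conePairing (volume.restrict (phaseTime T)) Prod.fst (fun n => n.2.1)
        (velKernel k m (fun n => n.2.2) h)) := by
  have hτ0 : ∀ᵐ n ∂((volume : Measure (ℝ × E3 × E3)).restrict (phaseTime T)), 0 ≤ n.1 := by
    filter_upwards [ae_restrict_mem (measurableSet_Ioo.prod
      (measurableSet_Ω.prod MeasurableSet.univ))] with n hn
    exact hn.1.1.le
  have hH := isConeKernel_velKernel (τ := Prod.fst) hm hk hh measurable_fst hτ0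
  rw [volume_restrict_phaseTime] at hH ⊢
  obtain ⟨h1, h2⟩ := retarded_duality (pos := Prod.fst) measurable_fst hH
  have hset : ∀ p : ℝ × E3, {q : E3 × E3 | ‖p.2 - q.1‖ < p.1} = Metric.ball p.2 p.1 ×ˢ univ := by
    intro p
    ext q
    simp [dist_eq_norm, norm_sub_rev]
  have hmeas : ∀ p : ℝ × E3, ((volume.restrict Ω).prod (volume : Measure E3)).restrict
      (Metric.ball p.2 p.1 ×ˢ univ) =
      volume.restrict ((Metric.ball p.2 p.1 ∩ Side.upper.halfSpace) ×ˢ univ) := by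
    intro p
    rw [← Measure.prod_restrict, Measure.restrict_restrict Metric.isOpen_ball.measurableSet,
      Measure.prod_restrict]
    rfl
  have hint : ∀ (p : ℝ × E3) (q : E3 × E3),
      velKernel k m (fun n : ℝ × E3 × E3 => n.2.2) h (p.2 - q.1, (p.1 - ‖p.2 - q.1‖, q)) =
        bulkIntegrand .upper k m h p.1 p.2 q := by
    intro p q
    simp only [velKernel, bulkIntegrand, Side.map, dir_eq_back, norm_sub_rev q.1 p.2]
    rw [div_eq_mul_inv]
  simp only [IntegrableOn, hset, hmeas, hint] at h1
  refine ⟨h1, h2.congr ?_⟩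
  filter_upwards [h1] with p hp
  simp only [retarded, hset, hmeas, hint]
  rw [Measure.volume_eq_prod] at hp ⊢
  rw [setIntegral_prod _ hp, bulkTerm]
  simp only [Measure.restrict_univ]

lemma plane_duality (hk : IsVelocityKernel k)
    (hh : IsLocalDensity ((volume.restrict (Ioo 0 T)).prod (volume : Measure (E2 × E3)))
      (fun n => planePoint n.2.1) (fun n => n.2.2) fun n => h (n.1, planePoint n.2.1, n.2.2)) :
    (∀ᵐ p ∂((volume : Measure (ℝ × E3)).restrict (Ioo 0 T ×ˢ univ)),
      PlaneConverges .upper k h p.1 p.2) ∧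
    IsDual T (fun p => planeTerm .upper k h p.1 p.2)
      (conePairing ((volume.restrict (Ioo 0 T)).prod (volume : Measure (E2 × E3))) Prod.fst
        (fun n => planePoint n.2.1)
        (velKernel k 1 (fun n => n.2.2) fun n => h (n.1, planePoint n.2.1, n.2.2))) := by
  have hτ0 : ∀ᵐ n ∂((volume.restrict (Ioo 0 T)).prod (volume : Measure (E2 × E3))), 0 ≤ n.1 := by
    refine Measure.quasiMeasurePreserving_fst.ae (p := fun t => 0 ≤ t) ?_
    filter_upwards [ae_restrict_mem measurableSet_Ioo] with t ht using ht.1.le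
  have hH := isConeKernel_velKernel (τ := Prod.fst) (m := 1) (by norm_num) hk hh measurable_fst hτ0
  obtain ⟨h1, h2⟩ := retarded_duality (pos := fun q : E2 × E3 => planePoint q.1)
    (continuous_planePoint.measurable.comp measurable_fst) hH
  have hset : ∀ p : ℝ × E3, {q : E2 × E3 | ‖p.2 - planePoint q.1‖ < p.1} =
      disc p.1 p.2 ×ˢ univ := by
    intro p
    ext q
    simp [disc, dist_eq_norm, norm_sub_rev]
  have hint : ∀ (p : ℝ × E3) (q : E2 × E3),
      velKernel k 1 (fun n : ℝ × E2 × E3 => n.2.2) (fun n => h (n.1, planePoint n.2.1, n.2.2))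
        (p.2 - planePoint q.1, (p.1 - ‖p.2 - planePoint q.1‖, q)) =
        planeIntegrand .upper k h p.1 p.2 q := by
    intro p q
    simp only [velKernel, planeIntegrand, Side.map, dir_eq_back, norm_sub_rev (planePoint q.1) p.2]
    rw [div_eq_mul_inv, pow_one]
  simp only [IntegrableOn, hset, hint] at h1
  refine ⟨h1, h2.congr ?_⟩
  filter_upwards [h1] with p hp
  simp only [retarded, hset, hint]
  rw [Measure.volume_eq_prod] at hp ⊢
  rw [setIntegral_prod _ hp, planeTerm]
  simp only [Measure.restrict_univ]

lemma initial_duality (hk : IsVelocityKernel k)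
    (hh : IsLocalDensity ((volume.restrict Ω).prod (volume : Measure E3))
      Prod.fst Prod.snd fun n => h (0, n.1, n.2)) :
    (∀ᵐ p ∂((volume : Measure (ℝ × E3)).restrict (Ioo 0 T ×ˢ univ)),
      InitialConverges .upper k h p.1 p.2) ∧
    IsDual T (fun p => initialTerm .upper k h p.1 p.2)
      (conePairing ((volume.restrict Ω).prod (volume : Measure E3)) (fun _ => 0) Prod.fst
        (velKernel k 1 Prod.snd fun n => h (0, n.1, n.2))) := by
  have hH := isConeKernel_velKernel (τ := fun _ => (0 : ℝ)) (m := 1) (by norm_num) hk hh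
    measurable_const (Filter.Eventually.of_forall fun _ => le_rfl)
  obtain ⟨h1, h2⟩ := sphereRetarded_duality (T := T) hH
  have hint : ∀ (p : ℝ × E3) (q : Metric.sphere (0 : E3) 1 × E3),
      velKernel k 1 Prod.snd (fun n : E3 × E3 => h (0, n.1, n.2))
        (-(p.1 • (q.1 : E3)), (p.2 + p.1 • (q.1 : E3), q.2)) =
        initialIntegrand .upper k h p.2 (p.2 + p.1 • (q.1 : E3), q.2) := by
    intro p q
    have e1 : p.2 - (p.2 + p.1 • (q.1 : E3)) = -(p.1 • (q.1 : E3)) := by abel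
    have e2 : p.2 + p.1 • (q.1 : E3) - p.2 = p.1 • (q.1 : E3) := by abel
    simp only [velKernel, initialIntegrand, Side.map, dir_eq_back, e1, e2, norm_neg]
    rw [div_eq_mul_inv, pow_one]
  have hmeas : ∀ p : ℝ × E3, (sphereMeasure.prod (volume : Measure E3)).restrict
      (sphereDirections .upper p.1 p.2 ×ˢ univ) =
      (sphereMeasure.restrict (sphereDirections .upper p.1 p.2)).prod volume := by
    intro p
    rw [← Measure.prod_restrict, Measure.restrict_univ]
  simp only [IntegrableOn, hmeas, hint] at h1
  refine ⟨h1, h2.congr ?_⟩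
  filter_upwards [h1] with p hp
  simp only [sphereRetarded, hmeas, hint]
  rw [integral_prod _ hp, initialTerm, sphereIntegral]

/-- The kernel of the Kirchhoff formula. The initial data of the fields do not depend on a velocity,
so that a one-point space takes the place of velocity space. -/
def kirchhoffKernel (u₀ u₁ : E3 → ℝ) (p : E3 × (E3 × Unit)) : ℝ :=
  (4 * Real.pi)⁻¹ * (‖p.1‖ ^ 2)⁻¹ * (‖p.1‖ * u₁ p.2.1 + u₀ p.2.1 - fderiv ℝ u₀ p.2.1 p.1)

lemma kirchhoff_duality {u₀ u₁ : E3 → ℝ}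
    (hH : IsConeKernel ((volume.restrict Ω).prod (Measure.dirac ())) (fun _ => 0) Prod.fst
      (kirchhoffKernel u₀ u₁)) :
    (∀ᵐ p ∂((volume : Measure (ℝ × E3)).restrict (Ioo 0 T ×ˢ univ)),
      KirchhoffConverges .upper u₀ u₁ p.1 p.2) ∧
    IsDual T (fun p => kirchhoffTerm .upper u₀ u₁ p.1 p.2)
      (conePairing ((volume.restrict Ω).prod (Measure.dirac ())) (fun _ => 0) Prod.fst
        (kirchhoffKernel u₀ u₁)) := by
  obtain ⟨h1, h2⟩ := sphereRetarded_duality (T := T) hH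
  have hpos : ∀ᵐ p ∂((volume : Measure (ℝ × E3)).restrict (Ioo 0 T ×ˢ univ)), 0 < p.1 := by
    filter_upwards [ae_restrict_mem (measurableSet_Ioo.prod MeasurableSet.univ)] with p hp
    exact hp.1.1
  have hint : ∀ (p : ℝ × E3), 0 < p.1 → ∀ (w : Metric.sphere (0 : E3) 1),
      kirchhoffKernel u₀ u₁ (-(p.1 • (w : E3)), (p.2 + p.1 • (w : E3), ())) =
        1 / (4 * Real.pi * p.1 ^ 2) *
          kirchhoffIntegrand .upper u₀ u₁ p.1 p.2 (p.2 + p.1 • (w : E3)) := by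
    intro p hp w
    have e2 : p.2 + p.1 • (w : E3) - p.2 = p.1 • (w : E3) := by abel
    have e3 : ‖-(p.1 • (w : E3))‖ = p.1 := by
      rw [norm_neg, norm_smul, Real.norm_of_nonneg hp.le]
      simp
    simp only [kirchhoffKernel, kirchhoffIntegrand, Side.map, e2, e3, map_neg]
    rw [one_div, mul_inv (4 * Real.pi) (p.1 ^ 2), sub_neg_eq_add]
  have hmeas : ∀ p : ℝ × E3, (sphereMeasure.prod (Measure.dirac ())).restrict
      (sphereDirections .upper p.1 p.2 ×ˢ univ) =
      (sphereMeasure.restrict (sphereDirections .upper p.1 p.2)).map fun w => (w, ()) := by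
    intro p
    rw [← Measure.prod_restrict, Measure.restrict_univ, Measure.prod_dirac]
  simp only [IntegrableOn, hmeas, (measurableEmbedding_prod_mk_right ()).integrable_map_iff] at h1
  refine ⟨?_, h2.congr ?_⟩
  · filter_upwards [h1, hpos] with p hp hp0
    have h3 : Integrable (fun w : Metric.sphere (0 : E3) 1 => 1 / (4 * Real.pi * p.1 ^ 2) *
        kirchhoffIntegrand .upper u₀ u₁ p.1 p.2 (p.2 + p.1 • (w : E3)))
        (sphereMeasure.restrict (sphereDirections .upper p.1 p.2)) := by
      refine hp.congr (Filter.Eventually.of_forall fun w => ?_)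
      exact hint p hp0 w
    have h4 : (1 / (4 * Real.pi * p.1 ^ 2)) ≠ 0 := by positivity
    exact (integrable_const_mul_iff (IsUnit.mk0 _ h4) _).1 h3
  · filter_upwards [hpos] with p hp0
    simp only [sphereRetarded, hmeas]
    rw [(measurableEmbedding_prod_mk_right ()).integral_map]
    simp only [hint p hp0]
    rw [integral_const_mul, kirchhoffTerm, sphereIntegral]
    ring

end

/-! ### Integrability of the particle density and its derivatives -/

lemma norm_planePoint (w : E2) : ‖planePoint w‖ = ‖w‖ := by
  rw [EuclideanSpace.norm_eq, EuclideanSpace.norm_eq]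
  simp [Fin.sum_univ_three, Fin.sum_univ_two, planePoint]

lemma planePoint_mem_Ωbar (w : E2) : planePoint w ∈ Ωbar := by
  simp [Ωbar, planePoint]

lemma Ω_subset_Ωbar : Ω ⊆ Ωbar := fun y hy => by
  have : 0 < y 2 := hy
  exact this.le

lemma IsLocalDensity.integrable_mul {N : Type*} [MeasurableSpace N] {ν : Measure N}
    {pos vel : N → E3} {h : N → ℝ} (hh : IsLocalDensity ν pos vel h) {k g : N → ℝ}
    (hk : Measurable k) {C : ℝ} (hkC : ∀ n, |k n| ≤ C * bracket (vel n)) (hg : Measurable g)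
    {M : ℝ} (hgM : ∀ n, |g n| ≤ M) {R : ℝ} (hgR : ∀ n, g n ≠ 0 → ‖pos n‖ < R) :
    Integrable (fun n => h n * g n * k n) ν := by
  have hS : MeasurableSet {n | ‖pos n‖ < R} :=
    measurableSet_lt hh.measurable_pos.norm measurable_const
  have h1 : Integrable ({n | ‖pos n‖ < R}.indicator
      fun n => C * M * |bracket (vel n) * h n|) ν :=
    (integrable_indicator_iff hS).2 (((hh.integrableOn R).abs).const_mul _)
  refine h1.mono' ((hh.aestronglyMeasurable.mul hg.aestronglyMeasurable).mul
    hk.aestronglyMeasurable) (Filter.Eventually.of_forall fun n => ?_)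
  by_cases hz : g n = 0
  · have hC : 0 ≤ C := by
      by_contra! hneg
      have h2 := hkC n
      have h3 := bracket_pos (vel n)
      nlinarith [abs_nonneg (k n)]
    have hM : 0 ≤ M := (abs_nonneg _).trans (hgM n)
    rw [hz, mul_zero, zero_mul, norm_zero]
    exact indicator_nonneg (fun _ _ => by positivity) _
  · rw [indicator_of_mem (by exact hgR n hz), Real.norm_eq_abs, abs_mul, abs_mul, abs_mul,
      abs_of_pos (bracket_pos _)]
    have h2 := mul_le_mul (hgM n) (hkC n) (abs_nonneg _) ((abs_nonneg _).trans (hgM n))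
    have h3 := mul_le_mul_of_nonneg_left h2 (abs_nonneg (h n))
    calc |h n| * |g n| * |k n| = |h n| * (|g n| * |k n|) := by ring
      _ ≤ _ := h3
      _ = _ := by ring

namespace IsDensity

variable {T : ℝ} {f ft : ℝ × E3 × E3 → ℝ} {fx : ℝ × E3 × E3 → E3}

/-- The decay assumption bounds `⟨v⟩ f` by an integrable function of the velocity. -/
lemma exists_bound (hf : IsDensity T f ft fx) : ∃ b : E3 → ℝ, Integrable b ∧ (∀ v, 0 ≤ b v) ∧
    ∀ᵐ v : E3, ∀ t ∈ Ico 0 T, ∀ x ∈ Ωbar, bracket v * |f (t, x, v)| ≤ b v := by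
  obtain ⟨δ, hδ, C, hC⟩ := hf.decay
  refine ⟨fun v => |C| * bracket v ^ (-(3 + δ)), (integrable_bracket_rpow hδ).const_mul _,
    fun v => mul_nonneg (abs_nonneg _) (Real.rpow_nonneg (bracket_pos v).le _), ?_⟩
  filter_upwards [hC] with v hv t ht x hx
  have h1 := (hv t ht x hx).trans (le_abs_self C)
  have hb := bracket_pos v
  have h2 : bracket v ^ (4 + δ) = bracket v * bracket v ^ (3 + δ) := by
    rw [show (4 : ℝ) + δ = 1 + (3 + δ) by ring, Real.rpow_add hb, Real.rpow_one]
  have h3 : 0 < bracket v ^ (3 + δ) := Real.rpow_pos_of_pos hb _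
  rw [h2] at h1
  rw [Real.rpow_neg hb.le, ← div_eq_mul_inv, le_div_iff₀ h3]
  linarith

/-- The restriction of `f` to a family of positions in the closed half space. -/
lemma isLocalDensity (hf : IsDensity T f ft fx) {Y : Type*} [MeasurableSpace Y] {μ : Measure Y}
    [SFinite μ] {pos : Y → E3} (hpos : Measurable pos) (hμ : ∀ R, μ {y | ‖pos y‖ < R} < ⊤)
    (hΩ : ∀ᵐ y ∂μ, pos y ∈ Ωbar) :
    IsLocalDensity ((volume.restrict (Ioo 0 T)).prod (μ.prod (volume : Measure E3)))
      (fun n => pos n.2.1) (fun n => n.2.2) (fun n => f (n.1, pos n.2.1, n.2.2)) where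
  measurable_pos := by fun_prop
  measurable_vel := by fun_prop
  aestronglyMeasurable := (hf.measurable.comp (by fun_prop)).aestronglyMeasurable
  integrableOn R := by
    obtain ⟨b, hb, hb0, hfb⟩ := hf.exists_bound
    have hset : {n : ℝ × Y × E3 | ‖pos n.2.1‖ < R} = univ ×ˢ ({y | ‖pos y‖ < R} ×ˢ univ) := by
      ext n
      simp
    have hfin : IsFiniteMeasure (μ.restrict {y | ‖pos y‖ < R}) :=
      ⟨by simpa using hμ R⟩
    have h1 : Integrable (fun n : ℝ × Y × E3 => b n.2.2) ((volume.restrict (Ioo 0 T)).prod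
        ((μ.restrict {y | ‖pos y‖ < R}).prod (volume : Measure E3))) :=
      (hb.comp_snd _).comp_snd _
    have hm := hf.measurable
    have hbr := continuous_bracket.measurable
    rw [hset, IntegrableOn, ← Measure.prod_restrict, ← Measure.prod_restrict, Measure.restrict_univ,
      Measure.restrict_univ]
    refine h1.mono' (by fun_prop) ?_
    have a1 : ∀ᵐ n ∂((volume.restrict (Ioo 0 T)).prod
        ((μ.restrict {y | ‖pos y‖ < R}).prod (volume : Measure E3))), n.1 ∈ Ioo 0 T :=
      Measure.quasiMeasurePreserving_fst.ae (p := fun t => t ∈ Ioo 0 T)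
        (ae_restrict_mem measurableSet_Ioo)
    have a2 : ∀ᵐ n ∂((volume.restrict (Ioo 0 T)).prod
        ((μ.restrict {y | ‖pos y‖ < R}).prod (volume : Measure E3))), pos n.2.1 ∈ Ωbar :=
      Measure.quasiMeasurePreserving_snd.ae (p := fun q : Y × E3 => pos q.1 ∈ Ωbar)
        (Measure.quasiMeasurePreserving_fst.ae (p := fun y => pos y ∈ Ωbar)
          (ae_restrict_of_ae hΩ))
    have a3 := (Measure.quasiMeasurePreserving_snd (μ := volume.restrict (Ioo 0 T))).ae
      ((Measure.quasiMeasurePreserving_snd (μ := μ.restrict {y | ‖pos y‖ < R})).ae hfb)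
    filter_upwards [a1, a2, a3] with n h1 h2 h3
    rw [norm_mul, Real.norm_of_nonneg (bracket_pos _).le]
    exact h3 _ ⟨h1.1.le, h1.2⟩ _ h2

lemma isLocalDensity_phase (hf : IsDensity T f ft fx) :
    IsLocalDensity (volume.restrict (phaseTime T)) (fun n => n.2.1) (fun n => n.2.2) f := by
  rw [volume_restrict_phaseTime]
  refine hf.isLocalDensity measurable_id (fun R => ?_) ?_
  · refine (Measure.restrict_apply_le _ _).trans_lt ?_
    have : {y : E3 | ‖id y‖ < R} = Metric.ball 0 R := by
      ext
      simp
    rw [this]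
    exact measure_ball_lt_top
  · filter_upwards [ae_restrict_mem measurableSet_Ω] with y hy using Ω_subset_Ωbar hy

lemma isLocalDensity_plane (hf : IsDensity T f ft fx) :
    IsLocalDensity ((volume.restrict (Ioo 0 T)).prod (volume : Measure (E2 × E3)))
      (fun n => planePoint n.2.1) (fun n => n.2.2) fun n => f (n.1, planePoint n.2.1, n.2.2) := by
  refine hf.isLocalDensity continuous_planePoint.measurable (fun R => ?_)
    (Filter.Eventually.of_forall planePoint_mem_Ωbar)
  have : {y : E2 | ‖planePoint y‖ < R} = Metric.ball 0 R := by
    ext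
    simp [norm_planePoint]
  rw [this]
  exact measure_ball_lt_top

lemma isLocalDensity_initial (hf : IsDensity T f ft fx) (hT : 0 < T) :
    IsLocalDensity ((volume.restrict Ω).prod (volume : Measure E3))
      Prod.fst Prod.snd fun n => f (0, n.1, n.2) where
  measurable_pos := by fun_prop
  measurable_vel := by fun_prop
  aestronglyMeasurable := (hf.measurable.comp (by fun_prop)).aestronglyMeasurable
  integrableOn R := by
    obtain ⟨b, hb, hb0, hfb⟩ := hf.exists_bound
    have hset : {n : E3 × E3 | ‖n.1‖ < R} = Metric.ball 0 R ×ˢ univ := by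
      ext n
      simp
    have hfin : IsFiniteMeasure (((volume : Measure E3).restrict Ω).restrict (Metric.ball 0 R)) :=
      ⟨by
        rw [Measure.restrict_apply_univ]
        exact (Measure.restrict_apply_le _ _).trans_lt measure_ball_lt_top⟩
    have h1 : Integrable (fun n : E3 × E3 => b n.2)
        (((volume.restrict Ω).restrict (Metric.ball 0 R)).prod (volume : Measure E3)) :=
      hb.comp_snd _
    have hm := hf.measurable
    have hbr := continuous_bracket.measurable
    rw [hset, IntegrableOn, ← Measure.prod_restrict, Measure.restrict_univ]
    refine h1.mono' (by fun_prop) ?_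
    have a2 : ∀ᵐ n ∂(((volume.restrict Ω).restrict (Metric.ball 0 R)).prod (volume : Measure E3)),
        n.1 ∈ Ω :=
      Measure.quasiMeasurePreserving_fst.ae (p := fun y => y ∈ Ω)
          (ae_restrict_of_ae (ae_restrict_mem measurableSet_Ω))
    have a3 := (Measure.quasiMeasurePreserving_snd
      (μ := ((volume : Measure E3).restrict Ω).restrict (Metric.ball 0 R))).ae hfb
    filter_upwards [a2, a3] with n h2 h3
    rw [norm_mul, Real.norm_of_nonneg (bracket_pos _).le]
    exact h3 _ ⟨le_rfl, hT⟩ _ (Ω_subset_Ωbar h2)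

/-- First order derivatives of `f` with bounded coefficients. -/
lemma isLocalDensity_deriv (hf : IsDensity T f ft fx) {c0 : E3 → ℝ} {c : E3 → E3}
    (hc0 : Continuous c0) (hc : Continuous c) (hc0b : ∀ v, |c0 v| ≤ 1) (hcb : ∀ v, ‖c v‖ ≤ 1) :
    IsLocalDensity (volume.restrict (phaseTime T)) (fun n => n.2.1) (fun n => n.2.2)
      fun n => c0 n.2.2 * ft n + inner ℝ (c n.2.2) (fx n) := by
  have hopen : MeasurableSet (phaseTime T) :=
    measurableSet_Ioo.prod (measurableSet_Ω.prod MeasurableSet.univ)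
  have mt : AEStronglyMeasurable ft (volume.restrict (phaseTime T)) :=
    hf.weak_t.2.1.aestronglyMeasurable
  have mx : AEStronglyMeasurable fx (volume.restrict (phaseTime T)) := by
    have h1 : ∀ j, AEStronglyMeasurable (fun p => fx p j) (volume.restrict (phaseTime T)) :=
      fun j => (hf.weak_x j).2.1.aestronglyMeasurable
    have h2 : fx = fun p => fx p 0 • e 0 + fx p 1 • e 1 + fx p 2 • e 2 :=
      funext fun p => eq_sum_smul_e _
    rw [h2]
    exact (((h1 0).smul_const _).add ((h1 1).smul_const _)).add ((h1 2).smul_const _)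
  have mc0 : AEStronglyMeasurable (fun n : ℝ × E3 × E3 => c0 n.2.2)
      (volume.restrict (phaseTime T)) := (hc0.comp (by fun_prop)).aestronglyMeasurable
  have mc : AEStronglyMeasurable (fun n : ℝ × E3 × E3 => c n.2.2)
      (volume.restrict (phaseTime T)) := (hc.comp (by fun_prop)).aestronglyMeasurable
  have mb : AEStronglyMeasurable (fun n : ℝ × E3 × E3 => bracket n.2.2)
      (volume.restrict (phaseTime T)) :=
    (continuous_bracket.comp (by fun_prop)).aestronglyMeasurable
  have ms := (mc0.mul mt).add (mc.inner (𝕜 := ℝ) mx)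
  refine ⟨by fun_prop, by fun_prop, ms, fun R => ?_⟩
  have hset : (volume.restrict (phaseTime T)).restrict {n : ℝ × E3 × E3 | ‖n.2.1‖ < R} =
      volume.restrict (Ioo 0 T ×ˢ (Ω ∩ Metric.ball 0 R) ×ˢ univ) := by
    rw [Measure.restrict_restrict (measurableSet_lt (by fun_prop) measurable_const)]
    congr 1
    ext n
    simp only [phaseTime, mem_inter_iff, mem_prod, mem_ofPred_eq, mem_univ, and_true,
      mem_ball_zero_iff]
    tauto
  have i1 := (hf.integrable_t R).norm
  have i2 := (hf.integrable_x R).norm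
  unfold IntegrableOn at i1 i2 ⊢
  rw [← hset] at i1 i2
  refine (i1.add i2).mono' (mb.mul ms).restrict (Filter.Eventually.of_forall fun n => ?_)
  have hb := bracket_pos n.2.2
  simp only [Pi.add_apply, norm_mul, norm_smul, Real.norm_eq_abs, abs_of_pos hb]
  have h1 : |c0 n.2.2 * ft n| ≤ |ft n| := by
    rw [abs_mul]
    exact mul_le_of_le_one_left (abs_nonneg _) (hc0b _)
  have h2 : |inner ℝ (c n.2.2) (fx n)| ≤ ‖fx n‖ :=
    (abs_real_inner_le_norm _ _).trans (mul_le_of_le_one_left (norm_nonneg _) (hcb _))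
  rw [← mul_add]
  exact mul_le_mul_of_nonneg_left ((abs_add_le _ _).trans (add_le_add h1 h2)) hb.le

end IsDensity

/-! ### Boundary layers -/

/-- The derivative of the cutoff `s ↦ smoothTransition (n s - 1)`, an approximate identity at `0⁺`. -/
def layer (n : ℕ) (s : ℝ) : ℝ := n * deriv Real.smoothTransition (n * s - 1)

lemma differentiable_smoothTransition : Differentiable ℝ Real.smoothTransition :=
  (Real.smoothTransition.contDiff (n := 1)).differentiable (by simp)

lemma hasDerivAt_cutoff (n : ℕ) (s : ℝ) :
    HasDerivAt (fun s : ℝ => Real.smoothTransition (n * s - 1)) (layer n s) s := by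
  have h1 : HasDerivAt (fun s : ℝ => n * s - 1) n s := by
    simpa using ((hasDerivAt_id s).const_mul (n : ℝ)).sub_const 1
  have h2 := (differentiable_smoothTransition (n * s - 1)).hasDerivAt.comp s h1
  refine h2.congr_deriv ?_
  rw [layer, mul_comm]

lemma continuous_layer (n : ℕ) : Continuous (layer n) := by
  have h : Continuous (deriv Real.smoothTransition) :=
    (Real.smoothTransition.contDiff (n := 1)).continuous_deriv (by simp)
  exact continuous_const.mul (h.comp (by fun_prop))

lemma layer_nonneg (n : ℕ) (s : ℝ) : 0 ≤ layer n s :=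
  mul_nonneg (Nat.cast_nonneg n) (Real.smoothTransition.monotone.deriv_nonneg)

lemma layer_eq_zero {n : ℕ} {s : ℝ} (h : 2 < n * s) : layer n s = 0 := by
  have h1 : Real.smoothTransition =ᶠ[𝓝 (n * s - 1)] fun _ => 1 := by
    filter_upwards [lt_mem_nhds (show (1 : ℝ) < n * s - 1 by linarith)] with r hr
    exact Real.smoothTransition.one_of_one_le hr.le
  rw [layer, h1.deriv_eq]
  simp

lemma tendsto_cutoff {s : ℝ} (hs : 0 < s) :
    ∀ᶠ n : ℕ in atTop, Real.smoothTransition (n * s - 1) = 1 := by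
  obtain ⟨N, hN⟩ := exists_nat_gt (2 / s)
  filter_upwards [eventually_ge_atTop N] with n hn
  refine Real.smoothTransition.one_of_one_le ?_
  have h1 : 2 / s < n := hN.trans_le (by exact_mod_cast hn)
  rw [div_lt_iff₀ hs] at h1
  linarith

lemma integral_layer {n : ℕ} (hn : 0 < n) :
    IntegrableOn (layer n) (Ioi 0) ∧ ∫ s in Ioi 0, layer n s = 1 := by
  have hn' : (0 : ℝ) < n := by exact_mod_cast hn
  have hlim : Tendsto (fun s : ℝ => Real.smoothTransition (n * s - 1)) atTop (𝓝 1) := by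
    refine tendsto_const_nhds.congr' ?_
    filter_upwards [eventually_ge_atTop (2 / (n : ℝ))] with s hs
    refine (Real.smoothTransition.one_of_one_le ?_).symm
    rw [div_le_iff₀ hn'] at hs
    linarith
  have h0 : Real.smoothTransition (n * 0 - 1) = 0 :=
    Real.smoothTransition.zero_of_nonpos (by norm_num)
  have hi := integrableOn_Ioi_deriv_of_nonneg'
    (fun s (_ : s ∈ Ici (0 : ℝ)) => hasDerivAt_cutoff n s) (fun s _ => layer_nonneg n s) hlim
  refine ⟨hi, ?_⟩
  rw [integral_Ioi_of_hasDerivAt_of_tendsto'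
    (fun s (_ : s ∈ Ici (0 : ℝ)) => hasDerivAt_cutoff n s) hi hlim, h0, sub_zero]

/-- The boundary layer `layer n` concentrates at `0⁺`: its integral against `G n` tends to the joint
limit of `G n s` as `n → ∞` and `s → 0⁺`. -/
lemma tendsto_integral_layer_mul {G : ℕ → ℝ → ℝ} {G0 B : ℝ}
    (hint : ∀ n, IntegrableOn (fun s => layer n s * G n s) (Ioi 0))
    (hb : ∀ n, ∀ s > 0, |G n s| ≤ B)
    (hlim : Tendsto (fun p : ℕ × ℝ => G p.1 p.2) (atTop ×ˢ 𝓝[>] 0) (𝓝 G0)) :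
    (∀ n > 0, |∫ s in Ioi 0, layer n s * G n s| ≤ B) ∧
    Tendsto (fun n => ∫ s in Ioi 0, layer n s * G n s) atTop (𝓝 G0) := by
  constructor
  · intro n hn
    obtain ⟨h1, h2⟩ := integral_layer hn
    have h3 := norm_integral_le_of_norm_le (μ := volume.restrict (Ioi 0)) (h1.mul_const B)
      (f := fun s => layer n s * G n s) (by
        filter_upwards [ae_restrict_mem measurableSet_Ioi] with s hs
        rw [norm_mul, Real.norm_of_nonneg (layer_nonneg n s)]
        exact mul_le_mul_of_nonneg_left (hb n s hs) (layer_nonneg n s))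
    rwa [integral_mul_const, h2, one_mul] at h3
  · rw [Metric.tendsto_nhds]
    intro ε hε
    have h0 : ∀ᶠ p : ℕ × ℝ in atTop ×ˢ 𝓝[>] 0, dist (G p.1 p.2) G0 < ε / 2 :=
      (Metric.tendsto_nhds.1 hlim) _ (half_pos hε)
    obtain ⟨pa, hpa, pb, hpb, hp⟩ := eventually_prod_iff.1 h0
    obtain ⟨c, hc, hcb⟩ := mem_nhdsGT_iff_exists_Ioc_subset.1 hpb
    have hc0 : (0 : ℝ) < c := hc
    obtain ⟨N, hN⟩ := exists_nat_gt (2 / c)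
    filter_upwards [hpa, eventually_ge_atTop N, eventually_gt_atTop 0] with n hna hnN hn
    obtain ⟨h1, h2⟩ := integral_layer hn
    have h3 : (∫ s in Ioi 0, layer n s * G n s) - G0 =
        ∫ s in Ioi 0, (layer n s * G n s - layer n s * G0) := by
      rw [integral_sub (hint n) (h1.mul_const G0), integral_mul_const, h2, one_mul]
    have hnc : 2 < n * c := by
      have h4 : 2 / c < n := hN.trans_le (by exact_mod_cast hnN)
      rwa [div_lt_iff₀ hc0] at h4
    have h4 := norm_integral_le_of_norm_le (μ := volume.restrict (Ioi 0)) (h1.mul_const (ε / 2))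
      (f := fun s => layer n s * G n s - layer n s * G0) (by
        filter_upwards [ae_restrict_mem measurableSet_Ioi] with s hs
        rw [← mul_sub, norm_mul, Real.norm_of_nonneg (layer_nonneg n s)]
        by_cases hsc : s ≤ c
        · refine mul_le_mul_of_nonneg_left ?_ (layer_nonneg n s)
          exact (hp hna (hcb ⟨hs, hsc⟩)).le
        · have hn' : (0 : ℝ) < n := by exact_mod_cast hn
          rw [layer_eq_zero (hnc.trans (mul_lt_mul_of_pos_left (not_le.1 hsc) hn'))]
          simp)
    rw [integral_mul_const, h2, one_mul, ← h3] at h4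
    rw [Real.dist_eq]
    exact h4.trans_lt (half_lt_self hε)

/-- Integrals over a boundary layer of width `1/n` converge to the integral of the trace. -/
lemma tendsto_integral_layer {Z : Type*} [MeasurableSpace Z] {ν : Measure Z} [SFinite ν]
    {G : ℕ → ℝ → Z → ℝ} {G0 B : Z → ℝ} (hB : Integrable B ν)
    (hm : ∀ n, AEStronglyMeasurable (fun p : ℝ × Z => G n p.1 p.2)
      ((volume.restrict (Ioi 0)).prod ν))
    (hb : ∀ᵐ ζ ∂ν, ∀ n, ∀ s > 0, |G n s ζ| ≤ B ζ)
    (hlim : ∀ᵐ ζ ∂ν, Tendsto (fun p : ℕ × ℝ => G p.1 p.2 ζ) (atTop ×ˢ 𝓝[>] 0) (𝓝 (G0 ζ))) :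
    Tendsto (fun n => ∫ p, layer n p.1 * G n p.1 p.2 ∂((volume.restrict (Ioi 0)).prod ν)) atTop
      (𝓝 (∫ ζ, G0 ζ ∂ν)) := by
  have hint : ∀ n, Integrable (fun p : ℝ × Z => layer n p.1 * G n p.1 p.2)
      ((volume.restrict (Ioi 0)).prod ν) := by
    intro n
    have h0 : IntegrableOn (layer n) (Ioi 0) := by
      rcases Nat.eq_zero_or_pos n with rfl | hn
      · have : layer 0 = fun _ => 0 := by
          funext s
          simp [layer]
        rw [this]
        exact integrableOn_zero
      · exact (integral_layer hn).1
    refine (h0.mul_prod hB).mono' ?_ ?_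
    · exact ((continuous_layer n).measurable.comp measurable_fst).aestronglyMeasurable.mul (hm n)
    · have a1 : ∀ᵐ p ∂((volume.restrict (Ioi (0 : ℝ))).prod ν), p.1 ∈ Ioi (0 : ℝ) :=
        Measure.quasiMeasurePreserving_fst.ae (p := fun t => t ∈ Ioi (0 : ℝ))
          (ae_restrict_mem measurableSet_Ioi)
      have a2 := (Measure.quasiMeasurePreserving_snd (μ := volume.restrict (Ioi (0 : ℝ)))).ae hb
      filter_upwards [a1, a2] with p h1 h2
      rw [norm_mul, Real.norm_of_nonneg (layer_nonneg n _)]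
      exact mul_le_mul_of_nonneg_left (h2 n _ h1) (layer_nonneg n _)
  have hsec : ∀ᵐ ζ ∂ν, ∀ n, IntegrableOn (fun s => layer n s * G n s ζ) (Ioi 0) := by
    rw [ae_all_iff]
    exact fun n => (hint n).prod_left_ae
  simp only [integral_prod_symm _ (hint _)]
  refine tendsto_integral_filter_of_dominated_convergence B ?_ ?_ hB ?_
  · exact Eventually.of_forall fun n => (hint n).integral_prod_right.aestronglyMeasurable
  · filter_upwards [eventually_gt_atTop 0] with n hn
    filter_upwards [hsec, hb, hlim] with ζ h1 h2 h3
    exact (tendsto_integral_layer_mul h1 h2 h3).1 n hn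
  · filter_upwards [hsec, hb, hlim] with ζ h1 h2 h3
    exact (tendsto_integral_layer_mul h1 h2 h3).2

/-! ### Integration by parts for the particle density -/

/-- A cutoff to bounded velocities. -/
def velCut (n : ℕ) (v : E3) : ℝ := Real.smoothTransition (n - ‖v‖ ^ 2)

/-- A cutoff away from the initial time. -/
def timeCut (n : ℕ) (s : ℝ) : ℝ := Real.smoothTransition (n * s - 1)

lemma velCut_mem (n : ℕ) (v : E3) : |velCut n v| ≤ 1 := by
  rw [velCut, abs_of_nonneg (Real.smoothTransition.nonneg _)]
  exact Real.smoothTransition.le_one _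

lemma timeCut_mem (n : ℕ) (s : ℝ) : |timeCut n s| ≤ 1 := by
  rw [timeCut, abs_of_nonneg (Real.smoothTransition.nonneg _)]
  exact Real.smoothTransition.le_one _

lemma contDiff_velCut (n : ℕ) : ContDiff ℝ ∞ (velCut n) :=
  Real.smoothTransition.contDiff.comp (contDiff_const.sub (contDiff_norm_sq ℝ))

lemma contDiff_timeCut (n : ℕ) : ContDiff ℝ ∞ (timeCut n) :=
  Real.smoothTransition.contDiff.comp ((contDiff_const.mul contDiff_id).sub contDiff_const)

lemma velCut_eventually (v : E3) : ∀ᶠ n : ℕ in atTop, velCut n v = 1 := by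
  obtain ⟨N, hN⟩ := exists_nat_gt (1 + ‖v‖ ^ 2)
  filter_upwards [eventually_ge_atTop N] with n hn
  have : (N : ℝ) ≤ n := by exact_mod_cast hn
  exact Real.smoothTransition.one_of_one_le (by linarith)

/-- The test functions in phase space built from a test function `a` in space-time and a function
`k` of the velocity. They are cut off near `t = 0`, near the boundary plane and at large velocities,
so that their support is a compact subset of `phaseTime T`. -/
def phaseTest (n : ℕ) (k : E3 → ℝ) (a : ℝ × E3 → ℝ) (p : ℝ × E3 × E3) : ℝ :=
  timeCut n p.1 * timeCut n (p.2.1 2) * velCut n p.2.2 * (k p.2.2 * a (p.1, p.2.1))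

lemma contDiff_coord (j : Fin 3) : ContDiff ℝ ∞ fun y : E3 => y j :=
  contDiff_euclidean.1 contDiff_id j

lemma contDiff_phaseTest (n : ℕ) {k : E3 → ℝ} (hk : ContDiff ℝ ∞ k) {a : ℝ × E3 → ℝ}
    (ha : ContDiff ℝ ∞ a) : ContDiff ℝ ∞ (phaseTest n k a) := by
  have h1 : ContDiff ℝ ∞ fun p : ℝ × E3 × E3 => p.2.1 := contDiff_fst.comp contDiff_snd
  have h2 : ContDiff ℝ ∞ fun p : ℝ × E3 × E3 => p.2.2 := contDiff_snd.comp contDiff_snd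
  exact ((((contDiff_timeCut n).comp contDiff_fst).mul
    ((contDiff_timeCut n).comp ((contDiff_coord 2).comp h1))).mul ((contDiff_velCut n).comp h2)).mul
    ((hk.comp h2).mul (ha.comp (contDiff_fst.prodMk h1)))

lemma phaseTest_support {T : ℝ} {n : ℕ} (hn : 0 < n) (k : E3 → ℝ) {a : ℝ × E3 → ℝ}
    (ha : IsTest T a) :
    HasCompactSupport (phaseTest n k a) ∧ tsupport (phaseTest n k a) ⊆ phaseTime T := by
  have hn' : (1 : ℝ) ≤ n := by exact_mod_cast hn
  set K : Set (ℝ × E3 × E3) := {p | 1 ≤ n * p.1 ∧ 1 ≤ n * p.2.1 2 ∧ ‖p.2.2‖ ^ 2 ≤ n ∧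
    (p.1, p.2.1) ∈ tsupport a} with hK
  have hKc : IsClosed K := by
    have c1 : IsClosed {p : ℝ × E3 × E3 | 1 ≤ n * p.1} := isClosed_le (by fun_prop) (by fun_prop)
    have c2 : IsClosed {p : ℝ × E3 × E3 | 1 ≤ n * p.2.1 2} :=
      isClosed_le (by fun_prop) (by fun_prop)
    have c3 : IsClosed {p : ℝ × E3 × E3 | ‖p.2.2‖ ^ 2 ≤ n} :=
      isClosed_le (by fun_prop) (by fun_prop)
    have c4 : IsClosed {p : ℝ × E3 × E3 | (p.1, p.2.1) ∈ tsupport a} :=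
      (isClosed_tsupport a).preimage (by fun_prop)
    exact c1.inter (c2.inter (c3.inter c4))
  have hKK : IsCompact K := by
    have h1 : IsCompact ((fun q : (ℝ × E3) × E3 => (q.1.1, q.1.2, q.2)) ''
        (tsupport a ×ˢ Metric.closedBall (0 : E3) n)) :=
      (ha.2.1.isCompact.prod (isCompact_closedBall _ _)).image (by fun_prop)
    refine h1.of_isClosed_subset hKc ?_
    rintro p ⟨-, -, h3, h4⟩
    refine ⟨((p.1, p.2.1), p.2.2), ⟨h4, ?_⟩, rfl⟩
    rw [mem_closedBall_zero_iff]
    nlinarith [norm_nonneg p.2.2]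
  have hsupp : Function.support (phaseTest n k a) ⊆ K := by
    intro p hp
    have h1 : ∀ x, Real.smoothTransition x ≠ 0 → 0 < x := fun x hx => by
      by_contra! hneg
      exact hx (Real.smoothTransition.zero_of_nonpos hneg)
    have h2 := left_ne_zero_of_mul hp
    have h3 := right_ne_zero_of_mul hp
    have h4 := h1 _ (left_ne_zero_of_mul (left_ne_zero_of_mul h2))
    have h5 := h1 _ (right_ne_zero_of_mul (left_ne_zero_of_mul h2))
    have h6 := h1 _ (right_ne_zero_of_mul h2)
    exact ⟨by linarith, by linarith, by linarith, subset_tsupport _ (right_ne_zero_of_mul h3)⟩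
  refine ⟨HasCompactSupport.of_support_subset_isCompact hKK hsupp,
    (closure_minimal hsupp hKc).trans ?_⟩
  rintro p ⟨h1, h2, -, h4⟩
  have hn0 : (0 : ℝ) < n := by linarith
  refine ⟨⟨?_, (ha.2.2 h4).1⟩, ?_, mem_univ _⟩
  · by_contra! hneg
    nlinarith
  · change 0 < p.2.1 2
    by_contra! hneg
    nlinarith

lemma lineDeriv_phaseTest (n : ℕ) (k : E3 → ℝ) {a : ℝ × E3 → ℝ} (ha : ContDiff ℝ ∞ a) (c : ℝ)
    (w : E3) (p : ℝ × E3 × E3) :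
    lineDeriv ℝ (phaseTest n k a) p (c, w, 0) =
      timeCut n p.1 * timeCut n (p.2.1 2) * velCut n p.2.2 * pd (c, w) a (p.1, p.2.1) * k p.2.2 +
      c * (layer n p.1 * (timeCut n (p.2.1 2) * velCut n p.2.2 * a (p.1, p.2.1) * k p.2.2)) +
      w 2 * (layer n (p.2.1 2) * (timeCut n p.1 * velCut n p.2.2 * a (p.1, p.2.1) * k p.2.2)) := by
  have hcut : ∀ s c : ℝ, HasDerivAt (fun r : ℝ => timeCut n (s + r * c)) (c * layer n s) 0 := by
    intro s c
    have h1 : HasDerivAt (fun r : ℝ => s + r * c) c 0 := by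
      simpa using ((hasDerivAt_id (0 : ℝ)).mul_const c).const_add s
    have h2 : HasDerivAt (timeCut n) (layer n (s + 0 * c)) (s + 0 * c) := hasDerivAt_cutoff n _
    refine (h2.comp (0 : ℝ) h1).congr_deriv ?_
    rw [zero_mul, add_zero, mul_comm]
  have ha' : HasDerivAt (fun r : ℝ => a (p.1 + r * c, p.2.1 + r • w))
      (pd (c, w) a (p.1, p.2.1)) 0 := by
    have h1 : HasDerivAt (fun r : ℝ => (p.1 + r * c, p.2.1 + r • w)) (c, w) 0 := by
      refine HasDerivAt.prodMk ?_ ?_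
      · simpa using ((hasDerivAt_id (0 : ℝ)).mul_const c).const_add p.1
      · simpa using ((hasDerivAt_id (0 : ℝ)).smul_const w).const_add p.2.1
    have h2 : HasFDerivAt a (fderiv ℝ a (p.1 + 0 * c, p.2.1 + (0 : ℝ) • w))
        (p.1 + 0 * c, p.2.1 + (0 : ℝ) • w) := (ha.differentiable (by simp) _).hasFDerivAt
    refine (h2.comp_hasDerivAt (0 : ℝ) h1).congr_deriv ?_
    simp [pd]
  refine HasLineDerivAt.lineDeriv ?_
  unfold HasLineDerivAt
  have h3 : (fun r : ℝ => phaseTest n k a (p + r • (c, w, (0 : E3)))) = fun r : ℝ =>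
      timeCut n (p.1 + r * c) * timeCut n (p.2.1 2 + r * w 2) * velCut n p.2.2 *
        (k p.2.2 * a (p.1 + r * c, p.2.1 + r • w)) := by
    funext r
    simp [phaseTest]
  rw [h3]
  refine ((((hcut p.1 c).mul (hcut (p.2.1 2) (w 2))).mul_const _).mul
    (ha'.const_mul _)).congr_deriv ?_
  simp only [zero_mul, add_zero, zero_smul, Pi.mul_apply]
  ring

section

variable {T : ℝ} {f ft : ℝ × E3 × E3 → ℝ} {fx : ℝ × E3 × E3 → E3}

lemma IsTest.integrable_phase {T : ℝ} {a : ℝ × E3 → ℝ} (ha : IsTest T a) {h : ℝ × E3 × E3 → ℝ}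
    (hh : IsLocalDensity (volume.restrict (phaseTime T)) (fun n => n.2.1) (fun n => n.2.2) h)
    {k : E3 → ℝ} (hk : Continuous k) {C : ℝ} (hkC : ∀ v, |k v| ≤ C * bracket v) :
    Integrable (fun p => h p * a (p.1, p.2.1) * k p.2.2) (volume.restrict (phaseTime T)) := by
  obtain ⟨M, hM⟩ := ha.isWeight.bounded
  obtain ⟨R, hR⟩ := ha.isWeight.support
  have hkm := hk.measurable
  have ham := ha.isWeight.measurable
  exact hh.integrable_mul (k := fun p => k p.2.2) (g := fun p => a (p.1, p.2.1)) (by fun_prop)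
    (fun n => hkC _) (by fun_prop) (fun n => hM _) (fun n hn => (hR _ hn).2)

lemma tendsto_time_layer (hf : IsDensity T f ft fx) {a : ℝ × E3 → ℝ} (ha : IsTest T a)
    (hT : 0 < T) {k : E3 → ℝ} (hk : Continuous k) {C : ℝ} (hkC : ∀ v, |k v| ≤ C * bracket v) :
    Tendsto (fun n : ℕ => ∫ p in phaseTime T, f p * (layer n p.1 *
      (timeCut n (p.2.1 2) * velCut n p.2.2 * a (p.1, p.2.1) * k p.2.2))) atTop
      (𝓝 (∫ q, f (0, q.1, q.2) * a (0, q.1) * k q.2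
        ∂((volume.restrict Ω).prod (volume : Measure E3)))) := by
  obtain ⟨b, hb, hb0, hfb⟩ := hf.exists_bound
  obtain ⟨M, hM⟩ := ha.isWeight.bounded
  obtain ⟨R, hR⟩ := ha.isWeight.support
  have hM0 : 0 ≤ M := (abs_nonneg _).trans (hM 0)
  have hC0 : 0 ≤ C := by
    have h1 := (abs_nonneg _).trans (hkC 0)
    have h2 := bracket_pos 0
    by_contra! hneg
    nlinarith
  have hfin : IsFiniteMeasure (((volume : Measure E3).restrict Ω).restrict (Metric.ball 0 R)) :=
    ⟨by
      rw [Measure.restrict_apply_univ]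
      exact (Measure.restrict_apply_le _ _).trans_lt measure_ball_lt_top⟩
  have hB : Integrable ((Metric.ball (0 : E3) R ×ˢ (univ : Set E3)).indicator
      fun q => C * M * b q.2) ((volume.restrict Ω).prod volume) := by
    rw [integrable_indicator_iff (Metric.isOpen_ball.measurableSet.prod MeasurableSet.univ),
      IntegrableOn, ← Measure.prod_restrict, Measure.restrict_univ]
    exact (hb.comp_snd _).const_mul _
  have hset : ∀ F : ℝ × E3 × E3 → ℝ, (∀ p, F p ≠ 0 → p.1 < T) → ∫ p in phaseTime T, F p =
      ∫ p, F p
        ∂((volume.restrict (Ioi 0)).prod ((volume.restrict Ω).prod (volume : Measure E3))) := by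
    intro F hF
    have h1 : (volume.restrict (Ioi (0 : ℝ))).prod ((volume.restrict Ω).prod (volume : Measure E3)) =
        volume.restrict (Ioi 0 ×ˢ Ω ×ˢ univ) := by
      rw [Measure.volume_eq_prod, Measure.volume_eq_prod, ← Measure.prod_restrict,
        ← Measure.prod_restrict, Measure.restrict_univ]
    rw [h1]
    refine (setIntegral_eq_of_subset_of_forall_sdiff_eq_zero
      (measurableSet_Ioi.prod (measurableSet_Ω.prod MeasurableSet.univ))
      (prod_mono Ioo_subset_Ioi_self subset_rfl) fun p hp => ?_).symm
    by_contra hne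
    exact hp.2 ⟨⟨hp.1.1, hF p hne⟩, hp.1.2⟩
  have hfm := hf.measurable
  have ham := ha.isWeight.measurable
  have hkm := hk.measurable
  have hv : ∀ n, Measurable (velCut n) := fun n => (contDiff_velCut n).continuous.measurable
  have ht : ∀ n, Measurable (timeCut n) := fun n => (contDiff_timeCut n).continuous.measurable
  have key := tendsto_integral_layer (ν := (volume.restrict Ω).prod (volume : Measure E3))
    (G := fun n s q => timeCut n (q.1 2) * velCut n q.2 * (f (s, q.1, q.2) * a (s, q.1) * k q.2))
    (G0 := fun q => f (0, q.1, q.2) * a (0, q.1) * k q.2) hB ?_ ?_ ?_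
  · refine key.congr fun n => ?_
    rw [hset]
    · exact integral_congr_ae (Eventually.of_forall fun p => by simp only; ring)
    · intro p hp
      exact (hR (p.1, p.2.1) fun h0 => hp (by simp [h0])).1
  · exact fun n => Measurable.aestronglyMeasurable (by fun_prop)
  · have a2 : ∀ᵐ q ∂((volume.restrict Ω).prod (volume : Measure E3)), q.1 ∈ Ω :=
      Measure.quasiMeasurePreserving_fst.ae (p := fun y => y ∈ Ω) (ae_restrict_mem measurableSet_Ω)
    have a3 := (Measure.quasiMeasurePreserving_snd (μ := (volume : Measure E3).restrict Ω)).ae hfb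
    filter_upwards [a2, a3] with q hq1 hq2 n s hs
    by_cases h0 : a (s, q.1) = 0
    · simp only [h0, mul_zero, zero_mul, abs_zero]
      exact indicator_nonneg (fun q _ => mul_nonneg (mul_nonneg hC0 hM0) (hb0 q.2)) _
    · have h1 := hR _ h0
      rw [indicator_of_mem (by exact ⟨by simpa using h1.2, mem_univ _⟩)]
      have h2 := hq2 s ⟨hs.le, h1.1⟩ q.1 (Ω_subset_Ωbar hq1)
      have h3 : |timeCut n (q.1 2) * velCut n q.2| ≤ 1 := by
        rw [abs_mul]
        exact mul_le_one₀ (timeCut_mem _ _) (abs_nonneg _) (velCut_mem _ _)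
      calc |timeCut n (q.1 2) * velCut n q.2 * (f (s, q.1, q.2) * a (s, q.1) * k q.2)|
          = |timeCut n (q.1 2) * velCut n q.2| * (|f (s, q.1, q.2)| * |a (s, q.1)| * |k q.2|) := by
            simp only [abs_mul]
        _ ≤ 1 * (|f (s, q.1, q.2)| * M * (C * bracket q.2)) := by
            gcongr
            · exact hM _
            · exact hkC _
        _ = C * M * (bracket q.2 * |f (s, q.1, q.2)|) := by ring
        _ ≤ C * M * b q.2 := mul_le_mul_of_nonneg_left h2 (mul_nonneg hC0 hM0)
  · have a2 : ∀ᵐ q ∂((volume.restrict Ω).prod (volume : Measure E3)), q.1 ∈ Ω :=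
      Measure.quasiMeasurePreserving_fst.ae (p := fun y => y ∈ Ω) (ae_restrict_mem measurableSet_Ω)
    have a3 := (Measure.quasiMeasurePreserving_snd (μ := (volume : Measure E3).restrict Ω)).ae
      hf.continuousOn
    filter_upwards [a2, a3] with q hq1 hq2
    have h1 : ∀ᶠ p : ℕ × ℝ in atTop ×ˢ 𝓝[>] (0 : ℝ), timeCut p.1 (q.1 2) * velCut p.1 q.2 = 1 := by
      have h2 : ∀ᶠ n : ℕ in atTop, timeCut n (q.1 2) * velCut n q.2 = 1 := by
        filter_upwards [tendsto_cutoff (s := q.1 2) hq1, velCut_eventually q.2] with n h2 h3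
        rw [h3, mul_one]
        exact h2
      exact h2.prod_inl _
    have h2 : Tendsto (fun s : ℝ => f (s, q.1, q.2) * a (s, q.1) * k q.2) (𝓝[>] 0)
        (𝓝 (f (0, q.1, q.2) * a (0, q.1) * k q.2)) := by
      have h3 := hq2 (0, q.1) ⟨⟨le_rfl, hT⟩, Ω_subset_Ωbar hq1⟩
      have h4 : Tendsto (fun s : ℝ => (s, q.1)) (𝓝[>] 0) (𝓝[Ico 0 T ×ˢ Ωbar] (0, q.1)) := by
        refine tendsto_nhdsWithin_iff.2 ⟨?_, ?_⟩
        · exact (Continuous.tendsto (by fun_prop) 0).mono_left nhdsWithin_le_nhds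
        · filter_upwards [Ioo_mem_nhdsGT hT] with s hs
          exact ⟨⟨hs.1.le, hs.2⟩, Ω_subset_Ωbar hq1⟩
      have h5 : Tendsto (fun s : ℝ => a (s, q.1)) (𝓝[>] 0) (𝓝 (a (0, q.1))) :=
        (Continuous.tendsto (ha.1.continuous.comp (by fun_prop : Continuous fun s : ℝ => (s, q.1)))
          0).mono_left nhdsWithin_le_nhds
      exact ((h3.tendsto.comp h4).mul h5).mul_const _
    refine (h2.comp tendsto_snd).congr' ?_
    filter_upwards [h1] with p hp
    simp only [Function.comp]
    rw [hp, one_mul]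

end

section

variable {T : ℝ} {f ft : ℝ × E3 × E3 → ℝ} {fx : ℝ × E3 × E3 → E3}

/-- Phase space-time in terms of the height above the boundary plane, and of time, foot point and
velocity. -/
lemma measurePreserving_phase_height (T : ℝ) :
    MeasurePreserving (fun p : ℝ × (ℝ × (E2 × E3)) => (p.2.1, (aboveMap (p.2.2.1, p.1), p.2.2.2)))
      ((volume.restrict (Ioi 0)).prod ((volume.restrict (Ioo 0 T)).prod (volume : Measure (E2 × E3))))
      (volume.restrict (phaseTime T)) := by
  rw [volume_restrict_phaseTime]
  have h1 : MeasurePreserving (fun q : ℝ × (E2 × E3) => (aboveMap (q.2.1, q.1), q.2.2))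
      ((volume.restrict (Ioi 0)).prod (volume : Measure (E2 × E3)))
      ((volume.restrict Ω).prod (volume : Measure E3)) :=
    (measurePreserving_aboveMap_Ω.prod (MeasurePreserving.id volume)).comp
      ((Measure.measurePreserving_swap.prod (MeasurePreserving.id volume)).comp
        (MeasurePreserving.symm _ (measurePreserving_prodAssoc (volume.restrict (Ioi (0 : ℝ)))
          (volume : Measure E2) (volume : Measure E3))))
  have h2 := ((MeasurePreserving.id (volume.restrict (Ioo 0 T))).prod h1).comp
    ((measurePreserving_prodAssoc (volume.restrict (Ioo (0 : ℝ) T)) (volume.restrict (Ioi (0 : ℝ)))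
      (volume : Measure (E2 × E3))).comp
      ((Measure.measurePreserving_swap.prod (MeasurePreserving.id volume)).comp
        (MeasurePreserving.symm _ (measurePreserving_prodAssoc (volume.restrict (Ioi (0 : ℝ)))
          (volume.restrict (Ioo (0 : ℝ) T)) (volume : Measure (E2 × E3))))))
  exact h2

lemma norm_planePoint_le (w : E2) (r : ℝ) : ‖planePoint w‖ ≤ ‖aboveMap (w, r)‖ := by
  rw [EuclideanSpace.norm_eq, EuclideanSpace.norm_eq]
  refine Real.sqrt_le_sqrt ?_
  simp only [Fin.sum_univ_three, aboveMap_zero, aboveMap_one, aboveMap_two]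
  simp only [planePoint]
  simp
  positivity

/-- The boundary layer at the plane `y₃ = 0` tends to the trace of `f` on the plane. -/
lemma tendsto_plane_layer (hf : IsDensity T f ft fx) {a : ℝ × E3 → ℝ} (ha : IsTest T a)
    {k : E3 → ℝ} (hk : Continuous k) {C : ℝ} (hkC : ∀ v, |k v| ≤ C * bracket v) :
    Tendsto (fun n : ℕ => ∫ p in phaseTime T, f p * (layer n (p.2.1 2) *
      (timeCut n p.1 * velCut n p.2.2 * a (p.1, p.2.1) * k p.2.2))) atTop
      (𝓝 (∫ q, f (q.1, planePoint q.2.1, q.2.2) * a (q.1, planePoint q.2.1) * k q.2.2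
        ∂((volume.restrict (Ioo 0 T)).prod (volume : Measure (E2 × E3))))) := by
  obtain ⟨b, hb, hb0, hfb⟩ := hf.exists_bound
  obtain ⟨M, hM⟩ := ha.isWeight.bounded
  obtain ⟨R, hR⟩ := ha.isWeight.support
  have hM0 : 0 ≤ M := (abs_nonneg _).trans (hM 0)
  have hC0 : 0 ≤ C := by
    have h1 := (abs_nonneg _).trans (hkC 0)
    have h2 := bracket_pos 0
    by_contra! hneg
    nlinarith
  have hB : Integrable ((univ ×ˢ (Metric.ball (0 : E2) R ×ˢ (univ : Set E3))).indicator
      fun q : ℝ × (E2 × E3) => C * M * b q.2.2)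
      ((volume.restrict (Ioo 0 T)).prod (volume : Measure (E2 × E3))) := by
    rw [integrable_indicator_iff (MeasurableSet.univ.prod
      (Metric.isOpen_ball.measurableSet.prod MeasurableSet.univ)),
      IntegrableOn, ← Measure.prod_restrict, Measure.restrict_univ, Measure.volume_eq_prod,
      ← Measure.prod_restrict, Measure.restrict_univ]
    have hfin : IsFiniteMeasure ((volume : Measure E2).restrict (Metric.ball 0 R)) :=
      ⟨by
        rw [Measure.restrict_apply_univ]
        exact measure_ball_lt_top⟩
    exact ((hb.comp_snd _).comp_snd _).const_mul _
  have hset : ∀ F : ℝ × E3 × E3 → ℝ, AEStronglyMeasurable F (volume.restrict (phaseTime T)) →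
      ∫ p in phaseTime T, F p = ∫ p, F (p.2.1, (aboveMap (p.2.2.1, p.1), p.2.2.2))
        ∂((volume.restrict (Ioi 0)).prod
          ((volume.restrict (Ioo 0 T)).prod (volume : Measure (E2 × E3)))) := by
    intro F hF
    have h1 := measurePreserving_phase_height T
    rw [← h1.map_eq] at hF ⊢
    rw [integral_map h1.aemeasurable hF]
  have hfm := hf.measurable
  have ham := ha.isWeight.measurable
  have hkm := hk.measurable
  have hv : ∀ n, Measurable (velCut n) := fun n => (contDiff_velCut n).continuous.measurable
  have ht : ∀ n, Measurable (timeCut n) := fun n => (contDiff_timeCut n).continuous.measurable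
  have hl : ∀ n, Measurable (layer n) := fun n => (continuous_layer n).measurable
  have hab := continuous_aboveMap.measurable
  have hs1 : ∀ᵐ q ∂((volume.restrict (Ioo 0 T)).prod (volume : Measure (E2 × E3))),
      q.1 ∈ Ioo 0 T := Measure.quasiMeasurePreserving_fst.ae (p := fun s => s ∈ Ioo 0 T)
        (ae_restrict_mem measurableSet_Ioo)
  have key := tendsto_integral_layer
    (ν := (volume.restrict (Ioo 0 T)).prod (volume : Measure (E2 × E3)))
    (G := fun n r q => timeCut n q.1 * velCut n q.2.2 *
      (f (q.1, aboveMap (q.2.1, r), q.2.2) * a (q.1, aboveMap (q.2.1, r)) * k q.2.2))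
    (G0 := fun q => f (q.1, planePoint q.2.1, q.2.2) * a (q.1, planePoint q.2.1) * k q.2.2)
    hB ?_ ?_ ?_
  · refine key.congr fun n => ?_
    rw [hset]
    · refine integral_congr_ae (Eventually.of_forall fun p => ?_)
      simp only [aboveMap_two]
      ring
    · exact Measurable.aestronglyMeasurable (by fun_prop)
  · exact fun n => Measurable.aestronglyMeasurable (by fun_prop)
  · have a3 := (Measure.quasiMeasurePreserving_snd (μ := volume.restrict (Ioo (0 : ℝ) T))).ae
      ((Measure.quasiMeasurePreserving_snd (μ := (volume : Measure E2))).ae hfb)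
    filter_upwards [hs1, a3] with q hq1 hq2 n r hr
    by_cases h0 : a (q.1, aboveMap (q.2.1, r)) = 0
    · simp only [h0, mul_zero, zero_mul, abs_zero]
      exact indicator_nonneg (fun q _ => mul_nonneg (mul_nonneg hC0 hM0) (hb0 q.2.2)) _
    · have h1 := hR _ h0
      have h4 : ‖q.2.1‖ < R := by
        rw [← norm_planePoint]
        exact (norm_planePoint_le _ _).trans_lt h1.2
      rw [indicator_of_mem (by exact ⟨mem_univ _, by simpa using h4, mem_univ _⟩)]
      have h2 := hq2 q.1 ⟨hq1.1.le, hq1.2⟩ (aboveMap (q.2.1, r)) (by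
        simpa [Ωbar] using (le_of_lt hr))
      have h3 : |timeCut n q.1 * velCut n q.2.2| ≤ 1 := by
        rw [abs_mul]
        exact mul_le_one₀ (timeCut_mem _ _) (abs_nonneg _) (velCut_mem _ _)
      set y := aboveMap (q.2.1, r)
      calc |timeCut n q.1 * velCut n q.2.2 * (f (q.1, y, q.2.2) * a (q.1, y) * k q.2.2)|
          = |timeCut n q.1 * velCut n q.2.2| *
              (|f (q.1, y, q.2.2)| * |a (q.1, y)| * |k q.2.2|) := by
            simp only [abs_mul]
        _ ≤ 1 * (|f (q.1, y, q.2.2)| * M * (C * bracket q.2.2)) := by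
            gcongr
            · exact hM _
            · exact hkC _
        _ = C * M * (bracket q.2.2 * |f (q.1, y, q.2.2)|) := by ring
        _ ≤ C * M * b q.2.2 := mul_le_mul_of_nonneg_left h2 (mul_nonneg hC0 hM0)
  · have a3 := (Measure.quasiMeasurePreserving_snd (μ := volume.restrict (Ioo (0 : ℝ) T))).ae
      ((Measure.quasiMeasurePreserving_snd (μ := (volume : Measure E2))).ae hf.continuousOn)
    filter_upwards [hs1, a3] with q hq1 hq2
    have h1 : ∀ᶠ p : ℕ × ℝ in atTop ×ˢ 𝓝[>] (0 : ℝ), timeCut p.1 q.1 * velCut p.1 q.2.2 = 1 := by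
      have h2 : ∀ᶠ n : ℕ in atTop, timeCut n q.1 * velCut n q.2.2 = 1 := by
        filter_upwards [tendsto_cutoff hq1.1, velCut_eventually q.2.2] with n h2 h3
        rw [h3, mul_one]
        exact h2
      exact h2.prod_inl _
    have hab0 : aboveMap (q.2.1, 0) = planePoint q.2.1 := by simp [aboveMap]
    have hT0 : q.1 ∈ Ico 0 T := ⟨hq1.1.le, hq1.2⟩
    have hcy : Tendsto (fun r : ℝ => (q.1, aboveMap (q.2.1, r))) (𝓝[>] 0)
        (𝓝 (q.1, planePoint q.2.1)) := by
      have h2 : Continuous fun r : ℝ => (q.1, aboveMap (q.2.1, r)) := by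
        have := continuous_aboveMap
        fun_prop
      have h3 := h2.tendsto 0
      rw [hab0] at h3
      exact h3.mono_left nhdsWithin_le_nhds
    have h2 : Tendsto (fun r : ℝ => f (q.1, aboveMap (q.2.1, r), q.2.2) *
        a (q.1, aboveMap (q.2.1, r)) * k q.2.2) (𝓝[>] 0)
        (𝓝 (f (q.1, planePoint q.2.1, q.2.2) * a (q.1, planePoint q.2.1) * k q.2.2)) := by
      have h3 := hq2 (q.1, planePoint q.2.1) ⟨hT0, planePoint_mem_Ωbar _⟩
      have h4 : Tendsto (fun r : ℝ => (q.1, aboveMap (q.2.1, r))) (𝓝[>] 0)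
          (𝓝[Ico 0 T ×ˢ Ωbar] (q.1, planePoint q.2.1)) := by
        refine tendsto_nhdsWithin_iff.2 ⟨hcy, ?_⟩
        filter_upwards [self_mem_nhdsWithin] with r hr
        exact ⟨hT0, by simpa [Ωbar] using (le_of_lt hr)⟩
      exact ((h3.tendsto.comp h4).mul ((ha.1.continuous.tendsto _).comp hcy)).mul_const _
    refine (h2.comp tendsto_snd).congr' ?_
    filter_upwards [h1] with p hp
    simp only [Function.comp]
    rw [hp, one_mul]

/-- Integration by parts in a constant direction `(c, w)` of space-time. The weak derivative is
tested with `phaseTest`; the derivatives of its cutoffs in `t` and `y₃` are boundary layers, and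
give the traces of `f` at `t = 0` and on the boundary plane. -/
lemma integral_by_parts_direction (hf : IsDensity T f ft fx) (hT : 0 < T) {c : ℝ} {w : E3}
    {g : ℝ × E3 × E3 → ℝ} (hw : HasWeakLineDeriv (phaseTime T) (c, w, 0) f g)
    (hg : IsLocalDensity (volume.restrict (phaseTime T)) (fun n => n.2.1) (fun n => n.2.2) g)
    {a : ℝ × E3 → ℝ} (ha : IsTest T a) {k : E3 → ℝ} (hk : ContDiff ℝ ∞ k) {C : ℝ}
    (hkC : ∀ v, |k v| ≤ C * bracket v) :
    ∫ p in phaseTime T,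
        (f p * pd (c, w) a (p.1, p.2.1) * k p.2.2 + g p * a (p.1, p.2.1) * k p.2.2) =
      -(c * ∫ q, f (0, q.1, q.2) * a (0, q.1) * k q.2
        ∂((volume.restrict Ω).prod (volume : Measure E3))) -
      w 2 * ∫ q, f (q.1, planePoint q.2.1, q.2.2) * a (q.1, planePoint q.2.1) * k q.2.2
        ∂((volume.restrict (Ioo 0 T)).prod (volume : Measure (E2 × E3))) := by
  have hfl := hf.isLocalDensity_phase
  have i1 := (ha.pd (c, w)).integrable_phase hfl hk.continuous hkC
  have i2 := ha.integrable_phase hg hk.continuous hkC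
  have hv : ∀ n, Continuous (velCut n) := fun n => (contDiff_velCut n).continuous
  have ht : ∀ n, Continuous (timeCut n) := fun n => (contDiff_timeCut n).continuous
  have hphase : MeasurableSet (phaseTime T) :=
    measurableSet_Ioo.prod (measurableSet_Ω.prod MeasurableSet.univ)
  set cut : ℕ → ℝ × E3 × E3 → ℝ :=
    fun n p => timeCut n p.1 * timeCut n (p.2.1 2) * velCut n p.2.2 with hcut
  have hcutc : ∀ n, Continuous (cut n) := fun n =>
    ((((ht n).comp continuous_fst).mul ((ht n).comp (by fun_prop))).mul ((hv n).comp (by fun_prop)))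
  have hcut1 : ∀ n p, |cut n p| ≤ 1 := fun n p => by
    simp only [hcut, abs_mul]
    exact mul_le_one₀ (mul_le_one₀ (timeCut_mem _ _) (abs_nonneg _) (timeCut_mem _ _))
      (abs_nonneg _) (velCut_mem _ _)
  have hcutlim : ∀ p ∈ phaseTime T, ∀ᶠ n : ℕ in atTop, cut n p = 1 := by
    rintro p ⟨h1, h2, -⟩
    filter_upwards [tendsto_cutoff h1.1, tendsto_cutoff (s := p.2.1 2) h2,
      velCut_eventually p.2.2] with n h3 h4 h5
    have h3' : timeCut n p.1 = 1 := h3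
    have h4' : timeCut n (p.2.1 2) = 1 := h4
    simp only [hcut, h3', h4', h5, mul_one]
  have hcutmul : ∀ {F : ℝ × E3 × E3 → ℝ}, Integrable F (volume.restrict (phaseTime T)) → ∀ n,
      Integrable (fun p => cut n p * F p) (volume.restrict (phaseTime T)) := fun hF n =>
    hF.bdd_mul (c := 1) (hcutc n).aestronglyMeasurable (Eventually.of_forall fun p => hcut1 n p)
  -- the limit of the interior terms
  have lim1 : Tendsto (fun n => ∫ p in phaseTime T, cut n p * (f p * pd (c, w) a (p.1, p.2.1) *
      k p.2.2 + g p * a (p.1, p.2.1) * k p.2.2)) atTop (𝓝 (∫ p in phaseTime T,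
      (f p * pd (c, w) a (p.1, p.2.1) * k p.2.2 + g p * a (p.1, p.2.1) * k p.2.2))) := by
    refine tendsto_integral_of_dominated_convergence _
      (fun n => (hcutmul (i1.add i2) n).aestronglyMeasurable) (i1.add i2).norm
      (fun n => Eventually.of_forall fun p => ?_) ?_
    · rw [norm_mul]
      exact mul_le_of_le_one_left (norm_nonneg _) (hcut1 n p)
    · filter_upwards [ae_restrict_mem hphase] with p hp
      refine tendsto_const_nhds.congr' ?_
      filter_upwards [hcutlim p hp] with n hn
      rw [hn, one_mul]
  have lim2 := ((tendsto_time_layer hf ha hT hk.continuous hkC).const_mul c).neg.sub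
    ((tendsto_plane_layer hf ha hk.continuous hkC).const_mul (w 2))
  refine tendsto_nhds_unique lim1 (lim2.congr' ?_)
  filter_upwards [eventually_gt_atTop 0] with n hn
  obtain ⟨hsc, hss⟩ := phaseTest_support hn k ha
  have hwk := hw.2.2 _ (contDiff_phaseTest n hk ha.1) hsc hss
  simp only [lineDeriv_phaseTest n k ha.1] at hwk
  -- integrability of the layer terms
  have ilay : ∀ F : ℝ × E3 → ℝ, Continuous F → Integrable (fun p : ℝ × E3 × E3 =>
      f p * (F (p.1, p.2.1) * velCut n p.2.2 * a (p.1, p.2.1) * k p.2.2))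
      (volume.restrict (phaseTime T)) := by
    intro F hF
    have hFa : Continuous fun q => F q * a q := hF.mul ha.1.continuous
    have hFc : HasCompactSupport fun q => F q * a q := ha.2.1.mul_left
    obtain ⟨M, hM⟩ := hFa.bounded_above_of_compact_support hFc
    obtain ⟨R, -, hR⟩ := exists_bound_of_hasCompactSupport hFc
    have hFm := hFa.measurable
    have h1 := hfl.integrable_mul (k := fun p => velCut n p.2.2 * k p.2.2)
      (g := fun p => F (p.1, p.2.1) * a (p.1, p.2.1))
      (Continuous.measurable (((hv n).comp (by fun_prop)).mul (hk.continuous.comp (by fun_prop))))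
      (C := C) (fun p => by
        rw [abs_mul]
        exact (mul_le_of_le_one_left (abs_nonneg _) (velCut_mem _ _)).trans (hkC _))
      (hFm.comp (f := fun p : ℝ × E3 × E3 => (p.1, p.2.1)) (by fun_prop))
      (M := M) (fun p => hM _) (R := R) (fun p hp => (hR _ hp).2)
    exact h1.congr (Eventually.of_forall fun p => by simp only; ring)
  have it := ilay (fun q => layer n q.1 * timeCut n (q.2 2))
    (((continuous_layer n).comp continuous_fst).mul ((ht n).comp (by fun_prop)))
  have ix := ilay (fun q => layer n (q.2 2) * timeCut n q.1)
    (((continuous_layer n).comp (by fun_prop)).mul ((ht n).comp continuous_fst))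
  have it' : Integrable (fun p : ℝ × E3 × E3 => f p * (layer n p.1 *
      (timeCut n (p.2.1 2) * velCut n p.2.2 * a (p.1, p.2.1) * k p.2.2)))
      (volume.restrict (phaseTime T)) :=
    it.congr (Eventually.of_forall fun p => by simp only; ring)
  have ix' : Integrable (fun p : ℝ × E3 × E3 => f p * (layer n (p.2.1 2) *
      (timeCut n p.1 * velCut n p.2.2 * a (p.1, p.2.1) * k p.2.2)))
      (volume.restrict (phaseTime T)) :=
    ix.congr (Eventually.of_forall fun p => by simp only; ring)
  have ic1 := hcutmul i1 n
  have ic2 := hcutmul i2 n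
  have e1 : ∫ p in phaseTime T, f p * (timeCut n p.1 * timeCut n (p.2.1 2) * velCut n p.2.2 *
      pd (c, w) a (p.1, p.2.1) * k p.2.2 +
      c * (layer n p.1 * (timeCut n (p.2.1 2) * velCut n p.2.2 * a (p.1, p.2.1) * k p.2.2)) +
      w 2 * (layer n (p.2.1 2) * (timeCut n p.1 * velCut n p.2.2 * a (p.1, p.2.1) * k p.2.2))) =
      (∫ p in phaseTime T, cut n p * (f p * pd (c, w) a (p.1, p.2.1) * k p.2.2)) +
      c * (∫ p in phaseTime T, f p * (layer n p.1 *
        (timeCut n (p.2.1 2) * velCut n p.2.2 * a (p.1, p.2.1) * k p.2.2))) +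
      w 2 * ∫ p in phaseTime T, f p * (layer n (p.2.1 2) *
        (timeCut n p.1 * velCut n p.2.2 * a (p.1, p.2.1) * k p.2.2)) := by
    rw [← integral_const_mul c, ← integral_const_mul (w 2), ← integral_add ic1 (it'.const_mul c)]
    refine Eq.trans ?_ (integral_add (ic1.add (it'.const_mul c)) (ix'.const_mul (w 2)))
    refine integral_congr_ae (Eventually.of_forall fun p => ?_)
    simp only [hcut]
    ring
  have e2 : ∫ p in phaseTime T, g p * phaseTest n k a p =
      ∫ p in phaseTime T, cut n p * (g p * a (p.1, p.2.1) * k p.2.2) := by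
    refine integral_congr_ae (Eventually.of_forall fun p => ?_)
    simp only [hcut, phaseTest]
    ring
  have e3 : ∫ p in phaseTime T, cut n p * (f p * pd (c, w) a (p.1, p.2.1) * k p.2.2 +
      g p * a (p.1, p.2.1) * k p.2.2) =
      (∫ p in phaseTime T, cut n p * (f p * pd (c, w) a (p.1, p.2.1) * k p.2.2)) +
      ∫ p in phaseTime T, cut n p * (g p * a (p.1, p.2.1) * k p.2.2) := by
    rw [← integral_add ic1 ic2]
    refine integral_congr_ae (Eventually.of_forall fun p => ?_)
    simp only
    ring
  rw [e1, e2] at hwk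
  rw [e3]
  linarith

end

section

variable {T : ℝ} {f ft : ℝ × E3 × E3 → ℝ} {fx : ℝ × E3 × E3 → E3}

/-- Integration by parts for the operator `c₀(v) ∂ₜ + c(v) · ∇ₓ`. -/
lemma integral_by_parts_operator (hf : IsDensity T f ft fx) (hT : 0 < T) {c0 : E3 → ℝ}
    {c : E3 → E3} (hc0 : ContDiff ℝ ∞ c0) (hc : ContDiff ℝ ∞ c) (hc0b : ∀ v, |c0 v| ≤ 1)
    (hcb : ∀ v, ‖c v‖ ≤ 1) {a : ℝ × E3 → ℝ} (ha : IsTest T a) {k : E3 → ℝ} (hk : ContDiff ℝ ∞ k)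
    {C : ℝ} (hkC : ∀ v, |k v| ≤ C * bracket v) :
    ∫ p in phaseTime T, (f p * (c0 p.2.2 * pd (1, 0) a (p.1, p.2.1) +
        pd (0, c p.2.2) a (p.1, p.2.1)) * k p.2.2 +
        (c0 p.2.2 * ft p + inner ℝ (c p.2.2) (fx p)) * a (p.1, p.2.1) * k p.2.2) =
      -(∫ q, f (0, q.1, q.2) * a (0, q.1) * (k q.2 * c0 q.2)
        ∂((volume.restrict Ω).prod (volume : Measure E3))) -
      ∫ q, f (q.1, planePoint q.2.1, q.2.2) * a (q.1, planePoint q.2.1) * (k q.2.2 * c q.2.2 2)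
        ∂((volume.restrict (Ioo 0 T)).prod (volume : Measure (E2 × E3))) := by
  have hfl := hf.isLocalDensity_phase
  have hcj : ∀ j v, |c v j| ≤ 1 := fun j v =>
    ((PiLp.norm_apply_le (c v) j).trans (hcb v))
  have hk0C : ∀ v, |k v * c0 v| ≤ C * bracket v := fun v => by
    rw [abs_mul]
    exact (mul_le_of_le_one_right (abs_nonneg _) (hc0b v)).trans (hkC v)
  have hkjC : ∀ j v, |k v * c v j| ≤ C * bracket v := fun j v => by
    rw [abs_mul]
    exact (mul_le_of_le_one_right (abs_nonneg _) (hcj j v)).trans (hkC v)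
  have hk0 : ContDiff ℝ ∞ fun v => k v * c0 v := hk.mul hc0
  have hkj : ∀ j, ContDiff ℝ ∞ fun v => k v * c v j := fun j => hk.mul (by fun_prop)
  have gt : IsLocalDensity (volume.restrict (phaseTime T)) (fun n => n.2.1) (fun n => n.2.2) ft := by
    simpa using hf.isLocalDensity_deriv (c0 := fun _ => 1) (c := fun _ => 0) continuous_const
      continuous_const (by simp) (by simp)
  have gx : ∀ j, IsLocalDensity (volume.restrict (phaseTime T)) (fun n => n.2.1) (fun n => n.2.2)
      fun p => fx p j := fun j => by
    simpa [e, EuclideanSpace.inner_single_left] using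
      hf.isLocalDensity_deriv (c0 := fun _ => 0) (c := fun _ => e j)
      continuous_const continuous_const (by simp) (by simp [e])
  have et := integral_by_parts_direction hf hT hf.weak_t gt ha hk0 hk0C
  have ex := fun j => integral_by_parts_direction hf hT (hf.weak_x j) (gx j) ha (hkj j) (hkjC j)
  have it := ((ha.pd (1, 0)).integrable_phase hfl hk0.continuous hk0C).add
    (ha.integrable_phase gt hk0.continuous hk0C)
  have ix := fun j => ((ha.pd (0, e j)).integrable_phase hfl (hkj j).continuous (hkjC j)).add
    (ha.integrable_phase (gx j) (hkj j).continuous (hkjC j))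
  have hsum := integral_add it (integrable_finsetSum Finset.univ fun j _ => ix j)
  rw [integral_finsetSum _ fun j _ => ix j] at hsum
  refine Eq.trans (integral_congr_ae (Eventually.of_forall fun p => ?_)) (hsum.trans ?_)
  · simp only [Pi.add_apply]
    rw [pd_space_eq_sum, real_inner_comm]
    simp only [PiLp.inner_apply, Real.inner_apply, Fin.sum_univ_three]
    ring
  · simp only [Pi.add_apply]
    rw [et, Finset.sum_congr rfl fun j _ => ex j]
    simp [e]
    ring

lemma pd_comp_translate {g : ℝ × E3 → ℝ} (b w : ℝ × E3) (p : ℝ × E3) :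
    pd b (fun q => g (q + w)) p = pd b g (p + w) := by
  unfold pd
  rw [fderiv_comp_add_right]

lemma IsTest.translate {g : ℝ × E3 → ℝ} (hg : IsTest T g) {w : ℝ × E3} (hw : 0 ≤ w.1) :
    IsTest T fun q => g (q + w) := by
  have h2 : Continuous fun q : ℝ × E3 => q + w := by fun_prop
  refine ⟨hg.1.comp (by fun_prop), hg.2.1.comp_homeomorph (Homeomorph.addRight w), ?_⟩
  have h1 : tsupport (fun q => g (q + w)) ⊆ (fun q => q + w) ⁻¹' tsupport g :=
    closure_minimal (fun q hq => subset_tsupport _ hq) ((isClosed_tsupport g).preimage h2)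
  intro q hq
  have h3 := (hg.2.2 (h1 hq)).1
  have h4 : q.1 + w.1 < T := h3
  exact ⟨by show q.1 < T; linarith, trivial⟩

/-- Integration by parts for `c₀(v) ∂ₜ + c(v) · ∇ₓ` along light cones. -/
lemma cone_integral_by_parts (hf : IsDensity T f ft fx) (hT : 0 < T) {c0 : E3 → ℝ}
    {c : E3 → E3} (hc0 : ContDiff ℝ ∞ c0) (hc : ContDiff ℝ ∞ c) (hc0b : ∀ v, |c0 v| ≤ 1)
    (hcb : ∀ v, ‖c v‖ ≤ 1) {g : ℝ × E3 → ℝ} (hg : IsTest T g) {k : E3 → E3 → ℝ}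
    (hk : IsVelocityKernel k) (hks : ∀ om, ‖om‖ ≤ 1 → ContDiff ℝ ∞ (k om)) :
    Integrable (fun p : E3 × ℝ × E3 × E3 => k (back p.1) p.2.2.2 * f p.2 * ‖p.1‖⁻¹ *
        (c0 p.2.2.2 * pd (1, 0) g (p.2.1 + ‖p.1‖, p.2.2.1 + p.1) +
          pd (0, c p.2.2.2) g (p.2.1 + ‖p.1‖, p.2.2.1 + p.1)))
      ((volume : Measure E3).prod (volume.restrict (phaseTime T))) ∧
    ∫ p : E3 × ℝ × E3 × E3, k (back p.1) p.2.2.2 * f p.2 * ‖p.1‖⁻¹ *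
        (c0 p.2.2.2 * pd (1, 0) g (p.2.1 + ‖p.1‖, p.2.2.1 + p.1) +
          pd (0, c p.2.2.2) g (p.2.1 + ‖p.1‖, p.2.2.1 + p.1))
        ∂((volume : Measure E3).prod (volume.restrict (phaseTime T))) =
      -conePairing (volume.restrict (phaseTime T)) Prod.fst (fun n => n.2.1)
        (velKernel k 1 (fun n => n.2.2) fun n => c0 n.2.2 * ft n + inner ℝ (c n.2.2) (fx n)) g -
      conePairing ((volume.restrict Ω).prod (volume : Measure E3)) (fun _ => 0) Prod.fst
        (velKernel (fun om v => k om v * c0 v) 1 Prod.snd fun n => f (0, n.1, n.2)) g -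
      conePairing ((volume.restrict (Ioo 0 T)).prod (volume : Measure (E2 × E3))) Prod.fst
        (fun n => planePoint n.2.1) (velKernel (fun om v => k om v * c v 2) 1 (fun n => n.2.2)
          fun n => f (n.1, planePoint n.2.1, n.2.2)) g := by
  have hcj : ∀ j v, |c v j| ≤ 1 := fun j v =>
    ((PiLp.norm_apply_le (c v) j).trans (hcb v))
  have hτ0 : ∀ᵐ n ∂((volume : Measure (ℝ × E3 × E3)).restrict (phaseTime T)), 0 ≤ n.1 := by
    filter_upwards [ae_restrict_mem (measurableSet_Ioo.prod
      (measurableSet_Ω.prod MeasurableSet.univ))] with n hn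
    exact hn.1.1.le
  have hτ1 : ∀ᵐ n ∂((volume.restrict (Ioo 0 T)).prod (volume : Measure (E2 × E3))), 0 ≤ n.1 := by
    refine Measure.quasiMeasurePreserving_fst.ae (p := fun t => 0 ≤ t) ?_
    filter_upwards [ae_restrict_mem measurableSet_Ioo] with t ht using ht.1.le
  have hmul : ∀ {b : E3 → ℝ}, Measurable b → (∀ v, |b v| ≤ 1) →
      IsVelocityKernel fun om v => k om v * b v := by
    intro b hb hb1
    refine ⟨hk.measurable.mul (hb.comp measurable_snd), ?_⟩
    obtain ⟨C, hC⟩ := hk.bound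
    refine ⟨C, fun om v h => ?_⟩
    rw [abs_mul]
    exact (mul_le_of_le_one_right (abs_nonneg _) (hb1 v)).trans (hC om v h)
  have hk0 := hmul hc0.continuous.measurable hc0b
  have hkj := fun j => hmul (b := fun v => c v j)
    (by have := hc.continuous.measurable; fun_prop) (hcj j)
  have hfl := hf.isLocalDensity_phase
  have hfi := hf.isLocalDensity_initial hT
  have hfp := hf.isLocalDensity_plane
  have hfd := hf.isLocalDensity_deriv hc0.continuous hc.continuous hc0b hcb
  have J0 := (isConeKernel_velKernel (τ := Prod.fst) (m := 1) (by norm_num) hk0 hfl measurable_fst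
    hτ0).integrable (hg.pd (1, 0)).isWeight
  have Jj := fun j => (isConeKernel_velKernel (τ := Prod.fst) (m := 1) (by norm_num) (hkj j) hfl
    measurable_fst hτ0).integrable (hg.pd (0, e j)).isWeight
  have Jd := (isConeKernel_velKernel (τ := Prod.fst) (m := 1) (by norm_num) hk hfd measurable_fst
    hτ0).integrable hg.isWeight
  have Ji := (isConeKernel_velKernel (τ := fun _ => (0 : ℝ)) (m := 1) (by norm_num) hk0 hfi
    measurable_const (Eventually.of_forall fun _ => le_rfl)).integrable hg.isWeight
  have Jp := (isConeKernel_velKernel (τ := Prod.fst) (m := 1) (by norm_num) (hkj 2) hfp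
    measurable_fst hτ1).integrable hg.isWeight
  have hint : Integrable (fun p : E3 × ℝ × E3 × E3 => k (back p.1) p.2.2.2 * f p.2 * ‖p.1‖⁻¹ *
        (c0 p.2.2.2 * pd (1, 0) g (p.2.1 + ‖p.1‖, p.2.2.1 + p.1) +
          pd (0, c p.2.2.2) g (p.2.1 + ‖p.1‖, p.2.2.1 + p.1)))
      ((volume : Measure E3).prod (volume.restrict (phaseTime T))) := by
    refine (J0.add (integrable_finsetSum Finset.univ fun j _ => Jj j)).congr
      (Eventually.of_forall fun p => ?_)
    simp only [Pi.add_apply, velKernel, pow_one]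
    rw [pd_space_eq_sum]
    simp only [Fin.sum_univ_three]
    ring
  refine ⟨hint, ?_⟩
  obtain ⟨C, hC⟩ := hk.bound
  have hz : ∀ z : E3, (∫ n in phaseTime T, k (back z) n.2.2 * f n * ‖z‖⁻¹ *
        (c0 n.2.2 * pd (1, 0) g (n.1 + ‖z‖, n.2.1 + z) +
          pd (0, c n.2.2) g (n.1 + ‖z‖, n.2.1 + z)) +
      velKernel k 1 (fun n => n.2.2) (fun n => c0 n.2.2 * ft n + inner ℝ (c n.2.2) (fx n)) (z, n) *
        g (n.1 + ‖z‖, n.2.1 + z)) =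
      -(∫ n, velKernel (fun om v => k om v * c0 v) 1 Prod.snd (fun n => f (0, n.1, n.2)) (z, n) *
        g (0 + ‖z‖, n.1 + z) ∂((volume.restrict Ω).prod (volume : Measure E3))) -
      ∫ n, velKernel (fun om v => k om v * c v 2) 1 (fun n => n.2.2)
          (fun n => f (n.1, planePoint n.2.1, n.2.2)) (z, n) * g (n.1 + ‖z‖, planePoint n.2.1 + z)
        ∂((volume.restrict (Ioo 0 T)).prod (volume : Measure (E2 × E3))) := by
    intro z
    have ha := hg.translate (w := (‖z‖, z)) (norm_nonneg z)
    have h1 := integral_by_parts_operator hf hT hc0 hc hc0b hcb ha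
      (hks _ (norm_back_le_one z)) (fun v => hC _ v (norm_back_le_one z))
    simp only [pd_comp_translate, Prod.mk_add_mk] at h1
    have h2 := congrArg (fun r => ‖z‖⁻¹ * r) h1
    simp only [mul_sub, mul_neg, ← integral_const_mul] at h2
    refine Eq.trans ?_ (h2.trans ?_)
    · refine integral_congr_ae (Eventually.of_forall fun n => ?_)
      simp only [velKernel, pow_one]
      ring
    · congr 1
      · congr 1
        refine integral_congr_ae (Eventually.of_forall fun n => ?_)
        simp only [velKernel, pow_one]
        ring
      · refine integral_congr_ae (Eventually.of_forall fun n => ?_)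
        simp only [velKernel, pow_one]
        ring
  have e2 : ∀ᵐ z : E3, (∫ n in phaseTime T, ((fun p : E3 × ℝ × E3 × E3 => k (back p.1) p.2.2.2 *
        f p.2 * ‖p.1‖⁻¹ *
        (c0 p.2.2.2 * pd (1, 0) g (p.2.1 + ‖p.1‖, p.2.2.1 + p.1) +
          pd (0, c p.2.2.2) g (p.2.1 + ‖p.1‖, p.2.2.1 + p.1))) + fun p : E3 × ℝ × E3 × E3 =>
        velKernel k 1 (fun n => n.2.2) (fun n => c0 n.2.2 * ft n + inner ℝ (c n.2.2) (fx n)) p *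
        g (p.2.1 + ‖p.1‖, p.2.2.1 + p.1)) (z, n)) = _ := Eventually.of_forall fun z => hz z
  have e1 := ((integral_add hint Jd).symm.trans
    ((integral_prod _ (hint.add Jd)).trans (integral_congr_ae e2))).trans
    (integral_sub Ji.integral_prod_left.neg Jp.integral_prod_left)
  have e3 := (integral_neg (f := fun z : E3 => _)).trans (congrArg Neg.neg (integral_prod _ Ji).symm)
  have e4 := (integral_prod _ Jp).symm
  replace e1 := e1.trans (congrArg₂ (· - ·) e3 e4)
  unfold conePairing
  linarith

end

/-! ### The Glassey-Strauss representation in dual form -/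

section

variable {T : ℝ} {f ft : ℝ × E3 × E3 → ℝ} {fx : ℝ × E3 × E3 → E3}

/-- The kernel in front of `f(0)`, for a general source operator. -/
def kerI (α0 : E3 → ℝ) (α : E3 → E3) (om v : E3) : ℝ := α0 v - kerS α0 α om v

/-- The kernel in front of the boundary values of `f`, for a general source operator. -/
def kerP (α0 : E3 → ℝ) (α : E3 → E3) (om v : E3) : ℝ := kerS α0 α om v * hat v 2

lemma isVelocityKernel_of_le_one {b : E3 → ℝ} (hb : Measurable b) (h : ∀ v, |b v| ≤ 1) :
    IsVelocityKernel fun _ v => b v :=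
  ⟨hb.comp measurable_snd, 1, fun _ v _ => (h v).trans (by rw [one_mul]; exact one_le_bracket v)⟩

lemma IsVelocityKernel.sub {k l : E3 → E3 → ℝ} (hk : IsVelocityKernel k)
    (hl : IsVelocityKernel l) : IsVelocityKernel fun om v => k om v - l om v := by
  obtain ⟨C, hC⟩ := hk.bound
  obtain ⟨D, hD⟩ := hl.bound
  refine ⟨hk.measurable.sub hl.measurable, C + D, fun om v h => ?_⟩
  rw [add_mul]
  exact (abs_sub _ _).trans (add_le_add (hC om v h) (hD om v h))

lemma IsVelocityKernel.mul_of_le_one {k : E3 → E3 → ℝ} (hk : IsVelocityKernel k) {b : E3 → ℝ}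
    (hb : Measurable b) (hb1 : ∀ v, |b v| ≤ 1) : IsVelocityKernel fun om v => k om v * b v := by
  refine ⟨hk.measurable.mul (hb.comp measurable_snd), ?_⟩
  obtain ⟨C, hC⟩ := hk.bound
  refine ⟨C, fun om v h => ?_⟩
  rw [abs_mul]
  exact (mul_le_of_le_one_right (abs_nonneg _) (hb1 v)).trans (hC om v h)

namespace IsSourceOperator

variable {α0 : E3 → ℝ} {α : E3 → E3}

lemma isVelocityKernel_kerS (hα : IsSourceOperator α0 α) : IsVelocityKernel (kerS α0 α) :=
  ⟨hα.measurable_kerS, 8, hα.abs_kerS_le⟩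

lemma isVelocityKernel_kerT (hα : IsSourceOperator α0 α) : IsVelocityKernel (kerT α0 α) :=
  ⟨hα.measurable_kerT, 8, hα.abs_kerT_le⟩

lemma isVelocityKernel_kerI (hα : IsSourceOperator α0 α) : IsVelocityKernel (kerI α0 α) :=
  (isVelocityKernel_of_le_one hα.smooth_time.continuous.measurable hα.abs_time_le).sub
    hα.isVelocityKernel_kerS

lemma isVelocityKernel_kerP (hα : IsSourceOperator α0 α) : IsVelocityKernel (kerP α0 α) :=
  hα.isVelocityKernel_kerS.mul_of_le_one (b := fun v => hat v 2)
    ((contDiff_hat_apply 2).continuous.measurable)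
    fun v => (PiLp.norm_apply_le (hat v) 2).trans (norm_hat_le_one v)

end IsSourceOperator

lemma IsDensity.isLocalDensity_transport (hf : IsDensity T f ft fx) :
    IsLocalDensity (volume.restrict (phaseTime T)) (fun n => n.2.1) (fun n => n.2.2)
      (transport ft fx) := by
  have h := hf.isLocalDensity_deriv (c0 := fun _ => 1) (c := hat) continuous_const
    continuous_hat (by simp) norm_hat_le_one
  simp only [one_mul] at h
  exact h

lemma ae_phaseTime_nonneg (T : ℝ) :
    ∀ᵐ n ∂((volume : Measure (ℝ × E3 × E3)).restrict (phaseTime T)), 0 ≤ n.1 := by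
  filter_upwards [ae_restrict_mem (measurableSet_Ioo.prod
    (measurableSet_Ω.prod MeasurableSet.univ))] with n hn
  exact hn.1.1.le

lemma ae_plane_nonneg (T : ℝ) :
    ∀ᵐ n ∂((volume.restrict (Ioo 0 T)).prod (volume : Measure (E2 × E3))), 0 ≤ n.1 := by
  refine Measure.quasiMeasurePreserving_fst.ae (p := fun t => 0 ≤ t) ?_
  filter_upwards [ae_restrict_mem measurableSet_Ioo] with t ht using ht.1.le

/-- The integral of the source operator applied to `f` along light cones is expressed by the terms of
the representation formulas. -/
lemma conePairing_source (hf : IsDensity T f ft fx) (hT : 0 < T) {α0 : E3 → ℝ} {α : E3 → E3}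
    (hα : IsSourceOperator α0 α) {g : ℝ × E3 → ℝ} (hg : IsTest T g) :
    conePairing (volume.restrict (phaseTime T)) Prod.fst (fun n => n.2.1)
        (velKernel (kerT α0 α) 2 (fun n => n.2.2) f) g -
      conePairing (volume.restrict (phaseTime T)) Prod.fst (fun n => n.2.1)
        (velKernel (kerS α0 α) 1 (fun n => n.2.2) (transport ft fx)) g -
      conePairing ((volume.restrict (Ioo 0 T)).prod (volume : Measure (E2 × E3))) Prod.fst
        (fun n => planePoint n.2.1) (velKernel (kerP α0 α) 1 (fun n => n.2.2)
          fun n => f (n.1, planePoint n.2.1, n.2.2)) g +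
      conePairing ((volume.restrict Ω).prod (volume : Measure E3)) (fun _ => 0) Prod.fst
        (velKernel (kerI α0 α) 1 Prod.snd fun n => f (0, n.1, n.2)) g =
    -conePairing (volume.restrict (phaseTime T)) Prod.fst (fun n => n.2.1)
        (velKernel (fun _ _ => 1) 1 (fun n => n.2.2)
          fun n => α0 n.2.2 * ft n + inner ℝ (α n.2.2) (fx n)) g -
      conePairing ((volume.restrict (Ioo 0 T)).prod (volume : Measure (E2 × E3))) Prod.fst
        (fun n => planePoint n.2.1) (velKernel (fun _ v => α v 2) 1 (fun n => n.2.2)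
          fun n => f (n.1, planePoint n.2.1, n.2.2)) g := by
  obtain ⟨i1, e1⟩ := cone_integral_by_parts hf hT hα.smooth_time hα.smooth_space hα.abs_time_le
    hα.norm_le hg (isVelocityKernel_of_le_one (b := fun _ => 1) measurable_const (by simp))
    fun _ _ => contDiff_const
  obtain ⟨i2, e2⟩ := cone_integral_by_parts hf hT (c0 := fun _ => 1) contDiff_const contDiff_hat
    (by simp) norm_hat_le_one hg hα.isVelocityKernel_kerS hα.contDiff_kerS
  have i3 := (isConeKernel_velKernel (τ := Prod.fst) (m := 2) le_rfl hα.isVelocityKernel_kerT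
    hf.isLocalDensity_phase measurable_fst (ae_phaseTime_nonneg T)).integrable hg.isWeight
  have i4 := (isConeKernel_velKernel (τ := fun _ => (0 : ℝ)) (m := 1) (by norm_num)
    (isVelocityKernel_of_le_one hα.smooth_time.continuous.measurable hα.abs_time_le)
    (hf.isLocalDensity_initial hT) measurable_const
    (Eventually.of_forall fun _ => le_rfl)).integrable hg.isWeight
  have i5 := (isConeKernel_velKernel (τ := fun _ => (0 : ℝ)) (m := 1) (by norm_num)
    hα.isVelocityKernel_kerS (hf.isLocalDensity_initial hT) measurable_const
    (Eventually.of_forall fun _ => le_rfl)).integrable hg.isWeight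
  -- the decomposition of the source operator along the light cones
  have e3 := integral_sub (i1.sub i2) i3
  have e4 := integral_prod_symm _ ((i1.sub i2).sub i3)
  have e5 : ∀ n : ℝ × E3 × E3, _ = (0 : ℝ) := fun n => (integral_const_mul (f n) _).trans
    ((congrArg (f n * ·) (hα.integral_decomposition hg.1 hg.2.1 n.1 n.2.1 n.2.2)).trans (mul_zero _))
  have e6 := e3.symm.trans (e4.trans ((integral_congr_ae (Eventually.of_forall fun n =>
    Eq.trans (integral_congr_ae (Eventually.of_forall fun z => by
      simp only [Pi.sub_apply, velKernel]
      ring)) (e5 n))).trans (integral_zero _ _)))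
  have e8 : conePairing ((volume.restrict Ω).prod (volume : Measure E3)) (fun _ => 0) Prod.fst
        (velKernel (kerI α0 α) 1 Prod.snd fun n => f (0, n.1, n.2)) g =
      conePairing ((volume.restrict Ω).prod (volume : Measure E3)) (fun _ => 0) Prod.fst
        (velKernel (fun _ v => α0 v) 1 Prod.snd fun n => f (0, n.1, n.2)) g -
      conePairing ((volume.restrict Ω).prod (volume : Measure E3)) (fun _ => 0) Prod.fst
        (velKernel (kerS α0 α) 1 Prod.snd fun n => f (0, n.1, n.2)) g := by
    refine Eq.trans (integral_congr_ae (Eventually.of_forall fun n => ?_)) (integral_sub i4 i5)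
    simp only [velKernel, kerI]
    ring
  have e9 : transport ft fx = fun n => 1 * ft n + inner ℝ (hat n.2.2) (fx n) := by
    funext n
    simp [transport]
  have e10 := (congrArg₂ (fun a b : ℝ => a - b - conePairing (volume.restrict (phaseTime T)) Prod.fst
    (fun n => n.2.1) (velKernel (kerT α0 α) 2 (fun n => n.2.2) f) g) e1 e2).symm.trans
    ((congrArg (· - conePairing (volume.restrict (phaseTime T)) Prod.fst
    (fun n => n.2.1) (velKernel (kerT α0 α) 2 (fun n => n.2.2) f) g)
      (integral_sub i1 i2)).symm.trans e6)
  have e11 : kerP α0 α = fun om v => kerS α0 α om v * hat v 2 := rfl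
  have e12 : kerS α0 α = fun om v => kerS α0 α om v := rfl
  rw [e8, e9, e11]
  simp only [one_mul, mul_one] at e10 ⊢
  rw [← e12] at e10
  linarith

end

section

variable {T : ℝ} {f ft : ℝ × E3 × E3 → ℝ} {fx : ℝ × E3 × E3 → E3}

/-- For kernels which do not depend on the direction, the integral along light cones produces the
potential of the weight. -/
lemma conePairing_eq_potential {N : Type*} [MeasurableSpace N] {ν : Measure N} [SFinite ν]
    {τ : N → ℝ} {pos vel : N → E3} {h : N → ℝ} {b : E3 → ℝ} {g : ℝ × E3 → ℝ}
    (hi : Integrable (fun p => velKernel (fun _ v => b v) 1 vel h p *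
      g (τ p.2 + ‖p.1‖, pos p.2 + p.1)) ((volume : Measure E3).prod ν)) :
    conePairing ν τ pos (velKernel (fun _ v => b v) 1 vel h) g =
      4 * Real.pi * ∫ n, b (vel n) * h n * potential g (τ n, pos n) ∂ν := by
  unfold conePairing
  rw [integral_prod_symm _ hi, ← integral_const_mul]
  refine integral_congr_ae (Eventually.of_forall fun n => ?_)
  have h1 : ∀ z : E3, velKernel (fun _ v => b v) 1 vel h (z, n) * g (τ n + ‖z‖, pos n + z) =
      (b (vel n) * h n) * (‖z‖⁻¹ * g (τ n + ‖z‖, pos n + z)) := fun z => by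
    simp only [velKernel, pow_one]
    ring
  simp only [h1]
  rw [integral_const_mul, potential]
  have := Real.pi_ne_zero
  field_simp

/-- Integration in the velocity of an integrable function on phase space-time. -/
lemma integral_phaseTime {F : ℝ × E3 × E3 → ℝ} (hF : IntegrableOn F (phaseTime T)) :
    Integrable (fun p : ℝ × E3 => ∫ v, F (p.1, p.2, v)) (volume.restrict (spaceTime T)) ∧
      ∫ p in phaseTime T, F p = ∫ p in spaceTime T, ∫ v, F (p.1, p.2, v) := by
  have h1 := measurePreserving_prodAssoc (volume.restrict (Ioo (0 : ℝ) T))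
    ((volume : Measure E3).restrict Ω) (volume : Measure E3)
  rw [← volume_restrict_phaseTime] at h1
  have h2 : (volume.restrict (Ioo (0 : ℝ) T)).prod ((volume : Measure E3).restrict Ω) =
      volume.restrict (spaceTime T) := by
    rw [spaceTime, Measure.volume_eq_prod, Measure.prod_restrict]
  rw [h2] at h1
  have h3 := (h1.integrable_comp_emb MeasurableEquiv.prodAssoc.measurableEmbedding).2 hF
  have h4 := h1.integral_comp MeasurableEquiv.prodAssoc.measurableEmbedding F
  refine ⟨h3.integral_prod_left, ?_⟩
  rw [← h4]
  exact integral_prod _ h3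

/-- Integration in the velocity of an integrable function on the boundary of phase space-time. -/
lemma integral_plane {F : ℝ × E2 × E3 → ℝ}
    (hF : Integrable F ((volume.restrict (Ioo 0 T)).prod (volume : Measure (E2 × E3)))) :
    ∫ p, F p ∂((volume.restrict (Ioo 0 T)).prod (volume : Measure (E2 × E3))) =
      ∫ q in Ioo 0 T ×ˢ (univ : Set E2), ∫ v, F (q.1, q.2, v) := by
  have h1 := measurePreserving_prodAssoc (volume.restrict (Ioo (0 : ℝ) T))
    (volume : Measure E2) (volume : Measure E3)
  have h2 : (volume.restrict (Ioo (0 : ℝ) T)).prod (volume : Measure E2) =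
      volume.restrict (Ioo 0 T ×ˢ univ) := by
    rw [Measure.volume_eq_prod, ← Measure.prod_restrict, Measure.restrict_univ]
  rw [h2] at h1
  have h3 := (h1.integrable_comp_emb MeasurableEquiv.prodAssoc.measurableEmbedding).2 hF
  have h4 := h1.integral_comp MeasurableEquiv.prodAssoc.measurableEmbedding F
  rw [Measure.volume_eq_prod E2 E3, ← h4]
  exact integral_prod _ h3

/-- The source of the wave equation, for a general source operator. -/
def source (α0 : E3 → ℝ) (α : E3 → E3) (ft : ℝ × E3 × E3 → ℝ) (fx : ℝ × E3 × E3 → E3)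
    (p : ℝ × E3) : ℝ :=
  -4 * Real.pi * ∫ v, (α0 v * ft (p.1, p.2, v) + inner ℝ (α v) (fx (p.1, p.2, v)))

/-- The Neumann datum, for a general source operator. -/
def datum (α : E3 → E3) (f : ℝ × E3 × E3 → ℝ) (p : ℝ × E3) : ℝ :=
  4 * Real.pi * ∫ v, α v 2 * f (p.1, p.2, v)

lemma IsDensity.integral_source_mul (hf : IsDensity T f ft fx) {α0 : E3 → ℝ} {α : E3 → E3}
    (hα : IsSourceOperator α0 α) {φ : ℝ × E3 → ℝ} (hφ : IsTest T φ) :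
    Integrable (fun p => source α0 α ft fx p * φ p) (volume.restrict (spaceTime T)) ∧
      ∫ p in spaceTime T, source α0 α ft fx p * φ p =
        -4 * Real.pi * ∫ p in phaseTime T,
          (α0 p.2.2 * ft p + inner ℝ (α p.2.2) (fx p)) * φ (p.1, p.2.1) := by
  have h1 := hφ.integrable_phase (k := fun _ => 1) (C := 1) (hf.isLocalDensity_deriv
    hα.smooth_time.continuous hα.smooth_space.continuous hα.abs_time_le hα.norm_le)
    continuous_const fun v => by simpa using one_le_bracket v
  simp only [mul_one] at h1
  obtain ⟨h2, h3⟩ := integral_phaseTime h1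
  have h4 : ∀ p : ℝ × E3, source α0 α ft fx p * φ p = -4 * Real.pi *
      ∫ v, (α0 v * ft (p.1, p.2, v) + inner ℝ (α v) (fx (p.1, p.2, v))) * φ (p.1, p.2) := by
    intro p
    rw [integral_mul_const, source]
    ring
  simp only [h4]
  exact ⟨h2.const_mul _, by rw [integral_const_mul, h3]⟩

/-- The terms of the representation formulas, integrated against `g`, give the right-hand side of the
wave equation integrated against the potential of `g`. -/
lemma conePairing_source_eq (hf : IsDensity T f ft fx) (hT : 0 < T) {α0 : E3 → ℝ} {α : E3 → E3}
    (hα : IsSourceOperator α0 α) {g φ : ℝ × E3 → ℝ} (hg : IsTest T g) (hφ : IsTest T φ)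
    (hφg : ∀ p : ℝ × E3, -1 ≤ p.1 → φ p = potential g p) :
    conePairing (volume.restrict (phaseTime T)) Prod.fst (fun n => n.2.1)
        (velKernel (kerT α0 α) 2 (fun n => n.2.2) f) g -
      conePairing (volume.restrict (phaseTime T)) Prod.fst (fun n => n.2.1)
        (velKernel (kerS α0 α) 1 (fun n => n.2.2) (transport ft fx)) g -
      conePairing ((volume.restrict (Ioo 0 T)).prod (volume : Measure (E2 × E3))) Prod.fst
        (fun n => planePoint n.2.1) (velKernel (kerP α0 α) 1 (fun n => n.2.2)
          fun n => f (n.1, planePoint n.2.1, n.2.2)) g +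
      conePairing ((volume.restrict Ω).prod (volume : Measure E3)) (fun _ => 0) Prod.fst
        (velKernel (kerI α0 α) 1 Prod.snd fun n => f (0, n.1, n.2)) g =
    (∫ p in spaceTime T, source α0 α ft fx p * φ p) -
      ∫ q in Ioo 0 T ×ˢ (univ : Set E2),
        datum α f (q.1, planePoint q.2) * φ (q.1, planePoint q.2) := by
  have hd := hf.isLocalDensity_deriv hα.smooth_time.continuous hα.smooth_space.continuous
    hα.abs_time_le hα.norm_le
  have hb2 : ∀ v, |α v 2| ≤ 1 := fun v => (PiLp.norm_apply_le (α v) 2).trans (hα.norm_le v)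
  have hm2 : Continuous fun v => α v 2 := by
    have := hα.smooth_space.continuous
    fun_prop
  have i1 := (isConeKernel_velKernel (τ := Prod.fst) (m := 1) (by norm_num)
    (isVelocityKernel_of_le_one (b := fun _ => 1) measurable_const (by simp)) hd
    measurable_fst (ae_phaseTime_nonneg T)).integrable hg.isWeight
  have i2 := (isConeKernel_velKernel (τ := Prod.fst) (m := 1) (by norm_num)
    (isVelocityKernel_of_le_one hm2.measurable hb2) hf.isLocalDensity_plane
    measurable_fst (ae_plane_nonneg T)).integrable hg.isWeight
  rw [conePairing_source hf hT hα hg, conePairing_eq_potential i1, conePairing_eq_potential i2,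
    (hf.integral_source_mul hα hφ).2]
  have e1 : ∫ n, 1 * (α0 n.2.2 * ft n + inner ℝ (α n.2.2) (fx n)) * potential g (n.1, n.2.1)
      ∂(volume.restrict (phaseTime T)) = ∫ p in phaseTime T,
      (α0 p.2.2 * ft p + inner ℝ (α p.2.2) (fx p)) * φ (p.1, p.2.1) := by
    refine integral_congr_ae ((ae_phaseTime_nonneg T).mono fun n hn => ?_)
    simp only [one_mul]
    rw [hφg _ (by linarith)]
  have e2 : ∫ n, α n.2.2 2 * f (n.1, planePoint n.2.1, n.2.2) *
      potential g (n.1, planePoint n.2.1) ∂((volume.restrict (Ioo 0 T)).prod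
        (volume : Measure (E2 × E3))) = ∫ n, α n.2.2 2 * f (n.1, planePoint n.2.1, n.2.2) *
      φ (n.1, planePoint n.2.1) ∂((volume.restrict (Ioo 0 T)).prod
        (volume : Measure (E2 × E3))) := by
    refine integral_congr_ae ((ae_plane_nonneg T).mono fun n hn => ?_)
    simp only
    rw [hφg _ (by linarith)]
  obtain ⟨M, hM⟩ := hφ.isWeight.bounded
  obtain ⟨R, hR⟩ := hφ.isWeight.support
  have hφm := hφ.isWeight.measurable
  have hpl := continuous_planePoint.measurable
  have i3 : Integrable (fun n : ℝ × E2 × E3 => α n.2.2 2 * f (n.1, planePoint n.2.1, n.2.2) *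
      φ (n.1, planePoint n.2.1)) ((volume.restrict (Ioo 0 T)).prod
        (volume : Measure (E2 × E3))) := by
    refine (hf.isLocalDensity_plane.integrable_mul (k := fun n => α n.2.2 2) (C := 1)
      (g := fun n => φ (n.1, planePoint n.2.1)) (M := M) (R := R) (hm2.measurable.comp (by fun_prop))
      (fun n => ?_) (by fun_prop) (fun n => hM _) (fun n hn => (hR _ hn).2)).congr
      (Eventually.of_forall fun n => by simp only; ring)
    rw [one_mul]
    exact (hb2 _).trans (one_le_bracket _)
  rw [e1, e2, integral_plane i3, ← integral_const_mul (4 * Real.pi) (fun q : ℝ × E2 => _)]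
  have e3 : ∀ q : ℝ × E2, 4 * Real.pi * (∫ v, α v 2 * f (q.1, planePoint q.2, v) *
      φ (q.1, planePoint q.2)) = datum α f (q.1, planePoint q.2) * φ (q.1, planePoint q.2) := by
    intro q
    rw [integral_mul_const, datum]
    ring
  simp only [e3]
  ring

end

/-! ### The Kirchhoff terms in dual form -/

/-- Measurable functions on the half space which are bounded on bounded sets. -/
structure IsLocallyBounded (b : E3 → ℝ) : Prop where
  aestronglyMeasurable : AEStronglyMeasurable b (volume.restrict Ω)
  bounded : ∀ R, ∃ M, ∀ y ∈ Ω, ‖y‖ < R → |b y| ≤ M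

section

variable {T : ℝ}

lemma integral_prod_dirac_unit (F : E3 × Unit → ℝ) :
    ∫ n, F n ∂((volume.restrict Ω).prod (Measure.dirac ())) = ∫ y in Ω, F (y, ()) := by
  rw [Measure.prod_dirac, (measurableEmbedding_prod_mk_right ()).integral_map]

lemma integrable_prod_dirac_unit {F : E3 × Unit → ℝ} :
    Integrable F ((volume.restrict Ω).prod (Measure.dirac ())) ↔
      IntegrableOn (fun y => F (y, ())) Ω := by
  rw [Measure.prod_dirac, (measurableEmbedding_prod_mk_right ()).integrable_map_iff]
  rfl

lemma IsLocallyBounded.isConeKernel {b : E3 → ℝ} (hb : IsLocallyBounded b) {κ : E3 → ℝ}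
    (hκ : Measurable κ) {C : ℝ} (hκC : ∀ z, |κ z| ≤ C * ((‖z‖ ^ 2)⁻¹ + 1)) :
    IsConeKernel ((volume.restrict Ω).prod (Measure.dirac ())) (fun _ => 0) Prod.fst
      fun p : E3 × E3 × Unit => κ p.1 * b p.2.1 where
  measurable_time := measurable_const
  measurable_pos := measurable_fst
  nonneg := Eventually.of_forall fun _ => le_rfl
  aestronglyMeasurable := by
    have h1 : Measurable fun p : E3 × E3 × Unit => κ p.1 := by fun_prop
    exact h1.aestronglyMeasurable.mul hb.aestronglyMeasurable.comp_fst.comp_snd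
  bound := by
    refine ⟨fun n => C * |b n.1|, fun R => ?_, Eventually.of_forall fun p => ?_⟩
    · have hS : MeasurableSet {n : E3 × Unit | ‖n.1‖ < R} :=
        measurableSet_lt (by fun_prop) measurable_const
      obtain ⟨M, hM⟩ := hb.bounded R
      have hfin : (volume.restrict Ω) (Metric.ball (0 : E3) R) ≠ ⊤ :=
        ((Measure.restrict_apply_le _ _).trans_lt measure_ball_lt_top).ne
      rw [← integrable_indicator_iff hS, integrable_prod_dirac_unit]
      have h2 : IntegrableOn (fun y => C * |b y|) (Metric.ball (0 : E3) R)
          (volume.restrict Ω) := by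
        refine Integrable.const_mul (Integrable.abs ?_) C
        refine Measure.integrableOn_of_bounded hfin hb.aestronglyMeasurable (M := M) ?_
        filter_upwards [ae_restrict_mem Metric.isOpen_ball.measurableSet,
          ae_restrict_of_ae (ae_restrict_mem measurableSet_Ω)] with y hy hy'
        exact hM y hy' (by simpa using hy)
      refine ((integrable_indicator_iff Metric.isOpen_ball.measurableSet).2 h2).congr
        (Eventually.of_forall fun y => ?_)
      simp [indicator]
    · rw [abs_mul]
      calc |κ p.1| * |b p.2.1| ≤ C * ((‖p.1‖ ^ 2)⁻¹ + 1) * |b p.2.1| :=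
            mul_le_mul_of_nonneg_right (hκC _) (abs_nonneg _)
        _ = _ := by ring

lemma IsConeKernel.add {N : Type*} [MeasurableSpace N] {ν : Measure N} {τ : N → ℝ} {pos : N → E3}
    {H K : E3 × N → ℝ} (hH : IsConeKernel ν τ pos H) (hK : IsConeKernel ν τ pos K) :
    IsConeKernel ν τ pos fun p => H p + K p where
  measurable_time := hH.measurable_time
  measurable_pos := hH.measurable_pos
  nonneg := hH.nonneg
  aestronglyMeasurable := hH.aestronglyMeasurable.add hK.aestronglyMeasurable
  bound := by
    obtain ⟨b, hb, hbH⟩ := hH.bound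
    obtain ⟨c, hc, hcK⟩ := hK.bound
    refine ⟨fun n => b n + c n, fun R => (hb R).add (hc R), ?_⟩
    filter_upwards [hbH, hcK] with p h1 h2
    rw [add_mul]
    exact (abs_add_le _ _).trans (add_le_add h1 h2)

/-- Initial data `u(0) = u₀`, `∂ₜ u(0) = u₁`. -/
structure IsInitialDatum (u₀ u₁ : E3 → ℝ) : Prop where
  contDiffOn : ContDiffOn ℝ 1 u₀ Ωbar
  isLocallyBounded : IsLocallyBounded u₁

lemma convex_Ωbar : Convex ℝ Ωbar := by
  intro x hx y hy a b ha hb _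
  have h1 : 0 ≤ x 2 := hx
  have h2 : 0 ≤ y 2 := hy
  show 0 ≤ (a • x + b • y) 2
  simp only [PiLp.add_apply, PiLp.smul_apply, smul_eq_mul]
  positivity

lemma Ωbar_mem_nhds {y : E3} (hy : y ∈ Ω) : Ωbar ∈ 𝓝 y :=
  mem_of_superset (isOpen_Ω.mem_nhds hy) Ω_subset_Ωbar

lemma uniqueDiffOn_Ωbar : UniqueDiffOn ℝ Ωbar :=
  uniqueDiffOn_convex convex_Ωbar
    ⟨e 2, mem_interior_iff_mem_nhds.2 (Ωbar_mem_nhds (by simp [Ω, e]))⟩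

lemma isLocallyBounded_of_continuousOn {u : E3 → ℝ} (h : ContinuousOn u Ωbar) :
    IsLocallyBounded u where
  aestronglyMeasurable := (h.mono Ω_subset_Ωbar).aestronglyMeasurable measurableSet_Ω
  bounded R := by
    have hc : IsCompact (Metric.closedBall (0 : E3) R ∩ Ωbar) :=
      (isCompact_closedBall 0 R).inter_right (isClosed_le continuous_const (by fun_prop))
    obtain ⟨M, hM⟩ := hc.exists_bound_of_continuousOn (h.mono inter_subset_right)
    exact ⟨M, fun y hy hyR => hM y ⟨by simpa using hyR.le, Ω_subset_Ωbar hy⟩⟩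

namespace IsInitialDatum

variable {u₀ u₁ : E3 → ℝ}

lemma differentiableAt (hu : IsInitialDatum u₀ u₁) {y : E3} (hy : y ∈ Ω) :
    DifferentiableAt ℝ u₀ y :=
  (hu.contDiffOn.contDiffAt (Ωbar_mem_nhds hy)).differentiableAt (by simp)

lemma isLocallyBounded_deriv (hu : IsInitialDatum u₀ u₁) (u : E3) :
    IsLocallyBounded fun y => fderiv ℝ u₀ y u := by
  have h1 : ContinuousOn (fun y => fderivWithin ℝ u₀ Ωbar y u) Ωbar :=
    (hu.contDiffOn.continuousOn_fderivWithin uniqueDiffOn_Ωbar (by simp)).clm_apply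
      continuousOn_const
  have h2 := isLocallyBounded_of_continuousOn h1
  have h3 : ∀ y ∈ Ω, fderivWithin ℝ u₀ Ωbar y u = fderiv ℝ u₀ y u := fun y hy => by
    rw [fderivWithin_of_mem_nhds (Ωbar_mem_nhds hy)]
  refine ⟨h2.aestronglyMeasurable.congr ?_, fun R => ?_⟩
  · filter_upwards [ae_restrict_mem measurableSet_Ω] with y hy using h3 y hy
  · obtain ⟨M, hM⟩ := h2.bounded R
    exact ⟨M, fun y hy hyR => by rw [← h3 y hy]; exact hM y hy hyR⟩

lemma isLocallyBounded_value (hu : IsInitialDatum u₀ u₁) : IsLocallyBounded u₀ :=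
  isLocallyBounded_of_continuousOn hu.contDiffOn.continuousOn

end IsInitialDatum

lemma abs_apply_mul_inv_norm_sq_le (z : E3) (j : Fin 3) : |z j * (‖z‖ ^ 2)⁻¹| ≤ ‖z‖⁻¹ := by
  rw [abs_mul, abs_of_nonneg (by positivity : 0 ≤ (‖z‖ ^ 2)⁻¹)]
  rcases eq_or_ne z 0 with rfl | hz
  · simp
  · have h1 : ‖z‖ ≠ 0 := norm_ne_zero_iff.2 hz
    calc |z j| * (‖z‖ ^ 2)⁻¹ ≤ ‖z‖ * (‖z‖ ^ 2)⁻¹ :=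
          mul_le_mul_of_nonneg_right (PiLp.norm_apply_le z j) (by positivity)
      _ = ‖z‖⁻¹ := by field_simp

lemma inv_norm_le (z : E3) : ‖z‖⁻¹ ≤ 1 * ((‖z‖ ^ 2)⁻¹ + 1) := by
  have h := inv_pow_le_inv_sq_add_one ‖z‖ (m := 1) (by norm_num)
  rwa [pow_one, ← one_mul ((‖z‖ ^ 2)⁻¹ + 1)] at h

lemma fderiv_eq_sum (u : E3 → ℝ) (y z : E3) :
    fderiv ℝ u y z = z 0 * fderiv ℝ u y (e 0) + z 1 * fderiv ℝ u y (e 1) +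
      z 2 * fderiv ℝ u y (e 2) := by
  conv_lhs => rw [eq_sum_smul_e z]
  simp

end

section

variable {T : ℝ} {u₀ u₁ : E3 → ℝ} {g : ℝ × E3 → ℝ}

lemma kirchhoffKernel_eq (p : E3 × E3 × Unit) : kirchhoffKernel u₀ u₁ p = (4 * Real.pi)⁻¹ *
    (‖p.1‖⁻¹ * u₁ p.2.1 + (‖p.1‖ ^ 2)⁻¹ * u₀ p.2.1 -
      ∑ j, p.1 j * (‖p.1‖ ^ 2)⁻¹ * fderiv ℝ u₀ p.2.1 (e j)) := by
  rw [kirchhoffKernel, fderiv_eq_sum]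
  have h : (‖p.1‖ ^ 2)⁻¹ * ‖p.1‖ = ‖p.1‖⁻¹ := by
    rcases eq_or_ne p.1 0 with h0 | h0
    · simp [h0]
    · have := norm_ne_zero_iff.2 h0
      field_simp
  rw [← h]
  simp only [Fin.sum_univ_three]
  ring

/-- Products `κ(z) b(y)` with `κ` singular at most like `|z|⁻²` and `b` locally bounded can be paired
with test functions along the light cones with vertices at `t = 0`. -/
lemma IsLocallyBounded.integrable {b : E3 → ℝ} (hb : IsLocallyBounded b) {κ : E3 → ℝ}
    (hκ : Measurable κ) {C : ℝ} (hκC : ∀ z, |κ z| ≤ C * ((‖z‖ ^ 2)⁻¹ + 1)) (hg : IsWeight T g) :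
    Integrable (fun p : E3 × E3 × Unit => κ p.1 * b p.2.1 * g (‖p.1‖, p.2.1 + p.1))
      ((volume : Measure E3).prod ((volume.restrict Ω).prod (Measure.dirac ()))) := by
  have h := (hb.isConeKernel hκ hκC).integrable hg
  simp only [zero_add] at h
  exact h

lemma inv_norm_sq_le (z : E3) : |(‖z‖ ^ 2)⁻¹| ≤ 1 * ((‖z‖ ^ 2)⁻¹ + 1) := by
  rw [abs_of_nonneg (by positivity)]
  linarith

lemma abs_inv_norm_le (z : E3) : |‖z‖⁻¹| ≤ 1 * ((‖z‖ ^ 2)⁻¹ + 1) := by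
  rw [abs_of_nonneg (by positivity)]
  exact inv_norm_le z

lemma abs_apply_mul_inv_norm_sq_le_add_one (j : Fin 3) (z : E3) :
    |z j * (‖z‖ ^ 2)⁻¹| ≤ 1 * ((‖z‖ ^ 2)⁻¹ + 1) :=
  (abs_apply_mul_inv_norm_sq_le z j).trans (inv_norm_le z)

lemma IsInitialDatum.isConeKernel_kirchhoffKernel (hu : IsInitialDatum u₀ u₁) :
    IsConeKernel ((volume.restrict Ω).prod (Measure.dirac ())) (fun _ => 0) Prod.fst
      (kirchhoffKernel u₀ u₁) := by
  have hg := fun j : Fin 3 => (hu.isLocallyBounded_deriv (e j)).isConeKernel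
    (κ := fun z => -(4 * Real.pi)⁻¹ * (z j * (‖z‖ ^ 2)⁻¹)) (C := |-(4 * Real.pi)⁻¹| * 1)
    (by fun_prop) fun z => by
      rw [abs_mul, mul_assoc]
      exact mul_le_mul_of_nonneg_left (abs_apply_mul_inv_norm_sq_le_add_one j z) (abs_nonneg _)
  have h1 := hu.isLocallyBounded.isConeKernel
    (κ := fun z => (4 * Real.pi)⁻¹ * ‖z‖⁻¹) (C := |(4 * Real.pi)⁻¹| * 1)
    (by fun_prop) fun z => by
      rw [abs_mul, mul_assoc]
      exact mul_le_mul_of_nonneg_left (abs_inv_norm_le z) (abs_nonneg _)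
  have h0 := hu.isLocallyBounded_value.isConeKernel
    (κ := fun z => (4 * Real.pi)⁻¹ * (‖z‖ ^ 2)⁻¹) (C := |(4 * Real.pi)⁻¹| * 1)
    (by fun_prop) fun z => by
      rw [abs_mul, mul_assoc]
      exact mul_le_mul_of_nonneg_left (inv_norm_sq_le z) (abs_nonneg _)
  have h := (h1.add h0).add (((hg 0).add (hg 1)).add (hg 2))
  have heq : kirchhoffKernel u₀ u₁ = _ := funext fun p => by
    rw [kirchhoffKernel_eq, Fin.sum_univ_three]
  rw [heq]
  convert h using 2 with p
  ring

lemma integral_prod_dirac_symm {F : E3 × E3 × Unit → ℝ}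
    (hF : Integrable F ((volume : Measure E3).prod ((volume.restrict Ω).prod (Measure.dirac ())))) :
    ∫ p, F p ∂((volume : Measure E3).prod ((volume.restrict Ω).prod (Measure.dirac ()))) =
      ∫ y in Ω, ∫ z, F (z, y, ()) := by
  rw [integral_prod_symm _ hF, integral_prod_dirac_unit]

/-- The terms of the Kirchhoff kernel with `u₀`, integrated by parts along the light cones: the sum
over `j` of the integrations by parts in `zⱼ` with the kernel `zⱼ / |z|²`, whose divergence is
`|z|⁻²`. -/
lemma IsLocallyBounded.integral_cone (hu : IsLocallyBounded u₀) (hg : IsTest T g) :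
    (∫ p : E3 × E3 × Unit, ‖p.1‖⁻¹ * u₀ p.2.1 * pd (1, 0) g (‖p.1‖, p.2.1 + p.1)
        ∂((volume : Measure E3).prod ((volume.restrict Ω).prod (Measure.dirac ())))) +
      (∫ p : E3 × E3 × Unit, (‖p.1‖ ^ 2)⁻¹ * u₀ p.2.1 * g (‖p.1‖, p.2.1 + p.1)
        ∂((volume : Measure E3).prod ((volume.restrict Ω).prod (Measure.dirac ())))) +
      (∑ j, ∫ p : E3 × E3 × Unit, p.1 j * (‖p.1‖ ^ 2)⁻¹ * u₀ p.2.1 *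
          pd (0, e j) g (‖p.1‖, p.2.1 + p.1)
        ∂((volume : Measure E3).prod ((volume.restrict Ω).prod (Measure.dirac ())))) = 0 := by
  set μ : Measure (E3 × E3 × Unit) :=
    (volume : Measure E3).prod ((volume.restrict Ω).prod (Measure.dirac ())) with hμ
  have hr : ∀ (j : Fin 3) (z : E3), |z j / ‖z‖| ≤ 1 := fun j z => by
    have h1 := abs_inner_div_norm_le z (e j)
    rw [inner_e] at h1
    simpa [e] using h1
  have hm : ∀ j : Fin 3, Measurable fun z : E3 => z j * (‖z‖ ^ 2)⁻¹ := fun j => by fun_prop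
  have hκt : ∀ (j : Fin 3) (z : E3), |z j * (‖z‖ ^ 2)⁻¹ * (z j / ‖z‖)| ≤
      1 * ((‖z‖ ^ 2)⁻¹ + 1) := fun j z => by
    rw [abs_mul]
    exact (mul_le_of_le_one_right (abs_nonneg _) (hr j z)).trans
      (abs_apply_mul_inv_norm_sq_le_add_one j z)
  have hκ' : ∀ (j : Fin 3) (z : E3), |(‖z‖ ^ 2)⁻¹ * (1 - 2 * (z j / ‖z‖) ^ 2)| ≤
      1 * (‖z‖ ^ 2)⁻¹ := fun j z => by
    have h1 := hr j z
    have h2 : (z j / ‖z‖) ^ 2 ≤ 1 := by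
      rw [← sq_abs]
      exact pow_le_one₀ (abs_nonneg _) h1
    rw [abs_mul, abs_of_nonneg (by positivity : 0 ≤ (‖z‖ ^ 2)⁻¹), mul_comm]
    refine mul_le_mul_of_nonneg_right (abs_le.2 ⟨?_, ?_⟩) (by positivity)
    · linarith
    · nlinarith [sq_nonneg (z j / ‖z‖)]
  have i1 := fun j : Fin 3 => hu.integrable (hm j) (abs_apply_mul_inv_norm_sq_le_add_one j)
    (hg.pd (0, e j)).isWeight
  have i2 := fun j : Fin 3 => hu.integrable (κ := fun z => z j * (‖z‖ ^ 2)⁻¹ * (z j / ‖z‖))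
    (by fun_prop) (hκt j) (hg.pd (1, 0)).isWeight
  have i3 := fun j : Fin 3 => hu.integrable (C := 1)
    (κ := fun z => (‖z‖ ^ 2)⁻¹ * (1 - 2 * (z j / ‖z‖) ^ 2)) (by fun_prop)
    (fun z => (hκ' j z).trans (by linarith)) hg.isWeight
  have hj : ∀ j : Fin 3, (∫ p, p.1 j * (‖p.1‖ ^ 2)⁻¹ * u₀ p.2.1 *
        pd (0, e j) g (‖p.1‖, p.2.1 + p.1) ∂μ) +
      (∫ p, p.1 j * (‖p.1‖ ^ 2)⁻¹ * (p.1 j / ‖p.1‖) * u₀ p.2.1 *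
        pd (1, 0) g (‖p.1‖, p.2.1 + p.1) ∂μ) +
      (∫ p, (‖p.1‖ ^ 2)⁻¹ * (1 - 2 * (p.1 j / ‖p.1‖) ^ 2) * u₀ p.2.1 *
        g (‖p.1‖, p.2.1 + p.1) ∂μ) = 0 := by
    intro j
    have e1 := integral_add ((i1 j).add (i2 j)) (i3 j)
    have e2 := integral_add (i1 j) (i2 j)
    have e3 := integral_prod_dirac_symm (((i1 j).add (i2 j)).add (i3 j))
    have e4 : ∀ y : E3, _ = (0 : ℝ) := fun y => (integral_const_mul (u₀ y) _).trans
      ((congrArg (u₀ y * ·) (integral_kernel_cone (C := 1) (hm j) (by fun_prop)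
        (fun z => by simpa using abs_apply_mul_inv_norm_sq_le z j) (hκ' j) (e j)
        (fun z hz => hasLineDerivAt_apply_mul_inv_norm_sq hz j) hg.1 hg.2.1 0 y)).trans
          (mul_zero _))
    have e5 := e1.symm.trans (e3.trans ((integral_congr_ae (Eventually.of_forall fun y =>
      Eq.trans (integral_congr_ae (Eventually.of_forall fun z => by
        simp only [Pi.add_apply, inner_e, zero_add]
        ring)) (e4 y))).trans (integral_zero _ _)))
    exact (congrArg (· + _) e2).symm.trans e5
  have hz0 : ∀ᵐ p ∂μ, p.1 ≠ 0 :=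
    Measure.quasiMeasurePreserving_fst.ae (p := fun z : E3 => z ≠ 0)
      (compl_mem_ae_iff.2 (measure_singleton _))
  have hsum : ∀ z : E3, z ≠ 0 → ∑ j, (z j / ‖z‖) ^ 2 = 1 := fun z hz => by
    have h1 := norm_ne_zero_iff.2 hz
    have h2 := EuclideanSpace.norm_sq_eq z
    simp only [div_pow]
    rw [← Finset.sum_div, div_eq_one_iff_eq (by positivity), h2]
    simp
  have e6 : ∫ p : E3 × E3 × Unit, ‖p.1‖⁻¹ * u₀ p.2.1 * pd (1, 0) g (‖p.1‖, p.2.1 + p.1) ∂μ =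
      ∑ j, ∫ p, p.1 j * (‖p.1‖ ^ 2)⁻¹ * (p.1 j / ‖p.1‖) * u₀ p.2.1 *
        pd (1, 0) g (‖p.1‖, p.2.1 + p.1) ∂μ := by
    rw [← integral_finsetSum _ fun j _ => i2 j]
    refine integral_congr_ae (hz0.mono fun p hp => ?_)
    have h1 := hsum p.1 hp
    have h2 := norm_ne_zero_iff.2 hp
    simp only
    rw [← Finset.sum_mul, ← Finset.sum_mul]
    congr 2
    calc ‖p.1‖⁻¹ = ‖p.1‖⁻¹ * ∑ j, (p.1 j / ‖p.1‖) ^ 2 := by rw [h1, mul_one]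
      _ = _ := by
        rw [Finset.mul_sum]
        refine Finset.sum_congr rfl fun j _ => ?_
        field_simp
  have e7 : ∫ p : E3 × E3 × Unit, (‖p.1‖ ^ 2)⁻¹ * u₀ p.2.1 * g (‖p.1‖, p.2.1 + p.1) ∂μ =
      ∑ j, ∫ p, (‖p.1‖ ^ 2)⁻¹ * (1 - 2 * (p.1 j / ‖p.1‖) ^ 2) * u₀ p.2.1 *
        g (‖p.1‖, p.2.1 + p.1) ∂μ := by
    rw [← integral_finsetSum _ fun j _ => i3 j]
    refine integral_congr_ae (hz0.mono fun p hp => ?_)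
    have h1 := hsum p.1 hp
    simp only [Fin.sum_univ_three] at h1 ⊢
    linear_combination (2 * ((‖p.1‖ ^ 2)⁻¹ * u₀ p.2.1 * g (‖p.1‖, p.2.1 + p.1))) * (h1)
  rw [e6, e7, ← Finset.sum_add_distrib, ← Finset.sum_add_distrib]
  refine Finset.sum_eq_zero fun j _ => ?_
  linarith [hj j]

/-- Integration by parts in `y`, for fixed `z`. The flux through the boundary plane vanishes, either
because `u₀ = 0` there or, if `g` is even, because it is odd in `z₃` for `j = 3`. -/
lemma IsInitialDatum.integral_parts (hu : IsInitialDatum u₀ u₁) (hg : IsTest T g) (j : Fin 3)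
    (hbc : (∀ t y, g (t, bar y) = g (t, y)) ∨ ∀ y : E3, y 2 = 0 → u₀ y = 0) :
    (∫ p : E3 × E3 × Unit, p.1 j * (‖p.1‖ ^ 2)⁻¹ * fderiv ℝ u₀ p.2.1 (e j) *
          g (‖p.1‖, p.2.1 + p.1)
        ∂((volume : Measure E3).prod ((volume.restrict Ω).prod (Measure.dirac ())))) +
      (∫ p : E3 × E3 × Unit, p.1 j * (‖p.1‖ ^ 2)⁻¹ * u₀ p.2.1 *
          pd (0, e j) g (‖p.1‖, p.2.1 + p.1)
        ∂((volume : Measure E3).prod ((volume.restrict Ω).prod (Measure.dirac ())))) = 0 := by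
  have hm : Measurable fun z : E3 => z j * (‖z‖ ^ 2)⁻¹ := by fun_prop
  have hb := hu.isLocallyBounded_value
  have i0 := hb.integrable hm (abs_apply_mul_inv_norm_sq_le_add_one j) hg.isWeight
  have i1 := (hu.isLocallyBounded_deriv (e j)).integrable hm (abs_apply_mul_inv_norm_sq_le_add_one j)
    hg.isWeight
  have i2 := hb.integrable hm (abs_apply_mul_inv_norm_sq_le_add_one j) (hg.pd (0, e j)).isWeight
  refine (integral_add i1 i2).symm.trans ((integral_prod _ (i1.add i2)).trans ?_)
  have hder : ∀ z : E3, ∀ y ∈ Ω, HasLineDerivAt ℝ (fun y => u₀ y * g (‖z‖, y + z))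
      (fderiv ℝ u₀ y (e j) * g (‖z‖, y + z) + u₀ y * pd (0, e j) g (‖z‖, y + z)) y (e j) := by
    intro z y hy
    have h1 := (hu.differentiableAt hy).hasFDerivAt.hasLineDerivAt (e j)
    have h2 : HasFDerivAt (fun y : E3 => (‖z‖, y + z))
        ((0 : E3 →L[ℝ] ℝ).prod (ContinuousLinearMap.id ℝ E3)) y :=
      (hasFDerivAt_const _ y).prodMk ((hasFDerivAt_id y).add_const z)
    have h3 : HasFDerivAt g (fderiv ℝ g (‖z‖, y + z)) (‖z‖, y + z) :=
      (hg.1.differentiable (by simp) _).hasFDerivAt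
    have h4 := (h3.comp y h2).hasLineDerivAt (e j)
    unfold HasLineDerivAt at h1 h4 ⊢
    refine (h1.mul h4).congr_deriv ?_
    simp [pd]
  have hz : ∀ᵐ z : E3, (∫ n, ((fun p : E3 × E3 × Unit => p.1 j * (‖p.1‖ ^ 2)⁻¹ *
        fderiv ℝ u₀ p.2.1 (e j) * g (‖p.1‖, p.2.1 + p.1)) + fun p : E3 × E3 × Unit =>
        p.1 j * (‖p.1‖ ^ 2)⁻¹ * u₀ p.2.1 * pd (0, e j) g (‖p.1‖, p.2.1 + p.1)) (z, n)
        ∂((volume.restrict Ω).prod (Measure.dirac ()))) =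
      -(z j * (‖z‖ ^ 2)⁻¹ * if j = 2 then ∫ w, u₀ (planePoint w) * g (‖z‖, planePoint w + z)
        else 0) := by
    filter_upwards [i0.prod_right_ae, (i1.add i2).prod_right_ae] with z h0 h12
    rw [integrable_prod_dirac_unit] at h0 h12
    rw [integral_prod_dirac_unit]
    by_cases hκ : z j * (‖z‖ ^ 2)⁻¹ = 0
    · simp [hκ]
    have h3 : ∀ y : E3, ((fun p : E3 × E3 × Unit => p.1 j * (‖p.1‖ ^ 2)⁻¹ *
        fderiv ℝ u₀ p.2.1 (e j) * g (‖p.1‖, p.2.1 + p.1)) + fun p : E3 × E3 × Unit =>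
        p.1 j * (‖p.1‖ ^ 2)⁻¹ * u₀ p.2.1 * pd (0, e j) g (‖p.1‖, p.2.1 + p.1)) (z, y, ()) =
        z j * (‖z‖ ^ 2)⁻¹ * (fderiv ℝ u₀ y (e j) * g (‖z‖, y + z) +
          u₀ y * pd (0, e j) g (‖z‖, y + z)) := fun y => by
      simp only [Pi.add_apply]
      ring
    simp only [h3, IntegrableOn] at h12 ⊢
    simp only [mul_assoc (z j * (‖z‖ ^ 2)⁻¹), IntegrableOn] at h0
    rw [integrable_const_mul_iff (IsUnit.mk0 _ hκ)] at h0 h12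
    rw [integral_const_mul, ← mul_neg]
    congr 1
    split_ifs with hj
    · subst hj
      obtain ⟨R, hR⟩ := hg.isWeight.support
      refine integral_Ω_normal (P := fun y => u₀ y * g (‖z‖, y + z)) 0 ?_
        (fun y hy _ => hder z y hy) (R + ‖z‖) ?_ h12
      · exact (hu.contDiffOn.continuousOn.mul
          (hg.1.continuous.comp (by fun_prop)).continuousOn).mono sdiff_subset
      · intro y _ hy
        have : g (‖z‖, y + z) = 0 := by
          by_contra hne
          have h4 := (hR _ hne).2
          have h5 := norm_sub_le (y + z) z
          simp only [add_sub_cancel_right] at h5 h4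
          linarith
        simp [this]
    · rw [neg_zero]
      refine setIntegral_lineDeriv_eq_zero (P := fun y => u₀ y * g (‖z‖, y + z)) measurableSet_Ω
        (e j) 0 ?_ (fun y hy _ => hder z y hy) h0 h12
      intro y r hy
      have : e j 2 = 0 := by
        simp [e, Ne.symm hj]
      simpa [Ω, this] using hy
  rw [integral_congr_ae hz, integral_neg, neg_eq_zero]
  split_ifs with hj
  · subst hj
    rcases hbc with hev | hzero
    · -- the flux through the boundary plane is odd under reflection
      have h1 := measurePreserving_bar.integral_comp measurableEmbedding_bar fun z : E3 =>
        z 2 * (‖z‖ ^ 2)⁻¹ * ∫ w, u₀ (planePoint w) * g (‖z‖, planePoint w + z)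
      have h2 : ∀ z : E3, bar z 2 * (‖bar z‖ ^ 2)⁻¹ * (∫ w, u₀ (planePoint w) *
          g (‖bar z‖, planePoint w + bar z)) =
          -(z 2 * (‖z‖ ^ 2)⁻¹ * ∫ w, u₀ (planePoint w) * g (‖z‖, planePoint w + z)) := by
        intro z
        have h3 : ∀ w, g (‖z‖, planePoint w + bar z) = g (‖z‖, planePoint w + z) := fun w => by
          have h4 := bar_add (planePoint w) z
          rw [bar_planePoint] at h4
          rw [← h4, hev]
        have h5 : ‖bar z‖ = ‖z‖ := norm_bar z
        have h6 : bar z 2 = - z 2 := by simp [bar]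
        rw [h5, h6]
        simp only [h3]
        ring
      simp only [h2, integral_neg] at h1
      linarith
    · have h1 : ∀ w, u₀ (planePoint w) = 0 := fun w => hzero _ (planePoint_two w)
      simp [h1]
  · simp

/-- The Kirchhoff term, integrated against `g`, gives the pairing of the initial data with the
potential of `g`. -/
lemma IsInitialDatum.conePairing_kirchhoffKernel (hu : IsInitialDatum u₀ u₁) (hg : IsTest T g)
    {φ : ℝ × E3 → ℝ} (hφg : ∀ p : ℝ × E3, -1 ≤ p.1 → φ p = potential g p)
    (hbc : (∀ t y, g (t, bar y) = g (t, y)) ∨ ∀ y : E3, y 2 = 0 → u₀ y = 0) :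
    conePairing ((volume.restrict Ω).prod (Measure.dirac ())) (fun _ => 0) Prod.fst
      (kirchhoffKernel u₀ u₁) g = initialPairing u₀ u₁ φ := by
  have hb := hu.isLocallyBounded_value
  have i1 := hu.isLocallyBounded.integrable (κ := fun z => ‖z‖⁻¹) (by fun_prop) abs_inv_norm_le
    hg.isWeight
  have i0 := hb.integrable (κ := fun z => (‖z‖ ^ 2)⁻¹) (by fun_prop) inv_norm_sq_le hg.isWeight
  have it := hb.integrable (κ := fun z => ‖z‖⁻¹) (by fun_prop) abs_inv_norm_le
    (hg.pd (1, 0)).isWeight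
  have ij := fun j : Fin 3 => (hu.isLocallyBounded_deriv (e j)).integrable
    (κ := fun z => z j * (‖z‖ ^ 2)⁻¹) (by fun_prop) (abs_apply_mul_inv_norm_sq_le_add_one j) hg.isWeight
  have eA := hb.integral_cone hg
  have eB := fun j => hu.integral_parts hg j hbc
  have hπ := Real.pi_ne_zero
  have dφ : ∀ x, deriv (fun s => φ (s, x)) 0 = potential (pd (1, 0) g) (0, x) := by
    intro x
    rw [← pd_potential hg.1 hg.2.1, ← deriv_time_eq_pd (contDiff_potential hg.1 hg.2.1)]
    refine Filter.EventuallyEq.deriv_eq ?_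
    filter_upwards [Ioi_mem_nhds (show (-1 : ℝ) < 0 by norm_num)] with s hs
    exact hφg (s, x) (le_of_lt hs)
  have hpot : ∀ (g : ℝ × E3 → ℝ) (b : E3 → ℝ) (y : E3),
      ∫ z : E3, ‖z‖⁻¹ * b y * g (‖z‖, y + z) = 4 * Real.pi * (b y * potential g (0, y)) := by
    intro g b y
    have h1 : ∀ z : E3, ‖z‖⁻¹ * b y * g (‖z‖, y + z) = b y * (‖z‖⁻¹ * g (0 + ‖z‖, y + z)) :=
      fun z => by rw [zero_add]; ring
    simp only [h1]
    rw [integral_const_mul, potential]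
    field_simp
  have q1 := integral_prod_dirac_symm i1
  have qt := integral_prod_dirac_symm it
  have r1 := i1.integral_prod_right
  have rt := it.integral_prod_right
  rw [integrable_prod_dirac_unit, IntegrableOn] at r1 rt
  simp only [hpot] at q1 qt r1 rt
  have e1 : initialPairing u₀ u₁ φ = (4 * Real.pi)⁻¹ *
      ((∫ y in Ω, 4 * Real.pi * (u₁ y * potential g (0, y))) -
        ∫ y in Ω, 4 * Real.pi * (u₀ y * potential (pd (1, 0) g) (0, y))) := by
    rw [← integral_sub r1 rt, ← integral_const_mul, initialPairing]
    refine integral_congr_ae (Eventually.of_forall fun y => ?_)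
    simp only [dφ]
    rw [hφg (0, y) (by norm_num)]
    field_simp
  rw [e1, ← q1, ← qt]
  have e2 := integral_sub (i1.add i0) (integrable_finsetSum Finset.univ fun j _ => ij j)
  have e3 := integral_add i1 i0
  have e4 := integral_finsetSum Finset.univ fun j _ => ij j
  have e5 : conePairing ((volume.restrict Ω).prod (Measure.dirac ())) (fun _ => 0) Prod.fst
      (kirchhoffKernel u₀ u₁) g = _ := (integral_congr_ae (Eventually.of_forall fun p => by
        simp only [kirchhoffKernel_eq, zero_add, Pi.add_apply, Fin.sum_univ_three]
        ring)).trans ((integral_const_mul (4 * Real.pi)⁻¹ _).trans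
          (congrArg ((4 * Real.pi)⁻¹ * ·) (e2.trans (congrArg₂ (· - ·) e3 e4))))
  rw [e5]
  simp only [Fin.sum_univ_three] at eA ⊢
  have b0 := eB 0
  have b1 := eB 1
  have b2 := eB 2
  congr 1
  linarith

end

/-! ### The represented field and its pairing with test functions -/

section

variable {T : ℝ}

lemma IsDual.add {X Y : ℝ × E3 → ℝ} {A B : (ℝ × E3 → ℝ) → ℝ} (hX : IsDual T X A)
    (hY : IsDual T Y B) : IsDual T (fun p => X p + Y p) fun g => A g + B g := by
  intro g hg
  obtain ⟨h1, h2⟩ := hX g hg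
  obtain ⟨h3, h4⟩ := hY g hg
  simp only [add_mul]
  exact ⟨h1.add h3, by rw [integral_add h1 h3, h2, h4]⟩

lemma IsDual.sub {X Y : ℝ × E3 → ℝ} {A B : (ℝ × E3 → ℝ) → ℝ} (hX : IsDual T X A)
    (hY : IsDual T Y B) : IsDual T (fun p => X p - Y p) fun g => A g - B g := by
  intro g hg
  obtain ⟨h1, h2⟩ := hX g hg
  obtain ⟨h3, h4⟩ := hY g hg
  simp only [sub_mul]
  exact ⟨h1.sub h3, by rw [integral_sub h1 h3, h2, h4]⟩

lemma measurePreserving_barTime_strip (T : ℝ) :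
    MeasurePreserving (fun p : ℝ × E3 => (p.1, bar p.2))
      ((volume : Measure (ℝ × E3)).restrict (Ioo 0 T ×ˢ univ))
      ((volume : Measure (ℝ × E3)).restrict (Ioo 0 T ×ˢ univ)) := by
  rw [Measure.volume_eq_prod, ← Measure.prod_restrict, Measure.restrict_univ]
  exact (MeasurePreserving.id _).prod measurePreserving_bar

lemma measurableEmbedding_barTime : MeasurableEmbedding fun p : ℝ × E3 => (p.1, bar p.2) :=
  (((Homeomorph.refl ℝ).prodCongr barIso.toHomeomorph).measurableEmbedding :)

lemma spaceTime_subset_strip (T : ℝ) : spaceTime T ⊆ Ioo 0 T ×ˢ univ :=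
  prod_mono_right (subset_univ _)

lemma measurableSet_spaceTime (T : ℝ) : MeasurableSet (spaceTime T) :=
  measurableSet_Ioo.prod measurableSet_Ω

/-- What holds almost everywhere in the whole space holds at `x` and at `x̄`. -/
lemma ae_and_ae_bar {P : ℝ × E3 → Prop}
    (h : ∀ᵐ p ∂((volume : Measure (ℝ × E3)).restrict (Ioo 0 T ×ˢ univ)), P p) :
    ∀ᵐ p ∂((volume : Measure (ℝ × E3)).restrict (spaceTime T)), P p ∧ P (p.1, bar p.2) := by
  have h1 := (measurePreserving_barTime_strip T).quasiMeasurePreserving.ae h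
  exact ae_restrict_of_ae_restrict_of_subset (spaceTime_subset_strip T) (h.and h1)

lemma IsWeight.cutΩ {g : ℝ × E3 → ℝ} (hg : IsWeight T g) : IsWeight T (cutΩ g) := by
  have hle : ∀ p, RVM.cutΩ g p ≠ 0 → RVM.cutΩ g p = g p := fun p hp => by
    have h1 : p ∈ {p : ℝ × E3 | p.2 ∈ Ω} := mem_of_indicator_ne_zero hp
    exact indicator_of_mem h1 _
  refine ⟨hg.measurable.indicator (measurableSet_Ω.preimage measurable_snd), ?_, ?_⟩
  · obtain ⟨M, hM⟩ := hg.bounded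
    refine ⟨M, fun p => ?_⟩
    by_cases h : RVM.cutΩ g p = 0
    · rw [h, abs_zero]
      exact (abs_nonneg _).trans (hM p)
    · rw [hle p h]
      exact hM p
  · obtain ⟨R, hR⟩ := hg.support
    exact ⟨R, fun p hp => hR p (by rw [← hle p hp]; exact hp)⟩

lemma IsWeight.comp_bar {g : ℝ × E3 → ℝ} (hg : IsWeight T g) :
    IsWeight T fun p => g (p.1, bar p.2) := by
  refine ⟨hg.measurable.comp measurableEmbedding_barTime.measurable, ?_, ?_⟩
  · obtain ⟨M, hM⟩ := hg.bounded
    exact ⟨M, fun p => hM _⟩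
  · obtain ⟨R, hR⟩ := hg.support
    exact ⟨R, fun p hp => by simpa only [norm_bar] using hR _ hp⟩

lemma IsWeight.reflect {g : ℝ × E3 → ℝ} (hg : IsWeight T g) (σ : ℝ) :
    IsWeight T (reflect σ g) := by
  have hb := hg.comp_bar
  refine ⟨hg.measurable.add (hb.measurable.const_mul σ), ?_, ?_⟩
  · obtain ⟨M, hM⟩ := hg.bounded
    refine ⟨M + |σ| * M, fun p => (abs_add_le _ _).trans (add_le_add (hM _) ?_)⟩
    rw [abs_mul]
    exact mul_le_mul_of_nonneg_left (hM _) (abs_nonneg _)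
  · obtain ⟨R, hR⟩ := hg.support
    refine ⟨R, fun p hp => ?_⟩
    by_cases h : g p = 0
    · have h2 : g (p.1, bar p.2) ≠ 0 := by
        intro h3
        exact hp (by simp [RVM.reflect, h, h3])
      simpa only [norm_bar] using hR _ h2
    · exact hR p h

/-- Integrating the reflected sum `X(t,x) + σ X(t,x̄)` over the half space amounts to integrating `X`
over the whole space against the reflection of the weight. -/
lemma IsDual.reflect {X : ℝ × E3 → ℝ} {A : (ℝ × E3 → ℝ) → ℝ} (hX : IsDual T X A) (σ : ℝ)
    {g : ℝ × E3 → ℝ} (hg : IsWeight T g) :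
    IntegrableOn (fun p => (X p + σ * X (p.1, bar p.2)) * g p) (spaceTime T) ∧
      ∫ p in spaceTime T, (X p + σ * X (p.1, bar p.2)) * g p = A (reflect σ (cutΩ g)) := by
  have h1 := (hX _ hg.cutΩ).1
  have h2 := (hX _ hg.cutΩ.comp_bar).1
  obtain ⟨-, h3⟩ := hX _ (hg.cutΩ.reflect σ)
  have hmp := measurePreserving_barTime_strip T
  have h4 : IntegrableOn (fun p => X (p.1, bar p.2) * cutΩ g p) (Ioo 0 T ×ˢ univ) := by
    have := (hmp.integrable_comp_emb measurableEmbedding_barTime).2 h2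
    simp only [Function.comp_def, bar_bar] at this
    exact this
  have h5 : ∫ p in Ioo 0 T ×ˢ univ, X (p.1, bar p.2) * cutΩ g p =
      ∫ p in Ioo 0 T ×ˢ univ, X p * cutΩ g (p.1, bar p.2) := by
    rw [← hmp.integral_comp measurableEmbedding_barTime]
    simp only [bar_bar]
  have hS : (Ioo 0 T ×ˢ univ) ∩ {p : ℝ × E3 | p.2 ∈ Ω} = spaceTime T := by
    ext p
    simp [spaceTime]
  have h6 : (fun p => X p * cutΩ g p + σ * (X (p.1, bar p.2) * cutΩ g p)) =
      {p : ℝ × E3 | p.2 ∈ Ω}.indicator fun p => (X p + σ * X (p.1, bar p.2)) * g p := by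
    funext p
    unfold cutΩ indicator
    split_ifs <;> ring
  have hm : MeasurableSet {p : ℝ × E3 | p.2 ∈ Ω} := measurableSet_Ω.preimage measurable_snd
  have h7 : Integrable (fun p => X p * cutΩ g p + σ * (X (p.1, bar p.2) * cutΩ g p))
      (volume.restrict (Ioo 0 T ×ˢ univ)) := h1.add (h4.const_mul σ)
  have h8 : ∫ p in Ioo 0 T ×ˢ univ, (X p * cutΩ g p + σ * (X (p.1, bar p.2) * cutΩ g p)) =
      A (RVM.reflect σ (cutΩ g)) := by
    rw [integral_add h1 (h4.const_mul σ), integral_const_mul, h5, ← integral_const_mul,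
      ← integral_add h1 (h2.const_mul σ), ← h3]
    refine integral_congr_ae (Eventually.of_forall fun p => ?_)
    simp only [RVM.reflect]
    ring
  rw [h6] at h7 h8
  rw [setIntegral_indicator hm, hS] at h8
  rw [integrable_indicator_iff hm, IntegrableOn, Measure.restrict_restrict hm, inter_comm, hS] at h7
  exact ⟨h7, h8⟩

variable {f ft : ℝ × E3 × E3 → ℝ} {fx : ℝ × E3 × E3 → E3} {α0 : E3 → ℝ} {α : E3 → E3}
  {u₀ u₁ : E3 → ℝ}

/-- The integrals of the representation formulas over the upper half of the ball, sphere and disc,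
for a general source operator and general initial data. -/
def upperField (α0 : E3 → ℝ) (α : E3 → E3) (f ft : ℝ × E3 × E3 → ℝ) (fx : ℝ × E3 × E3 → E3)
    (u₀ u₁ : E3 → ℝ) (p : ℝ × E3) : ℝ :=
  kirchhoffTerm .upper u₀ u₁ p.1 p.2 + (bulkTerm .upper (kerT α0 α) 2 f p.1 p.2 -
    bulkTerm .upper (kerS α0 α) 1 (transport ft fx) p.1 p.2 -
    planeTerm .upper (kerP α0 α) f p.1 p.2 + initialTerm .upper (kerI α0 α) f p.1 p.2)

/-- The field represented by the formulas: the integrals over the upper half at `x`, and their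
reflection. -/
def field (σ : ℝ) (α0 : E3 → ℝ) (α : E3 → E3) (f ft : ℝ × E3 × E3 → ℝ) (fx : ℝ × E3 × E3 → E3)
    (u₀ u₁ : E3 → ℝ) (p : ℝ × E3) : ℝ :=
  upperField α0 α f ft fx u₀ u₁ p + σ * upperField α0 α f ft fx u₀ u₁ (p.1, bar p.2)

/-- The right-hand side of the weak formulation of the wave equation. -/
def weakPairing (T : ℝ) (u₀ u₁ : E3 → ℝ) (G h : ℝ × E3 → ℝ) (φ : ℝ × E3 → ℝ) : ℝ :=
  (∫ p in spaceTime T, G p * φ p) + initialPairing u₀ u₁ φ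
    - ∫ q in Ioo 0 T ×ˢ (univ : Set E2), h (q.1, planePoint q.2) * φ (q.1, planePoint q.2)

/-- The integrals of the upper field against weights, computed by retarded duality; on test
functions they agree with the weak formulation evaluated at the potential. -/
lemma exists_isDual_upperField (hf : IsDensity T f ft fx) (hT : 0 < T)
    (hα : IsSourceOperator α0 α) (hu : IsInitialDatum u₀ u₁) :
    ∃ A, IsDual T (upperField α0 α f ft fx u₀ u₁) A ∧ ∀ g φ, IsTest T g → IsTest T φ →
      (∀ p : ℝ × E3, -1 ≤ p.1 → φ p = potential g p) →
      ((∀ t y, g (t, bar y) = g (t, y)) ∨ ∀ y : E3, y 2 = 0 → u₀ y = 0) →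
      A g = weakPairing T u₀ u₁ (source α0 α ft fx) (datum α f) φ := by
  have h1 := (kirchhoff_duality (T := T) hu.isConeKernel_kirchhoffKernel).2
  have h2 := (bulk_duality (m := 2) le_rfl hα.isVelocityKernel_kerT hf.isLocalDensity_phase).2
  have h3 := (bulk_duality (m := 1) (by norm_num) hα.isVelocityKernel_kerS
    hf.isLocalDensity_transport).2
  have h4 := (plane_duality hα.isVelocityKernel_kerP hf.isLocalDensity_plane).2
  have h5 := (initial_duality (T := T) hα.isVelocityKernel_kerI (hf.isLocalDensity_initial hT)).2
  refine ⟨_, h1.add (((h2.sub h3).sub h4).add h5), fun g φ hg hφ hφg hbc => ?_⟩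
  have e1 := conePairing_source_eq hf hT hα hg hφ hφg
  have e2 := hu.conePairing_kirchhoffKernel hg hφg hbc
  simp only [weakPairing]
  rw [e2, e1]
  ring

end

/-! ### Weak solutions are given by the formulas -/

section

variable {T : ℝ}

/-- Test functions with the boundary condition `∂₃ φ = 0` (`σ = 1`) or `φ = 0` (`σ = -1`). -/
def IsAdmissible (T σ : ℝ) (φ : ℝ × E3 → ℝ) : Prop :=
  (σ = 1 ∧ ∀ t ∈ Ico 0 T, ∀ x : E3, x 2 = 0 → pd (0, e 2) φ (t, x) = 0) ∨
    (σ = -1 ∧ ∀ t ∈ Ico 0 T, ∀ x : E3, x 2 = 0 → φ (t, x) = 0)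

lemma pd_congr {φ χ : ℝ × E3 → ℝ} {p : ℝ × E3} (h : φ =ᶠ[𝓝 p] χ) (a : ℝ × E3) :
    pd a φ =ᶠ[𝓝 p] pd a χ := by
  filter_upwards [h.fderiv (𝕜 := ℝ)] with q hq
  simp only [pd, hq]

lemma wave_congr {φ χ : ℝ × E3 → ℝ} {p : ℝ × E3} (h : φ =ᶠ[𝓝 p] χ) : wave φ p = wave χ p := by
  have h1 : ∀ a, pd a (pd a φ) p = pd a (pd a χ) p := fun a =>
    (pd_congr (pd_congr h a) a).eq_of_nhds
  simp only [wave, h1]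

lemma IsTest.reflect {g : ℝ × E3 → ℝ} (hg : IsTest T g) (σ : ℝ) : IsTest T (reflect σ g) := by
  refine ⟨contDiff_reflect hg.1 σ, hasCompactSupport_reflect hg.2.1 σ, ?_⟩
  have h1 : tsupport (RVM.reflect σ g) ⊆ tsupport g ∪ barTime ⁻¹' tsupport g := by
    refine closure_minimal (fun p hp => ?_)
      ((isClosed_tsupport g).union ((isClosed_tsupport g).preimage barTime.continuous))
    by_contra hne
    rw [mem_union, not_or] at hne
    have h2 : g p = 0 := image_eq_zero_of_notMem_tsupport hne.1
    have h3 : g (p.1, bar p.2) = 0 := image_eq_zero_of_notMem_tsupport hne.2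
    exact hp (by simp [RVM.reflect, h2, h3])
  intro p hp
  rcases h1 hp with h | h
  · exact hg.2.2 h
  · exact ⟨(hg.2.2 h).1, trivial⟩

lemma isAdmissible_of_eq_potential {σ : ℝ} (hσ : σ = 1 ∨ σ = -1) {ψ φ : ℝ × E3 → ℝ}
    (hψ : IsTest T ψ) (hφψ : ∀ p : ℝ × E3, -1 ≤ p.1 → φ p = potential (reflect σ ψ) p) :
    IsAdmissible T σ φ := by
  have hsm := contDiff_potential (contDiff_reflect hψ.1 σ) (hasCompactSupport_reflect hψ.2.1 σ)
  rcases hσ with rfl | rfl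
  · refine Or.inl ⟨rfl, fun t ht x hx => ?_⟩
    have h1 : φ =ᶠ[𝓝 (t, x)] potential (reflect 1 ψ) := by
      have h2 : ∀ᶠ p : ℝ × E3 in 𝓝 (t, x), -1 < p.1 :=
        continuous_fst.continuousAt.eventually (lt_mem_nhds (by simp only; linarith [ht.1]))
      exact h2.mono fun p hp => hφψ p hp.le
    rw [(pd_congr h1 _).eq_of_nhds]
    exact pd_normal_eq_zero_of_even hsm
      (fun t x => potential_reflect_bar (Or.inl rfl) ψ t x) hx
  · refine Or.inr ⟨rfl, fun t ht x hx => ?_⟩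
    rw [hφψ _ (by simp only; linarith [ht.1])]
    exact eq_zero_of_odd (fun t x => potential_reflect_bar (Or.inr rfl) ψ t x) hx

lemma LocallyIntegrableUpTo.locallyIntegrableOn {u : ℝ × E3 → ℝ} (hu : LocallyIntegrableUpTo T u) :
    LocallyIntegrableOn u (spaceTime T) := by
  intro p hp
  refine ⟨Ioo 0 T ×ˢ (Ω ∩ Metric.ball 0 (‖p.2‖ + 1)), ?_, hu _⟩
  refine mem_nhdsWithin_of_mem_nhds (IsOpen.mem_nhds
    (isOpen_Ioo.prod (isOpen_Ω.inter Metric.isOpen_ball)) ⟨hp.1, hp.2, ?_⟩)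
  simp

lemma IsDual.locallyIntegrableUpTo {X : ℝ × E3 → ℝ} {A : (ℝ × E3 → ℝ) → ℝ} (hX : IsDual T X A)
    (σ : ℝ) : LocallyIntegrableUpTo T fun p => X p + σ * X (p.1, bar p.2) := by
  intro R
  have h1 := (hX.reflect σ (isWeight_indicator T R)).1
  have hS : MeasurableSet (Iio T ×ˢ Metric.ball (0 : E3) R) :=
    measurableSet_Iio.prod Metric.isOpen_ball.measurableSet
  have h2 : (fun p : ℝ × E3 => (X p + σ * X (p.1, bar p.2)) *
      (Iio T ×ˢ Metric.ball (0 : E3) R).indicator (fun _ => (1 : ℝ)) p) =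
      (Iio T ×ˢ Metric.ball (0 : E3) R).indicator fun p => X p + σ * X (p.1, bar p.2) := by
    funext p
    unfold indicator
    split_ifs <;> simp
  rw [h2, IntegrableOn, integrable_indicator_iff hS, IntegrableOn,
    Measure.restrict_restrict hS] at h1
  refine IntegrableOn.mono_set h1 ?_
  rintro p ⟨hp1, hp2, hp3⟩
  exact ⟨⟨hp1.2, hp3⟩, hp1, hp2⟩

lemma tsupport_subset_snd {ψ : ℝ × E3 → ℝ} (h : tsupport ψ ⊆ spaceTime T) :
    tsupport ψ ⊆ univ ×ˢ Ω := h.trans (prod_mono_left (subset_univ _))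

lemma cutΩ_of_tsupport_subset {ψ : ℝ × E3 → ℝ} (h : tsupport ψ ⊆ univ ×ˢ Ω) : cutΩ ψ = ψ :=
  cutΩ_eq_self fun _ hp => (h (subset_tsupport _ hp)).2

lemma reflect_even_or {σ : ℝ} {u₀ : E3 → ℝ}
    (hσ : σ = 1 ∨ (σ = -1 ∧ ∀ y : E3, y 2 = 0 → u₀ y = 0)) (ψ : ℝ × E3 → ℝ) :
    (∀ t y, reflect σ ψ (t, bar y) = reflect σ ψ (t, y)) ∨ ∀ y : E3, y 2 = 0 → u₀ y = 0 := by
  rcases hσ with rfl | ⟨-, h⟩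
  · exact Or.inl fun t y => by rw [reflect_bar (Or.inl rfl), one_mul]
  · exact Or.inr h

variable {f ft : ℝ × E3 × E3 → ℝ} {fx : ℝ × E3 × E3 → E3} {α0 : E3 → ℝ} {α : E3 → E3}
  {u₀ u₁ : E3 → ℝ}

/-- Test functions in the interior, integrated against the represented field. The potential of the
reflected test function serves as test function in the weak formulation. -/
lemma exists_test_of_interior (hf : IsDensity T f ft fx) (hT : 0 < T)
    (hα : IsSourceOperator α0 α) (hu : IsInitialDatum u₀ u₁) {σ : ℝ}
    (hσ : σ = 1 ∨ (σ = -1 ∧ ∀ y : E3, y 2 = 0 → u₀ y = 0)) {ψ : ℝ × E3 → ℝ} (hψ : IsTest T ψ)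
    (hΩ : tsupport ψ ⊆ univ ×ˢ Ω) :
    ∃ φ, IsTest T φ ∧ (∀ p : ℝ × E3, -1 ≤ p.1 → φ p = potential (reflect σ ψ) p) ∧
      IsAdmissible T σ φ ∧ (∀ p ∈ spaceTime T, box φ p = ψ p) ∧
      IntegrableOn (fun p => field σ α0 α f ft fx u₀ u₁ p * ψ p) (spaceTime T) ∧
      ∫ p in spaceTime T, field σ α0 α f ft fx u₀ u₁ p * ψ p =
        weakPairing T u₀ u₁ (source α0 α ft fx) (datum α f) φ := by
  have hσ' : σ = 1 ∨ σ = -1 := hσ.imp id And.left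
  have hg := hψ.reflect σ
  obtain ⟨φ, hφ, hφg⟩ := exists_isTest_eq_potential hg.1 hg.2.1 hg.2.2
  obtain ⟨A, hA, hAL⟩ := exists_isDual_upperField hf hT hα hu
  obtain ⟨h1, h2⟩ := hA.reflect σ hψ.isWeight
  rw [cutΩ_of_tsupport_subset hΩ, hAL _ φ hg hφ hφg (reflect_even_or hσ ψ)] at h2
  refine ⟨φ, hφ, hφg, isAdmissible_of_eq_potential hσ' hψ hφg, fun p hp => ?_, h1, h2⟩
  have h3 : φ =ᶠ[𝓝 p] potential (reflect σ ψ) := by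
    have h4 : ∀ᶠ q : ℝ × E3 in 𝓝 p, -1 < q.1 :=
      continuous_fst.continuousAt.eventually (lt_mem_nhds (by linarith [hp.1.1]))
    exact h4.mono fun q hq => hφg q hq.le
  rw [box_eq_wave hφ.1, wave_congr h3]
  exact wave_potential_reflect hσ' hψ.1 hψ.2.1 hΩ (Ω_subset_Ωbar hp.2)

lemma isOpen_spaceTime (T : ℝ) : IsOpen (spaceTime T) := isOpen_Ioo.prod isOpen_Ω

lemma locallyIntegrableUpTo_field (hf : IsDensity T f ft fx) (hT : 0 < T)
    (hα : IsSourceOperator α0 α) (hu : IsInitialDatum u₀ u₁) (σ : ℝ) :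
    LocallyIntegrableUpTo T (field σ α0 α f ft fx u₀ u₁) := by
  obtain ⟨A, hA, -⟩ := exists_isDual_upperField hf hT hα hu
  exact hA.locallyIntegrableUpTo σ

/-- A weak solution agrees with the represented field. -/
lemma ae_eq_field_of_weak (hf : IsDensity T f ft fx) (hT : 0 < T) (hα : IsSourceOperator α0 α)
    (hu : IsInitialDatum u₀ u₁) {σ : ℝ}
    (hσ : σ = 1 ∨ (σ = -1 ∧ ∀ y : E3, y 2 = 0 → u₀ y = 0)) {u : ℝ × E3 → ℝ}
    (hui : LocallyIntegrableUpTo T u)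
    (hw : ∀ φ, IsTest T φ → IsAdmissible T σ φ → ∫ p in spaceTime T, u p * box φ p =
      weakPairing T u₀ u₁ (source α0 α ft fx) (datum α f) φ) :
    ∀ᵐ p ∂((volume : Measure (ℝ × E3)).restrict (spaceTime T)),
      u p = field σ α0 α f ft fx u₀ u₁ p := by
  have hF := (locallyIntegrableUpTo_field hf hT hα hu σ).locallyIntegrableOn
  have h0 := (isOpen_spaceTime T).ae_eq_zero_of_integral_contDiff_smul_eq_zero
    (hui.locallyIntegrableOn.sub hF) fun ψ hψ hψc hψs => by
    have hψT : IsTest T ψ := ⟨hψ, hψc, fun p hp => ⟨(hψs hp).1.2, trivial⟩⟩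
    obtain ⟨φ, hφ, -, hadm, hbox, hi, heq⟩ := exists_test_of_interior hf hT hα hu hσ hψT
      (tsupport_subset_snd hψs)
    have e1 := hw φ hφ hadm
    have e2 : ∫ p in spaceTime T, u p * box φ p = ∫ p in spaceTime T, u p * ψ p :=
      setIntegral_congr_fun (measurableSet_spaceTime T) fun p hp => by
        simp only [hbox p hp]
    have i1 : IntegrableOn (fun p => u p * ψ p) (spaceTime T) := by
      obtain ⟨R, hR⟩ := hψT.isWeight.support
      obtain ⟨M, hM⟩ := hψT.isWeight.bounded
      have h1 : IntegrableOn (fun p => u p * ψ p) (Ioo 0 T ×ˢ (Ω ∩ Metric.ball 0 R)) :=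
        (hui R).mul_bdd (c := M) hψ.continuous.aestronglyMeasurable
          (Eventually.of_forall fun p => hM p)
      refine h1.of_forall_sdiff_eq_zero (measurableSet_spaceTime T) fun p hp => ?_
      by_cases hz : ψ p = 0
      · simp [hz]
      · exact absurd ⟨hp.1.1, hp.1.2, by simpa using (hR p hz).2⟩ hp.2
    have hz : ∀ p ∉ spaceTime T, ψ p • (u - field σ α0 α f ft fx u₀ u₁) p = 0 := fun p hp => by
      have : ψ p = 0 := by
        by_contra hne
        exact hp (hψs (subset_tsupport _ hne))
      simp [this]
    rw [← setIntegral_eq_integral_of_forall_compl_eq_zero hz]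
    have e3 : ∀ p, ψ p • (u - field σ α0 α f ft fx u₀ u₁) p =
        u p * ψ p - field σ α0 α f ft fx u₀ u₁ p * ψ p := fun p => by
      simp only [Pi.sub_apply, smul_eq_mul]
      ring
    simp only [e3]
    rw [integral_sub i1 hi, heq, ← e1, e2, sub_self]
  rw [ae_restrict_iff' (measurableSet_spaceTime T)]
  filter_upwards [h0] with p hp hpS
  exact sub_eq_zero.1 (hp hpS)

end

/-! ### The formulas give weak solutions -/

section

variable {T : ℝ}

/-- Uniform bounds on a function and its support. -/
structure IsBoundedBy (M R : ℝ) (g : ℝ × E3 → ℝ) : Prop where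
  bound : ∀ p, |g p| ≤ M
  support : ∀ p, g p ≠ 0 → |p.1| < R ∧ ‖p.2‖ < R

lemma IsTest.exists_isBoundedBy {g : ℝ × E3 → ℝ} (hg : IsTest T g) :
    ∃ M R, IsBoundedBy M R g := by
  obtain ⟨M, hM⟩ := hg.isWeight.bounded
  obtain ⟨R, -, hR⟩ := exists_bound_of_hasCompactSupport hg.2.1
  exact ⟨M, R, hM, hR⟩

lemma IsBoundedBy.reflect {M R σ : ℝ} {g : ℝ × E3 → ℝ} (hg : IsBoundedBy M R g) :
    IsBoundedBy (M + |σ| * M) R (reflect σ g) where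
  bound p := by
    refine (abs_add_le _ _).trans (add_le_add (hg.bound _) ?_)
    rw [abs_mul]
    exact mul_le_mul_of_nonneg_left (hg.bound _) (abs_nonneg _)
  support p hp := by
    by_cases h : g p = 0
    · have h2 : g (p.1, bar p.2) ≠ 0 := by
        intro h3
        exact hp (by simp [RVM.reflect, h, h3])
      simpa only [norm_bar] using hg.support _ h2
    · exact hg.support p h

lemma IsBoundedBy.norm_le {M R : ℝ} {g : ℝ × E3 → ℝ} (hg : IsBoundedBy M R g) {t : ℝ}
    (ht : 0 ≤ t) (x z : E3) :
    ‖‖z‖⁻¹ * g (t + ‖z‖, x + z)‖ ≤ (Metric.ball (0 : E3) R).indicator (fun z => ‖z‖⁻¹ * M) z := by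
  by_cases hz : g (t + ‖z‖, x + z) = 0
  · rw [hz, mul_zero, norm_zero]
    have hM : 0 ≤ M := (abs_nonneg _).trans (hg.bound 0)
    exact indicator_nonneg (fun _ _ => by positivity) _
  · have h1 := (hg.support _ hz).1
    simp only [abs_of_nonneg (add_nonneg ht (norm_nonneg z))] at h1
    rw [indicator_of_mem (by rw [mem_ball_zero_iff]; linarith), norm_mul, norm_inv, norm_norm]
    exact mul_le_mul_of_nonneg_left (hg.bound _) (by positivity)

lemma integrable_indicator_inv_norm (M R : ℝ) :
    Integrable ((Metric.ball (0 : E3) R).indicator fun z => ‖z‖⁻¹ * M) := by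
  have h := integrableOn_norm_pow_inv 1 (by norm_num) R
  simp only [pow_one] at h
  exact (integrable_indicator_iff Metric.isOpen_ball.measurableSet).2 (h.mul_const M)

/-- Potentials of uniformly bounded functions are uniformly bounded. -/
lemma exists_potential_bound (M R : ℝ) : ∃ K, ∀ g : ℝ × E3 → ℝ, IsBoundedBy M R g →
    ∀ t, 0 ≤ t → ∀ x, |potential g (t, x)| ≤ K ∧ (potential g (t, x) ≠ 0 → ‖x‖ < 2 * R) := by
  refine ⟨|(4 * Real.pi)⁻¹| * ∫ z, (Metric.ball (0 : E3) R).indicator (fun z => ‖z‖⁻¹ * M) z,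
    fun g hg t ht x => ⟨?_, fun hne => ?_⟩⟩
  · unfold potential
    rw [abs_mul]
    exact mul_le_mul_of_nonneg_left (norm_integral_le_of_norm_le
      (integrable_indicator_inv_norm M R) (Eventually.of_forall fun z => hg.norm_le ht x z))
      (abs_nonneg _)
  · obtain ⟨z, hz⟩ := exists_of_potential_ne_zero hne
    obtain ⟨h1, h2⟩ := hg.support _ hz
    simp only [abs_of_nonneg (add_nonneg ht (norm_nonneg z))] at h1 h2
    have h3 := norm_sub_le (x + z) z
    simp only [add_sub_cancel_right] at h3
    linarith

lemma tendsto_potential {M R : ℝ} {g : ℕ → ℝ × E3 → ℝ} {g' : ℝ × E3 → ℝ}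
    (hg : ∀ n, IsBoundedBy M R (g n)) (hm : ∀ n, Measurable (g n))
    (hlim : ∀ p, Tendsto (fun n => g n p) atTop (𝓝 (g' p))) {t : ℝ} (ht : 0 ≤ t) (x : E3) :
    Tendsto (fun n => potential (g n) (t, x)) atTop (𝓝 (potential g' (t, x))) := by
  unfold potential
  refine Tendsto.const_mul _ (tendsto_integral_of_dominated_convergence _ (fun n => ?_)
    (integrable_indicator_inv_norm M R) (fun n => Eventually.of_forall fun z =>
      (hg n).norm_le ht x z) (Eventually.of_forall fun z => (hlim _).const_mul _))
  have h := hm n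
  exact Measurable.aestronglyMeasurable (by fun_prop)

/-- Cutoff of a test function near the boundary plane. -/
def planeCut (n : ℕ) (w : ℝ × E3 → ℝ) (p : ℝ × E3) : ℝ := timeCut n (p.2 2) * w p

lemma contDiff_planeFactor (n : ℕ) : ContDiff ℝ ∞ fun p : ℝ × E3 => timeCut n (p.2 2) :=
  (contDiff_timeCut n).comp (by fun_prop)

lemma IsTest.planeCut {w : ℝ × E3 → ℝ} (hw : IsTest T w) (n : ℕ) : IsTest T (planeCut n w) :=
  ⟨(contDiff_planeFactor n).mul hw.1, hw.2.1.mul_left,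
    (tsupport_mul_subset_right (f := fun p : ℝ × E3 => timeCut n (p.2 2))).trans hw.2.2⟩

lemma IsBoundedBy.planeCut {M R : ℝ} {w : ℝ × E3 → ℝ} (hw : IsBoundedBy M R w) (n : ℕ) :
    IsBoundedBy M R (planeCut n w) where
  bound p := by
    unfold RVM.planeCut
    rw [abs_mul]
    exact (mul_le_of_le_one_left (abs_nonneg _) (timeCut_mem _ _)).trans (hw.bound p)
  support p hp := hw.support p (right_ne_zero_of_mul hp)

lemma tsupport_planeCut_subset (n : ℕ) (w : ℝ × E3 → ℝ) :
    tsupport (planeCut n w) ⊆ univ ×ˢ Ω := by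
  have hc : IsClosed {p : ℝ × E3 | 1 ≤ n * p.2 2} := isClosed_le continuous_const (by fun_prop)
  refine (closure_minimal (fun p hp => ?_) hc).trans fun p hp => ⟨trivial, ?_⟩
  · by_contra hlt
    have h1 : ¬ 1 ≤ n * p.2 2 := hlt
    refine hp ?_
    rw [planeCut, timeCut, Real.smoothTransition.zero_of_nonpos (by linarith), zero_mul]
  · have h1 : 1 ≤ n * p.2 2 := hp
    have h2 : (0 : ℝ) < n * p.2 2 := by linarith
    exact pos_of_mul_pos_right h2 (Nat.cast_nonneg n)

lemma tendsto_planeCut (w : ℝ × E3 → ℝ) (p : ℝ × E3) :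
    Tendsto (fun n => planeCut n w p) atTop (𝓝 (cutΩ w p)) := by
  by_cases hp : p.2 ∈ Ω
  · have h1 : cutΩ w p = w p := indicator_of_mem (by exact hp) _
    rw [h1]
    refine tendsto_const_nhds.congr' ?_
    filter_upwards [tendsto_cutoff (s := p.2 2) hp] with n hn
    have hn' : timeCut n (p.2 2) = 1 := hn
    rw [planeCut, hn', one_mul]
  · have h1 : cutΩ w p = 0 := indicator_of_notMem (by exact hp) _
    rw [h1]
    have h2 : p.2 2 ≤ 0 := not_lt.1 hp
    refine tendsto_const_nhds.congr fun n => ?_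
    rw [planeCut, timeCut, Real.smoothTransition.zero_of_nonpos, zero_mul]
    have := mul_nonpos_of_nonneg_of_nonpos (Nat.cast_nonneg (α := ℝ) n) h2
    linarith

lemma pd_time_reflect {g : ℝ × E3 → ℝ} (hg : ContDiff ℝ ∞ g) (σ : ℝ) :
    pd (1, 0) (reflect σ g) = reflect σ (pd (1, 0) g) := by
  funext p
  have h1 := (hg.differentiable (by simp) p).hasFDerivAt
  have h2 := ((contDiff_comp_bar hg).differentiable (by simp) p).hasFDerivAt
  have h3 : HasFDerivAt (reflect σ g) _ p := h1.add (h2.const_mul σ)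
  have h4 := pd_comp_bar hg (1, 0) p
  have h5 : bar 0 = 0 := by
    have := bar_smul 0 0
    simpa using this
  simp only [h5] at h4
  unfold pd at h4 ⊢
  rw [h3.fderiv]
  simp only [add_apply, smul_apply, smul_eq_mul, h4,
    reflect]

lemma pd_time_planeCut {w : ℝ × E3 → ℝ} (hw : ContDiff ℝ ∞ w) (n : ℕ) :
    pd (1, 0) (planeCut n w) = planeCut n (pd (1, 0) w) := by
  funext p
  rw [← deriv_time_eq_pd (ψ := planeCut n w) ((contDiff_planeFactor n).mul hw) p.1 p.2]
  simp only [planeCut]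
  rw [deriv_const_mul_field, deriv_time_eq_pd hw]

lemma wave_pd {φ : ℝ × E3 → ℝ} (h : ContDiff ℝ ∞ φ) (a : ℝ × E3) :
    wave (pd a φ) = pd a (wave φ) := by
  funext p
  have h1 : ∀ b, pd b (pd b (pd a φ)) p = pd a (pd b (pd b φ)) p := fun b => by
    rw [pd_comm h b a, pd_comm (contDiff_pd h b) b a]
  have hd : ∀ b, DifferentiableAt ℝ (pd b (pd b φ)) p := fun b =>
    (contDiff_pd (contDiff_pd h b) b).differentiable (by simp) p
  have h3 : HasFDerivAt (wave φ) _ p := (hd (1, 0)).hasFDerivAt.sub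
    (HasFDerivAt.fun_sum fun j (_ : j ∈ Finset.univ) => (hd (0, e j)).hasFDerivAt)
  have h4 : pd a (wave φ) p = _ := congrArg (fun l => l a) h3.fderiv
  rw [h4]
  simp only [wave, h1]
  simp [pd]

/-- The boundary conditions hold for all times `t ≥ 0`. -/
lemma IsAdmissible.extend {σ : ℝ} {φ : ℝ × E3 → ℝ} (h : IsAdmissible T σ φ) (hφ : IsTest T φ) :
    (σ = 1 ∧ ∀ s ≥ 0, ∀ y : E3, y 2 = 0 → pd (0, e 2) φ (s, y) = 0) ∨
      (σ = -1 ∧ ∀ s ≥ 0, ∀ y : E3, y 2 = 0 → φ (s, y) = 0) := by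
  have hz : ∀ {χ : ℝ × E3 → ℝ}, IsTest T χ → ∀ s, T ≤ s → ∀ y, χ (s, y) = 0 := by
    intro χ hχ s hs y
    by_contra hne
    have : s < T := (hχ.2.2 (subset_tsupport _ hne)).1
    linarith
  refine h.imp (fun h => ⟨h.1, fun s hs y hy => ?_⟩) fun h => ⟨h.1, fun s hs y hy => ?_⟩
  · rcases lt_or_ge s T with hsT | hsT
    · exact h.2 s ⟨hs, hsT⟩ y hy
    · exact hz (hφ.pd _) s hsT y
  · rcases lt_or_ge s T with hsT | hsT
    · exact h.2 s ⟨hs, hsT⟩ y hy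
    · exact hz hφ s hsT y

/-- A smooth function of time vanishing for `s ≥ 0` has vanishing derivative for `s ≥ 0`. -/
lemma pd_time_eq_zero {χ : ℝ × E3 → ℝ} (hχ : ContDiff ℝ ∞ χ) {y : E3}
    (h : ∀ s ≥ 0, χ (s, y) = 0) {s : ℝ} (hs : 0 ≤ s) : pd (1, 0) χ (s, y) = 0 := by
  have h1 : ∀ s > 0, pd (1, 0) χ (s, y) = 0 := fun s hs => by
    rw [← deriv_time_eq_pd hχ]
    have h2 : (fun r => χ (r, y)) =ᶠ[𝓝 s] fun _ => 0 := by
      filter_upwards [lt_mem_nhds hs] with r hr using h r hr.le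
    rw [h2.deriv_eq]
    simp
  have hc : Continuous fun s => pd (1, 0) χ (s, y) :=
    (contDiff_pd hχ _).continuous.comp (by fun_prop)
  have h3 : closure (Ioi (0 : ℝ)) ⊆ {s | pd (1, 0) χ (s, y) = 0} :=
    closure_minimal (fun s hs => h1 s hs) (isClosed_eq hc continuous_const)
  rw [closure_Ioi] at h3
  exact h3 hs

lemma IsAdmissible.pd_time {σ : ℝ} {φ : ℝ × E3 → ℝ} (h : IsAdmissible T σ φ) (hφ : IsTest T φ) :
    IsAdmissible T σ (pd (1, 0) φ) := by
  rcases h.extend hφ with ⟨hσ, h1⟩ | ⟨hσ, h1⟩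
  · refine Or.inl ⟨hσ, fun t ht x hx => ?_⟩
    rw [pd_comm hφ.1]
    exact pd_time_eq_zero (contDiff_pd hφ.1 _) (fun s hs => h1 s hs x hx) ht.1
  · exact Or.inr ⟨hσ, fun t ht x hx => pd_time_eq_zero hφ.1 (fun s hs => h1 s hs x hx) ht.1⟩

/-- The potentials of the cut off wave operator of an admissible test function approximate that
test function. -/
lemma IsAdmissible.tendsto_potential {σ : ℝ} {φ : ℝ × E3 → ℝ} (h : IsAdmissible T σ φ)
    (hφ : IsTest T φ) {t : ℝ} (ht : 0 ≤ t) {x : E3} (hx : x ∈ Ωbar) :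
    Tendsto (fun n => potential (reflect σ (planeCut n (wave φ))) (t, x)) atTop (𝓝 (φ (t, x))) := by
  obtain ⟨M, R, hMR⟩ := hφ.wave.exists_isBoundedBy
  have hbc := (h.extend hφ).imp (fun h => (⟨h.1, fun s hs => h.2 s (ht.trans hs)⟩ :
      σ = 1 ∧ ∀ s ≥ t, ∀ y : E3, y 2 = 0 → pd (0, e 2) φ (s, y) = 0))
    (fun h => (⟨h.1, fun s hs => h.2 s (ht.trans hs)⟩ :
      σ = -1 ∧ ∀ s ≥ t, ∀ y : E3, y 2 = 0 → φ (s, y) = 0))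
  rw [← potential_reflect_wave hφ.1 hφ.2.1 hx hbc]
  exact RVM.tendsto_potential (fun n => (hMR.planeCut n).reflect)
    (fun n => ((hφ.wave.planeCut n).reflect σ).1.continuous.measurable)
    (fun p => (tendsto_planeCut _ p).add ((tendsto_planeCut _ _).const_mul σ)) ht x

end

section

variable {T : ℝ} {f ft : ℝ × E3 × E3 → ℝ} {fx : ℝ × E3 × E3 → E3} {α0 : E3 → ℝ} {α : E3 → E3}
  {u₀ u₁ : E3 → ℝ}

lemma IsDensity.integrableOn_source (hf : IsDensity T f ft fx) (hα : IsSourceOperator α0 α)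
    (R : ℝ) : Integrable ((univ ×ˢ Metric.ball (0 : E3) R).indicator (source α0 α ft fx))
      (volume.restrict (spaceTime T)) := by
  have hd := hf.isLocalDensity_deriv hα.smooth_time.continuous hα.smooth_space.continuous
    hα.abs_time_le hα.norm_le
  have h1 := hd.integrable_mul (k := fun _ => 1) (C := 1) measurable_const
    (fun n => by simpa using one_le_bracket n.2.2)
    (g := fun n => (Metric.ball (0 : E3) R).indicator (fun _ => (1 : ℝ)) n.2.1) (M := 1) (R := R)
    ((measurable_const.indicator Metric.isOpen_ball.measurableSet).comp (by fun_prop))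
    (fun n => by unfold indicator; split_ifs <;> simp)
    (fun n hn => by simpa using mem_of_indicator_ne_zero hn)
  simp only [mul_one] at h1
  obtain ⟨h2, -⟩ := integral_phaseTime h1
  refine (h2.const_mul (-4 * Real.pi)).congr (Eventually.of_forall fun p => ?_)
  simp only
  rw [integral_mul_const]
  by_cases hp : p.2 ∈ Metric.ball (0 : E3) R
  · rw [indicator_of_mem hp, indicator_of_mem (mem_prod.2 ⟨mem_univ _, hp⟩), mul_one, source]
  · rw [indicator_of_notMem hp, indicator_of_notMem fun h => hp h.2]
    ring

lemma IsDensity.exists_moment_bound (hf : IsDensity T f ft fx) {k : E3 → ℝ} (hk : ∀ v, |k v| ≤ 1) :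
    ∃ D, ∀ t ∈ Ico 0 T, ∀ x ∈ Ωbar, |∫ v, k v * f (t, x, v)| ≤ D := by
  obtain ⟨b, hb, hb0, hfb⟩ := hf.exists_bound
  refine ⟨∫ v, b v, fun t ht x hx => ?_⟩
  rw [← Real.norm_eq_abs]
  refine norm_integral_le_of_norm_le hb ?_
  filter_upwards [hfb] with v hv
  rw [norm_mul]
  exact (mul_le_mul_of_nonneg_right ((hk v).trans (one_le_bracket v)) (abs_nonneg _)).trans
    (hv t ht x hx)

lemma IsDensity.measurable_moment (hf : IsDensity T f ft fx) {k : E3 → ℝ} (hk : Measurable k) :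
    Measurable fun p : ℝ × E3 => ∫ v, k v * f (p.1, p.2, v) := by
  have h3 := hf.measurable
  have h1 : Measurable fun q : (ℝ × E3) × E3 => k q.2 * f (q.1.1, q.1.2, q.2) :=
    (hk.comp measurable_snd).mul (h3.comp (by fun_prop))
  exact h1.stronglyMeasurable.integral_prod_right.measurable

lemma IsSourceOperator.abs_space_apply_le (hα : IsSourceOperator α0 α) (j : Fin 3) (v : E3) :
    |α v j| ≤ 1 := (PiLp.norm_apply_le (α v) j).trans (hα.norm_le v)

lemma IsSourceOperator.contDiff_space_apply (hα : IsSourceOperator α0 α) (j : Fin 3) :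
    ContDiff ℝ ∞ fun v => α v j := by
  have := hα.smooth_space
  fun_prop

lemma IsDensity.exists_datum_bound (hf : IsDensity T f ft fx) (hα : IsSourceOperator α0 α) :
    ∃ D, ∀ t ∈ Ico 0 T, ∀ x ∈ Ωbar, |datum α f (t, x)| ≤ D := by
  obtain ⟨D, hD⟩ := hf.exists_moment_bound (hα.abs_space_apply_le 2)
  refine ⟨|4 * Real.pi| * D, fun t ht x hx => ?_⟩
  rw [datum, abs_mul]
  exact mul_le_mul_of_nonneg_left (hD t ht x hx) (abs_nonneg _)

lemma IsDensity.measurable_datum (hf : IsDensity T f ft fx) (hα : IsSourceOperator α0 α) :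
    Measurable (datum α f) :=
  (hf.measurable_moment (hα.contDiff_space_apply 2).continuous.measurable).const_mul _

/-- The weak pairing is continuous under bounded convergence of the test functions and of their time
derivatives. -/
lemma tendsto_weakPairing (hf : IsDensity T f ft fx) (hα : IsSourceOperator α0 α)
    (hu : IsInitialDatum u₀ u₁) {φn : ℕ → ℝ × E3 → ℝ} {φ : ℝ × E3 → ℝ}
    (hφn : ∀ n, IsTest T (φn n)) (hφ : IsTest T φ) {K K' R : ℝ}
    (hK : ∀ n, ∀ t, 0 ≤ t → ∀ x, |φn n (t, x)| ≤ K ∧ (φn n (t, x) ≠ 0 → ‖x‖ < R))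
    (hK' : ∀ n, ∀ x, |pd (1, 0) (φn n) (0, x)| ≤ K' ∧
      (pd (1, 0) (φn n) (0, x) ≠ 0 → ‖x‖ < R))
    (hlim : ∀ t, 0 ≤ t → ∀ x ∈ Ωbar, Tendsto (fun n => φn n (t, x)) atTop (𝓝 (φ (t, x))))
    (hlim' : ∀ x ∈ Ωbar,
      Tendsto (fun n => pd (1, 0) (φn n) (0, x)) atTop (𝓝 (pd (1, 0) φ (0, x)))) :
    Tendsto (fun n => weakPairing T u₀ u₁ (source α0 α ft fx) (datum α f) (φn n)) atTop
      (𝓝 (weakPairing T u₀ u₁ (source α0 α ft fx) (datum α f) φ)) := by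
  have hK0 : 0 ≤ K := (abs_nonneg _).trans (hK 0 0 le_rfl 0).1
  have hK0' : 0 ≤ K' := (abs_nonneg _).trans (hK' 0 0).1
  -- the source term
  have t1 : Tendsto (fun n => ∫ p in spaceTime T, source α0 α ft fx p * φn n p) atTop
      (𝓝 (∫ p in spaceTime T, source α0 α ft fx p * φ p)) := by
    refine tendsto_integral_of_dominated_convergence _
      (fun n => (hf.integral_source_mul hα (hφn n)).1.aestronglyMeasurable)
      ((hf.integrableOn_source hα R).norm.mul_const K) (fun n => ?_) ?_
    · filter_upwards [ae_restrict_mem (measurableSet_spaceTime T)] with p hp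
      obtain ⟨h1, h2⟩ := hK n p.1 hp.1.1.le p.2
      rw [norm_mul]
      by_cases hz : φn n p = 0
      · rw [hz, norm_zero, mul_zero]
        positivity
      · have hm : p ∈ (univ : Set ℝ) ×ˢ Metric.ball (0 : E3) R :=
          mem_prod.2 ⟨mem_univ _, by simpa using h2 hz⟩
        rw [indicator_of_mem hm]
        exact mul_le_mul_of_nonneg_left h1 (norm_nonneg _)
    · filter_upwards [ae_restrict_mem (measurableSet_spaceTime T)] with p hp
      exact (hlim p.1 hp.1.1.le p.2 (Ω_subset_Ωbar hp.2)).const_mul _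
  -- the initial data
  have t2 : Tendsto (fun n => initialPairing u₀ u₁ (φn n)) atTop (𝓝 (initialPairing u₀ u₁ φ)) := by
    obtain ⟨M1, hM1⟩ := hu.isLocallyBounded.bounded R
    obtain ⟨M0, hM0⟩ := hu.isLocallyBounded_value.bounded R
    have hd : ∀ χ : ℝ × E3 → ℝ, IsTest T χ → ∀ x,
        deriv (fun s => χ (s, x)) 0 = pd (1, 0) χ (0, x) :=
      fun χ hχ x => deriv_time_eq_pd hχ.1 0 x
    unfold initialPairing
    simp only [hd _ hφ, fun n => hd _ (hφn n)]
    have hB : Integrable ((Metric.ball (0 : E3) R).indicator fun _ => |M1| * K + |M0| * K')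
        (volume.restrict Ω) := by
      rw [integrable_indicator_iff Metric.isOpen_ball.measurableSet]
      exact integrableOn_const ((Measure.restrict_apply_le _ _).trans_lt measure_ball_lt_top).ne
    refine tendsto_integral_of_dominated_convergence _ (fun n => ?_) hB (fun n => ?_) ?_
    · have c1 : Continuous fun x => φn n (0, x) := (hφn n).1.continuous.comp (by fun_prop)
      have c2 : Continuous fun x => pd (1, 0) (φn n) (0, x) :=
        (contDiff_pd (hφn n).1 _).continuous.comp (by fun_prop)
      exact (hu.isLocallyBounded.aestronglyMeasurable.mul c1.aestronglyMeasurable).sub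
        (hu.isLocallyBounded_value.aestronglyMeasurable.mul c2.aestronglyMeasurable)
    · filter_upwards [ae_restrict_mem measurableSet_Ω] with x hx
      obtain ⟨h1, h2⟩ := hK n 0 le_rfl x
      obtain ⟨h3, h4⟩ := hK' n x
      by_cases hxR : ‖x‖ < R
      · rw [indicator_of_mem (by simpa using hxR)]
        refine (norm_sub_le _ _).trans (add_le_add ?_ ?_)
        · rw [norm_mul]
          exact mul_le_mul ((hM1 x hx hxR).trans (le_abs_self _)) h1 (abs_nonneg _) (abs_nonneg _)
        · rw [norm_mul]
          exact mul_le_mul ((hM0 x hx hxR).trans (le_abs_self _)) h3 (abs_nonneg _) (abs_nonneg _)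
      · have e1 : φn n (0, x) = 0 := by
          by_contra hne
          exact hxR (h2 hne)
        have e2 : pd (1, 0) (φn n) (0, x) = 0 := by
          by_contra hne
          exact hxR (h4 hne)
        rw [e1, e2]
        simp only [mul_zero, sub_zero, norm_zero]
        exact indicator_nonneg (fun _ _ => by positivity) _
    · filter_upwards [ae_restrict_mem measurableSet_Ω] with x hx
      exact ((hlim 0 le_rfl x (Ω_subset_Ωbar hx)).const_mul _).sub
        ((hlim' x (Ω_subset_Ωbar hx)).const_mul _)
  -- the Neumann datum
  have t3 : Tendsto (fun n => ∫ q in Ioo 0 T ×ˢ (univ : Set E2),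
        datum α f (q.1, planePoint q.2) * φn n (q.1, planePoint q.2)) atTop
      (𝓝 (∫ q in Ioo 0 T ×ˢ (univ : Set E2),
        datum α f (q.1, planePoint q.2) * φ (q.1, planePoint q.2))) := by
    obtain ⟨D, hD⟩ := hf.exists_datum_bound hα
    have hpl := continuous_planePoint
    have hS : MeasurableSet ((univ : Set ℝ) ×ˢ Metric.ball (0 : E2) R) :=
      MeasurableSet.univ.prod Metric.isOpen_ball.measurableSet
    have hB : Integrable (((univ : Set ℝ) ×ˢ Metric.ball (0 : E2) R).indicator fun _ => |D| * K)
        (volume.restrict (Ioo 0 T ×ˢ (univ : Set E2))) := by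
      rw [integrable_indicator_iff hS]
      refine integrableOn_const ?_
      rw [Measure.restrict_apply hS]
      have : (univ : Set ℝ) ×ˢ Metric.ball (0 : E2) R ∩ Ioo 0 T ×ˢ univ =
          Ioo 0 T ×ˢ Metric.ball (0 : E2) R := by
        ext q
        simp [and_comm]
      rw [this, Measure.volume_eq_prod, Measure.prod_prod]
      exact ENNReal.mul_ne_top (by simp) measure_ball_lt_top.ne
    refine tendsto_integral_of_dominated_convergence _ (fun n => ?_) hB (fun n => ?_) ?_
    · have h1 := hf.measurable_datum hα
      have h2 := (hφn n).1.continuous.measurable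
      have h3 := hpl.measurable
      exact Measurable.aestronglyMeasurable (by fun_prop)
    · filter_upwards [ae_restrict_mem (measurableSet_Ioo.prod MeasurableSet.univ)] with q hq
      obtain ⟨h1, h2⟩ := hK n q.1 hq.1.1.le (planePoint q.2)
      rw [norm_mul]
      by_cases hz : φn n (q.1, planePoint q.2) = 0
      · rw [hz, norm_zero, mul_zero]
        exact indicator_nonneg (fun _ _ => by positivity) _
      · have h3 := h2 hz
        rw [norm_planePoint] at h3
        rw [indicator_of_mem (mem_prod.2 ⟨mem_univ _, by simpa using h3⟩)]
        exact mul_le_mul ((hD q.1 ⟨hq.1.1.le, hq.1.2⟩ _ (planePoint_mem_Ωbar _)).trans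
          (le_abs_self _)) h1 (abs_nonneg _) (abs_nonneg _)
    · filter_upwards [ae_restrict_mem (measurableSet_Ioo.prod MeasurableSet.univ)] with q hq
      exact (hlim q.1 hq.1.1.le _ (planePoint_mem_Ωbar _)).const_mul _
  exact (t1.add t2).sub t3

/-- The represented field satisfies the weak formulation. For test functions whose wave `wave φ`
is supported away from the boundary plane this is the duality of the retarded integrals. In general
`wave φ` is cut off near the plane; the potentials of the reflected cutoffs are test functions, and
tend to `φ` because of its boundary condition. -/
lemma integral_field_mul_box (hf : IsDensity T f ft fx) (hT : 0 < T) (hα : IsSourceOperator α0 α)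
    (hu : IsInitialDatum u₀ u₁) {σ : ℝ}
    (hσ : σ = 1 ∨ (σ = -1 ∧ ∀ y : E3, y 2 = 0 → u₀ y = 0)) {φ : ℝ × E3 → ℝ} (hφ : IsTest T φ)
    (hadm : IsAdmissible T σ φ) :
    ∫ p in spaceTime T, field σ α0 α f ft fx u₀ u₁ p * box φ p =
      weakPairing T u₀ u₁ (source α0 α ft fx) (datum α f) φ := by
  have hψ : ∀ n, IsTest T (planeCut n (wave φ)) := fun n => hφ.wave.planeCut n
  choose φn hφn hpot _ _ hi heq using fun n =>
    exists_test_of_interior hf hT hα hu hσ (hψ n) (tsupport_planeCut_subset n (wave φ))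
  obtain ⟨A, hA, -⟩ := exists_isDual_upperField hf hT hα hu
  have hiw : IntegrableOn (fun p => field σ α0 α f ft fx u₀ u₁ p * wave φ p) (spaceTime T) :=
    (hA.reflect σ hφ.wave.isWeight).1
  have l1 : Tendsto (fun n => ∫ p in spaceTime T, field σ α0 α f ft fx u₀ u₁ p *
      planeCut n (wave φ) p) atTop
      (𝓝 (∫ p in spaceTime T, field σ α0 α f ft fx u₀ u₁ p * wave φ p)) := by
    refine tendsto_integral_of_dominated_convergence _ (fun n => (hi n).aestronglyMeasurable)
      hiw.norm (fun n => Eventually.of_forall fun p => ?_) ?_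
    · rw [norm_mul, norm_mul, planeCut, norm_mul]
      exact mul_le_mul_of_nonneg_left
        (mul_le_of_le_one_left (norm_nonneg _) (timeCut_mem _ _)) (norm_nonneg _)
    · filter_upwards [ae_restrict_mem (measurableSet_spaceTime T)] with p hp
      have h1 := tendsto_planeCut (wave φ) p
      have h2 : cutΩ (wave φ) p = wave φ p := indicator_of_mem (by exact hp.2) _
      rw [h2] at h1
      exact h1.const_mul _
  -- The time derivative of a potential is the potential of the time derivative.
  have hdφ : ∀ n x, pd (1, 0) (φn n) (0, x) =
      potential (reflect σ (planeCut n (wave (pd (1, 0) φ)))) (0, x) := by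
    intro n x
    have h1 : φn n =ᶠ[𝓝 ((0 : ℝ), x)] potential (reflect σ (planeCut n (wave φ))) := by
      have h4 : ∀ᶠ q : ℝ × E3 in 𝓝 ((0 : ℝ), x), -1 < q.1 :=
        continuous_fst.continuousAt.eventually (lt_mem_nhds (by norm_num))
      exact h4.mono fun q hq => hpot n q hq.le
    have hg := (hψ n).reflect σ
    rw [(pd_congr h1 _).eq_of_nhds, pd_potential hg.1 hg.2.1, pd_time_reflect (hψ n).1,
      pd_time_planeCut (contDiff_wave hφ.1), wave_pd hφ.1]
  obtain ⟨M, R, hMR⟩ := hφ.wave.exists_isBoundedBy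
  obtain ⟨M', R', hMR'⟩ := (hφ.pd (1, 0)).wave.exists_isBoundedBy
  obtain ⟨K, hK⟩ := exists_potential_bound (M + |σ| * M) R
  obtain ⟨K', hK'⟩ := exists_potential_bound (M' + |σ| * M') R'
  have l2 := tendsto_weakPairing (u₀ := u₀) (u₁ := u₁) hf hα hu hφn hφ (K := K) (K' := K')
    (R := max (2 * R) (2 * R')) (fun n t ht x => by
      obtain ⟨h1, h2⟩ := hK _ (hMR.planeCut n).reflect t ht x
      rw [hpot n (t, x) (by simp only; linarith)]
      exact ⟨h1, fun h => (h2 h).trans_le (le_max_left _ _)⟩)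
    (fun n x => by
      obtain ⟨h1, h2⟩ := hK' _ (hMR'.planeCut n).reflect 0 le_rfl x
      rw [hdφ]
      exact ⟨h1, fun h => (h2 h).trans_le (le_max_right _ _)⟩)
    (fun t ht x hx => (hadm.tendsto_potential hφ ht hx).congr fun n =>
      (hpot n (t, x) (by simp only; linarith)).symm)
    (fun x hx => by
      simp only [hdφ]
      exact (hadm.pd_time hφ).tendsto_potential (hφ.pd _) le_rfl hx)
  rw [box_eq_wave hφ.1]
  exact tendsto_nhds_unique l1 (l2.congr fun n => (heq n).symm)

end

/-! ### Identification of the sources -/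

section

variable {T : ℝ} {f ft : ℝ × E3 × E3 → ℝ} {fx : ℝ × E3 × E3 → E3} {α0 : E3 → ℝ} {α : E3 → E3}

lemma LocallyIntegrableOn.integrable_mul_test {u φ : ℝ × E3 → ℝ}
    (hu : LocallyIntegrableOn u (spaceTime T)) (hφ : Continuous φ) (hc : HasCompactSupport φ)
    (hs : tsupport φ ⊆ spaceTime T) : IntegrableOn (fun p => u p * φ p) (spaceTime T) := by
  obtain ⟨M, hM⟩ := hφ.bounded_above_of_compact_support hc
  have h1 : IntegrableOn (fun p => u p * φ p) (tsupport φ) :=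
    (hu.integrableOn_compact_subset hs hc).mul_bdd (c := M) hφ.aestronglyMeasurable
      (Eventually.of_forall fun p => hM p)
  refine h1.of_forall_sdiff_eq_zero (measurableSet_spaceTime T) fun p hp => ?_
  rw [image_eq_zero_of_notMem_tsupport hp.2, mul_zero]

lemma HasWeakLineDeriv.moment {U : Set (ℝ × E3)} {a : ℝ × E3} {k l : E3 → ℝ} {W : ℝ × E3 → ℝ}
    (h : HasWeakLineDeriv U a (fun p => ∫ v, l v * f (p.1, p.2, v)) W) {c : ℝ}
    (hk : ∀ v, k v = c * l v) :
    HasWeakLineDeriv U a (fun p => ∫ v, k v * f (p.1, p.2, v)) fun p => c * W p := by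
  obtain ⟨h1, h2, h3⟩ := h
  have e1 : (fun p : ℝ × E3 => ∫ v, k v * f (p.1, p.2, v)) =
      fun p => c * ∫ v, l v * f (p.1, p.2, v) := by
    funext p
    rw [← integral_const_mul]
    simp only [hk, mul_assoc]
  rw [e1]
  refine ⟨h1.smul c, h2.smul c, fun φ hφ hφc hφs => ?_⟩
  simp only [mul_assoc]
  rw [integral_const_mul, integral_const_mul, h3 φ hφ hφc hφs, mul_neg]

lemma IsTest.integral_moment {a : ℝ × E3 → ℝ} (ha : IsTest T a) {h : ℝ × E3 × E3 → ℝ}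
    (hh : IsLocalDensity (volume.restrict (phaseTime T)) (fun n => n.2.1) (fun n => n.2.2) h)
    {k : E3 → ℝ} (hk : Continuous k) (hk1 : ∀ v, |k v| ≤ 1) :
    ∫ p in phaseTime T, h p * a (p.1, p.2.1) * k p.2.2 =
      ∫ p in spaceTime T, (∫ v, k v * h (p.1, p.2, v)) * a p := by
  rw [(integral_phaseTime (ha.integrable_phase hh hk (C := 1)
    fun v => by simpa using (hk1 v).trans (one_le_bracket v))).2]
  refine integral_congr_ae (Eventually.of_forall fun p => ?_)
  simp only
  rw [← integral_mul_const]
  refine integral_congr_ae (Eventually.of_forall fun v => ?_)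
  simp only
  ring

lemma IsDensity.locallyIntegrableUpTo_source (hf : IsDensity T f ft fx)
    (hα : IsSourceOperator α0 α) : LocallyIntegrableUpTo T (source α0 α ft fx) := by
  intro R
  have h1 := hf.integrableOn_source hα R
  have hS : MeasurableSet ((univ : Set ℝ) ×ˢ Metric.ball (0 : E3) R) :=
    MeasurableSet.univ.prod Metric.isOpen_ball.measurableSet
  rw [integrable_indicator_iff hS, IntegrableOn, Measure.restrict_restrict hS] at h1
  refine IntegrableOn.mono_set h1 ?_
  rintro p ⟨hp1, hp2, hp3⟩
  exact ⟨⟨trivial, hp3⟩, hp1, hp2⟩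

lemma integral_weakLineDeriv {a : ℝ × E3} {u w φ : ℝ × E3 → ℝ}
    (h : HasWeakLineDeriv (spaceTime T) a u w) (hφ : ContDiff ℝ ∞ φ) (hc : HasCompactSupport φ)
    (hs : tsupport φ ⊆ spaceTime T) :
    ∫ p in spaceTime T, w p * φ p = - ∫ p in spaceTime T, u p * pd a φ p := by
  rw [← neg_eq_iff_eq_neg, ← h.2.2 φ hφ hc hs]
  refine integral_congr_ae (Eventually.of_forall fun p => ?_)
  simp only [pd, (hφ.differentiable (by simp) p).lineDeriv_eq_fderiv]

/-- The source, formed with the weak derivatives of the velocity moments of `f`, is the velocity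
moment of the weak derivatives of `f`. -/
lemma ae_eq_source (hf : IsDensity T f ft fx) (hT : 0 < T) (hα : IsSourceOperator α0 α)
    {W0 : ℝ × E3 → ℝ} {W : Fin 3 → ℝ × E3 → ℝ}
    (h0 : HasWeakLineDeriv (spaceTime T) (1, 0) (fun p => ∫ v, α0 v * f (p.1, p.2, v)) W0)
    (hW : ∀ j, HasWeakLineDeriv (spaceTime T) (0, e j) (fun p => ∫ v, α v j * f (p.1, p.2, v))
      (W j)) :
    ∀ᵐ p ∂((volume : Measure (ℝ × E3)).restrict (spaceTime T)),
      -4 * Real.pi * (W0 p + (W 0 p + W 1 p + W 2 p)) = source α0 α ft fx p := by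
  have hl : LocallyIntegrableOn (fun p => -4 * Real.pi * (W0 p + (W 0 p + W 1 p + W 2 p)))
      (spaceTime T) :=
    (h0.2.1.add (((hW 0).2.1.add (hW 1).2.1).add (hW 2).2.1)).smul (-4 * Real.pi)
  have hS := (hf.locallyIntegrableUpTo_source hα).locallyIntegrableOn
  have hz := (isOpen_spaceTime T).ae_eq_zero_of_integral_contDiff_smul_eq_zero (hl.sub hS)
    fun φ hφ hc hs => by
    have hφT : IsTest T φ := ⟨hφ, hc, fun p hp => ⟨(hs hp).1.2, trivial⟩⟩
    have hout : ∀ p ∉ spaceTime T, φ p = 0 := fun p hp =>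
      image_eq_zero_of_notMem_tsupport fun h => hp (hs h)
    have hfl := hf.isLocalDensity_phase
    have i0 := LocallyIntegrableOn.integrable_mul_test h0.2.1 hφ.continuous hc hs
    have iW := fun j => LocallyIntegrableOn.integrable_mul_test (hW j).2.1 hφ.continuous hc hs
    have iG := LocallyIntegrableOn.integrable_mul_test hl hφ.continuous hc hs
    have iS := LocallyIntegrableOn.integrable_mul_test hS hφ.continuous hc hs
    -- the source formed with the weak derivatives of the moments
    have e1 : ∫ p in spaceTime T, -4 * Real.pi * (W0 p + (W 0 p + W 1 p + W 2 p)) * φ p =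
        -4 * Real.pi * ((∫ p in spaceTime T, W0 p * φ p) + ((∫ p in spaceTime T, W 0 p * φ p) +
          (∫ p in spaceTime T, W 1 p * φ p) + ∫ p in spaceTime T, W 2 p * φ p)) := by
      rw [← integral_add (iW 0) (iW 1)]
      refine Eq.trans ?_ (congrArg _ ((integral_add i0 (((iW 0).add (iW 1)).add (iW 2))).trans
        (congrArg _ (integral_add ((iW 0).add (iW 1)) (iW 2)))))
      rw [← integral_const_mul]
      refine integral_congr_ae (Eventually.of_forall fun p => ?_)
      simp only [Pi.add_apply]
      ring
    -- the velocity moments of the weak derivatives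
    have hk1 : ∀ v : E3, |(fun _ => (1 : ℝ)) v| ≤ 1 * bracket v := fun v => by
      simpa using one_le_bracket v
    have e2 := integral_by_parts_operator hf hT hα.smooth_time hα.smooth_space hα.abs_time_le
      hα.norm_le hφT contDiff_const hk1
    have hin : ∀ q : E3 × E3, φ (0, q.1) = 0 := fun q => hout _ fun h => lt_irrefl _ h.1.1
    have hpl : ∀ q : ℝ × E2 × E3, φ (q.1, planePoint q.2.1) = 0 := fun q =>
      hout _ fun h => absurd (show 0 < planePoint q.2.1 2 from h.2) (by simp [planePoint_two])
    simp only [hin, hpl, mul_zero, zero_mul, integral_zero, neg_zero, sub_zero, mul_one] at e2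
    have b0 : ∀ v, |α0 v| ≤ 1 * bracket v := fun v => by
      simpa using (hα.abs_time_le v).trans (one_le_bracket v)
    have bj : ∀ j v, |α v j| ≤ 1 * bracket v := fun j v => by
      simpa using (hα.abs_space_apply_le j v).trans (one_le_bracket v)
    have p0 := (hφT.pd (1, 0)).integrable_phase hfl hα.smooth_time.continuous b0
    have pj := fun j => (hφT.pd (0, e j)).integrable_phase hfl
      (hα.contDiff_space_apply j).continuous (bj j)
    have pS := hφT.integrable_phase (hf.isLocalDensity_deriv hα.smooth_time.continuous
      hα.smooth_space.continuous hα.abs_time_le hα.norm_le) continuous_const hk1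
    simp only [mul_one] at pS
    have e3 : (∫ p in phaseTime T, f p * pd (1, 0) φ (p.1, p.2.1) * α0 p.2.2) +
        (((∫ p in phaseTime T, f p * pd (0, e 0) φ (p.1, p.2.1) * α p.2.2 0) +
          (∫ p in phaseTime T, f p * pd (0, e 1) φ (p.1, p.2.1) * α p.2.2 1)) +
          ∫ p in phaseTime T, f p * pd (0, e 2) φ (p.1, p.2.1) * α p.2.2 2) +
        ∫ p in phaseTime T, (α0 p.2.2 * ft p + inner ℝ (α p.2.2) (fx p)) * φ (p.1, p.2.1) = 0 := by
      refine Eq.trans ?_ e2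
      rw [← integral_add (pj 0) (pj 1)]
      refine Eq.symm (Eq.trans ?_ ((integral_add (p0.add (((pj 0).add (pj 1)).add (pj 2)))
        pS).trans (congrArg (· + _) ((integral_add p0 (((pj 0).add (pj 1)).add (pj 2))).trans
        (congrArg _ (integral_add ((pj 0).add (pj 1)) (pj 2)))))))
      refine integral_congr_ae (Eventually.of_forall fun p => ?_)
      simp only [Pi.add_apply]
      rw [pd_space_eq_sum, Fin.sum_univ_three]
      ring
    rw [(hφT.pd (1, 0)).integral_moment hfl hα.smooth_time.continuous hα.abs_time_le,
      (hφT.pd (0, e 0)).integral_moment hfl (hα.contDiff_space_apply 0).continuous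
        (hα.abs_space_apply_le 0),
      (hφT.pd (0, e 1)).integral_moment hfl (hα.contDiff_space_apply 1).continuous
        (hα.abs_space_apply_le 1),
      (hφT.pd (0, e 2)).integral_moment hfl (hα.contDiff_space_apply 2).continuous
        (hα.abs_space_apply_le 2)] at e3
    rw [integral_weakLineDeriv h0 hφ hc hs, integral_weakLineDeriv (hW 0) hφ hc hs,
      integral_weakLineDeriv (hW 1) hφ hc hs, integral_weakLineDeriv (hW 2) hφ hc hs] at e1
    rw [← setIntegral_eq_integral_of_forall_compl_eq_zero (s := spaceTime T) fun p hp => by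
      rw [hout p hp, zero_smul]]
    refine Eq.trans (integral_congr_ae (Eventually.of_forall fun p => ?_))
      ((integral_sub iG iS).trans ?_)
    · simp only [Pi.sub_apply, smul_eq_mul]
      ring
    · rw [e1, (hf.integral_source_mul hα hφT).2]
      linear_combination 4 * Real.pi * e3
  rw [ae_restrict_iff' (measurableSet_spaceTime T)]
  filter_upwards [hz] with p hp hpS
  exact sub_eq_zero.1 (hp hpS)

lemma ae_sourceE_eq (hf : IsDensity T f ft fx) (hT : 0 < T) {ρx Jt : ℝ × E3 → E3}
    (hρx : ∀ j, HasWeakLineDeriv (spaceTime T) (0, e j) (rho f) (fun p => ρx p j))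
    (hJt : ∀ i, HasWeakLineDeriv (spaceTime T) (1, 0) (curr f i) (fun p => Jt p i)) (i : Fin 3) :
    ∀ᵐ p ∂((volume : Measure (ℝ × E3)).restrict (spaceTime T)),
      sourceE ρx Jt i p = source (fun v => hat v i) (fun _ => e i) ft fx p := by
  have h1 : ∀ j, HasWeakLineDeriv (spaceTime T) (0, e j)
      (fun p => ∫ v, (fun _ => (1 : ℝ)) v * f (p.1, p.2, v)) (fun p => ρx p j) := fun j => by
    simp only [one_mul]
    exact hρx j
  filter_upwards [ae_eq_source hf hT (isSourceOperator_electric i) (hJt i)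
    fun j => (h1 j).moment (c := e i j) (k := fun _ => e i j) fun v => by simp] with p hp
  rw [← hp, sourceE]
  fin_cases i <;> simp [e] <;> ring

lemma ae_sourceB_eq (hf : IsDensity T f ft fx) (hT : 0 < T) {Jt : ℝ × E3 → E3}
    {Jx : Fin 3 → ℝ × E3 → E3}
    (hJt : ∀ i, HasWeakLineDeriv (spaceTime T) (1, 0) (curr f i) (fun p => Jt p i))
    (hJx : ∀ j i, HasWeakLineDeriv (spaceTime T) (0, e j) (curr f i) (fun p => Jx j p i))
    (i : Fin 3) :
    ∀ᵐ p ∂((volume : Measure (ℝ × E3)).restrict (spaceTime T)),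
      sourceB Jx i p = source (fun _ => 0) (fun v => cross (e i) (hat v)) ft fx p := by
  have h0 := (show HasWeakLineDeriv (spaceTime T) (1, 0)
    (fun p => ∫ v, hat v 0 * f (p.1, p.2, v)) (fun p => Jt p 0) from hJt 0).moment
    (c := 0) (k := fun _ => 0) (by simp)
  have hJ : ∀ j k, HasWeakLineDeriv (spaceTime T) (0, e j)
    (fun p => ∫ v, hat v k * f (p.1, p.2, v)) (fun p => Jx j p k) := hJx
  -- each component of `eᵢ × v̂` is, up to the sign, one component of `v̂`, or zero
  have hW : ∃ (c : Fin 3 → ℝ) (k : Fin 3 → Fin 3),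
      (∀ j v, cross (e i) (hat v) j = c j * hat v (k j)) ∧
      ∀ p, sourceB Jx i p = -4 * Real.pi * (c 0 * Jx 0 p (k 0) + c 1 * Jx 1 p (k 1) +
        c 2 * Jx 2 p (k 2)) := by
    fin_cases i
    · refine ⟨![0, -1, 1], ![0, 2, 1], fun j v => ?_, fun p => ?_⟩
      · fin_cases j <;> simp [cross_apply_zero, cross_apply_one, cross_apply_two, e]
      · simp [sourceB]
        ring
    · refine ⟨![1, 0, -1], ![2, 0, 0], fun j v => ?_, fun p => ?_⟩
      · fin_cases j <;> simp [cross_apply_zero, cross_apply_one, cross_apply_two, e]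
      · simp [sourceB]
        ring
    · refine ⟨![-1, 1, 0], ![1, 0, 0], fun j v => ?_, fun p => ?_⟩
      · fin_cases j <;> simp [cross_apply_zero, cross_apply_one, cross_apply_two, e]
      · simp [sourceB]
        ring
  obtain ⟨c, k, hck, hs⟩ := hW
  filter_upwards [ae_eq_source hf hT (isSourceOperator_magnetic i) h0
    fun j => (hJ j (k j)).moment (c := c j) (k := fun v => cross (e i) (hat v) j)
      fun v => hck j v] with p hp
  rw [← hp, hs p]
  ring

end

/-! ### The initial data and the boundary data -/

section

variable {T : ℝ} {f ft : ℝ × E3 × E3 → ℝ} {fx : ℝ × E3 × E3 → E3} {α0 : E3 → ℝ} {α : E3 → E3}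
  {u₀ u₁ : E3 → ℝ}

lemma IsLocallyBounded.congr {b c : E3 → ℝ} (hb : IsLocallyBounded b) (h : ∀ y ∈ Ω, b y = c y) :
    IsLocallyBounded c := by
  refine ⟨hb.aestronglyMeasurable.congr ?_, fun R => ?_⟩
  · filter_upwards [ae_restrict_mem measurableSet_Ω] with y hy using h y hy
  · obtain ⟨M, hM⟩ := hb.bounded R
    exact ⟨M, fun y hy hyR => by rw [← h y hy]; exact hM y hy hyR⟩

lemma IsLocallyBounded.sub {b c : E3 → ℝ} (hb : IsLocallyBounded b) (hc : IsLocallyBounded c) :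
    IsLocallyBounded fun y => b y - c y := by
  refine ⟨hb.aestronglyMeasurable.sub hc.aestronglyMeasurable, fun R => ?_⟩
  obtain ⟨M, hM⟩ := hb.bounded R
  obtain ⟨N, hN⟩ := hc.bounded R
  exact ⟨M + N, fun y hy hyR => (abs_sub _ _).trans (add_le_add (hM y hy hyR) (hN y hy hyR))⟩

lemma IsLocallyBounded.const_mul {b : E3 → ℝ} (hb : IsLocallyBounded b) (c : ℝ) :
    IsLocallyBounded fun y => c * b y := by
  refine ⟨hb.aestronglyMeasurable.const_mul c, fun R => ?_⟩
  obtain ⟨M, hM⟩ := hb.bounded R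
  refine ⟨|c| * M, fun y hy hyR => ?_⟩
  rw [abs_mul]
  exact mul_le_mul_of_nonneg_left (hM y hy hyR) (abs_nonneg c)

lemma contDiffOn_apply {F : E3 → E3} (hF : ContDiffOn ℝ 1 F Ωbar) (k : Fin 3) :
    ContDiffOn ℝ 1 (fun x => F x k) Ωbar := contDiffOn_euclidean.1 hF k

lemma isLocallyBounded_fderiv_apply {F : E3 → E3} (hF : ContDiffOn ℝ 1 F Ωbar) (j k : Fin 3) :
    IsLocallyBounded fun y => fderiv ℝ F y (e j) k := by
  have h0 : IsInitialDatum (fun x => F x k) fun _ => 0 :=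
    ⟨contDiffOn_apply hF k, isLocallyBounded_of_continuousOn continuousOn_const⟩
  refine (h0.isLocallyBounded_deriv (e j)).congr fun y hy => ?_
  have h1 : DifferentiableAt ℝ F y :=
    (hF.contDiffAt (Ωbar_mem_nhds hy)).differentiableAt (by simp)
  have h2 := ((PiLp.proj 2 (fun _ : Fin 3 => ℝ) k : E3 →L[ℝ] ℝ).hasFDerivAt (x := F y)).comp y
    h1.hasFDerivAt
  have h3 : HasFDerivAt (fun x => F x k)
      ((PiLp.proj 2 (fun _ : Fin 3 => ℝ) k : E3 →L[ℝ] ℝ).comp (fderiv ℝ F y)) y := h2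
  rw [h3.fderiv]
  rfl

lemma isLocallyBounded_curl {F : E3 → E3} (hF : ContDiffOn ℝ 1 F Ωbar) (i : Fin 3) :
    IsLocallyBounded fun y => curl F y i := by
  have h := isLocallyBounded_fderiv_apply hF
  fin_cases i
  · exact (h 1 2).sub (h 2 1)
  · exact (h 2 0).sub (h 0 2)
  · exact (h 0 1).sub (h 1 0)

lemma isLocallyBounded_curr (hf : IsDensity T f ft fx) (hT : 0 < T) (i : Fin 3) :
    IsLocallyBounded fun y => curr f i (0, y) := by
  have h1 := hf.measurable_moment (k := fun v => hat v i)
    (contDiff_hat_apply i).continuous.measurable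
  obtain ⟨D, hD⟩ := hf.exists_moment_bound (k := fun v => hat v i) fun v => abs_hat_apply_le v i
  exact ⟨(h1.comp (by fun_prop : Measurable fun y : E3 => ((0 : ℝ), y))).aestronglyMeasurable,
    fun R => ⟨D, fun y hy _ => hD 0 ⟨le_rfl, hT⟩ y (Ω_subset_Ωbar hy)⟩⟩

lemma isInitialDatum_electric (hf : IsDensity T f ft fx) (hT : 0 < T) {E0 B0 : E3 → E3}
    (hE0 : ContDiffOn ℝ 1 E0 Ωbar) (hB0 : ContDiffOn ℝ 1 B0 Ωbar) (i : Fin 3) :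
    IsInitialDatum (fun x => E0 x i) (dtE0 f B0 i) :=
  ⟨contDiffOn_apply hE0 i,
    (isLocallyBounded_curl hB0 i).sub ((isLocallyBounded_curr hf hT i).const_mul _)⟩

lemma isInitialDatum_magnetic {E0 B0 : E3 → E3} (hE0 : ContDiffOn ℝ 1 E0 Ωbar)
    (hB0 : ContDiffOn ℝ 1 B0 Ωbar) (i : Fin 3) :
    IsInitialDatum (fun x => B0 x i) (dtB0 E0 i) :=
  ⟨contDiffOn_apply hB0 i, ((isLocallyBounded_curl hE0 i).const_mul (-1)).congr fun y _ => by
    rw [dtB0, neg_one_mul]⟩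

lemma LocallyIntegrableUpTo.congr {u w : ℝ × E3 → ℝ} (hu : LocallyIntegrableUpTo T u)
    (h : ∀ᵐ p ∂((volume : Measure (ℝ × E3)).restrict (spaceTime T)), w p = u p) :
    LocallyIntegrableUpTo T w := by
  intro R
  have hsub : Ioo 0 T ×ˢ (Ω ∩ Metric.ball 0 R) ⊆ spaceTime T :=
    prod_mono_right inter_subset_left
  exact (hu R).congr ((ae_restrict_of_ae_restrict_of_subset hsub h).mono fun p hp => hp.symm)

/-- The weak formulation, tested with functions satisfying the boundary condition of the parity `σ`,
characterizes the represented field. -/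
lemma weak_iff_ae_eq_field (hf : IsDensity T f ft fx) (hT : 0 < T) (hα : IsSourceOperator α0 α)
    (hu : IsInitialDatum u₀ u₁) {σ : ℝ}
    (hσ : σ = 1 ∨ (σ = -1 ∧ ∀ y : E3, y 2 = 0 → u₀ y = 0)) {u : ℝ × E3 → ℝ} :
    (LocallyIntegrableUpTo T u ∧ ∀ φ, IsTest T φ → IsAdmissible T σ φ →
      ∫ p in spaceTime T, u p * box φ p =
        weakPairing T u₀ u₁ (source α0 α ft fx) (datum α f) φ) ↔
    ∀ᵐ p ∂((volume : Measure (ℝ × E3)).restrict (spaceTime T)),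
      u p = field σ α0 α f ft fx u₀ u₁ p := by
  refine ⟨fun h => ae_eq_field_of_weak hf hT hα hu hσ h.1 h.2, fun h =>
    ⟨(locallyIntegrableUpTo_field hf hT hα hu σ).congr h, fun φ hφ hadm => ?_⟩⟩
  rw [← integral_field_mul_box hf hT hα hu hσ hφ hadm]
  exact integral_congr_ae (h.mono fun p hp => by simp only [hp])

lemma isWeakDirichlet_iff (hf : IsDensity T f ft fx) (hT : 0 < T) (hα : IsSourceOperator α0 α)
    (hα2 : ∀ v, α v 2 = 0) (hu : IsInitialDatum u₀ u₁) (hu0 : ∀ y : E3, y 2 = 0 → u₀ y = 0)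
    {G u : ℝ × E3 → ℝ}
    (hG : ∀ᵐ p ∂((volume : Measure (ℝ × E3)).restrict (spaceTime T)), G p = source α0 α ft fx p) :
    IsWeakDirichlet T u₀ u₁ G u ↔
      ∀ᵐ p ∂((volume : Measure (ℝ × E3)).restrict (spaceTime T)),
        u p = field (-1) α0 α f ft fx u₀ u₁ p := by
  rw [← weak_iff_ae_eq_field hf hT hα hu (Or.inr ⟨rfl, hu0⟩), IsWeakDirichlet]
  refine and_congr_right fun _ => forall_congr' fun φ => forall_congr' fun _ => ?_
  have h1 : IsAdmissible T (-1) φ ↔ ∀ t ∈ Ico 0 T, ∀ x : E3, x 2 = 0 → φ (t, x) = 0 := by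
    norm_num [IsAdmissible]
  have h2 : ∫ p in spaceTime T, G p * φ p = ∫ p in spaceTime T, source α0 α ft fx p * φ p :=
    integral_congr_ae (hG.mono fun p hp => by simp only [hp])
  simp only [h1, h2, weakPairing, datum, hα2, zero_mul, integral_zero, mul_zero, sub_zero]

lemma isWeakNeumann_iff (hf : IsDensity T f ft fx) (hT : 0 < T) (hα : IsSourceOperator α0 α)
    (hu : IsInitialDatum u₀ u₁) {G h u : ℝ × E3 → ℝ} (hh : ∀ p, h p = datum α f p)
    (hG : ∀ᵐ p ∂((volume : Measure (ℝ × E3)).restrict (spaceTime T)), G p = source α0 α ft fx p) :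
    IsWeakNeumann T u₀ u₁ G h u ↔
      ∀ᵐ p ∂((volume : Measure (ℝ × E3)).restrict (spaceTime T)),
        u p = field 1 α0 α f ft fx u₀ u₁ p := by
  rw [← weak_iff_ae_eq_field hf hT hα hu (Or.inl rfl), IsWeakNeumann]
  refine and_congr_right fun _ => forall_congr' fun φ => forall_congr' fun hφ => ?_
  have h1 : IsAdmissible T 1 φ ↔ ∀ t ∈ Ico 0 T, ∀ x : E3, x 2 = 0 →
      fderiv ℝ (fun y => φ (t, y)) x (e 2) = 0 := by
    simp only [fderiv_space_eq_pd hφ.1]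
    norm_num [IsAdmissible]
  have h2 : ∫ p in spaceTime T, G p * φ p = ∫ p in spaceTime T, source α0 α ft fx p * φ p :=
    integral_congr_ae (hG.mono fun p hp => by simp only [hp])
  simp only [h1, h2, weakPairing, hh]

/-! ### The kernels of the representation formulas -/

lemma kerEA_eq (i : Fin 3) : kerEA i 2 = fun om v =>
    (fun (_ : E3) (_ : E3) => e i 2) om v - kerP (fun v => hat v i) (fun _ => e i) om v := by
  funext om v
  have h : delta i 2 = e i 2 := by fin_cases i <;> simp [delta, e]
  simp only [kerEA, kerP, ← kerES_eq, kerES, h]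
  ring

lemma kerBA_eq (i : Fin 3) : kerBA i = fun om v =>
    (fun (_ : E3) v => cross (e i) (hat v) 2) om v -
      kerP (fun _ => 0) (fun v => cross (e i) (hat v)) om v := by
  funext om v
  have h : - cross (e 2) (hat v) i = cross (e i) (hat v) 2 := by
    fin_cases i <;> simp [cross_apply_zero, cross_apply_one, cross_apply_two, e]
  have h2 : kerS (fun _ => 0) (fun v => cross (e i) (hat v)) om v = -kerBS i om v := by
    rw [kerBS_eq, neg_neg]
  simp only [kerBA, kerP, h, h2, kerBS]
  ring

lemma kerEN_eq (i : Fin 3) : kerEN i = fun _ _ => 2 * e i 2 := by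
  funext om v
  fin_cases i <;> simp [kerEN, delta, e]

lemma kerBN_eq (i : Fin 3) : kerBN i = fun _ v => -2 * cross (e i) (hat v) 2 := by
  funext om v
  fin_cases i <;> simp [kerBN, cross_apply_two, e]

/-- On directions `ω` with `|ω| ≤ 1` the boundary terms of the integration by parts at `t = 0`
collapse, since `∑ⱼ ωⱼ (δᵢⱼ - κ v̂ⱼ) = ωᵢ - κ (v̂ · ω)` and `κ (1 + v̂ · ω) = ωᵢ + v̂ᵢ`. -/
lemma kerEI_eq (i : Fin 3) {om : E3} (v : E3) (h : ‖om‖ ≤ 1) :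
    kerEI i om v = - kerI (fun v => hat v i) (fun _ => e i) om v := by
  have h1 := (one_add_inner_hat_pos v om h).ne'
  have h2 : ∑ j, om j * delta i j = om i := by simp [delta]
  have h3 : kerEI i om v = (∑ j, om j * delta i j) -
      kerES i om v * inner ℝ (hat v) om := by
    simp only [kerEI, kerEA, inner_eq_sum, Fin.sum_univ_three, kerES]
    ring
  have h4 : kerES i om v * (1 + inner ℝ (hat v) om) = om i + hat v i := div_mul_cancel₀ _ h1
  rw [h3, h2, kerI, ← kerES_eq]
  linear_combination -h4

lemma kerBS_eq_kerI (i : Fin 3) :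
    kerBS i = kerI (fun _ => 0) (fun v => cross (e i) (hat v)) := by
  funext om v
  rw [kerBS_eq, kerI, zero_sub]

lemma IsVelocityKernel.of_eq_neg {k l : E3 → E3 → ℝ} (hl : IsVelocityKernel l)
    (hk : Measurable fun p : E3 × E3 => k p.1 p.2) (h : ∀ om v, ‖om‖ ≤ 1 → k om v = -l om v) :
    IsVelocityKernel k := by
  obtain ⟨C, hC⟩ := hl.bound
  exact ⟨hk, C, fun om v ho => by rw [h om v ho, abs_neg]; exact hC om v ho⟩

lemma isVelocityKernel_kerEI (i : Fin 3) : IsVelocityKernel (kerEI i) := by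
  refine (isSourceOperator_electric i).isVelocityKernel_kerI.of_eq_neg ?_
    fun om v h => kerEI_eq i v h
  have h1 : ∀ j, Measurable fun p : E3 × E3 => p.1 j * kerEA i j p.1 p.2 := fun j => by
    have h2 : (fun p : E3 × E3 => p.1 j * kerEA i j p.1 p.2) =
        fun p => p.1 j * (delta i j - kerES i p.1 p.2 * hat p.2 j) := by
      funext p
      rw [kerEA, kerES]
      ring
    rw [h2]
    exact (continuous_fst_apply j).measurable.mul (measurable_const.sub
      ((measurable_kerES i).mul (continuous_hat_snd_apply j).measurable))
  exact Finset.measurable_sum _ fun j _ => h1 j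

/-! ### The representation formulas as fields -/

lemma planeTerm_eq_integral_prod {s : Side} {k : E3 → E3 → ℝ} {h : ℝ × E3 × E3 → ℝ} {t : ℝ} {x : E3}
    (hk : PlaneConverges s k h t x) :
    planeTerm s k h t x = ∫ p in disc t x ×ˢ univ, planeIntegrand s k h t x p := by
  rw [PlaneConverges, Measure.volume_eq_prod] at hk
  rw [Measure.volume_eq_prod, setIntegral_prod _ hk, planeTerm]
  simp only [Measure.restrict_univ]

lemma planeIntegrand_sub (s : Side) (k l : E3 → E3 → ℝ) (h : ℝ × E3 × E3 → ℝ) (t : ℝ) (x : E3) :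
    planeIntegrand s (fun om v => k om v - l om v) h t x =
      fun p => planeIntegrand s k h t x p - planeIntegrand s l h t x p := by
  funext p
  simp only [planeIntegrand]
  ring

lemma planeTerm_sub {s : Side} {k l : E3 → E3 → ℝ} {h : ℝ × E3 × E3 → ℝ} {t : ℝ} {x : E3}
    (hk : PlaneConverges s k h t x) (hl : PlaneConverges s l h t x) :
    planeTerm s (fun om v => k om v - l om v) h t x = planeTerm s k h t x - planeTerm s l h t x := by
  have hkl : PlaneConverges s (fun om v => k om v - l om v) h t x := by
    rw [PlaneConverges, planeIntegrand_sub]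
    exact hk.sub hl
  rw [planeTerm_eq_integral_prod hkl, planeTerm_eq_integral_prod hk, planeTerm_eq_integral_prod hl,
    planeIntegrand_sub, integral_sub hk hl]

lemma planeTerm_const_mul (s : Side) (c : ℝ) (k : E3 → E3 → ℝ) (h : ℝ × E3 × E3 → ℝ) (t : ℝ)
    (x : E3) : planeTerm s (fun om v => c * k om v) h t x = c * planeTerm s k h t x := by
  simp only [planeTerm, ← integral_const_mul]
  refine integral_congr_ae (Eventually.of_forall fun z => ?_)
  refine integral_congr_ae (Eventually.of_forall fun v => ?_)
  simp only [planeIntegrand]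
  ring

/-- Without dependence of the kernel on the direction, the upper and lower disc integrals agree. -/
lemma planeTerm_bar (b : E3 → ℝ) (h : ℝ × E3 × E3 → ℝ) (t : ℝ) (x : E3) :
    planeTerm .upper (fun _ v => b v) h t (bar x) = planeTerm .upper (fun _ v => b v) h t x := by
  have h1 : ∀ z, ‖planePoint z - bar x‖ = ‖planePoint z - x‖ := fun z => by
    rw [norm_sub_rev, norm_bar_sub, bar_planePoint, norm_sub_rev]
  simp only [planeTerm, planeIntegrand, disc_bar, h1]

lemma norm_dir_le_one (x y : E3) : ‖dir x y‖ ≤ 1 := by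
  rw [dir_eq_back]
  exact norm_back_le_one _

lemma initialTerm_eq_neg {k l : E3 → E3 → ℝ} (hkl : ∀ om v, ‖om‖ ≤ 1 → k om v = -l om v)
    (h : ℝ × E3 × E3 → ℝ) (t : ℝ) (x : E3) :
    initialTerm .upper k h t x = -initialTerm .upper l h t x := by
  simp only [initialTerm, sphereIntegral, initialIntegrand, Side.map, hkl _ _ (norm_dir_le_one _ _),
    neg_mul, neg_div, integral_neg, mul_neg]

lemma bulkTerm_neg {k l : E3 → E3 → ℝ} (hkl : ∀ om v, k om v = -l om v) (m : ℕ)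
    (h : ℝ × E3 × E3 → ℝ) (t : ℝ) (x : E3) :
    bulkTerm .upper k m h t x = -bulkTerm .upper l m h t x := by
  simp only [bulkTerm, bulkIntegrand, ← integral_neg, hkl, neg_mul, neg_div]

/-- The disc integrals with the kernel `α₃` of the direct and the reflected part cancel against the
additional disc integral of the formulas: for `σ = 1` they add up to twice the same term, for
`σ = -1` they all vanish. -/
lemma planeTerm_cancel {σ : ℝ} {t : ℝ} {x : E3}
    (hσ : σ = 1 ∨ ∀ v, α v 2 = 0)
    (hA : PlaneConverges .upper (fun _ v => α v 2) f t x)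
    (hP : PlaneConverges .upper (kerP α0 α) f t x)
    (hA' : PlaneConverges .upper (fun _ v => α v 2) f t (bar x))
    (hP' : PlaneConverges .upper (kerP α0 α) f t (bar x)) :
    planeTerm .upper (fun om v => (fun (_ : E3) v => α v 2) om v - kerP α0 α om v) f t x +
      σ * planeTerm .lower (fun om v => (fun (_ : E3) v => α v 2) om v - kerP α0 α om v) f t x -
      2 * planeTerm .upper (fun _ v => α v 2) f t x =
    -planeTerm .upper (kerP α0 α) f t x - σ * planeTerm .upper (kerP α0 α) f t (bar x) := by
  rw [planeTerm_lower, planeTerm_sub hA hP, planeTerm_sub hA' hP', planeTerm_bar (fun v => α v 2)]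
  rcases hσ with rfl | h0
  · ring
  · have : planeTerm .upper (fun _ v => α v 2) f t x = 0 := by
      simp [planeTerm, planeIntegrand, h0]
    rw [this]
    ring

lemma formulaE_eq_field {E0 B0 : E3 → E3} (i : Fin 3) {t : ℝ} {x : E3}
    (hA : ∀ y, y = x ∨ y = bar x → PlaneConverges .upper (fun _ _ => e i 2) f t y)
    (hP : ∀ y, y = x ∨ y = bar x →
      PlaneConverges .upper (kerP (fun v => hat v i) (fun _ => e i)) f t y) :
    formulaE f ft fx E0 B0 i t x = field (-iota i) (fun v => hat v i) (fun _ => e i) f ft fx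
      (fun y => E0 y i) (dtE0 f B0 i) (t, x) := by
  have h1 := planeTerm_cancel (f := f) (α := fun _ => e i) (σ := -iota i)
    (by fin_cases i <;> simp [iota, e]) (hA x (Or.inl rfl)) (hP x (Or.inl rfl))
    (hA _ (Or.inr rfl)) (hP _ (Or.inr rfl))
  have h2 := planeTerm_const_mul .upper 2 (fun _ _ => e i 2) f t x
  simp only [formulaE, field, upperField, kerEA_eq, kerEN_eq, kerES_eq, kerET_eq, h2,
    initialTerm_lower, bulkTerm_lower, kirchhoffTerm_lower,
    initialTerm_eq_neg fun om v h => kerEI_eq i (om := om) v h]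
  linear_combination h1

lemma formulaB_eq_field {E0 B0 : E3 → E3} (i : Fin 3) {t : ℝ} {x : E3}
    (hA : ∀ y, y = x ∨ y = bar x →
      PlaneConverges .upper (fun _ v => cross (e i) (hat v) 2) f t y)
    (hP : ∀ y, y = x ∨ y = bar x →
      PlaneConverges .upper (kerP (fun _ => 0) (fun v => cross (e i) (hat v))) f t y) :
    formulaB f ft fx E0 B0 i t x = field (iota i) (fun _ => 0) (fun v => cross (e i) (hat v)) f ft fx
      (fun y => B0 y i) (dtB0 E0 i) (t, x) := by
  have h1 := planeTerm_cancel (f := f) (α := fun v => cross (e i) (hat v)) (σ := iota i)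
    (by fin_cases i <;> simp [iota, e, cross_apply_two]) (hA x (Or.inl rfl)) (hP x (Or.inl rfl))
    (hA _ (Or.inr rfl)) (hP _ (Or.inr rfl))
  have h2 := planeTerm_const_mul .upper (-2) (fun _ v => cross (e i) (hat v) 2) f t x
  have h3 := fun y => bulkTerm_neg (kerBS_eq i) 1 (transport ft fx) t y
  simp only [formulaB, field, upperField, kerBA_eq, kerBN_eq, kerBT_eq, h2, h3,
    initialTerm_lower, bulkTerm_lower, kirchhoffTerm_lower]
  simp only [kerBS_eq_kerI]
  linear_combination h1

end

/-! ### Absolute convergence -/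

section

variable {T : ℝ} {f ft : ℝ × E3 × E3 → ℝ} {fx : ℝ × E3 × E3 → E3} {u₀ u₁ : E3 → ℝ}
  {k : E3 → E3 → ℝ} {h : ℝ × E3 × E3 → ℝ}

/-- The lower side at `x` is the upper side at `x̄`, so that almost everywhere statements about the
upper side carry over to both sides. -/
lemma ae_forall_side {P : Side → ℝ → E3 → Prop}
    (hlow : ∀ t x, P .lower t x ↔ P .upper t (bar x))
    (hup : ∀ᵐ p ∂((volume : Measure (ℝ × E3)).restrict (Ioo 0 T ×ˢ univ)), P .upper p.1 p.2) :
    ∀ᵐ p ∂((volume : Measure (ℝ × E3)).restrict (spaceTime T)), ∀ s, P s p.1 p.2 := by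
  filter_upwards [ae_and_ae_bar hup] with p hp s
  cases s
  · exact hp.1
  · exact (hlow _ _).2 hp.2

lemma ae_bulkConverges {m : ℕ} (hm : m ≤ 2) (hk : IsVelocityKernel k)
    (hh : IsLocalDensity (volume.restrict (phaseTime T)) (fun n => n.2.1) (fun n => n.2.2) h) :
    ∀ᵐ p ∂((volume : Measure (ℝ × E3)).restrict (spaceTime T)),
      ∀ s, BulkConverges s k m h p.1 p.2 :=
  ae_forall_side (bulkConverges_lower k m h) (bulk_duality hm hk hh).1

lemma ae_planeConverges (hk : IsVelocityKernel k) (hf : IsDensity T f ft fx) :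
    ∀ᵐ p ∂((volume : Measure (ℝ × E3)).restrict (spaceTime T)),
      ∀ s, PlaneConverges s k f p.1 p.2 :=
  ae_forall_side (planeConverges_lower k f) (plane_duality hk hf.isLocalDensity_plane).1

lemma ae_initialConverges (hk : IsVelocityKernel k) (hf : IsDensity T f ft fx) (hT : 0 < T) :
    ∀ᵐ p ∂((volume : Measure (ℝ × E3)).restrict (spaceTime T)),
      ∀ s, InitialConverges s k f p.1 p.2 :=
  ae_forall_side (initialConverges_lower k f) (initial_duality hk (hf.isLocalDensity_initial hT)).1

lemma ae_kirchhoffConverges (hu : IsInitialDatum u₀ u₁) :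
    ∀ᵐ p ∂((volume : Measure (ℝ × E3)).restrict (spaceTime T)),
      ∀ s, KirchhoffConverges s u₀ u₁ p.1 p.2 :=
  ae_forall_side (kirchhoffConverges_lower u₀ u₁)
    (kirchhoff_duality hu.isConeKernel_kirchhoffKernel).1

lemma isVelocityKernel_datum {α0 : E3 → ℝ} {α : E3 → E3} (hα : IsSourceOperator α0 α) :
    IsVelocityKernel fun _ v => α v 2 :=
  isVelocityKernel_of_le_one (hα.contDiff_space_apply 2).continuous.measurable
    (hα.abs_space_apply_le 2)

lemma IsVelocityKernel.const_mul_velocity {b : E3 → ℝ} (c : ℝ)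
    (hb : IsVelocityKernel fun _ v => b v) :
    IsVelocityKernel fun _ v => c * b v := by
  obtain ⟨C, hC⟩ := hb.bound
  refine ⟨hb.measurable.const_mul c, |c| * C, fun om v ho => ?_⟩
  rw [abs_mul, mul_assoc]
  exact mul_le_mul_of_nonneg_left (hC om v ho) (abs_nonneg c)

lemma ae_formulasConverge (hf : IsDensity T f ft fx) (hT : 0 < T) {E0 B0 : E3 → E3}
    (hE0 : ContDiffOn ℝ 1 E0 Ωbar) (hB0 : ContDiffOn ℝ 1 B0 Ωbar) :
    ∀ᵐ p ∂((volume : Measure (ℝ × E3)).restrict (spaceTime T)),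
      FormulasConverge f ft fx E0 B0 p.1 p.2 := by
  unfold FormulasConverge
  rw [ae_all_iff]
  intro i
  have hα := isSourceOperator_electric i
  have hβ := isSourceOperator_magnetic i
  have kES : IsVelocityKernel (kerES i) := kerES_eq i ▸ hα.isVelocityKernel_kerS
  have kET : IsVelocityKernel (kerET i) := kerET_eq i ▸ hα.isVelocityKernel_kerT
  have kBS : IsVelocityKernel (kerBS i) := kerBS_eq_kerI i ▸ hβ.isVelocityKernel_kerI
  have kBT : IsVelocityKernel (kerBT i) := kerBT_eq i ▸ hβ.isVelocityKernel_kerT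
  have kEA : IsVelocityKernel (kerEA i 2) :=
    kerEA_eq i ▸ (isVelocityKernel_datum hα).sub hα.isVelocityKernel_kerP
  have kBA : IsVelocityKernel (kerBA i) :=
    kerBA_eq i ▸ (isVelocityKernel_datum hβ).sub hβ.isVelocityKernel_kerP
  have kEN : IsVelocityKernel (kerEN i) :=
    kerEN_eq i ▸ IsVelocityKernel.const_mul_velocity 2 (isVelocityKernel_datum hα)
  have kBN : IsVelocityKernel (kerBN i) :=
    kerBN_eq i ▸ IsVelocityKernel.const_mul_velocity (-2) (isVelocityKernel_datum hβ)
  filter_upwards [ae_kirchhoffConverges (T := T) (isInitialDatum_electric hf hT hE0 hB0 i),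
    ae_kirchhoffConverges (T := T) (isInitialDatum_magnetic hE0 hB0 i),
    ae_bulkConverges le_rfl kET hf.isLocalDensity_phase,
    ae_bulkConverges le_rfl kBT hf.isLocalDensity_phase,
    ae_bulkConverges one_le_two kES hf.isLocalDensity_transport,
    ae_bulkConverges one_le_two kBS hf.isLocalDensity_transport,
    ae_planeConverges kEA hf, ae_planeConverges kBA hf, ae_planeConverges kEN hf,
    ae_planeConverges kBN hf, ae_initialConverges (isVelocityKernel_kerEI i) hf hT,
    ae_initialConverges kBS hf hT] with p h1 h2 h3 h4 h5 h6 h7 h8 h9 h10 h11 h12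
  exact ⟨fun s => ⟨h1 s, h3 s, h5 s, h7 s, h11 s, h2 s, h4 s, h6 s, h8 s, h12 s⟩, h9 _, h10 _⟩

lemma ae_formula_eq_field (hf : IsDensity T f ft fx) (E0 B0 : E3 → E3) (i : Fin 3) :
    ∀ᵐ p ∂((volume : Measure (ℝ × E3)).restrict (spaceTime T)),
      formulaE f ft fx E0 B0 i p.1 p.2 = field (-iota i) (fun v => hat v i) (fun _ => e i) f ft fx
        (fun y => E0 y i) (dtE0 f B0 i) p ∧
      formulaB f ft fx E0 B0 i p.1 p.2 = field (iota i) (fun _ => 0)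
        (fun v => cross (e i) (hat v)) f ft fx (fun y => B0 y i) (dtB0 E0 i) p := by
  have hα := isSourceOperator_electric i
  have hβ := isSourceOperator_magnetic i
  filter_upwards [ae_planeConverges (isVelocityKernel_datum hα) hf,
    ae_planeConverges (isVelocityKernel_datum hβ) hf,
    ae_planeConverges hα.isVelocityKernel_kerP hf,
    ae_planeConverges hβ.isVelocityKernel_kerP hf] with p h1 h2 h3 h4
  have key : ∀ {k : E3 → E3 → ℝ}, (∀ s, PlaneConverges s k f p.1 p.2) →
      ∀ y, y = p.2 ∨ y = bar p.2 → PlaneConverges .upper k f p.1 y := by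
    rintro k hk y (rfl | rfl)
    · exact hk .upper
    · exact (planeConverges_lower k f p.1 p.2).1 (hk .lower)
  exact ⟨formulaE_eq_field i (key h1) (key h3), formulaB_eq_field i (key h2) (key h4)⟩

/-- The weak formulation for a pair of fields, component by component. -/
lemma isWeakField_iff (hf : IsDensity T f ft fx) (hT : 0 < T) {ρx Jt : ℝ × E3 → E3}
    {Jx : Fin 3 → ℝ × E3 → E3}
    (hρx : ∀ j, HasWeakLineDeriv (spaceTime T) (0, e j) (rho f) (fun p => ρx p j))
    (hJt : ∀ i, HasWeakLineDeriv (spaceTime T) (1, 0) (curr f i) (fun p => Jt p i))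
    (hJx : ∀ j i, HasWeakLineDeriv (spaceTime T) (0, e j) (curr f i) (fun p => Jx j p i))
    {E0 B0 : E3 → E3} (hE0 : ContDiffOn ℝ 1 E0 Ωbar) (hB0 : ContDiffOn ℝ 1 B0 Ωbar)
    (hcompat : ∀ x : E3, x 2 = 0 → E0 x 0 = 0 ∧ E0 x 1 = 0 ∧ B0 x 2 = 0) (E B : ℝ × E3 → E3) :
    IsWeakField T f ρx Jt Jx E0 B0 E B ↔ ∀ i,
      (∀ᵐ p ∂((volume : Measure (ℝ × E3)).restrict (spaceTime T)),
        E p i = field (-iota i) (fun v => hat v i) (fun _ => e i) f ft fx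
          (fun y => E0 y i) (dtE0 f B0 i) p) ∧
      ∀ᵐ p ∂((volume : Measure (ℝ × E3)).restrict (spaceTime T)),
        B p i = field (iota i) (fun _ => 0) (fun v => cross (e i) (hat v)) f ft fx
          (fun y => B0 y i) (dtB0 E0 i) p := by
  have hE := isInitialDatum_electric hf hT hE0 hB0
  have hB := isInitialDatum_magnetic hE0 hB0
  have sE := ae_sourceE_eq hf hT hρx hJt
  have sB := ae_sourceB_eq hf hT hJt hJx
  have E1 := isWeakDirichlet_iff (u := fun p => E p 0) hf hT (isSourceOperator_electric 0)
    (fun v => by simp [e]) (hE 0) (fun y hy => (hcompat y hy).1) (sE 0)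
  have E2 := isWeakDirichlet_iff (u := fun p => E p 1) hf hT (isSourceOperator_electric 1)
    (fun v => by simp [e]) (hE 1) (fun y hy => (hcompat y hy).2.1) (sE 1)
  have E3 := isWeakNeumann_iff (u := fun p => E p 2) (h := fun p => 4 * Real.pi * rho f p) hf hT
    (isSourceOperator_electric 2) (hE 2) (fun p => by simp [datum, rho, e]) (sE 2)
  have B1 := isWeakNeumann_iff (u := fun p => B p 0) (h := fun p => 4 * Real.pi * curr f 1 p) hf hT
    (isSourceOperator_magnetic 0) (hB 0) (fun p => by simp [datum, curr, e, cross_apply_two]) (sB 0)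
  have B2 := isWeakNeumann_iff (u := fun p => B p 1) (h := fun p => -4 * Real.pi * curr f 0 p) hf hT
    (isSourceOperator_magnetic 1) (hB 1)
    (fun p => by simp [datum, curr, e, cross_apply_two, integral_neg]) (sB 1)
  have B3 := isWeakDirichlet_iff (u := fun p => B p 2) hf hT (isSourceOperator_magnetic 2)
    (fun v => by simp [e, cross_apply_two]) (hB 2) (fun y hy => (hcompat y hy).2.2) (sB 2)
  have i0 : iota 0 = 1 := by simp [iota]
  have i1 : iota 1 = 1 := by simp [iota]
  have i2 : iota 2 = -1 := by simp [iota]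
  simp only [Fin.forall_fin_succ, Fin.forall_fin_zero, Fin.succ_zero_eq_one, Fin.succ_one_eq_two, i0, i1,
    i2, neg_neg, and_true, ← E1, ← E2, ← E3, ← B1, ← B2, ← B3]
  exact ⟨fun h => ⟨⟨h.E_one, h.B_one⟩, ⟨h.E_two, h.B_two⟩, h.E_three, h.B_three⟩,
    fun h => ⟨h.1.1, h.2.1.1, h.2.2.1, h.1.2, h.2.1.2, h.2.2.2⟩⟩

end

end RVM

end

theorem mainTheorem5 (T : ℝ) (hT : 0 < T)
    (f ft : ℝ × RVM.E3 × RVM.E3 → ℝ) (fx : ℝ × RVM.E3 × RVM.E3 → RVM.E3)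
    (hf : RVM.IsDensity T f ft fx)
    (ρx Jt : ℝ × RVM.E3 → RVM.E3) (Jx : Fin 3 → ℝ × RVM.E3 → RVM.E3)
    (hρx : ∀ j, RVM.HasWeakLineDeriv (RVM.spaceTime T) (0, RVM.e j) (RVM.rho f)
      (fun p => ρx p j))
    (hJt : ∀ i, RVM.HasWeakLineDeriv (RVM.spaceTime T) (1, 0) (RVM.curr f i) (fun p => Jt p i))
    (hJx : ∀ j i, RVM.HasWeakLineDeriv (RVM.spaceTime T) (0, RVM.e j) (RVM.curr f i)
      (fun p => Jx j p i))
    (E0 B0 : RVM.E3 → RVM.E3)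
    (hE0 : ContDiffOn ℝ 1 E0 RVM.Ωbar) (hB0 : ContDiffOn ℝ 1 B0 RVM.Ωbar)
    (hcompat : ∀ x : RVM.E3, x 2 = 0 → E0 x 0 = 0 ∧ E0 x 1 = 0 ∧ B0 x 2 = 0)
    (E B : ℝ × RVM.E3 → RVM.E3) :
    (∀ᵐ p ∂(volume.restrict (RVM.spaceTime T)), RVM.FormulasConverge f ft fx E0 B0 p.1 p.2) ∧
    (RVM.IsWeakField T f ρx Jt Jx E0 B0 E B ↔
      ∀ᵐ p ∂(volume.restrict (RVM.spaceTime T)), ∀ i : Fin 3,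
        E p i = RVM.formulaE f ft fx E0 B0 i p.1 p.2 ∧
        B p i = RVM.formulaB f ft fx E0 B0 i p.1 p.2) := by
  refine ⟨RVM.ae_formulasConverge hf hT hE0 hB0, ?_⟩
  rw [RVM.isWeakField_iff hf hT hρx hJt hJx hE0 hB0 hcompat, ae_all_iff]
  refine forall_congr' fun i => ?_
  rw [← Filter.eventually_and]
  refine Filter.eventually_congr ?_
  filter_upwards [RVM.ae_formula_eq_field hf E0 B0 i] with p hp
  rw [hp.1, hp.2]
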